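/- **Setting.** Let $(\Omega,\Xi,\mu)$ be a probability space with $L^2(\Omega)$ separable, and let $\mathcal T(x):\Omega\to\Omega$, $x\in\mathbb R^n$, be an ergodic dynamical system: $\mathcal T(0)=\mathrm{id}$, $\mathcal T(x+y)=\mathcal T(x)\mathcal T(y)$, each $\mathcal T(x)$ preserves $\mu$, $\{(x,\omega):\mathcal T(x)\omega\in A\}$ is measurable for the product of the Lebesgue $\sigma$-algebra and $\Xi$ for every $A\in\Xi$, and every $A\in\Xi$ with $\mu(\mathcal T(x)A\,\triangle\,A)=0$ for all $x$ has $\mu(A)\in\{0,1\}$. Let $\mathcal F\in\Xi$, $\mathcal M=\Omega\setminus\mathcal F$, $\mu(\mathcal F)>0$, $\mu(\mathcal M)>0$, $F(\omega)=\{x\in\mathbb R^n:\mathcal T(x)\omega\in\mathcal F\}$ and $M(\omega)=\mathbb R^n\setminus F(\omega)$. Assume that almost surely $F(\omega)$ is open and connected, and that $M(\omega)$ is a disperse medium: almost surely its connected components (grains) are closures of bounded $C^2$ domains, the curvature of whose boundaries has a deterministic bound; the distance between two distinct grains is at least a deterministic positive constant; the diameter of the grains is at most a deterministic constant; and every ball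 of some deterministic radius $r_0>0$ meets $M(\omega)$. Let $G\subset\mathbb R^n$ be a bounded domain with $C^\infty$ boundary and outward normal $\nu$. **Spaces.** Let $D_j$ be the generator in $L^2(\Omega)$ of the group $t\mapsto U(te_j)$, where $(U(x)f)(\omega)=f(\mathcal T(x)\omega)$; let $\mathcal D(\Omega)=\bigcap_j\mathrm{dom}(D_j)$, with the graph scalar product, $\nabla_\omega f=(D_1f,\dots,D_nf)$ and $\mathrm{div}_\omega g=\sum_jD_jg_j$. Let $V$ be the set of $\mathbf z\in L^2(G;\mathcal D(\Omega)^n)$ with $$\mathrm{div}_\omega\mathbf z=0\ \text{in } G\times\mathcal F,\quad \mathbf z=0\ \text{on } G\times\mathcal M,\quad \mathrm{div}_x\mathbb E(\mathbf z)=0\ \text{in } G,\quad \mathbb E(\mathbf z)\cdot\nu=0\ \text{on }\partial G$$ (the last two in the weak sense). Let $\mathcal V^2_{\rm pot}(\Omega)$ be the set of $f\in L^2(\Omega)^n$ with $\mathbb E f=0$ such that almost all realizations $x\mapsto f(\mathcal T(x)\omega)$ are potential (weak gradients) in $\mathbb R^n$, and let $X$ be the closure in $L^2(\mathcal F)^n$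 of the restrictions to $\mathcal F$ of its elements. Let $L^2_0(G)=\{P\in L^2(G):\int_GP\,dx=0\}$. **Data.** Let $z_1,\dots,z_N$ be non-zero integers, $\mathrm{Pe}_j>0$, $n_j^c>0$, $\Psi^0\in L^\infty(\mathcal F)$ (the equilibrium potential), $n_j^0(\omega)=n_j^c\exp\{-z_j\Psi^0(\omega)\}$, and $\mathbf E,\mathbf f^*\in L^2(G)^n$. **Proposition.** There is exactly one $$(\mathbf u^0,P^0,\{\Phi_j^0,\Phi_j^1\}_{j=1,\dots,N})\in V\times L^2_0(G)\times\big(H^1_0(G)\times L^2(G;X)\big)^N$$ such that $$\begin{aligned} &\int_{G\times\mathcal F}\nabla_\omega\mathbf u^0:\nabla_\omega\xi\,dx\,d\mu-\int_{G\times\mathcal F}P^0\,\mathrm{div}_x\xi\,dx\,d\mu\\ &+\sum_{j=1}^N\int_{G\times\mathcal F}z_jn_j^0\Big(-\xi\cdot(\nabla_x\Phi_j^0+\Phi_j^1)+\mathbf u^0\cdot(\nabla_x\varphi_j+g_j)\Big)dx\,d\mu\\ &+\sum_{j=1}^N\frac{z_j^2}{\mathrm{Pe}_j}\int_{G\times\mathcal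 F}n_j^0(\nabla_x\Phi_j^0+\Phi_j^1)\cdot(\nabla_x\varphi_j+g_j)\,dx\,d\mu\\ =\;&-\sum_{j=1}^N\frac{z_j^2}{\mathrm{Pe}_j}\int_{G\times\mathcal F}n_j^0\,\mathbf E\cdot(\nabla_x\varphi_j+g_j)\,dx\,d\mu+\sum_{j=1}^N\int_{G\times\mathcal F}z_jn_j^0\,\mathbf E\cdot\xi\,dx\,d\mu-\int_{G\times\mathcal F}\mathbf f^*\cdot\xi\,dx\,d\mu \end{aligned}$$ for all $\xi\in C_0^\infty(G;\mathcal D(\Omega)^n)$ with $\xi=0$ on $G\times\mathcal M$ and $\mathrm{div}_\omega\xi=0$ on $G\times\mathcal F$, all $\varphi_j\in C_0^\infty(G)$ and all $g_j\in L^2(G;X)$, $j=1,\dots,N$. -/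

import Mathlib

open MeasureTheory Set Filter Topology
open scoped ENNReal

noncomputable section

namespace TwoScale

/-! ### Euclidean space, smooth domains, Lebesgue spaces -/

/-- The Euclidean space of dimension `n`. -/
abbrev Space (n : ℕ) : Type := EuclideanSpace ℝ (Fin n)

/-- The `i`-th vector of the canonical basis. -/
abbrev basisVec {n : ℕ} (i : Fin n) : Space n := EuclideanSpace.single i (1 : ℝ)

/-- The order of differentiability of `C^∞` functions (smooth, not analytic). -/
abbrev smooth : WithTop ℕ∞ := ((⊤ : ℕ∞) : WithTop ℕ∞)

/-- `D` is, near the point `p`, the sublevel set `{ψ < 0}` of a function `ψ` of class `C^k` on the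
neighbourhood `U` of `p`, with non-zero differential at `p`. -/
def IsDefiningFunction {n : ℕ} (k : WithTop ℕ∞) (D : Set (Space n)) (p : Space n)
    (U : Set (Space n)) (ψ : Space n → ℝ) : Prop :=
  IsOpen U ∧ p ∈ U ∧ ContDiffOn ℝ k ψ U ∧ fderiv ℝ ψ p ≠ 0 ∧ D ∩ U = {x ∈ U | ψ x < 0}

/-- A bounded domain (non-empty, open, connected) with boundary of class `C^k`. -/
structure IsBoundedDomain {n : ℕ} (k : WithTop ℕ∞) (D : Set (Space n)) : Prop where
  isOpen : IsOpen D
  isConnected : IsConnected D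
  isBounded : Bornology.IsBounded D
  boundary : ∀ p ∈ frontier D, ∃ U ψ, IsDefiningFunction k D p U ψ

/-- The principal curvatures of the boundary of the `C²` domain `D` are at most `K` in absolute
value. With respect to the unit normal `∇ψ / |∇ψ|`, the second fundamental form of `{ψ = 0}` at `p`
is `τ ↦ D²ψ(p)(τ, τ) / |∇ψ(p)|` (up to sign) on the tangent space `{τ | Dψ(p) τ = 0}`; it does not
depend on the defining function. -/
def CurvatureBoundedBy {n : ℕ} (D : Set (Space n)) (K : ℝ) : Prop :=
  ∀ p ∈ frontier D, ∀ U ψ, IsDefiningFunction 2 D p U ψ →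
    ∀ τ : Space n, fderiv ℝ ψ p τ = 0 →
      |fderiv ℝ (fderiv ℝ ψ) p τ τ| ≤ K * ‖fderiv ℝ ψ p‖ * ‖τ‖ ^ 2

/-- `φ ∈ C^∞_0(G; H)`. -/
structure IsTestFunction {n : ℕ} {H : Type*} [NormedAddCommGroup H] [NormedSpace ℝ H]
    (G : Set (Space n)) (φ : Space n → H) : Prop where
  contDiff : ContDiff ℝ smooth φ
  hasCompactSupport : HasCompactSupport φ
  tsupport_subset : tsupport φ ⊆ G

/-- The Hilbert space `L²(ν)ⁿ`. -/
abbrev L2Vec (n : ℕ) {α : Type*} [MeasurableSpace α] (ν : Measure α) : Type _ :=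
  PiLp 2 (fun _ : Fin n => Lp ℝ 2 ν)

/-- The vector in `ℝⁿ` which is the value of `w ∈ L²(ν)ⁿ` at the point `a`. -/
def L2Vec.eval {n : ℕ} {α : Type*} [MeasurableSpace α] {ν : Measure α} (w : L2Vec n ν) (a : α) :
    Space n :=
  WithLp.toLp 2 fun i => w i a

/-- `L²(G)`, for Lebesgue measure. -/
abbrev L2 {n : ℕ} (G : Set (Space n)) : Type := Lp ℝ 2 (volume.restrict G)

/-- `L²_0(G)`: the elements of `L²(G)` with zero mean. -/
def L2Zero {n : ℕ} (G : Set (Space n)) : Set (L2 G) := {P | ∫ x in G, P x = 0}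

/-- `H¹_0(G)`: the closure of `C^∞_0(G)` for the norm `(‖Φ‖² + ‖∇Φ‖²)^{1/2}`. An element `Φ` is
recorded together with its weak gradient, as the pair `(Φ, ∇Φ) ∈ L²(G) × L²(G)ⁿ`; the second entry
is determined by the first. -/
def H10 {n : ℕ} (G : Set (Space n)) : Set (WithLp 2 (L2 G × L2Vec n (volume.restrict G))) :=
  closure {p | ∃ φ : Space n → ℝ, IsTestFunction G φ ∧
    (∀ᵐ x ∂(volume.restrict G), p.fst x = φ x) ∧
    (∀ᵐ x ∂(volume.restrict G), p.snd.eval x = gradient φ x)}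

/-- `div m = 0` in `G` and `m · ν = 0` on `∂G` in the usual weak sense for fields in `L²(G)ⁿ`:
orthogonality to the gradients of all functions in `C^∞_0(ℝⁿ)`. The functions supported in `G` give
`div m = 0`; for such `m` the normal trace is the functional `φ ↦ ∫_G m · ∇φ`. -/
def IsSolenoidalTangential {n : ℕ} (G : Set (Space n)) (m : Space n → Space n) : Prop :=
  ∀ φ : Space n → ℝ, IsTestFunction univ φ → ∫ x in G, inner ℝ (m x) (gradient φ x) = 0

/-! ### The dynamical system and the stochastic derivatives -/

/-- An ergodic dynamical system with `n`-dimensional time on `(Ω, μ)`. In `jointlyMeasurable`,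
`NullMeasurableSpace (Space n) volume` is `ℝⁿ` with its Lebesgue `σ`-algebra. -/
structure ErgodicSystem (n : ℕ) {Ω : Type*} [MeasurableSpace Ω] (μ : Measure Ω) where
  /-- The maps of the system. -/
  T : Space n → Ω → Ω
  zero : ∀ ω, T 0 ω = ω
  add : ∀ x y ω, T (x + y) ω = T x (T y ω)
  measurePreserving : ∀ x, MeasurePreserving (T x) μ μ
  jointlyMeasurable : ∀ A : Set Ω, MeasurableSet A →
    MeasurableSet {p : NullMeasurableSpace (Space n) volume × Ω | T p.1 p.2 ∈ A}
  ergodic : ∀ A : Set Ω, MeasurableSet A → (∀ x, μ (symmDiff (T x '' A) A) = 0) →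
    μ A = 0 ∨ μ A = 1

section System

variable {n : ℕ} {Ω : Type*} [MeasurableSpace Ω] {μ : Measure Ω}

/-- The operator `(U(x) f)(ω) = f(T(x) ω)` on `L²(Ω)`. -/
def ErgodicSystem.U (S : ErgodicSystem n μ) (x : Space n) : Lp ℝ 2 μ →ₗ[ℝ] Lp ℝ 2 μ :=
  Lp.compMeasurePreservingₗ ℝ (S.T x) (S.measurePreserving x)

/-- The Hilbert space `𝒟(Ω)`, the common domain of the generators `D_j` of the one-parameter groups
`t ↦ U(t e_j)` on `L²(Ω)`, with the graph scalar product `(f, g) + ∑ j, (D_j f, D_j g)`: an element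
`f` is recorded together with its stochastic gradient, as the pair
`(f, (D_1 f, …, D_n f)) ∈ L²(Ω) × L²(Ω)ⁿ`. -/
def ErgodicSystem.D (S : ErgodicSystem n μ) : Submodule ℝ (WithLp 2 (Lp ℝ 2 μ × L2Vec n μ)) where
  carrier := {p | ∀ j : Fin n,
    HasDerivAt (fun t : ℝ => S.U (t • basisVec j) p.fst) (p.snd j) 0}
  zero_mem' := by
    intro j
    simpa using hasDerivAt_const (0 : ℝ) (0 : Lp ℝ 2 μ)
  add_mem' := by
    intro a b ha hb j
    simpa using (ha j).fun_add (hb j)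
  smul_mem' := by
    intro c a ha j
    simpa using (ha j).fun_const_smul c

/-- The function underlying an element of `𝒟(Ω)`. -/
def ErgodicSystem.val (S : ErgodicSystem n μ) (f : S.D) : Lp ℝ 2 μ := f.1.fst

/-- The stochastic derivative `D_j f`. -/
def ErgodicSystem.deriv (S : ErgodicSystem n μ) (j : Fin n) (f : S.D) : Lp ℝ 2 μ := f.1.snd j

/-- The Hilbert space `𝒟(Ω)ⁿ`. -/
abbrev ErgodicSystem.DVec (S : ErgodicSystem n μ) : Type _ := PiLp 2 (fun _ : Fin n => S.D)

/-- The vector in `ℝⁿ` which is the value of `z ∈ 𝒟(Ω)ⁿ` at `ω`. -/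
def ErgodicSystem.eval (S : ErgodicSystem n μ) (z : S.DVec) (ω : Ω) : Space n :=
  WithLp.toLp 2 fun i => S.val (z i) ω

/-- The expectation `𝔼(z) ∈ ℝⁿ` of `z ∈ 𝒟(Ω)ⁿ`. -/
def ErgodicSystem.mean (S : ErgodicSystem n μ) (z : S.DVec) : Space n :=
  WithLp.toLp 2 fun i => ∫ ω, S.val (z i) ω ∂μ

/-- The fields `z ∈ 𝒟(Ω)ⁿ` such that `z = 0` on `ℳ = Ω ∖ ℱ` and `div_ω z = 0` in `ℱ`. -/
def ErgodicSystem.W (S : ErgodicSystem n μ) (F : Set Ω) : Set S.DVec :=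
  {z | (∀ i, ∀ᵐ ω ∂(μ.restrict Fᶜ), S.val (z i) ω = 0) ∧
    ∀ᵐ ω ∂(μ.restrict F), ∑ j, S.deriv j (z j) ω = 0}

/-- The velocity space `V`: the `z ∈ L²(G; 𝒟(Ω)ⁿ)` such that `div_ω z = 0` in `G × ℱ`, `z = 0` on
`G × ℳ`, `div_x 𝔼(z) = 0` in `G` and `𝔼(z) · ν = 0` on `∂G`. -/
def ErgodicSystem.V (S : ErgodicSystem n μ) (F : Set Ω) (G : Set (Space n)) :
    Set (Lp S.DVec 2 (volume.restrict G)) :=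
  {z | (∀ᵐ x ∂(volume.restrict G), z x ∈ S.W F) ∧
    IsSolenoidalTangential G (fun x => S.mean (z x))}

/-- A vector field on `ℝⁿ` is potential: it is the weak gradient of a function `w`. -/
def IsPotential (v : Space n → Space n) : Prop :=
  LocallyIntegrable v ∧ ∃ w : Space n → ℝ, LocallyIntegrable w ∧
    ∀ φ : Space n → ℝ, IsTestFunction univ φ →
      ∫ x, w x • gradient φ x = -∫ x, φ x • v x

/-- `𝒱²_pot(Ω)`: the `f ∈ L²(Ω)ⁿ` with zero expectation almost all realizations
`x ↦ f(T(x) ω)` of which are potential. -/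
def ErgodicSystem.Vpot (S : ErgodicSystem n μ) : Set (L2Vec n μ) :=
  {f | (∀ᵐ ω ∂μ, IsPotential fun x => f.eval (S.T x ω)) ∧ ∀ i, ∫ ω, f i ω ∂μ = 0}

/-- The space `X`: the closure in `L²(ℱ)ⁿ` of the restrictions to `ℱ` of the elements of
`𝒱²_pot(Ω)`. These restrictions already form a linear space, so the span adds nothing. -/
def ErgodicSystem.X (S : ErgodicSystem n μ) (F : Set Ω) :
    Submodule ℝ (L2Vec n (μ.restrict F)) :=
  (Submodule.span ℝ {w : L2Vec n (μ.restrict F) |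
    ∃ f ∈ S.Vpot, ∀ i, ∀ᵐ ω ∂(μ.restrict F), w i ω = f i ω}).topologicalClosure

/-! ### The random porous medium -/

/-- The random pore space `F(ω)`. -/
def ErgodicSystem.pore (S : ErgodicSystem n μ) (F : Set Ω) (ω : Ω) : Set (Space n) :=
  {x | S.T x ω ∈ F}

/-- The random skeleton `M(ω) = ℝⁿ ∖ F(ω)`. -/
def ErgodicSystem.skeleton (S : ErgodicSystem n μ) (F : Set Ω) (ω : Ω) : Set (Space n) :=
  (S.pore F ω)ᶜ

/-- The grains: the connected components of `M(ω)`. -/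
def ErgodicSystem.grains (S : ErgodicSystem n μ) (F : Set Ω) (ω : Ω) : Set (Set (Space n)) :=
  {C | ∃ x ∈ S.skeleton F ω, C = connectedComponentIn (S.skeleton F ω) x}

/-- `ℱ` defines a random disperse porous medium. -/
structure ErgodicSystem.IsDisperseMedium (S : ErgodicSystem n μ) (F : Set Ω) : Prop where
  measurableSet : MeasurableSet F
  pore_pos : 0 < μ F
  skeleton_pos : 0 < μ Fᶜ
  pore_open : ∀ᵐ ω ∂μ, IsOpen (S.pore F ω)
  pore_connected : ∀ᵐ ω ∂μ, IsConnected (S.pore F ω)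
  /-- Almost surely the grains are (closures of) bounded `C²` domains, and the curvature of their
  boundaries has a deterministic bound. -/
  grains_smooth : ∃ K : ℝ, ∀ᵐ ω ∂μ, ∀ C ∈ S.grains F ω,
    ∃ B : Set (Space n), IsBoundedDomain 2 B ∧ C = closure B ∧ CurvatureBoundedBy B K
  /-- The distance between two grains is at least a deterministic positive constant. -/
  separated : ∃ r : ℝ, 0 < r ∧ ∀ᵐ ω ∂μ, ∀ C ∈ S.grains F ω, ∀ C' ∈ S.grains F ω, C ≠ C' →
    ∀ x ∈ C, ∀ y ∈ C', r ≤ dist x y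
  /-- The diameter of the grains is at most a deterministic constant. -/
  diameter : ∃ d : ℝ, ∀ᵐ ω ∂μ, ∀ C ∈ S.grains F ω, ∀ x ∈ C, ∀ y ∈ C, dist x y ≤ d
  /-- Every ball of some deterministic radius meets the skeleton. -/
  dense : ∃ r₀ : ℝ, 0 < r₀ ∧ ∀ᵐ ω ∂μ, ∀ x : Space n,
    (Metric.ball x r₀ ∩ S.skeleton F ω).Nonempty

/-! ### The two-scale homogenized problem -/

/-- The equilibrium concentrations `n_j⁰(ω) = n_j^c exp(-z_j Ψ⁰(ω))`. -/
def concentration {N : ℕ} (nc : Fin N → ℝ) (z : Fin N → ℤ) (Ψ : Ω → ℝ) (j : Fin N) (ω : Ω) : ℝ :=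
  nc j * Real.exp (-(z j : ℝ) * Ψ ω)

/-- The unknowns `(u⁰, P⁰, {Φ_j⁰, Φ_j¹})`, where `Φ_j⁰` comes with its weak gradient. -/
structure Unknowns (N : ℕ) (S : ErgodicSystem n μ) (F : Set Ω) (G : Set (Space n)) where
  /-- velocity -/
  u : Lp S.DVec 2 (volume.restrict G)
  /-- pressure -/
  P : L2 G
  /-- macroscopic ionic potentials -/
  Φ₀ : Fin N → WithLp 2 (L2 G × L2Vec n (volume.restrict G))
  /-- two-scale correctors -/
  Φ₁ : Fin N → Lp (S.X F) 2 (volume.restrict G)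

/-- The variational equation, for the test functions `ξ`, `φ_j`, `g_j`. Integrals over `G × ℱ` are
written as iterated integrals. -/
def VariationalEquation {N : ℕ} (S : ErgodicSystem n μ) (F : Set Ω) (G : Set (Space n))
    (z : Fin N → ℤ) (Pe : Fin N → ℝ) (n₀ : Fin N → Ω → ℝ)
    (E f : L2Vec n (volume.restrict G)) (s : Unknowns N S F G)
    (ξ : Space n → S.DVec) (φ : Fin N → Space n → ℝ)
    (g : Fin N → Lp (S.X F) 2 (volume.restrict G)) : Prop :=
  (∫ x in G, ∫ ω in F, ∑ i, ∑ k, S.deriv k (s.u x i) ω * S.deriv k (ξ x i) ω ∂μ)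
  - (∫ x in G, ∫ ω in F, s.P x * ∑ i, S.val (fderiv ℝ ξ x (basisVec i) i) ω ∂μ)
  + (∑ j, ∫ x in G, ∫ ω in F, (z j : ℝ) * n₀ j ω *
      (-inner ℝ (S.eval (ξ x) ω) ((s.Φ₀ j).snd.eval x + (s.Φ₁ j x).1.eval ω)
        + inner ℝ (S.eval (s.u x) ω) (gradient (φ j) x + (g j x).1.eval ω)) ∂μ)
  + (∑ j, (z j : ℝ) ^ 2 / Pe j * ∫ x in G, ∫ ω in F, n₀ j ω *
      inner ℝ ((s.Φ₀ j).snd.eval x + (s.Φ₁ j x).1.eval ω)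
        (gradient (φ j) x + (g j x).1.eval ω) ∂μ)
  = - (∑ j, (z j : ℝ) ^ 2 / Pe j * ∫ x in G, ∫ ω in F, n₀ j ω *
      inner ℝ (E.eval x) (gradient (φ j) x + (g j x).1.eval ω) ∂μ)
    + (∑ j, ∫ x in G, ∫ ω in F, (z j : ℝ) * n₀ j ω *
        inner ℝ (E.eval x) (S.eval (ξ x) ω) ∂μ)
    - ∫ x in G, ∫ ω in F, inner ℝ (f.eval x) (S.eval (ξ x) ω) ∂μ

/-- `s` belongs to `V × L²_0(G) × (H¹_0(G) × L²(G; X))^N` and satisfies the variational equation for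
all `ξ ∈ C^∞_0(G; 𝒟(Ω)ⁿ)` with `ξ = 0` on `G × ℳ` and `div_ω ξ = 0` on `G × ℱ`, all
`φ_j ∈ C^∞_0(G)` and all `g_j ∈ L²(G; X)`. -/
structure IsSolution {N : ℕ} (S : ErgodicSystem n μ) (F : Set Ω) (G : Set (Space n))
    (z : Fin N → ℤ) (Pe : Fin N → ℝ) (n₀ : Fin N → Ω → ℝ)
    (E f : L2Vec n (volume.restrict G)) (s : Unknowns N S F G) : Prop where
  u_mem : s.u ∈ S.V F G
  P_mem : s.P ∈ L2Zero G
  Φ₀_mem : ∀ j, s.Φ₀ j ∈ H10 G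
  equation : ∀ (ξ : Space n → S.DVec) (φ : Fin N → Space n → ℝ)
    (g : Fin N → Lp (S.X F) 2 (volume.restrict G)),
    IsTestFunction G ξ → (∀ x, ξ x ∈ S.W F) → (∀ j, IsTestFunction G (φ j)) →
      VariationalEquation S F G z Pe n₀ E f s ξ φ g

end System

end TwoScale

end

open TwoScale

set_option linter.unusedSectionVars false

noncomputable section

namespace TwoScale

/-! ### The flow: measurability and the Koopman group -/

/-! The problem is a coercive linear system with a skew-symmetric coupling. If the equation is
tested with the solution itself, the terms carrying `z_j n_j⁰` cancel and what remains is `∫|∇_ω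
u|²` and the weighted integrals `∫ n_j⁰ |∇Φ_j⁰ + Φ_j¹|²` over `G × ℱ`. The Lax–Milgram theorem
(`exists_unique_skew`) then gives velocity and potentials, provided that these two quantities
control the norms. The pressure is recovered afterwards.

Velocity. The graph norm of `𝒟(Ω)ⁿ` is controlled by a stochastic Poincaré inequality for functions
vanishing on `ℳ` (`exists_poincare`). Almost surely a grain lies within a fixed distance of the
origin. The bounded curvature forces its shadow along `e_j` to have a size bounded below
(`exists_le_volume_contactSlab`): the slopes of the hyperplanes supporting the grain from above fill
a ball, and the curvature bounds the Jacobian of the slope map, as in the Alexandrov–Bakelman–Pucci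
estimate. On each line over the shadow the function vanishes somewhere, hence is bounded by the
integral of its derivative along the line. Fubini's theorem and stationarity turn this into an
inequality in `L²(Ω)`.

Potentials. It must be shown that `∇Φ⁰` and `Φ¹` cannot cancel each other on `ℱ`, that is, that the
constants make a positive angle with `X` (`IsDisperseMedium.exists_angle`). This follows from fields
`ζ_k ∈ 𝒟(Ω)ⁿ` that vanish on `ℳ`, are divergence free, have expectation `e_k` and are orthogonal to
`𝒱²_pot`: the scalar product of `v + g` with `ζ_k` is `v_k`. To build them, let `b_i` be minus the
lowest `i`-th coordinate of the grain containing the origin. Along the flow it behaves on the grains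
like the coordinate `x_i` up to a constant, so that after smoothing `D_j b_i = δ_ij` on `ℳ`. With `c
= 1/(n - 1)` the field `ζ_k = (1 - c ∑ D_j b_j) e_k + c D_k b` has all the required properties
(`IsDisperseMedium.exists_unitFields`). That `n ≥ 2` is forced by the connectedness of the pore
space and the boundedness of the grains.

Pressure. The momentum residual is a functional vanishing on `V`. Subtracting from a velocity `z`
the lift `∑ 𝔼(z)_i ζ_i` of its expectation leaves an element of `V`, so the functional only sees
`𝔼(z)`, through a density in `L²(G)ⁿ` orthogonal to all solenoidal tangential fields. Such a density
is a gradient, because the Poincaré–Wirtinger inequality gives the space of gradients a closed range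
(`IsBoundedDomain.exists_pressure`). Conversely, a functional that has a pressure on smooth test
fields vanishes on all of `V` (`IsPressure.apply_eq_zero`). Hence smooth tests determine velocity
and potentials, and the pressure is unique by the Poincaré–Wirtinger inequality again. -/

theorem ae_eq_zero_of_ae_slices {α β : Type*} [MeasurableSpace α] [MeasurableSpace β]
    {ν : Measure α} {μ : Measure β} [SFinite ν] [SFinite μ] {f : α × β → ℝ≥0∞}
    (hf : AEMeasurable f (ν.prod μ)) (h : ∀ᵐ a ∂ν, ∀ᵐ b ∂μ, f (a, b) = 0) :
    ∀ᵐ p ∂(ν.prod μ), f p = 0 := by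
  have h1 : ∫⁻ p, f p ∂(ν.prod μ) = 0 := by
    rw [lintegral_prod _ hf]
    refine (lintegral_congr_ae (h.mono fun a ha => lintegral_congr_ae ha)).trans ?_
    simp
  exact (lintegral_eq_zero_iff' hf).1 h1

namespace ErgodicSystem

variable {n : ℕ} {Ω : Type*} [MeasurableSpace Ω] {μ : Measure Ω} (S : ErgodicSystem n μ)

/-- The product of the Lebesgue `σ`-algebra with that of `Ω` is contained in the completion of the
product `σ`-algebra, since preimages of null measurable sets under the first projection are null
measurable. -/
theorem nullMeasurableSet_flow {A : Set Ω} (hA : MeasurableSet A) :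
    NullMeasurableSet {p : Space n × Ω | S.T p.1 p.2 ∈ A} (volume.prod μ) := by
  have key : ∀ s : Set (NullMeasurableSpace (Space n) volume × Ω), MeasurableSet s →
      @MeasurableSet (NullMeasurableSpace (Space n × Ω) (volume.prod μ)) _ s := by
    intro s hs
    have h : (Prod.instMeasurableSpace :
        MeasurableSpace (NullMeasurableSpace (Space n) volume × Ω)) ≤
        (inferInstance : MeasurableSpace (NullMeasurableSpace (Space n × Ω) (volume.prod μ))) := by
      refine sup_le ?_ ?_
      · rintro t ⟨t', ht', rfl⟩
        have h2 : @NullMeasurableSet (Space n) _ t' volume := ht'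
        exact (h2.preimage (Measure.quasiMeasurePreserving_fst (ν := μ)) :)
      · rintro t ⟨t', ht', rfl⟩
        exact (measurable_snd ht').nullMeasurableSet
    exact h s hs
  exact key _ (S.jointlyMeasurable A hA)

variable [IsProbabilityMeasure μ]

/-- A property that holds almost surely holds along almost every point of the orbits. -/
theorem ae_flow {p : Ω → Prop} (hp : ∀ᵐ ω ∂μ, p ω) :
    ∀ᵐ q ∂((volume : Measure (Space n)).prod μ), p (S.T q.1 q.2) := by
  -- The exceptional set is enlarged to a measurable null set, to which `nullMeasurableSet_flow`
  -- applies; its slices are preimages under the measure preserving maps `T x`.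
  have h0 : MeasurableSet (toMeasurable μ {ω | ¬ p ω}) := measurableSet_toMeasurable _ _
  have h1 := S.nullMeasurableSet_flow h0
  have h2 : ∀ᵐ q ∂((volume : Measure (Space n)).prod μ),
      ({q : Space n × Ω | S.T q.1 q.2 ∈ toMeasurable μ {ω | ¬ p ω}}.indicator
        (fun _ => (1 : ℝ≥0∞))) q = 0 := by
    refine ae_eq_zero_of_ae_slices (aemeasurable_const.indicator₀ h1) ?_
    refine ae_of_all _ fun x => ?_
    have h3 : μ (S.T x ⁻¹' (toMeasurable μ {ω | ¬ p ω})) = 0 := by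
      rw [(S.measurePreserving x).measure_preimage h0.nullMeasurableSet, measure_toMeasurable]
      exact hp
    have h4 : ∀ᵐ ω ∂μ, ω ∉ S.T x ⁻¹' (toMeasurable μ {ω | ¬ p ω}) :=
      measure_eq_zero_iff_ae_notMem.1 h3
    filter_upwards [h4] with ω hω
    exact indicator_of_notMem (by simpa using hω) _
  filter_upwards [h2] with q hq
  by_contra hne
  have : q ∈ {p' : Space n × Ω | S.T p'.1 p'.2 ∈ toMeasurable μ {ω | ¬ p ω}} :=
    subset_toMeasurable μ {ω | ¬ p ω} hne
  simp [indicator_of_mem this] at hq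

/-- Joint measurability, for the parametrization `g` of the translations. -/
theorem aemeasurable_flow_comp {α : Type*} [MeasurableSpace α] {ν : Measure α} [SFinite ν]
    {g : α → Space n} (hg : Measure.QuasiMeasurePreserving g ν volume)
    {f : Ω → ℝ} (hf : AEMeasurable f μ) :
    AEMeasurable (fun p : α × Ω => f (S.T (g p.1) p.2)) (ν.prod μ) := by
  have h0 : AEMeasurable (fun p : Space n × Ω => f (S.T p.1 p.2)) (volume.prod μ) := by
    have h1 : AEMeasurable (fun p : Space n × Ω => hf.mk f (S.T p.1 p.2)) (volume.prod μ) := by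
      refine NullMeasurable.aemeasurable fun s hs => ?_
      exact S.nullMeasurableSet_flow (hf.measurable_mk hs)
    exact h1.congr ((S.ae_flow hf.ae_eq_mk).mono fun p hp => hp.symm)
  exact h0.comp_quasiMeasurePreserving (QuasiMeasurePreserving.prodMap hg (Measure.QuasiMeasurePreserving.id μ))

theorem ae_flow_comp {α : Type*} [MeasurableSpace α] {ν : Measure α} [SFinite ν]
    {g : α → Space n} (hg : Measure.QuasiMeasurePreserving g ν volume)
    {p : Ω → Prop} (hp : ∀ᵐ ω ∂μ, p ω) :
    ∀ᵐ q ∂(ν.prod μ), p (S.T (g q.1) q.2) :=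
  (QuasiMeasurePreserving.prodMap hg (Measure.QuasiMeasurePreserving.id μ)).ae (S.ae_flow hp)

/-! The operators `U x`. -/

theorem U_coeFn (x : Space n) (f : Lp ℝ 2 μ) : S.U x f =ᵐ[μ] fun ω => f (S.T x ω) :=
  Lp.coeFn_compMeasurePreserving f (S.measurePreserving x)

@[simp] theorem norm_U (x : Space n) (f : Lp ℝ 2 μ) : ‖S.U x f‖ = ‖f‖ :=
  Lp.norm_compMeasurePreserving f (S.measurePreserving x)

theorem U_zero (f : Lp ℝ 2 μ) : S.U 0 f = f := by
  refine Lp.ext ((S.U_coeFn 0 f).trans (ae_of_all _ fun ω => ?_))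
  simp only [S.zero]

theorem U_add (x y : Space n) (f : Lp ℝ 2 μ) : S.U (x + y) f = S.U x (S.U y f) := by
  refine Lp.ext ?_
  filter_upwards [S.U_coeFn (x + y) f, S.U_coeFn x (S.U y f),
    (S.measurePreserving x).quasiMeasurePreserving.ae (S.U_coeFn y f)] with ω h1 h2 h3
  rw [h1, h2, h3, add_comm, S.add]

/-- `U x` as a continuous linear map. -/
def UL (x : Space n) : Lp ℝ 2 μ →L[ℝ] Lp ℝ 2 μ :=
  (Lp.compMeasurePreservingₗᵢ ℝ (S.T x) (S.measurePreserving x)).toContinuousLinearMap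

theorem UL_apply (x : Space n) (f : Lp ℝ 2 μ) : S.UL x f = S.U x f := rfl

theorem inner_U_U (x : Space n) (f g : Lp ℝ 2 μ) :
    inner ℝ (S.U x f) (S.U x g) = inner ℝ f g :=
  (Lp.compMeasurePreservingₗᵢ ℝ (S.T x) (S.measurePreserving x)).inner_map_map f g

theorem inner_U_left (x : Space n) (f g : Lp ℝ 2 μ) :
    inner ℝ (S.U x f) g = inner ℝ f (S.U (-x) g) := by
  rw [← S.inner_U_U (-x) (S.U x f) g, ← S.U_add, neg_add_cancel, S.U_zero]

end ErgodicSystem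

/-! ### Strong continuity -/

theorem enorm_sq_eq_lintegral {α E : Type*} [MeasurableSpace α] [NormedAddCommGroup E]
    {ν : Measure α} (f : Lp E 2 ν) : ‖f‖ₑ ^ 2 = ∫⁻ a, ‖f a‖ₑ ^ 2 ∂ν := by
  rw [Lp.enorm_def]
  have := eLpNorm_nnreal_pow_eq_lintegral (f := f) (μ := ν) (p := 2) two_ne_zero
  simpa only [NNReal.coe_ofNat, ENNReal.coe_ofNat, ENNReal.rpow_ofNat] using this

theorem eLpNorm_two_sq {α E : Type*} [MeasurableSpace α] [NormedAddCommGroup E]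
    {ν : Measure α} (f : α → E) : eLpNorm f 2 ν ^ 2 = ∫⁻ a, ‖f a‖ₑ ^ 2 ∂ν := by
  have := eLpNorm_nnreal_pow_eq_lintegral (f := f) (μ := ν) (p := 2) two_ne_zero
  simpa only [NNReal.coe_ofNat, ENNReal.coe_ofNat, ENNReal.rpow_ofNat] using this

theorem memLp_two_of_lintegral {α E : Type*} [MeasurableSpace α] [NormedAddCommGroup E]
    {ν : Measure α} {f : α → E} (hf : AEStronglyMeasurable f ν)
    (h : ∫⁻ a, ‖f a‖ₑ ^ 2 ∂ν < ∞) : MemLp f 2 ν := by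
  refine ⟨hf, ?_⟩
  rw [← eLpNorm_two_sq] at h
  by_contra hne
  rw [not_lt, top_le_iff] at hne
  simp [hne] at h

/-- Continuity of translations in `L²(ℝⁿ)`. It is applied below to single realizations. -/
theorem tendsto_lintegral_translation {n : ℕ} {v : Space n → ℝ} (hv : MemLp v 2 volume) :
    Tendsto (fun h => ∫⁻ x, ‖v (x + h) - v x‖ₑ ^ 2) (𝓝 0) (𝓝 0) := by
  let f := hv.toLp v
  let g : Space n → C(Space n, Space n) := fun h => ⟨fun x => x + h, by fun_prop⟩
  have hgm : ∀ h, MeasurePreserving (g h) (volume : Measure (Space n)) volume := fun h =>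
    measurePreserving_add_right volume h
  have hg : Continuous g := by
    refine ContinuousMap.continuous_of_continuous_uncurry _ ?_
    change Continuous fun p : Space n × Space n => p.2 + p.1
    fun_prop
  have h1 : ContinuousAt (fun h => Lp.compMeasurePreserving (g h) (hgm h) f) 0 :=
    ContinuousAt.compMeasurePreservingLp continuousAt_const hg.continuousAt hgm (by simp)
  have h2 : Tendsto (fun h => ‖Lp.compMeasurePreserving (g h) (hgm h) f - f‖ₑ ^ 2) (𝓝 0) (𝓝 0) := by
    have h3 : Lp.compMeasurePreserving (g 0) (hgm 0) f = f := by
      refine Lp.ext ((Lp.coeFn_compMeasurePreserving f (hgm 0)).trans (ae_of_all _ fun x => ?_))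
      simp [g]
    have h4 := (h1.tendsto.sub_const f).enorm
    rw [h3, sub_self, enorm_zero] at h4
    simpa [Function.comp_def] using (ENNReal.continuous_pow 2).continuousAt.tendsto.comp h4
  refine h2.congr fun h => ?_
  rw [enorm_sq_eq_lintegral]
  refine lintegral_congr_ae ?_
  filter_upwards [Lp.coeFn_sub (Lp.compMeasurePreserving (g h) (hgm h) f) f,
    Lp.coeFn_compMeasurePreserving f (hgm h), hv.coeFn_toLp,
    (hgm h).quasiMeasurePreserving.ae hv.coeFn_toLp] with x e1 e2 e3 e4
  rw [e1, Pi.sub_apply, e2, Function.comp_apply, e3, e4]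
  rfl

theorem enorm_sub_sq_le (a b : ℝ) : ‖a - b‖ₑ ^ 2 ≤ 2 * (‖a‖ₑ ^ 2 + ‖b‖ₑ ^ 2) := by
  have h : (a - b) ^ 2 ≤ 2 * (a ^ 2 + b ^ 2) := by nlinarith [sq_nonneg (a + b)]
  have e : ∀ c : ℝ, ‖c‖ₑ ^ 2 = ENNReal.ofReal (c ^ 2) := fun c => by
    rw [Real.enorm_eq_ofReal_abs, ← ENNReal.ofReal_pow (abs_nonneg c), sq_abs]
  rw [e, e, e, ← ENNReal.ofReal_add (sq_nonneg a) (sq_nonneg b),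
    show (2 : ℝ≥0∞) = ENNReal.ofReal 2 by simp, ← ENNReal.ofReal_mul (by norm_num)]
  exact ENNReal.ofReal_le_ofReal h

theorem measurePreserving_add_right_space {n : ℕ} (h : Space n) :
    MeasurePreserving (fun x : Space n => x + h) volume volume :=
  measurePreserving_add_right volume h

namespace ErgodicSystem

variable {n : ℕ} {Ω : Type*} [MeasurableSpace Ω] {μ : Measure Ω} (S : ErgodicSystem n μ)
variable [IsProbabilityMeasure μ]

theorem lintegral_enorm_sq_flow (f : Lp ℝ 2 μ) (x : Space n) :
    ∫⁻ ω, ‖f (S.T x ω)‖ₑ ^ 2 ∂μ = ‖f‖ₑ ^ 2 := by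
  rw [show ‖f‖ₑ = ‖S.U x f‖ₑ by rw [← ofReal_norm, ← ofReal_norm, S.norm_U],
    enorm_sq_eq_lintegral]
  exact lintegral_congr_ae ((S.U_coeFn x f).mono fun ω h => by simp only [h])

theorem lintegral_enorm_sq_flow_sub (f : Lp ℝ 2 μ) (x h : Space n) :
    ∫⁻ ω, ‖f (S.T (x + h) ω) - f (S.T x ω)‖ₑ ^ 2 ∂μ = ‖S.U h f - f‖ₑ ^ 2 := by
  rw [← S.lintegral_enorm_sq_flow (S.U h f - f) x]
  refine lintegral_congr_ae ?_
  have q := (S.measurePreserving x).quasiMeasurePreserving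
  filter_upwards [q.ae (Lp.coeFn_sub (S.U h f) f), q.ae (S.U_coeFn h f)] with ω h1 h2
  rw [h1, Pi.sub_apply, h2, add_comm x h, S.add]

/-- Strong continuity comes from joint measurability alone. Since `‖U h f - f‖` does not change when
`f` is replaced by `U x f`, its square can be averaged over `x` in the unit ball. By Fubini this
average is bounded by the expectation of the `L²(ℝⁿ)` distance between a truncated realization and
its translate, which tends to zero by dominated convergence. -/
theorem tendsto_U_zero (f : Lp ℝ 2 μ) : Tendsto (fun h => S.U h f) (𝓝 0) (𝓝 f) := by
  -- Radius 2 leaves room for `x` and `x + h` when both `x` and `h` have norm less than 1.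
  set B : Set (Space n) := Metric.ball 0 2 with hB
  have hBm : MeasurableSet B := measurableSet_ball
  let w : Ω → Space n → ℝ := fun ω => B.indicator fun x => f (S.T x ω)
  have hfm : AEMeasurable f μ := (Lp.aestronglyMeasurable f).aemeasurable
  have hw : ∀ h : Space n, AEMeasurable (fun p : Ω × Space n => w p.1 (p.2 + h))
      (μ.prod volume) := by
    intro h
    have h1 := (S.aemeasurable_flow_comp
      (measurePreserving_add_right_space h).quasiMeasurePreserving hfm).prod_swap
    exact h1.indicator (s := {p : Ω × Space n | p.2 + h ∈ B})
      ((measurable_snd.add_const h) hBm)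
  have hw0 : AEMeasurable (fun p : Ω × Space n => w p.1 p.2) (μ.prod volume) := by
    simpa using hw 0
  let F : Space n → Ω → ℝ≥0∞ := fun h ω => ∫⁻ x, ‖w ω (x + h) - w ω x‖ₑ ^ 2
  let b : Ω → ℝ≥0∞ := fun ω => ∫⁻ x, ‖w ω x‖ₑ ^ 2
  have hFm : ∀ h, AEMeasurable (F h) μ := fun h =>
    (((hw h).sub hw0).enorm.pow_const 2).lintegral_prod_right'
  have hbfin : ∫⁻ ω, b ω ∂μ ≠ ∞ := by
    have e : ∫⁻ ω, b ω ∂μ = ∫⁻ x, ∫⁻ ω, ‖w ω x‖ₑ ^ 2 ∂μ :=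
      lintegral_lintegral_swap (hw0.enorm.pow_const 2)
    have e2 : ∀ x, ∫⁻ ω, ‖w ω x‖ₑ ^ 2 ∂μ = B.indicator (fun _ => ‖f‖ₑ ^ 2) x := by
      intro x
      by_cases hx : x ∈ B
      · rw [indicator_of_mem hx, ← S.lintegral_enorm_sq_flow f x]
        simp [w, hx]
      · rw [indicator_of_notMem hx]
        simp [w, hx]
    rw [e]
    simp_rw [e2]
    rw [lintegral_indicator hBm, lintegral_const, Measure.restrict_apply_univ]
    exact ENNReal.mul_ne_top (by simp) (measure_ball_lt_top).ne
  have hbm : AEMeasurable b μ := (hw0.enorm.pow_const 2).lintegral_prod_right'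
  have hFb : ∀ h, ∀ᵐ ω ∂μ, F h ω ≤ 4 * b ω := by
    intro h
    have hm := Measure.ae_ae_of_ae_prod (hw0.ae_eq_mk)
    have : ∀ᵐ ω ∂μ, AEMeasurable (w ω) volume := by
      filter_upwards [hm] with ω hω
      exact ⟨_, (hw0.measurable_mk.comp measurable_prodMk_left), hω⟩
    filter_upwards [this] with ω hω
    have h0 : ∫⁻ x, ‖w ω (x + h)‖ₑ ^ 2 = b ω :=
      lintegral_add_right_eq_self (fun x => ‖w ω x‖ₑ ^ 2) h
    calc F h ω ≤ ∫⁻ x, 2 * (‖w ω (x + h)‖ₑ ^ 2 + ‖w ω x‖ₑ ^ 2) :=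
          lintegral_mono fun x => enorm_sub_sq_le _ _
      _ = 2 * (b ω + b ω) := by
          rw [lintegral_const_mul' _ _ (by simp),
            lintegral_add_right' _ (hω.enorm.pow_const 2), h0]
      _ = 4 * b ω := by ring
  have hlim : Tendsto (fun h => ∫⁻ ω, F h ω ∂μ) (𝓝 0) (𝓝 (∫⁻ _, 0 ∂μ)) := by
    refine tendsto_lintegral_filter_of_dominated_convergence' (fun ω => 4 * b ω)
      (Eventually.of_forall hFm) (Eventually.of_forall hFb) ?_ ?_
    · rw [lintegral_const_mul' _ _ (by simp)]
      exact ENNReal.mul_ne_top (by simp) hbfin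
    · filter_upwards [ae_lt_top' hbm hbfin, Measure.ae_ae_of_ae_prod (hw0.ae_eq_mk)] with ω h1 h2
      refine tendsto_lintegral_translation (memLp_two_of_lintegral ?_ h1)
      exact AEMeasurable.aestronglyMeasurable
        ⟨_, (hw0.measurable_mk.comp measurable_prodMk_left), h2⟩
  have hvol : (volume (Metric.ball (0 : Space n) 1)) ≠ 0 :=
    (Metric.measure_ball_pos volume _ one_pos).ne'
  have hvol' : (volume (Metric.ball (0 : Space n) 1)) ≠ ∞ := measure_ball_lt_top.ne
  have hle : ∀ᶠ h in 𝓝 (0 : Space n), volume (Metric.ball (0 : Space n) 1) * ‖S.U h f - f‖ₑ ^ 2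
      ≤ ∫⁻ ω, F h ω ∂μ := by
    filter_upwards [Metric.ball_mem_nhds (0 : Space n) one_pos] with h hh
    have e : ∫⁻ ω, F h ω ∂μ = ∫⁻ x, ∫⁻ ω, ‖w ω (x + h) - w ω x‖ₑ ^ 2 ∂μ :=
      lintegral_lintegral_swap (((hw h).sub hw0).enorm.pow_const 2)
    rw [e]
    calc volume (Metric.ball (0 : Space n) 1) * ‖S.U h f - f‖ₑ ^ 2
        = ∫⁻ x in Metric.ball (0 : Space n) 1, ‖S.U h f - f‖ₑ ^ 2 := by
          rw [lintegral_const, Measure.restrict_apply_univ, mul_comm]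
      _ ≤ ∫⁻ x in Metric.ball (0 : Space n) 1, ∫⁻ ω, ‖w ω (x + h) - w ω x‖ₑ ^ 2 ∂μ := by
          refine setLIntegral_mono' measurableSet_ball fun x hx => ?_
          rw [← S.lintegral_enorm_sq_flow_sub f x h]
          have hx0 : ‖x‖ < 1 := by simpa using hx
          have hh0 : ‖h‖ < 1 := by simpa using hh
          have m1 : x ∈ B := by simp [hB]; linarith
          have m2 : x + h ∈ B := by
            simp only [hB, Metric.mem_ball, dist_zero_right]
            linarith [norm_add_le x h]
          simp [w, m1, m2]
      _ ≤ _ := setLIntegral_le_lintegral _ _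
  rw [lintegral_zero] at hlim
  have h5 : Tendsto (fun h => volume (Metric.ball (0 : Space n) 1) * ‖S.U h f - f‖ₑ ^ 2)
      (𝓝 0) (𝓝 0) :=
    tendsto_of_tendsto_of_tendsto_of_le_of_le' tendsto_const_nhds hlim
      (Eventually.of_forall fun _ => zero_le) hle
  have h6 : Tendsto (fun h => ‖S.U h f - f‖ₑ ^ 2) (𝓝 0) (𝓝 0) := by
    have h7 := ENNReal.Tendsto.const_mul (a := (volume (Metric.ball (0 : Space n) 1))⁻¹) h5
      (Or.inr (ENNReal.inv_ne_top.2 hvol))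
    simp_rw [← mul_assoc, ENNReal.inv_mul_cancel hvol hvol', one_mul, mul_zero] at h7
    exact h7
  rw [tendsto_iff_norm_sub_tendsto_zero]
  have h8 : Tendsto (fun h => ‖S.U h f - f‖ ^ 2) (𝓝 0) (𝓝 0) := by
    have := (ENNReal.tendsto_toReal (by simp : (0 : ℝ≥0∞) ≠ ∞)).comp h6
    simpa [Function.comp_def] using this
  have h9 := (Real.continuous_sqrt.tendsto 0).comp h8
  simpa [Function.comp_def, Real.sqrt_sq (norm_nonneg _)] using h9

theorem continuous_U (f : Lp ℝ 2 μ) : Continuous fun x => S.U x f := by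
  rw [continuous_iff_continuousAt]
  intro x
  have h1 : Tendsto (fun y => S.U (y - x) f) (𝓝 x) (𝓝 f) := by
    refine (S.tendsto_U_zero f).comp ?_
    have : Tendsto (fun y : Space n => y - x) (𝓝 x) (𝓝 (x - x)) := tendsto_id.sub_const x
    simpa using this
  have h2 := ((S.UL x).continuous.tendsto f).comp h1
  refine h2.congr fun y => ?_
  simp only [Function.comp_apply, UL_apply]
  rw [← S.U_add, add_sub_cancel]

end ErgodicSystem

/-! ### The stochastic derivatives -/

namespace ErgodicSystem

variable {n : ℕ} {Ω : Type*} [MeasurableSpace Ω] {μ : Measure Ω} (S : ErgodicSystem n μ)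
variable [IsProbabilityMeasure μ]

/-- The group law carries the derivative at time zero to every time. -/
theorem hasDerivAt_U (f : S.D) (j : Fin n) (t : ℝ) :
    HasDerivAt (fun s : ℝ => S.U (s • basisVec j) (S.val f)) (S.U (t • basisVec j) (S.deriv j f))
      t := by
  have h0 : HasDerivAt (fun s : ℝ => S.U (s • basisVec j) (S.val f)) (S.deriv j f) (t - t) := by
    rw [sub_self]; exact f.2 j
  have h1 := (S.UL (t • basisVec j)).hasFDerivAt.comp_hasDerivAt t (h0.comp_sub_const t t)
  refine h1.congr_of_eventuallyEq (Eventually.of_forall fun s => ?_)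
  simp only [Function.comp_apply, UL_apply]
  rw [← S.U_add, ← add_smul, add_sub_cancel]

theorem norm_U_smul_sub_le (f : S.D) (j : Fin n) (t : ℝ) :
    ‖S.U (t • basisVec j) (S.val f) - S.val f‖ ≤ |t| * ‖S.deriv j f‖ := by
  have h := convex_univ.norm_image_sub_le_of_norm_hasDerivWithin_le
    (f := fun s : ℝ => S.U (s • basisVec j) (S.val f)) (C := ‖S.deriv j f‖) (x := 0) (y := t)
    (fun s _ => (S.hasDerivAt_U f j s).hasDerivWithinAt) (fun s _ => (S.norm_U _ _).le)
    (mem_univ _) (mem_univ _)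
  simpa [S.U_zero, mul_comm] using h

/-- The coordinates are moved one at a time; since `U` is isometric, the increments add up. -/
theorem norm_U_sub_le (f : S.D) (x : Space n) :
    ‖S.U x (S.val f) - S.val f‖ ≤ ∑ j, |x j| * ‖S.deriv j f‖ := by
  have key : ∀ s : Finset (Fin n), ‖S.U (∑ j ∈ s, x j • basisVec j) (S.val f) - S.val f‖ ≤
      ∑ j ∈ s, |x j| * ‖S.deriv j f‖ := by
    intro s
    induction s using Finset.induction_on with
    | empty => simp [S.U_zero]
    | insert a s ha ih =>
      rw [Finset.sum_insert ha, Finset.sum_insert ha, add_comm (x a • _), S.U_add]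
      set y := ∑ j ∈ s, x j • (basisVec j : Space n)
      have e : S.U y (S.U (x a • basisVec a) (S.val f)) - S.val f =
          S.U y (S.U (x a • basisVec a) (S.val f) - S.val f) + (S.U y (S.val f) - S.val f) := by
        rw [map_sub]; abel
      rw [e]
      refine (norm_add_le _ _).trans (add_le_add ?_ ih)
      rw [S.norm_U]
      exact S.norm_U_smul_sub_le f a _
  have hx : ∑ j, x j • (basisVec j : Space n) = x := by
    have := (EuclideanSpace.basisFun (Fin n) ℝ).sum_repr x
    simpa [basisVec] using this
  simpa [hx] using key Finset.univ

/-- The operators `U` are isometries, so convergence of the derivatives at time zero is uniform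
along the orbits, and limits may be differentiated. -/
theorem isClosed_D : IsClosed (S.D : Set (WithLp 2 (Lp ℝ 2 μ × L2Vec n μ))) := by
  rw [← isSeqClosed_iff_isClosed]
  intro p p₀ hp hlim j
  have hfst : Tendsto (fun k => (p k).fst) atTop (𝓝 p₀.fst) :=
    ((WithLp.continuous_fst 2 _ _).tendsto p₀).comp hlim
  have hsnd : Tendsto (fun k => (p k).snd j) atTop (𝓝 (p₀.snd j)) :=
    (((PiLp.proj (𝕜 := ℝ) 2 (fun _ : Fin n => Lp ℝ 2 μ) j).continuous.comp
      (WithLp.continuous_snd 2 _ _)).tendsto p₀).comp hlim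
  have hu : TendstoUniformly (fun k (t : ℝ) => S.U (t • basisVec j) ((p k).snd j))
      (fun t => S.U (t • basisVec j) (p₀.snd j)) atTop := by
    rw [Metric.tendstoUniformly_iff]
    intro ε hε
    filter_upwards [Metric.tendsto_nhds.1 hsnd ε hε] with k hk t
    rw [dist_comm, dist_eq_norm, ← map_sub, S.norm_U, ← dist_eq_norm]
    exact hk
  have h := hasDerivAt_of_tendstoUniformly hu
    (Eventually.of_forall fun k t => S.hasDerivAt_U ⟨p k, hp k⟩ j t)
    (fun t => ((S.UL (t • basisVec j)).continuous.tendsto _).comp hfst) 0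
  simp only [zero_smul, S.U_zero] at h
  exact h

instance : CompleteSpace S.D := S.isClosed_D.completeSpace_coe

/-- The underlying function, as a continuous linear map. -/
def valL : S.D →L[ℝ] Lp ℝ 2 μ :=
  (WithLp.fstL 2 ℝ (Lp ℝ 2 μ) (L2Vec n μ)).comp S.D.subtypeL

/-- The stochastic derivative, as a continuous linear map. -/
def derivL (j : Fin n) : S.D →L[ℝ] Lp ℝ 2 μ :=
  (PiLp.proj (𝕜 := ℝ) 2 (fun _ : Fin n => Lp ℝ 2 μ) j).comp
    ((WithLp.sndL 2 ℝ (Lp ℝ 2 μ) (L2Vec n μ)).comp S.D.subtypeL)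

@[simp] theorem valL_apply (f : S.D) : S.valL f = S.val f := rfl

@[simp] theorem derivL_apply (j : Fin n) (f : S.D) : S.derivL j f = S.deriv j f := rfl

theorem norm_sq_D (f : S.D) : ‖f‖ ^ 2 = ‖S.val f‖ ^ 2 + ∑ j, ‖S.deriv j f‖ ^ 2 := by
  have h1 : ‖f‖ ^ 2 = ‖(f : WithLp 2 (Lp ℝ 2 μ × L2Vec n μ))‖ ^ 2 := rfl
  rw [h1, WithLp.prod_norm_sq_eq_of_L2, PiLp.norm_sq_eq_of_L2]
  rfl

/-- The constant function `1` in `L²(Ω)`. -/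
def one : Lp ℝ 2 μ := indicatorConstLp 2 MeasurableSet.univ (measure_ne_top μ univ) (1 : ℝ)

theorem inner_one (f : Lp ℝ 2 μ) : inner ℝ (one : Lp ℝ 2 μ) f = ∫ ω, f ω ∂μ := by
  rw [one, L2.inner_indicatorConstLp_one, setIntegral_univ]

theorem integral_comp_T (x : Space n) {g : Ω → ℝ} (hg : AEStronglyMeasurable g μ) :
    ∫ ω, g (S.T x ω) ∂μ = ∫ ω, g ω ∂μ := by
  have h := (S.measurePreserving x).map_eq
  rw [← integral_map (S.measurePreserving x).measurable.aemeasurable (by rwa [h]), h]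

theorem integral_U (x : Space n) (f : Lp ℝ 2 μ) : ∫ ω, S.U x f ω ∂μ = ∫ ω, f ω ∂μ := by
  rw [integral_congr_ae (S.U_coeFn x f), S.integral_comp_T x (Lp.aestronglyMeasurable f)]

/-- The expectation is constant along the orbit, by invariance of `μ`. -/
theorem integral_deriv (j : Fin n) (f : S.D) : ∫ ω, S.deriv j f ω ∂μ = 0 := by
  have h0 := S.hasDerivAt_U f j 0
  have h1 := (innerSL ℝ (one : Lp ℝ 2 μ)).hasFDerivAt.comp_hasDerivAt (0 : ℝ) h0
  have h2 : ((innerSL ℝ (one : Lp ℝ 2 μ)) ∘ fun s : ℝ => S.U (s • basisVec j) (S.val f)) =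
      fun _ => ∫ ω, S.val f ω ∂μ := by
    funext s
    simp only [Function.comp_apply, innerSL_apply_apply, inner_one, S.integral_U]
  rw [h2] at h1
  have h3 := h1.unique (hasDerivAt_const (0 : ℝ) _)
  simpa [inner_one, S.U_zero] using h3

/-- A function vanishing on `ℳ` has stochastic derivatives vanishing on `ℳ`. -/
theorem deriv_eq_zero_on {F : Set Ω} (hF : MeasurableSet F) (f : S.D)
    (hf : ∀ᵐ ω ∂(μ.restrict Fᶜ), S.val f ω = 0) (j : Fin n) :
    ∀ᵐ ω ∂(μ.restrict Fᶜ), S.deriv j f ω = 0 := by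
  rw [ae_restrict_iff' hF.compl] at hf
  let χ : Lp ℝ 2 μ := indicatorConstLp 2 hF (measure_ne_top μ F) (1 : ℝ)
  have hset : ∀ A : Set Ω, MeasurableSet A → ∫ ω in A ∩ Fᶜ, S.deriv j f ω ∂μ = 0 := by
    intro A hA
    have hAm : MeasurableSet (A ∩ Fᶜ) := hA.inter hF.compl
    let a : Lp ℝ 2 μ := indicatorConstLp 2 hAm (measure_ne_top μ _) (1 : ℝ)
    -- The indicator of the points of `A ∩ ℳ` that the shift by `t` moves into `ℱ`. Its norm tends
    -- to zero by strong continuity at the indicator of `ℱ`; on the rest of `A ∩ ℳ` the difference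
    -- quotient is zero.
    let w : ℝ → Lp ℝ 2 μ := fun t =>
      indicatorConstLp 2 (hAm.inter ((S.measurePreserving (t • basisVec j)).measurable hF))
        (measure_ne_top μ _) (1 : ℝ)
    let q : ℝ → Lp ℝ 2 μ := slope (fun t : ℝ => S.U (t • basisVec j) (S.val f)) 0
    have hq : Tendsto q (𝓝[≠] 0) (𝓝 (S.deriv j f)) := hasDerivAt_iff_tendsto_slope.1 (f.2 j)
    have hw : ∀ t, ‖w t‖ ≤ ‖S.U (t • basisVec j) χ - χ‖ := by
      intro t
      refine Lp.norm_le_norm_of_ae_le ?_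
      have hmp := S.measurePreserving (t • (basisVec j : Space n))
      filter_upwards [indicatorConstLp_coeFn (p := 2) (c := (1 : ℝ)) (μ := μ)
          (hs := hAm.inter (hmp.measurable hF)) (hμs := measure_ne_top μ _),
        Lp.coeFn_sub (S.U (t • basisVec j) χ) χ, S.U_coeFn (t • basisVec j) χ,
        indicatorConstLp_coeFn (p := 2) (c := (1 : ℝ)) (μ := μ) (hs := hF)
          (hμs := measure_ne_top μ _),
        hmp.quasiMeasurePreserving.ae (indicatorConstLp_coeFn (p := 2) (c := (1 : ℝ)) (μ := μ)
          (hs := hF) (hμs := measure_ne_top μ _))] with ω h1 h2 h3 h4 h5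
      rw [h2, Pi.sub_apply, h3]
      simp only [χ, w]
      rw [h1, h4, h5]
      by_cases hω : ω ∈ A ∩ Fᶜ ∩ S.T (t • basisVec j) ⁻¹' F
      · have e1 : ω ∉ F := hω.1.2
        have e2 : S.T (t • basisVec j) ω ∈ F := hω.2
        rw [indicator_of_mem hω, indicator_of_notMem e1, indicator_of_mem e2]
        simp
      · rw [indicator_of_notMem hω]
        simp
    have hw0 : Tendsto (fun t => ‖w t‖) (𝓝[≠] 0) (𝓝 0) := by
      refine squeeze_zero (fun _ => norm_nonneg _) hw ?_
      have h1 : Continuous fun t : ℝ => ‖S.U (t • basisVec j) χ - χ‖ :=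
        (((S.continuous_U χ).comp (by fun_prop : Continuous fun t : ℝ =>
          t • (basisVec j : Space n))).sub continuous_const).norm
      have h2 := h1.tendsto 0
      simp only [zero_smul, S.U_zero, sub_self, norm_zero] at h2
      exact h2.mono_left nhdsWithin_le_nhds
    have hlim1 : Tendsto (fun t => inner ℝ (w t) (q t)) (𝓝[≠] 0) (𝓝 0) := by
      refine squeeze_zero_norm (fun t => norm_inner_le_norm (w t) (q t)) ?_
      simpa using hw0.mul hq.norm
    have hlim2 : Tendsto (fun t => inner ℝ a (q t)) (𝓝[≠] 0) (𝓝 (inner ℝ a (S.deriv j f))) :=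
      tendsto_const_nhds.inner hq
    have heq : ∀ t, inner ℝ a (q t) = inner ℝ (w t) (q t) := by
      intro t
      simp only [a, w]
      rw [L2.inner_indicatorConstLp_one, L2.inner_indicatorConstLp_one]
      refine (setIntegral_eq_of_subset_of_ae_sdiff_eq_zero hAm.nullMeasurableSet
        inter_subset_left ?_)
      have hmp := S.measurePreserving (t • (basisVec j : Space n))
      filter_upwards [hf, hmp.quasiMeasurePreserving.ae hf, S.U_coeFn (t • basisVec j) (S.val f),
        Lp.coeFn_smul (t - 0)⁻¹ (S.U (t • basisVec j) (S.val f) - S.U ((0 : ℝ) • basisVec j)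
          (S.val f)), Lp.coeFn_sub (S.U (t • basisVec j) (S.val f)) (S.U ((0 : ℝ) • basisVec j)
          (S.val f))] with ω h1 h2 h3 h4 h5 hω
      have e1 : ω ∈ Fᶜ := hω.1.2
      have e2 : S.T (t • basisVec j) ω ∈ Fᶜ := fun h => hω.2 ⟨hω.1, h⟩
      simp only [q, slope, vsub_eq_sub]
      rw [h4, Pi.smul_apply, h5, Pi.sub_apply, h3, h2 e2, zero_smul, S.U_zero, h1 e1]
      simp
    have h3 : inner ℝ a (S.deriv j f) = 0 :=
      tendsto_nhds_unique (hlim2.congr heq) hlim1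
    rwa [L2.inner_indicatorConstLp_one] at h3
  refine ae_eq_zero_of_forall_setIntegral_eq_of_sigmaFinite (μ := μ.restrict Fᶜ) ?_ ?_
  · intro s hs _
    exact ((Lp.memLp (S.deriv j f)).integrable (by norm_num)).restrict.integrableOn
  · intro s hs _
    rw [Measure.restrict_restrict hs]
    exact hset s hs

end ErgodicSystem

/-! ### Smoothing along the flow -/

/-- The partial derivative `∂_j κ`. -/
def pd {n : ℕ} (j : Fin n) (κ : Space n → ℝ) (x : Space n) : ℝ := fderiv ℝ κ x (basisVec j)

namespace IsTestFunction

variable {n : ℕ} {G : Set (Space n)} {κ : Space n → ℝ}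

theorem mono {H : Type*} [NormedAddCommGroup H] [NormedSpace ℝ H] {G' : Set (Space n)}
    {φ : Space n → H} (h : IsTestFunction G φ) (hG : G ⊆ G') : IsTestFunction G' φ :=
  ⟨h.1, h.2, h.3.trans hG⟩

theorem differentiable {H : Type*} [NormedAddCommGroup H] [NormedSpace ℝ H]
    {φ : Space n → H} (h : IsTestFunction G φ) : Differentiable ℝ φ :=
  h.contDiff.differentiable (by simp)

theorem contDiff_one {H : Type*} [NormedAddCommGroup H] [NormedSpace ℝ H]
    {φ : Space n → H} (h : IsTestFunction G φ) : ContDiff ℝ 1 φ :=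
  h.contDiff.of_le (by norm_cast)

theorem fderiv_apply {H : Type*} [NormedAddCommGroup H] [NormedSpace ℝ H]
    {φ : Space n → H} (h : IsTestFunction G φ) (v : Space n) :
    IsTestFunction G fun x => fderiv ℝ φ x v := by
  refine ⟨?_, h.hasCompactSupport.fderiv_apply ℝ v, ?_⟩
  · exact (h.contDiff.fderiv_right (m := smooth) (by norm_cast)).clm_apply contDiff_const
  · exact (tsupport_fderiv_apply_subset ℝ v).trans h.tsupport_subset

theorem pd (h : IsTestFunction G κ) (j : Fin n) : IsTestFunction G (pd j κ) :=
  h.fderiv_apply (basisVec j)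

theorem continuous {H : Type*} [NormedAddCommGroup H] [NormedSpace ℝ H]
    {φ : Space n → H} (h : IsTestFunction G φ) : Continuous φ := h.contDiff.continuous

theorem integrable (h : IsTestFunction G κ) : Integrable κ :=
  h.continuous.integrable_of_hasCompactSupport h.hasCompactSupport

end IsTestFunction

theorem pd_comm {n : ℕ} {κ : Space n → ℝ} (h : ContDiff ℝ smooth κ) (i j : Fin n) :
    pd i (pd j κ) = pd j (pd i κ) := by
  have h2 : ∀ x, HasFDerivAt (fderiv ℝ κ) (fderiv ℝ (fderiv ℝ κ) x) x := fun x =>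
    ((h.fderiv_right (m := smooth) (by norm_cast)).differentiable (by simp) x).hasFDerivAt
  have key : ∀ (a b : Fin n) x, pd a (pd b κ) x =
      fderiv ℝ (fderiv ℝ κ) x (basisVec a) (basisVec b) := by
    intro a b x
    have h3 : HasFDerivAt (pd b κ) ((fderiv ℝ (fderiv ℝ κ) x).flip (basisVec b)) x := by
      have := (h2 x).clm_apply (hasFDerivAt_const (basisVec b : Space n) x)
      refine this.congr_fderiv ?_
      ext v; simp
    rw [pd, h3.fderiv]
    rfl
  funext x
  rw [key, key]
  refine ((h.contDiffAt (x := x)).isSymmSndFDerivAt ?_).eq _ _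
  simp only [minSmoothness_of_isRCLikeNormedField]
  norm_cast

theorem gradient_apply_eq_pd {n : ℕ} {φ : Space n → ℝ} (x : Space n)
    (i : Fin n) : gradient φ x i = pd i φ x := by
  have h : inner ℝ (gradient φ x) (basisVec i) = fderiv ℝ φ x (basisVec i) := by
    rw [gradient, InnerProductSpace.toDual_symm_apply]
  rw [pd, ← h, EuclideanSpace.inner_single_right]
  simp

namespace ErgodicSystem

variable {n : ℕ} {Ω : Type*} [MeasurableSpace Ω] {μ : Measure Ω} (S : ErgodicSystem n μ)
variable [IsProbabilityMeasure μ]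

/-- The function `∫ κ(y) f(T(-y) ω) dy`. -/
def smear (κ : Space n → ℝ) (f : Lp ℝ 2 μ) : Lp ℝ 2 μ := ∫ y, κ y • S.U (-y) f

variable {κ : Space n → ℝ}

theorem integrable_smear (hκ : Continuous κ) (hc : HasCompactSupport κ) (f : Lp ℝ 2 μ)
    (x : Space n) : Integrable fun y => κ y • S.U (x - y) f :=
  (hκ.smul ((S.continuous_U f).comp (by fun_prop))).integrable_of_hasCompactSupport
    hc.smul_right

theorem U_smear (hκ : Continuous κ) (hc : HasCompactSupport κ) (f : Lp ℝ 2 μ) (x : Space n) :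
    S.U x (S.smear κ f) = ∫ y, κ y • S.U (x - y) f := by
  have h0 := S.integrable_smear hκ hc f 0
  simp only [zero_sub] at h0
  have := (S.UL x).integral_comp_comm h0
  rw [smear]
  refine Eq.trans this.symm ?_
  refine integral_congr_ae (ae_of_all _ fun y => ?_)
  simp only [map_smul, UL_apply]
  rw [← S.U_add, sub_eq_add_neg]

theorem inner_smear (hκ : Continuous κ) (hc : HasCompactSupport κ) (f g : Lp ℝ 2 μ) :
    inner ℝ g (S.smear κ f) = ∫ y, κ y * inner ℝ g (S.U (-y) f) := by
  have h0 := S.integrable_smear hκ hc f 0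
  simp only [zero_sub] at h0
  rw [smear, ← integral_inner h0]
  simp only [inner_smul_right]

/-- By `U_smear` the orbit of a smeared function is the convolution of `κ` with `x ↦ U x f`, and the
derivative of a convolution can be put on the smooth factor. -/
theorem hasDerivAt_smear (hκ : IsTestFunction univ κ) (f : Lp ℝ 2 μ) (j : Fin n) :
    HasDerivAt (fun t : ℝ => S.U (t • basisVec j) (S.smear κ f)) (S.smear (pd j κ) f) 0 := by
  have hF : LocallyIntegrable (fun x => S.U x f) (volume : Measure (Space n)) :=
    (S.continuous_U f).locallyIntegrable
  have h1 := hκ.hasCompactSupport.hasFDerivAt_convolution_left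
    (ContinuousLinearMap.lsmul ℝ ℝ : ℝ →L[ℝ] Lp ℝ 2 μ →L[ℝ] Lp ℝ 2 μ) hκ.contDiff_one hF
    (μ := volume) ((0 : ℝ) • basisVec j)
  have h2 : HasDerivAt (fun t : ℝ => t • (basisVec j : Space n)) (basisVec j) 0 := by
    simpa using (hasDerivAt_id (0 : ℝ)).smul_const (basisVec j : Space n)
  have h3 := h1.comp_hasDerivAt (0 : ℝ) h2
  refine (h3.congr_of_eventuallyEq (Eventually.of_forall fun t => ?_)).congr_deriv ?_
  · rw [S.U_smear hκ.continuous hκ.hasCompactSupport]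
    rfl
  · rw [convolution_def, ContinuousLinearMap.integral_apply, smear]
    · refine integral_congr_ae (ae_of_all _ fun y => ?_)
      simp [ContinuousLinearMap.precompL_apply, pd]
    · have h4 : HasCompactSupport (fderiv ℝ κ) := hκ.hasCompactSupport.fderiv ℝ
      have h5 := (h4.convolutionExists_left
        ((ContinuousLinearMap.lsmul ℝ ℝ : ℝ →L[ℝ] Lp ℝ 2 μ →L[ℝ] Lp ℝ 2 μ).precompL (Space n))
        (hκ.contDiff_one.continuous_fderiv one_ne_zero) hF) ((0 : ℝ) • basisVec j)
      exact h5.integrable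

/-- The smoothed function, as an element of `𝒟(Ω)`. -/
def smearD (hκ : IsTestFunction univ κ) (f : Lp ℝ 2 μ) : S.D :=
  ⟨WithLp.toLp 2 (S.smear κ f, WithLp.toLp 2 fun j => S.smear (pd j κ) f),
    fun j => S.hasDerivAt_smear hκ f j⟩

@[simp] theorem val_smearD (hκ : IsTestFunction univ κ) (f : Lp ℝ 2 μ) :
    S.val (S.smearD hκ f) = S.smear κ f := rfl

@[simp] theorem deriv_smearD (hκ : IsTestFunction univ κ) (f : Lp ℝ 2 μ) (j : Fin n) :
    S.deriv j (S.smearD hκ f) = S.smear (pd j κ) f := rfl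

theorem U_one (x : Space n) : S.U x (one : Lp ℝ 2 μ) = one := by
  refine Lp.ext ?_
  have h : (one : Lp ℝ 2 μ) =ᵐ[μ] fun _ => (1 : ℝ) :=
    indicatorConstLp_coeFn.trans (by simp)
  filter_upwards [S.U_coeFn x one, (S.measurePreserving x).quasiMeasurePreserving.ae h, h]
    with ω h1 h2 h3
  rw [h1, h2, h3]

/-- The constant function `1`, as an element of `𝒟(Ω)`. -/
def oneD : S.D :=
  ⟨WithLp.toLp 2 (one, 0), fun j => by
    simpa [S.U_one] using hasDerivAt_const (0 : ℝ) (one : Lp ℝ 2 μ)⟩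

@[simp] theorem val_oneD : S.val S.oneD = one := rfl

@[simp] theorem deriv_oneD (j : Fin n) : S.deriv j S.oneD = 0 := rfl

/-- Fubini's theorem for `smear`. -/
theorem inner_smear_eq_integral (hκ : Continuous κ) (hc : HasCompactSupport κ) (f b : Lp ℝ 2 μ) :
    inner ℝ f (S.smear κ b) = ∫ ω, b ω * (∫ y, κ y * f (S.T y ω)) ∂μ := by
  rw [S.inner_smear hκ hc]
  have hfm : AEMeasurable f μ := (Lp.aestronglyMeasurable f).aemeasurable
  have hbm : AEMeasurable b μ := (Lp.aestronglyMeasurable b).aemeasurable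
  have hm : AEMeasurable (fun p : Space n × Ω => b p.2 * (κ p.1 * f (S.T p.1 p.2)))
      (volume.prod μ) :=
    (hbm.comp_quasiMeasurePreserving Measure.quasiMeasurePreserving_snd).mul
      ((hκ.measurable.comp measurable_fst).aemeasurable.mul
        (S.aemeasurable_flow_comp (Measure.QuasiMeasurePreserving.id _) hfm))
  have hin : ∀ y, inner ℝ f (S.U (-y) b) = ∫ ω, b ω * f (S.T y ω) ∂μ := by
    intro y
    rw [real_inner_comm, S.inner_U_left, neg_neg, L2.inner_def]
    refine integral_congr_ae ((S.U_coeFn y f).mono fun ω h => ?_)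
    simp only [h]
    exact mul_comm _ _
  have hint : ∀ y, Integrable (fun ω => b ω * f (S.T y ω)) μ := by
    intro y
    have := L2.integrable_inner (𝕜 := ℝ) b (S.U y f)
    refine this.congr ((S.U_coeFn y f).mono fun ω h => ?_)
    simp only [h]
    exact mul_comm _ _
  -- A bound independent of `y`, by Cauchy–Schwarz and isometry; with the compact support of `κ` it
  -- makes the double integral absolutely convergent.
  have hbd : ∀ y, ∫ ω, ‖b ω * f (S.T y ω)‖ ∂μ ≤ ‖b‖ * ‖f‖ := by
    intro y
    have e : ∫ ω, ‖b ω * f (S.T y ω)‖ ∂μ = ∫ ω, ‖b ω‖ * ‖S.U y f ω‖ ∂μ := by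
      refine integral_congr_ae ((S.U_coeFn y f).mono fun ω h => ?_)
      simp only [h, norm_mul]
    rw [e]
    have h1 := integral_mul_le_Lp_mul_Lq_of_nonneg (μ := μ) Real.HolderConjugate.two_two
      (f := fun ω => ‖b ω‖) (g := fun ω => ‖S.U y f ω‖)
      (ae_of_all _ fun _ => norm_nonneg _) (ae_of_all _ fun _ => norm_nonneg _)
      (by simpa using (Lp.memLp b).norm) (by simpa using (Lp.memLp (S.U y f)).norm)
    refine h1.trans (le_of_eq ?_)
    have hn : ∀ g : Lp ℝ 2 μ, (∫ ω, ‖g ω‖ ^ (2 : ℝ) ∂μ) ^ (1 / (2 : ℝ)) = ‖g‖ := by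
      intro g
      have h2 : ‖g‖ ^ 2 = ∫ ω, ‖g ω‖ ^ (2 : ℝ) ∂μ := by
        rw [← real_inner_self_eq_norm_sq, L2.inner_def]
        refine integral_congr_ae (ae_of_all _ fun ω => ?_)
        simp
      rw [← h2, ← Real.sqrt_eq_rpow, Real.sqrt_sq (norm_nonneg _)]
    rw [hn, hn, S.norm_U]
  have hI : Integrable (fun p : Space n × Ω => b p.2 * (κ p.1 * f (S.T p.1 p.2)))
      (volume.prod μ) := by
    rw [integrable_prod_iff hm.aestronglyMeasurable]
    constructor
    · refine ae_of_all _ fun y => ?_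
      refine ((hint y).const_mul (κ y)).congr (ae_of_all _ fun ω => ?_)
      simp only; ring
    · refine Integrable.mono' (g := fun y => ‖κ y‖ * (‖b‖ * ‖f‖))
        ((hκ.norm.integrable_of_hasCompactSupport hc.norm).mul_const _)
        hm.aestronglyMeasurable.norm.integral_prod_right' (ae_of_all _ fun y => ?_)
      rw [Real.norm_of_nonneg (integral_nonneg fun _ => norm_nonneg _)]
      have e : ∫ ω, ‖b ω * (κ y * f (S.T y ω))‖ ∂μ = ‖κ y‖ * ∫ ω, ‖b ω * f (S.T y ω)‖ ∂μ := by
        rw [← integral_const_mul]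
        refine integral_congr_ae (ae_of_all _ fun ω => ?_)
        simp only [norm_mul]; ring
      simp only [e]
      exact mul_le_mul_of_nonneg_left (hbd y) (norm_nonneg _)
  have h2 := integral_integral_swap (f := fun y ω => b ω * (κ y * f (S.T y ω))) hI
  calc ∫ y, κ y * inner ℝ f (S.U (-y) b)
      = ∫ y, ∫ ω, b ω * (κ y * f (S.T y ω)) ∂μ := by
        refine integral_congr_ae (ae_of_all _ fun y => ?_)
        simp only [hin y]
        rw [← integral_const_mul]
        refine integral_congr_ae (ae_of_all _ fun ω => ?_)
        simp only; ring
    _ = ∫ ω, (∫ y, b ω * (κ y * f (S.T y ω))) ∂μ := h2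
    _ = _ := by simp_rw [integral_const_mul]

/-- A weak gradient is curl-free: both sides equal minus the integral of the potential against `∂_i
∂_j κ`. -/
theorem IsPotential.integral_pd_mul {v : Space n → Space n} (hv : IsPotential v)
    (hκ : IsTestFunction univ κ) (i j : Fin n) :
    ∫ x, pd j κ x * v x i = ∫ x, pd i κ x * v x j := by
  obtain ⟨hloc, w, hw, h⟩ := hv
  have key : ∀ a b : Fin n, ∫ x, pd a κ x * v x b = -∫ x, w x * pd b (pd a κ) x := by
    intro a b
    have h1 := h (pd a κ) (hκ.pd a)
    have i1 : Integrable fun x => w x • gradient (pd a κ) x := by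
      refine (hw.integrable_smul_right_of_hasCompactSupport ?_ ?_)
      · have : gradient (pd a κ) = fun x => (InnerProductSpace.toDual ℝ (Space n)).symm
          (fderiv ℝ (pd a κ) x) := rfl
        rw [this]
        exact (LinearIsometryEquiv.continuous _).comp
          ((hκ.pd a).contDiff_one.continuous_fderiv one_ne_zero)
      · exact ((hκ.pd a).hasCompactSupport.fderiv ℝ).comp_left (map_zero _)
    have i2 : Integrable fun x => pd a κ x • v x :=
      hloc.integrable_smul_left_of_hasCompactSupport (hκ.pd a).continuous
        (hκ.pd a).hasCompactSupport
    have h2 := congrArg (EuclideanSpace.proj b : Space n →L[ℝ] ℝ) h1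
    rw [map_neg, ← (EuclideanSpace.proj b : Space n →L[ℝ] ℝ).integral_comp_comm i1,
      ← (EuclideanSpace.proj b : Space n →L[ℝ] ℝ).integral_comp_comm i2] at h2
    simp only [PiLp.proj_apply, PiLp.smul_apply, smul_eq_mul, gradient_apply_eq_pd] at h2
    linarith
  rw [key, key, pd_comm hκ.contDiff]

/-- Elements of `𝒱²_pot` are curl-free, in weak form. -/
theorem inner_smear_pd_comm {f : L2Vec n μ} (hf : f ∈ S.Vpot) (hκ : IsTestFunction univ κ)
    (b : Lp ℝ 2 μ) (i j : Fin n) :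
    inner ℝ (f i) (S.smear (pd j κ) b) = inner ℝ (f j) (S.smear (pd i κ) b) := by
  rw [S.inner_smear_eq_integral (hκ.pd j).continuous (hκ.pd j).hasCompactSupport,
    S.inner_smear_eq_integral (hκ.pd i).continuous (hκ.pd i).hasCompactSupport]
  refine integral_congr_ae (hf.1.mono fun ω h => ?_)
  have := IsPotential.integral_pd_mul h hκ i j
  simp only [L2Vec.eval] at this
  simp only [this]

end ErgodicSystem

/-! ### The projection of a bounded domain with bounded curvature -/

/-- The unit ball is mapped into the ball of radius `‖A‖`; comparing volumes gives the bound. -/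
theorem abs_det_le_pow {n : ℕ} (A : Space n →L[ℝ] Space n) : |A.det| ≤ ‖A‖ ^ n := by
  have h1 : A '' Metric.closedBall 0 1 ⊆ Metric.closedBall 0 ‖A‖ := by
    rintro _ ⟨x, hx, rfl⟩
    have hx' : ‖x‖ ≤ 1 := by simpa using hx
    simpa using (A.le_opNorm x).trans (mul_le_of_le_one_right (norm_nonneg A) hx')
  have h2 := measure_mono (μ := (volume : Measure (Space n))) h1
  rw [Measure.addHaar_image_continuousLinearMap,
    Measure.addHaar_closedBall' _ _ (norm_nonneg A), finrank_euclideanSpace_fin] at h2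
  have h3 := (Metric.measure_closedBall_pos (volume : Measure (Space n)) 0 one_pos).ne'
  have h4 : volume (Metric.closedBall (0 : Space n) 1) ≠ ∞ := measure_closedBall_lt_top.ne
  rw [ENNReal.mul_le_mul_iff_left h3 h4] at h2
  exact (ENNReal.ofReal_le_ofReal_iff (by positivity)).1 h2

variable {n : ℕ} {B : Set (Space n)} {e : Space n}

/-- The hyperplane through `q` with slope `a` over `e^⊥` supports `B` from above. -/
structure IsContact (B : Set (Space n)) (e q a : Space n) : Prop where
  mem : q ∈ closure B
  orth : inner ℝ a e = 0
  norm_le : ‖a‖ ≤ 1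
  le : ∀ b ∈ closure B, inner ℝ (e - a) b ≤ inner ℝ (e - a) q

/-- The orthogonal projection along the unit vector `e`. -/
def projL (e : Space n) : Space n →L[ℝ] Space n :=
  ContinuousLinearMap.id ℝ (Space n) - (innerSL ℝ e).smulRight e

theorem projL_apply (e x : Space n) : projL e x = x - inner ℝ e x • e := by
  simp [projL]

theorem IsDefiningFunction.of_mem {k : WithTop ℕ∞} {p q : Space n} {U : Set (Space n)}
    {ψ : Space n → ℝ} (h : IsDefiningFunction k B p U ψ) (hq : q ∈ U) (hne : fderiv ℝ ψ q ≠ 0) :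
    IsDefiningFunction k B q U ψ := ⟨h.1, hq, h.2.2.1, hne, h.2.2.2.2⟩

theorem IsDefiningFunction.contDiffAt {k : WithTop ℕ∞} {p : Space n} {U : Set (Space n)}
    {ψ : Space n → ℝ} (h : IsDefiningFunction k B p U ψ) : ContDiffAt ℝ k ψ p :=
  h.2.2.1.contDiffAt (h.1.mem_nhds h.2.1)

theorem IsDefiningFunction.mem_iff {k : WithTop ℕ∞} {p q : Space n} {U : Set (Space n)}
    {ψ : Space n → ℝ} (h : IsDefiningFunction k B p U ψ) (hq : q ∈ U) : q ∈ B ↔ ψ q < 0 := by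
  have := Set.ext_iff.1 h.2.2.2.2 q
  simp only [mem_inter_iff, mem_ofPred_eq, hq, and_true, true_and] at this
  exact this

/-- From an interior point one could move a little in the direction `e - a`, which increases the
supported functional. This direction is not zero, since its product with `e` is 1. -/
theorem IsContact.notMem (he : ‖e‖ = 1) (hB : IsOpen B) {q a : Space n}
    (h : IsContact B e q a) : q ∉ B := by
  intro hq
  have hne : e - a ≠ 0 := by
    intro h0
    have : inner ℝ (e - a) e = 0 := by rw [h0, inner_zero_left]
    rw [inner_sub_left, h.orth, real_inner_self_eq_norm_sq, he] at this
    norm_num at this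
  have hc : Tendsto (fun s : ℝ => q + s • (e - a)) (𝓝[>] 0) (𝓝 q) := by
    have : Continuous fun s : ℝ => q + s • (e - a) := by fun_prop
    have h2 := this.tendsto 0
    simp only [zero_smul, add_zero] at h2
    exact h2.mono_left nhdsWithin_le_nhds
  obtain ⟨s, hs, hs0⟩ := ((hc.eventually (hB.mem_nhds hq)).and self_mem_nhdsWithin).exists
  have h3 := h.le _ (subset_closure hs)
  rw [inner_add_right, inner_smul_right, real_inner_self_eq_norm_sq] at h3
  have : 0 < s * ‖e - a‖ ^ 2 := mul_pos hs0 (by positivity)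
  linarith

theorem eventually_mem_of_fderiv_neg {k : WithTop ℕ∞} (hk : k ≠ 0) {q : Space n}
    {U : Set (Space n)} {ψ : Space n → ℝ} (h : IsDefiningFunction k B q U ψ) (hq : ψ q ≤ 0)
    {v : Space n} (hv : fderiv ℝ ψ q v < 0) : ∀ᶠ s in 𝓝[>] (0 : ℝ), q + s • v ∈ B := by
  have hd : HasFDerivAt ψ (fderiv ℝ ψ q) (q + (0 : ℝ) • v) := by
    simpa using (h.contDiffAt.differentiableAt hk).hasFDerivAt
  have hl : HasDerivAt (fun s : ℝ => q + s • v) v 0 := by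
    simpa using ((hasDerivAt_id (0 : ℝ)).smul_const v).const_add q
  have hs := hasDerivAt_iff_tendsto_slope.1 (hd.comp_hasDerivAt (0 : ℝ) hl)
  have h1 := (hs.eventually (gt_mem_nhds hv)).filter_mono
    (nhdsWithin_mono _ (fun x (hx : (0 : ℝ) < x) => ne_of_gt hx))
  have hc : Tendsto (fun s : ℝ => q + s • v) (𝓝[>] 0) (𝓝 q) := by
    have h2 := hl.continuousAt.tendsto
    simp only [zero_smul, add_zero] at h2
    exact h2.mono_left nhdsWithin_le_nhds
  filter_upwards [h1, hc.eventually (h.1.mem_nhds h.2.1), self_mem_nhdsWithin] with s h3 h4 h5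
  rw [h.mem_iff h4]
  have h5' : (0 : ℝ) < s := h5
  simp only [slope, vsub_eq_sub, sub_zero, Function.comp_apply, zero_smul, add_zero,
    smul_eq_mul] at h3
  have : ψ (q + s • v) - ψ q < 0 := by
    by_contra hcon
    push Not at hcon
    have := mul_nonneg (inv_nonneg.2 h5'.le) hcon
    linarith
  linarith

theorem IsContact.apply_eq_zero {k : WithTop ℕ∞} (he : ‖e‖ = 1) (hB : IsOpen B) {q a : Space n}
    (hc : IsContact B e q a) {U : Set (Space n)} {ψ : Space n → ℝ}
    (h : IsDefiningFunction k B q U ψ) : ψ q = 0 := by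
  refine le_antisymm ?_ ?_
  · have hcont : ContinuousAt ψ q := h.contDiffAt.continuousAt
    have hcl : (𝓝[B] q).NeBot := mem_closure_iff_nhdsWithin_neBot.1 hc.mem
    refine le_of_tendsto (hcont.tendsto.mono_left (nhdsWithin_le_nhds (s := B))) ?_
    filter_upwards [self_mem_nhdsWithin, nhdsWithin_le_nhds (h.1.mem_nhds h.2.1)] with x hx hxU
    exact ((h.mem_iff hxU).1 hx).le
  · by_contra hlt
    exact hc.notMem he hB ((h.mem_iff h.2.1).2 (not_le.1 hlt))

/-- At a contact point the gradient of a defining function is a positive multiple of `e - a`. -/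
theorem IsContact.gradient_eq {k : WithTop ℕ∞} (hk : k ≠ 0) (he : ‖e‖ = 1) (hB : IsOpen B)
    {q a : Space n} (hc : IsContact B e q a) {U : Set (Space n)} {ψ : Space n → ℝ}
    (h : IsDefiningFunction k B q U ψ) :
    0 < inner ℝ (gradient ψ q) e ∧
      e - a = (inner ℝ (gradient ψ q) e)⁻¹ • gradient ψ q := by
  set g := gradient ψ q with hg
  have hgv : ∀ v, fderiv ℝ ψ q v = inner ℝ g v := fun v => by
    rw [hg, gradient, InnerProductSpace.toDual_symm_apply]
  have hg0 : g ≠ 0 := by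
    intro h0
    apply h.2.2.2.1
    ext v
    rw [hgv, h0, inner_zero_left]; rfl
  -- A direction in which `ψ` decreases leads into `B`, where the supported functional cannot exceed
  -- its value at `q`.
  have h1 : ∀ v, inner ℝ g v < 0 → inner ℝ (e - a) v ≤ 0 := by
    intro v hv
    have hv' : fderiv ℝ ψ q v < 0 := by rw [hgv]; exact hv
    obtain ⟨s, hs, hs0⟩ := ((eventually_mem_of_fderiv_neg hk h
      (hc.apply_eq_zero he hB h).le hv').and self_mem_nhdsWithin).exists
    have h3 := hc.le _ (subset_closure hs)
    rw [inner_add_right, inner_smul_right] at h3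
    have hs0' : (0 : ℝ) < s := hs0
    by_contra hcon
    have := mul_pos hs0' (not_le.1 hcon)
    linarith
  have hgg : 0 < inner ℝ g g := real_inner_self_pos.2 hg0
  set c := inner ℝ (e - a) g / inner ℝ g g with hcdef
  have horth : inner ℝ (e - a - c • g) g = 0 := by
    rw [inner_sub_left, inner_smul_left, hcdef]
    simp only [conj_trivial]
    rw [div_mul_cancel₀ _ hgg.ne', sub_self]
  -- If `e - a` had a component `w` orthogonal to `g`, then `-g + s w` would be a direction of
  -- decrease of `ψ` for every `s`, and a large `s` would increase the functional.
  have hzero : e - a - c • g = 0 := by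
    by_contra hne
    set w := e - a - c • g with hw
    have hww : 0 < inner ℝ w w := real_inner_self_pos.2 hne
    have h2 : ∀ s : ℝ, inner ℝ (e - a) (-g + s • w) ≤ 0 := by
      intro s
      apply h1
      rw [inner_add_right, inner_neg_right, inner_smul_right, real_inner_comm w g, horth]
      linarith
    have hew : inner ℝ (e - a) w = inner ℝ w w := by
      have : e - a = w + c • g := by rw [hw]; abel
      rw [this, inner_add_left, inner_smul_left, real_inner_comm w g, horth]
      simp
    have h3 := h2 ((inner ℝ (e - a) g + 1) / inner ℝ w w)
    rw [inner_add_right, inner_neg_right, inner_smul_right, hew,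
      div_mul_cancel₀ _ hww.ne'] at h3
    linarith
  have hea : e - a = c • g := sub_eq_zero.1 hzero
  have h4 : c * inner ℝ g e = 1 := by
    have : inner ℝ (e - a) e = 1 := by
      rw [inner_sub_left, hc.orth, real_inner_self_eq_norm_sq, he]; norm_num
    rwa [hea, inner_smul_left] at this
  have hc0 : 0 ≤ c := by
    have h5 := h1 (-g) (by rw [inner_neg_right]; linarith)
    rw [inner_neg_right] at h5
    exact div_nonneg (by linarith) hgg.le
  have hcne : c ≠ 0 := by rintro h0; rw [h0, zero_mul] at h4; norm_num at h4
  have hcpos : 0 < c := lt_of_le_of_ne hc0 (Ne.symm hcne)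
  have hge : 0 < inner ℝ g e := by
    by_contra hcon
    have := mul_nonpos_of_nonneg_of_nonpos hc0 (not_lt.1 hcon)
    linarith
  refine ⟨hge, ?_⟩
  rw [hea, eq_inv_of_mul_eq_one_left h4]

theorem IsContact.gradient_slope {k : WithTop ℕ∞} (hk : k ≠ 0) (he : ‖e‖ = 1) (hB : IsOpen B)
    {q a : Space n} (hc : IsContact B e q a) {U : Set (Space n)} {ψ : Space n → ℝ}
    (h : IsDefiningFunction k B q U ψ) :
    a = e - (inner ℝ (gradient ψ q) e)⁻¹ • gradient ψ q := by
  rw [← (hc.gradient_eq hk he hB h).2]; abel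

theorem IsContact.frontier (he : ‖e‖ = 1) (hB : IsOpen B) {q a : Space n}
    (hc : IsContact B e q a) : q ∈ frontier B := by
  rw [hB.frontier_eq]
  exact ⟨hc.mem, hc.notMem he hB⟩

/-- The heights of two contact points. -/
theorem IsContact.height_le {q a q' a' : Space n} (hc : IsContact B e q a)
    (hc' : IsContact B e q' a') :
    inner ℝ e (q' - q) ≤ inner ℝ a (projL e (q' - q)) := by
  have h := hc.le _ hc'.mem
  have h2 : inner ℝ a (projL e (q' - q)) = inner ℝ a (q' - q) := by
    rw [projL_apply, inner_sub_right, inner_smul_right, hc.orth, mul_zero, sub_zero]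
  rw [h2]
  simp only [inner_sub_left, inner_sub_right] at h ⊢
  linarith

theorem norm_projL_le (he : ‖e‖ = 1) (x : Space n) : ‖projL e x‖ ≤ ‖x‖ := by
  have h : ‖x‖ ^ 2 = ‖projL e x‖ ^ 2 + (inner ℝ e x) ^ 2 := by
    rw [projL_apply, norm_sub_sq_real, inner_smul_right, norm_smul, he, real_inner_comm]
    simp only [Real.norm_eq_abs, mul_one, sq_abs]
    ring
  nlinarith [norm_nonneg x, norm_nonneg (projL e x), sq_nonneg (inner ℝ e x : ℝ)]

theorem projL_smul_self (he : ‖e‖ = 1) (s : ℝ) : projL e (s • e) = 0 := by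
  rw [projL_apply, inner_smul_right, real_inner_self_eq_norm_sq, he]; simp

/-- The two height inequalities give equal heights, so the points coincide; the slope is then
determined by the normal of the smooth boundary. -/
theorem IsContact.eq_of_projL_eq (he : ‖e‖ = 1) (hB : IsBoundedDomain 2 B)
    {q a q' a' : Space n} (hc : IsContact B e q a)
    (hc' : IsContact B e q' a') (h : projL e q = projL e q') : q = q' ∧ a = a' := by
  have h0 : projL e (q' - q) = 0 := by rw [map_sub, h, sub_self]
  have h0' : projL e (q - q') = 0 := by rw [map_sub, h, sub_self]
  have h1 := hc.height_le hc'
  have h2 := hc'.height_le hc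
  rw [h0, inner_zero_right] at h1
  rw [h0', inner_zero_right, ← neg_sub, inner_neg_right] at h2
  have h3 : inner ℝ e (q' - q) = 0 := le_antisymm h1 (by linarith)
  have h4 : q' - q = 0 := by
    rw [projL_apply, h3, zero_smul, sub_zero] at h0; exact h0
  have h5 : q = q' := (sub_eq_zero.1 h4).symm
  refine ⟨h5, ?_⟩
  subst h5
  obtain ⟨U, ψ, hU⟩ := hB.boundary q (hc.frontier he hB.isOpen)
  rw [hc.gradient_slope two_ne_zero he hB.isOpen hU, hc'.gradient_slope two_ne_zero he hB.isOpen hU]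

theorem isClosed_contact (B : Set (Space n)) (e : Space n) :
    IsClosed {p : Space n × Space n | IsContact B e p.1 p.2} := by
  have : {p : Space n × Space n | IsContact B e p.1 p.2} =
      {p | p.1 ∈ closure B} ∩ {p | inner ℝ p.2 e = 0} ∩ {p | ‖p.2‖ ≤ 1} ∩
        ⋂ b ∈ closure B, {p | inner ℝ (e - p.2) b ≤ inner ℝ (e - p.2) p.1} := by
    ext p
    simp only [mem_ofPred_eq, mem_inter_iff, mem_iInter]
    exact ⟨fun h => ⟨⟨⟨h.1, h.2⟩, h.3⟩, h.4⟩, fun h => ⟨h.1.1.1, h.1.1.2, h.1.2, h.2⟩⟩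
  rw [this]
  refine ((IsClosed.inter ?_ ?_).inter ?_).inter ?_
  · exact isClosed_closure.preimage continuous_fst
  · exact isClosed_eq (by fun_prop) continuous_const
  · exact isClosed_le (by fun_prop) continuous_const
  · exact isClosed_biInter fun b _ => isClosed_le (by fun_prop) (by fun_prop)

/-- Surjectivity of the slope map: a linear functional attains its maximum on the compact closure.
-/
theorem exists_contact (hB : IsBoundedDomain 2 B) {a : Space n} (ha : inner ℝ a e = 0)
    (ha1 : ‖a‖ ≤ 1) : ∃ q, IsContact B e q a := by
  have hcomp : IsCompact (closure B) := hB.isBounded.isCompact_closure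
  obtain ⟨q, hq, hmax⟩ := hcomp.exists_isMaxOn hB.isConnected.nonempty.closure
    (f := fun b => inner ℝ (e - a) b) (by fun_prop)
  exact ⟨q, hq, ha, ha1, fun b hb => hmax hb⟩

/-- The points of the slab `0 ≤ x · e ≤ 1` below or above contact points. -/
def contactSlab (B : Set (Space n)) (e : Space n) : Set (Space n) :=
  {x | ∃ q a, IsContact B e q a ∧ projL e q = projL e x ∧ 0 ≤ inner ℝ e x ∧ inner ℝ e x ≤ 1}

theorem isCompact_contactSlab (he : ‖e‖ = 1) (hB : Bornology.IsBounded B) :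
    IsCompact (contactSlab B e) := by
  have h1 : IsCompact {p : Space n × Space n | IsContact B e p.1 p.2} := by
    refine (hB.isCompact_closure.prod (isCompact_closedBall (0 : Space n) 1)).of_isClosed_subset
      (isClosed_contact B e) fun p hp => ⟨hp.mem, by simpa using hp.norm_le⟩
  have h2 := (h1.prod (isCompact_Icc (a := (0 : ℝ)) (b := 1))).image
    (f := fun r : (Space n × Space n) × ℝ => projL e r.1.1 + r.2 • e) (by fun_prop)
  convert h2 using 1
  ext x
  constructor
  · rintro ⟨q, a, hc, hp, h0, h1⟩
    refine ⟨⟨⟨q, a⟩, inner ℝ e x⟩, ⟨hc, h0, h1⟩, ?_⟩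
    simp only
    rw [hp, projL_apply]; abel
  · rintro ⟨⟨⟨q, a⟩, t⟩, ⟨hc, h0, h1⟩, rfl⟩
    simp only at h0 h1 hc
    have hpq : inner ℝ e (projL e q) = 0 := by
      rw [projL_apply, inner_sub_right, inner_smul_right, real_inner_self_eq_norm_sq, he]; simp
    have hpp : projL e (projL e q) = projL e q := by
      conv_lhs => rw [projL_apply, hpq]
      simp
    have hi : inner ℝ e (projL e q + t • e) = t := by
      rw [inner_add_right, hpq, inner_smul_right, real_inner_self_eq_norm_sq, he]; simp
    refine ⟨q, a, hc, ?_, by rw [hi]; exact h0, by rw [hi]; exact h1⟩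
    rw [map_add, projL_smul_self he, add_zero, hpp]

/-- The gradient of a defining function has positive product with `e` at a contact point, so a small
step downwards from it enters `B`. -/
theorem exists_add_smul_mem (he : ‖e‖ = 1) (hB : IsBoundedDomain 2 B) {x : Space n}
    (hx : x ∈ contactSlab B e) : ∃ t : ℝ, x + t • e ∈ B := by
  obtain ⟨q, a, hc, hp, -⟩ := hx
  obtain ⟨U, ψ, hU⟩ := hB.boundary q (hc.frontier he hB.isOpen)
  have hge := (hc.gradient_eq two_ne_zero he hB.isOpen hU).1
  have hv : fderiv ℝ ψ q (-e) < 0 := by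
    rw [map_neg]
    have : fderiv ℝ ψ q e = inner ℝ (gradient ψ q) e := by
      rw [gradient, InnerProductSpace.toDual_symm_apply]
    linarith
  obtain ⟨s, hs⟩ := (eventually_mem_of_fderiv_neg two_ne_zero hU
    (hc.apply_eq_zero he hB.isOpen hU).le hv).exists
  refine ⟨inner ℝ e q - inner ℝ e x - s, ?_⟩
  rw [projL_apply, projL_apply] at hp
  convert hs using 1
  rw [sub_smul, sub_smul, smul_neg]
  have : x = q - inner ℝ e q • e + inner ℝ e x • e := by rw [hp]; abel
  nth_rewrite 1 [this]
  abel

theorem contactSlab_subset_closedBall (he : ‖e‖ = 1) {R : ℝ}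
    (hR : closure B ⊆ Metric.closedBall 0 R) :
    contactSlab B e ⊆ Metric.closedBall 0 (R + 1) := by
  rintro x ⟨q, a, hc, hp, h0, h1⟩
  have h2 : ‖q‖ ≤ R := by simpa using hR hc.mem
  have h3 : x = projL e q + inner ℝ e x • e := by rw [hp, projL_apply]; abel
  rw [mem_closedBall_zero_iff]
  rw [h3]
  refine (norm_add_le _ _).trans (add_le_add ((norm_projL_le he q).trans h2) ?_)
  rw [norm_smul, he, mul_one, Real.norm_eq_abs, abs_of_nonneg h0]
  exact h1

variable {n : ℕ} {B : Set (Space n)} {e : Space n}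

/-- A contact point over `x`, and its slope. -/
def contactPoint (B : Set (Space n)) (e x : Space n) : Space n × Space n :=
  open Classical in
  if h : ∃ p : Space n × Space n, IsContact B e p.1 p.2 ∧ projL e p.1 = projL e x
    then h.choose else 0

theorem contactPoint_spec {x : Space n} (hx : x ∈ contactSlab B e) :
    IsContact B e (contactPoint B e x).1 (contactPoint B e x).2 ∧
      projL e (contactPoint B e x).1 = projL e x := by
  obtain ⟨q, a, hc, hp, -⟩ := hx
  have h : ∃ p : Space n × Space n, IsContact B e p.1 p.2 ∧ projL e p.1 = projL e x :=
    ⟨(q, a), hc, hp⟩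
  rw [contactPoint, dif_pos h]
  exact h.choose_spec

theorem eq_projL_add (e x : Space n) : x = projL e x + inner ℝ e x • e := by
  rw [projL_apply]; abel

/-- The derivative of the contact point. -/
def contactDeriv (e a : Space n) : Space n →L[ℝ] Space n :=
  projL e + ((innerSL ℝ a).comp (projL e)).smulRight e

theorem contactDeriv_apply (e a v : Space n) :
    contactDeriv e a v = projL e v + inner ℝ a (projL e v) • e := by
  simp [contactDeriv]

theorem norm_contactDeriv_le (he : ‖e‖ = 1) {a : Space n} (ha : ‖a‖ ≤ 1) (v : Space n) :
    ‖contactDeriv e a v‖ ≤ 2 * ‖v‖ := by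
  rw [contactDeriv_apply]
  have h1 := norm_projL_le he v
  have h2 := abs_real_inner_le_norm a (projL e v)
  have h3 : ‖inner ℝ a (projL e v) • e‖ ≤ ‖v‖ := by
    rw [norm_smul, he, mul_one, Real.norm_eq_abs]
    nlinarith [norm_nonneg a, norm_nonneg (projL e v)]
  linarith [norm_add_le (projL e v) (inner ℝ a (projL e v) • e)]

/-- The difference of the heights of two contact points lies between the products of the horizontal
displacement with the two slopes. Replacing it by the linear expression with slope `a₀` therefore
costs at most the difference of the slopes times the displacement. Differentiability of the contact
point is thus reduced to continuity of its slope. -/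
theorem norm_contactPoint_sub_le (he : ‖e‖ = 1) {x x₀ : Space n} (hx : x ∈ contactSlab B e)
    (hx₀ : x₀ ∈ contactSlab B e) :
    ‖(contactPoint B e x).1 - (contactPoint B e x₀).1 -
      contactDeriv e (contactPoint B e x₀).2 (x - x₀)‖ ≤
      ‖(contactPoint B e x).2 - (contactPoint B e x₀).2‖ * ‖x - x₀‖ := by
  obtain ⟨hc, hp⟩ := contactPoint_spec hx
  obtain ⟨hc₀, hp₀⟩ := contactPoint_spec hx₀
  set q := (contactPoint B e x).1
  set a := (contactPoint B e x).2
  set q₀ := (contactPoint B e x₀).1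
  set a₀ := (contactPoint B e x₀).2
  have hpp : projL e (q - q₀) = projL e (x - x₀) := by rw [map_sub, map_sub, hp, hp₀]
  have h1 := hc₀.height_le hc
  have h2 := hc.height_le hc₀
  rw [← neg_sub q q₀, map_neg, inner_neg_right, inner_neg_right, hpp] at h2
  rw [hpp] at h1
  have e1 : q - q₀ - contactDeriv e a₀ (x - x₀) =
      (inner ℝ e (q - q₀) - inner ℝ a₀ (projL e (x - x₀))) • e := by
    rw [contactDeriv_apply, ← hpp]
    nth_rewrite 1 [eq_projL_add e (q - q₀)]
    rw [sub_smul]; abel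
  rw [e1, norm_smul, he, mul_one, Real.norm_eq_abs]
  have h3 := abs_real_inner_le_norm (a - a₀) (projL e (x - x₀))
  rw [inner_sub_left] at h3
  have h4 := norm_projL_le he (x - x₀)
  have h5 : ‖a - a₀‖ * ‖projL e (x - x₀)‖ ≤ ‖a - a₀‖ * ‖x - x₀‖ := by gcongr
  refine le_trans ?_ (h3.trans h5)
  rw [abs_of_nonpos (by linarith)]
  refine le_trans ?_ (neg_le_abs _)
  linarith

theorem dist_contactPoint_le (he : ‖e‖ = 1) {x x₀ : Space n} (hx : x ∈ contactSlab B e)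
    (hx₀ : x₀ ∈ contactSlab B e) :
    ‖(contactPoint B e x).1 - (contactPoint B e x₀).1‖ ≤ 4 * ‖x - x₀‖ := by
  have h1 := norm_contactPoint_sub_le he hx hx₀
  have ha := (contactPoint_spec hx).1.norm_le
  have ha₀ := (contactPoint_spec hx₀).1.norm_le
  have h2 := norm_contactDeriv_le he ha₀ (x - x₀)
  have h3 := norm_sub_le (contactPoint B e x).2 (contactPoint B e x₀).2
  have h4 := norm_sub_norm_le ((contactPoint B e x).1 - (contactPoint B e x₀).1)
    (contactDeriv e (contactPoint B e x₀).2 (x - x₀))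
  nlinarith [norm_nonneg (x - x₀)]

/-- The vector `e - g / (g · e)` for `g = ∇ψ`. -/
def slopeField (e : Space n) (ψ : Space n → ℝ) (q : Space n) : Space n :=
  e - (inner ℝ (gradient ψ q) e)⁻¹ • gradient ψ q

/-- The vector representing a linear form. -/
def toGrad (n : ℕ) : (Space n →L[ℝ] ℝ) →L[ℝ] Space n where
  toFun l := (InnerProductSpace.toDual ℝ (Space n)).symm l
  map_add' := map_add _
  map_smul' c l := by simp
  cont := (InnerProductSpace.toDual ℝ (Space n)).symm.continuous

theorem inner_toGrad (l : Space n →L[ℝ] ℝ) (v : Space n) : inner ℝ (toGrad n l) v = l v :=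
  InnerProductSpace.toDual_symm_apply

theorem hasFDerivAt_gradient {ψ : Space n → ℝ} {q : Space n} (h : ContDiffAt ℝ 2 ψ q) :
    HasFDerivAt (gradient ψ) ((toGrad n).comp (fderiv ℝ (fderiv ℝ ψ) q)) q := by
  have h1 : DifferentiableAt ℝ (fderiv ℝ ψ) q :=
    (h.fderiv_right (m := 1) (by norm_num)).differentiableAt one_ne_zero
  exact (toGrad n).hasFDerivAt.comp q h1.hasFDerivAt

/-- Quotient rule. In the second argument of the Hessian, `w` is corrected by a multiple of `e` so
as to become tangent to the boundary; this is the form in which a curvature bound can be used. -/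
theorem exists_hasFDerivAt_slopeField {ψ : Space n → ℝ} {q : Space n} (h : ContDiffAt ℝ 2 ψ q)
    (hne : inner ℝ (gradient ψ q) e ≠ 0) :
    ∃ N : Space n →L[ℝ] Space n, HasFDerivAt (slopeField e ψ) N q ∧
      ∀ v w, inner ℝ (N v) w = -(inner ℝ (gradient ψ q) e)⁻¹ *
        fderiv ℝ (fderiv ℝ ψ) q v
          (w - ((inner ℝ (gradient ψ q) e)⁻¹ * inner ℝ (gradient ψ q) w) • e) := by
  have hg := hasFDerivAt_gradient h
  have hi := ((hasDerivAt_inv hne).comp_hasFDerivAt q (hg.inner ℝ (hasFDerivAt_const e q))).smul hg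
  refine ⟨_, hi.const_sub e, fun v w => ?_⟩
  have hne' : fderiv ℝ ψ q e ≠ 0 := by simpa using hne
  simp [inner_add_left, inner_smul_left, inner_toGrad, fderivInnerCLM_apply]
  field_simp
  ring

/-- Polarization and the parallelogram law: the curvature bound concerns only the quadratic form,
while the derivative of the slope needs the bilinear one. -/
theorem abs_bilin_le {L : Space n →L[ℝ] Space n →L[ℝ] ℝ} {M : ℝ} {x y : Space n}
    (hs : L x y = L y x) (h1 : |L (x + y) (x + y)| ≤ M * ‖x + y‖ ^ 2)
    (h2 : |L (x - y) (x - y)| ≤ M * ‖x - y‖ ^ 2) :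
    |L x y| ≤ M * (‖x‖ ^ 2 + ‖y‖ ^ 2) / 2 := by
  have e1 : L (x + y) (x + y) - L (x - y) (x - y) = 4 * L x y := by
    simp only [map_add, map_sub, add_apply, sub_apply, hs]
    ring
  have e2 : ‖x + y‖ ^ 2 + ‖x - y‖ ^ 2 = 2 * (‖x‖ ^ 2 + ‖y‖ ^ 2) := by
    rw [norm_add_sq_real, norm_sub_sq_real]; ring
  have e3 : M * ‖x + y‖ ^ 2 + M * ‖x - y‖ ^ 2 = 2 * (M * (‖x‖ ^ 2 + ‖y‖ ^ 2)) := by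
    rw [← mul_add, e2]; ring
  rw [abs_le] at *
  constructor <;> linarith

/-- The slope map is differentiable on the contact slab, with a derivative bounded in terms of the
curvature. -/
theorem exists_hasFDerivWithinAt_slope (he : ‖e‖ = 1) (hB : IsBoundedDomain 2 B) {K : ℝ}
    (hK : CurvatureBoundedBy B K) {x₀ : Space n} (hx₀ : x₀ ∈ contactSlab B e) :
    ∃ A : Space n →L[ℝ] Space n, ‖A‖ ≤ 13 * |K| ∧
      HasFDerivWithinAt (fun x => (contactPoint B e x).2) A (contactSlab B e) x₀ := by
  obtain ⟨hc₀, hp₀⟩ := contactPoint_spec hx₀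
  set q₀ := (contactPoint B e x₀).1 with hq₀
  set a₀ := (contactPoint B e x₀).2 with ha₀
  obtain ⟨U, ψ, hU⟩ := hB.boundary q₀ (hc₀.frontier he hB.isOpen)
  obtain ⟨hge, hea⟩ := hc₀.gradient_eq two_ne_zero he hB.isOpen hU
  obtain ⟨N, hN, hNv⟩ := exists_hasFDerivAt_slopeField (e := e) hU.contDiffAt hge.ne'
  set g := gradient ψ q₀ with hg
  set S := contactSlab B e with hS
  set q : Space n → Space n := fun x => (contactPoint B e x).1 with hq
  set a : Space n → Space n := fun x => (contactPoint B e x).2 with ha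
  have hqc : Tendsto q (𝓝[S] x₀) (𝓝 q₀) := by
    rw [tendsto_iff_norm_sub_tendsto_zero]
    have h1 : Tendsto (fun x => 4 * ‖x - x₀‖) (𝓝[S] x₀) (𝓝 0) := by
      have : Continuous fun x : Space n => 4 * ‖x - x₀‖ := by fun_prop
      have h2 := this.tendsto x₀
      simp only [sub_self, norm_zero, mul_zero] at h2
      exact h2.mono_left nhdsWithin_le_nhds
    refine squeeze_zero' (Eventually.of_forall fun _ => norm_nonneg _) ?_ h1
    filter_upwards [self_mem_nhdsWithin] with x hx
    exact dist_contactPoint_le he hx hx₀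
  have hfd : ContinuousAt (fderiv ℝ ψ) q₀ :=
    (hU.contDiffAt.fderiv_right (m := 1) (by norm_num)).continuousAt
  -- Contact points over points near `x₀` stay in `U` and `∇ψ` does not vanish there, so the single
  -- function `ψ` gives all nearby slopes.
  have haeq : a =ᶠ[𝓝[S] x₀] slopeField e ψ ∘ q := by
    filter_upwards [self_mem_nhdsWithin, hqc.eventually (hU.1.mem_nhds hU.2.1),
      hqc.eventually (hfd.eventually_ne hU.2.2.2.1)] with x hx h1 h2
    exact (contactPoint_spec hx).1.gradient_slope two_ne_zero he hB.isOpen (hU.of_mem h1 h2)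
  have hax₀ : a x₀ = slopeField e ψ (q x₀) :=
    hc₀.gradient_slope two_ne_zero he hB.isOpen hU
  have hac : Tendsto a (𝓝[S] x₀) (𝓝 a₀) := by
    refine Tendsto.congr' haeq.symm ?_
    rw [show a₀ = slopeField e ψ q₀ from hax₀]
    exact hN.continuousAt.tendsto.comp hqc
  -- Continuity of the slope makes the error in `norm_contactPoint_sub_le` of order `o(‖x - x₀‖)`.
  have hqd : HasFDerivWithinAt q (contactDeriv e a₀) S x₀ := by
    rw [hasFDerivWithinAt_iff_isLittleO, Asymptotics.isLittleO_iff]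
    intro ε hε
    have h1 : ∀ᶠ x in 𝓝[S] x₀, ‖a x - a₀‖ < ε := by
      have := (tendsto_iff_norm_sub_tendsto_zero.1 hac).eventually (gt_mem_nhds hε)
      exact this
    filter_upwards [self_mem_nhdsWithin, h1] with x hx h2
    refine (norm_contactPoint_sub_le he hx hx₀).trans ?_
    gcongr
  have hcomp : HasFDerivWithinAt (slopeField e ψ ∘ q) (N.comp (contactDeriv e a₀)) S x₀ :=
    HasFDerivAt.comp_hasFDerivWithinAt x₀ hN hqd
  refine ⟨N.comp (contactDeriv e a₀), ?_, hcomp.congr_of_eventuallyEq haeq hax₀⟩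
  -- the bound
  have hgv : ∀ v, fderiv ℝ ψ q₀ v = inner ℝ g v := fun v => by
    rw [hg, gradient, InnerProductSpace.toDual_symm_apply]
  have hgea : g = inner ℝ g e • (e - a₀) := by rw [hea, smul_smul, mul_inv_cancel₀ hge.ne', one_smul]
  have hsymm : IsSymmSndFDerivAt ℝ ψ q₀ :=
    hU.contDiffAt.isSymmSndFDerivAt (by simp)
  have hnormea : ‖e - a₀‖ ≤ 2 := by
    have := norm_sub_le e a₀
    rw [he] at this
    linarith [hc₀.norm_le]
  have hgnorm : ‖fderiv ℝ ψ q₀‖ ≤ 2 * inner ℝ g e := by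
    refine ContinuousLinearMap.opNorm_le_bound _ (by positivity) fun v => ?_
    rw [hgv, hgea, inner_smul_left]
    have h1 := abs_real_inner_le_norm (e - a₀) v
    have h2 : inner ℝ (inner ℝ g e • (e - a₀)) e = (inner ℝ g e : ℝ) := by rw [← hgea]
    rw [h2, Real.norm_eq_abs, abs_mul]
    simp only [conj_trivial]
    rw [abs_of_pos hge]
    nlinarith [norm_nonneg v, mul_le_mul_of_nonneg_right hnormea (norm_nonneg v)]
  have hquad : ∀ τ, inner ℝ g τ = 0 →
      |fderiv ℝ (fderiv ℝ ψ) q₀ τ τ| ≤ (|K| * (2 * inner ℝ g e)) * ‖τ‖ ^ 2 := by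
    intro τ hτ
    refine (hK q₀ (hc₀.frontier he hB.isOpen) U ψ hU τ (by rw [hgv, hτ])).trans ?_
    gcongr
    exact le_abs_self K
  refine ContinuousLinearMap.opNorm_le_of_unit_norm (by positivity) fun τ hτ => ?_
  set T := contactDeriv e a₀ τ with hT
  have hTn : ‖T‖ ≤ 2 := by simpa [hτ] using norm_contactDeriv_le he hc₀.norm_le τ
  have hTt : inner ℝ g T = 0 := by
    have h1 : inner ℝ e (projL e τ) = 0 := by
      rw [projL_apply, inner_sub_right, inner_smul_right, real_inner_self_eq_norm_sq, he]; simp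
    have h2 : inner ℝ (e - a₀) T = 0 := by
      rw [hT, contactDeriv_apply, inner_add_right, inner_smul_right, inner_sub_left,
        inner_sub_left, h1, hc₀.orth, real_inner_self_eq_norm_sq, he]
      ring
    rw [hgea, inner_smul_left, h2, mul_zero]
  have hbound : ∀ w : Space n, ‖w‖ = 1 → inner ℝ (N T) w ≤ 13 * |K| := by
    intro w hw
    rw [hNv]
    set w' := w - ((inner ℝ g e)⁻¹ * inner ℝ g w) • e with hw'
    have e1 : (inner ℝ g e)⁻¹ * inner ℝ g w = inner ℝ (e - a₀) w := by
      rw [hea, inner_smul_left]; simp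
    have hw'n : ‖w'‖ ≤ 3 := by
      rw [hw', e1]
      refine (norm_sub_le _ _).trans ?_
      rw [norm_smul, he, hw, mul_one, Real.norm_eq_abs]
      have := abs_real_inner_le_norm (e - a₀) w
      rw [hw, mul_one] at this
      linarith
    have hw't : inner ℝ g w' = 0 := by
      rw [hw', inner_sub_right, inner_smul_right]
      field_simp
      ring
    have h1 := abs_bilin_le (L := fderiv ℝ (fderiv ℝ ψ) q₀) (hsymm.eq T w')
      (hquad (T + w') (by rw [inner_add_right, hTt, hw't, add_zero]))
      (hquad (T - w') (by rw [inner_sub_right, hTt, hw't, sub_zero]))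
    -- Here 13 is `2² + 3²`. Polarization halves it, and the factor 2 in `‖∇ψ‖ ≤ 2 (∇ψ · e)`
    -- restores it.
    have h2 : ‖T‖ ^ 2 + ‖w'‖ ^ 2 ≤ 13 := by
      nlinarith [norm_nonneg T, norm_nonneg w']
    have h3 : |fderiv ℝ (fderiv ℝ ψ) q₀ T w'| ≤ 13 * |K| * inner ℝ g e := by
      refine h1.trans ?_
      have h4 : 0 ≤ |K| * inner ℝ g e := by positivity
      nlinarith
    calc -(inner ℝ g e)⁻¹ * fderiv ℝ (fderiv ℝ ψ) q₀ T w'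
        ≤ (inner ℝ g e)⁻¹ * |fderiv ℝ (fderiv ℝ ψ) q₀ T w'| := by
          rw [neg_mul, ← mul_neg]
          exact mul_le_mul_of_nonneg_left (neg_le_abs _) (inv_nonneg.2 hge.le)
      _ ≤ (inner ℝ g e)⁻¹ * (13 * |K| * inner ℝ g e) :=
          mul_le_mul_of_nonneg_left h3 (inv_nonneg.2 hge.le)
      _ = 13 * |K| := by field_simp
  change ‖N T‖ ≤ 13 * |K|
  by_cases hz : N T = 0
  · rw [hz, norm_zero]; positivity
  · have hpos : 0 < ‖N T‖ := norm_pos_iff.2 hz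
    have h1 := hbound (‖N T‖⁻¹ • N T) (by rw [norm_smul, norm_inv, norm_norm,
      inv_mul_cancel₀ hpos.ne'])
    rw [inner_smul_right, real_inner_self_eq_norm_sq] at h1
    have : ‖N T‖⁻¹ * ‖N T‖ ^ 2 = ‖N T‖ := by field_simp
    rwa [this] at h1

/-- A point `y` of this ball has horizontal part of norm at most 1, which is the slope of some
contact point by `exists_contact`, and height in `[0, 1]`, which is the height of a point of the
slab over it. -/
theorem exists_slope_image (he : ‖e‖ = 1) (hB : IsBoundedDomain 2 B) :
    Metric.closedBall ((1 / 2 : ℝ) • e) (1 / 2) ⊆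
      (fun x => (contactPoint B e x).2 + inner ℝ e x • e) '' contactSlab B e := by
  intro y hy
  rw [mem_closedBall_iff_norm] at hy
  have horth : inner ℝ (projL e y) e = 0 := by
    rw [real_inner_comm, projL_apply, inner_sub_right, inner_smul_right,
      real_inner_self_eq_norm_sq, he]; simp
  have hn : ‖projL e y‖ ≤ 1 := by
    have h1 : projL e y = projL e (y - (1 / 2 : ℝ) • e) := by
      rw [map_sub, projL_smul_self he, sub_zero]
    rw [h1]
    linarith [norm_projL_le he (y - (1 / 2 : ℝ) • e)]
  have ht : |inner ℝ e y - 1 / 2| ≤ 1 / 2 := by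
    have h1 := abs_real_inner_le_norm e (y - (1 / 2 : ℝ) • e)
    rw [inner_sub_right, inner_smul_right, real_inner_self_eq_norm_sq, he] at h1
    norm_num at h1 hy ⊢
    linarith
  rw [abs_le] at ht
  obtain ⟨q, hq⟩ := exists_contact hB horth hn
  have hie : inner ℝ e (projL e q + inner ℝ e y • e) = inner ℝ e y := by
    rw [inner_add_right, inner_smul_right, real_inner_self_eq_norm_sq, he, projL_apply,
      inner_sub_right, inner_smul_right, real_inner_self_eq_norm_sq, he]; ring
  have hpe : projL e (projL e q + inner ℝ e y • e) = projL e q := by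
    rw [map_add, projL_smul_self he, add_zero]
    nth_rewrite 2 [eq_projL_add e q]
    rw [map_add, projL_smul_self he, add_zero]
  have hx : projL e q + inner ℝ e y • e ∈ contactSlab B e :=
    ⟨q, projL e y, hq, hpe.symm, by rw [hie]; linarith [ht.1], by rw [hie]; linarith [ht.2]⟩
  refine ⟨_, hx, ?_⟩
  obtain ⟨hc, hp⟩ := contactPoint_spec hx
  have := (hc.eq_of_projL_eq he hB hq (hp.trans hpe)).2
  simp only
  rw [this, hie]
  exact (eq_projL_add e y).symm

/-- The contact slab of a domain with curvature at most `K` has a volume bounded below. -/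
theorem exists_le_volume_contactSlab (he : ‖e‖ = 1) (K : ℝ) :
    ∃ c : ℝ≥0∞, 0 < c ∧ ∀ B : Set (Space n), IsBoundedDomain 2 B → CurvatureBoundedBy B K →
      c ≤ volume (contactSlab B e) := by
  -- A bound for the Jacobian: the derivative of the slope has norm at most `13 |K|`, and the height
  -- term `x ↦ (e · x) e` adds 1.
  set Λ : ℝ≥0∞ := ENNReal.ofReal ((13 * |K| + 1) ^ n) with hΛ
  have hΛ0 : Λ ≠ 0 := by
    rw [hΛ]; simp only [ne_eq, ENNReal.ofReal_eq_zero, not_le]; positivity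
  refine ⟨volume (Metric.closedBall ((1 / 2 : ℝ) • e) (1 / 2)) / Λ, ?_, fun B hB hK => ?_⟩
  · exact ENNReal.div_pos (Metric.measure_closedBall_pos volume _ (by norm_num)).ne'
      ENNReal.ofReal_ne_top
  have hmeas : MeasurableSet (contactSlab B e) :=
    (isCompact_contactSlab he hB.isBounded).isClosed.measurableSet
  have hd : ∀ x ∈ contactSlab B e, ∃ A : Space n →L[ℝ] Space n, ‖A‖ ≤ 13 * |K| + 1 ∧
      HasFDerivWithinAt (fun x => (contactPoint B e x).2 + inner ℝ e x • e) A
        (contactSlab B e) x := by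
    intro x hx
    obtain ⟨A, hA, hA'⟩ := exists_hasFDerivWithinAt_slope he hB hK hx
    have h2 : HasFDerivWithinAt (fun x : Space n => inner ℝ e x • e)
        ((innerSL ℝ e).smulRight e) (contactSlab B e) x :=
      ((innerSL ℝ e).smulRight e).hasFDerivWithinAt
    refine ⟨_, ?_, hA'.add h2⟩
    refine (norm_add_le _ _).trans (add_le_add hA ?_)
    rw [ContinuousLinearMap.norm_smulRight_apply, innerSL_apply_norm, he, mul_one]
  choose! A hA hA' using hd
  rw [ENNReal.div_le_iff hΛ0 ENNReal.ofReal_ne_top]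
  calc volume (Metric.closedBall ((1 / 2 : ℝ) • e) (1 / 2))
      ≤ volume ((fun x => (contactPoint B e x).2 + inner ℝ e x • e) '' contactSlab B e) :=
        measure_mono (exists_slope_image he hB)
    _ ≤ ∫⁻ x in contactSlab B e, ENNReal.ofReal |(A x).det| :=
        addHaar_image_le_lintegral_abs_det_fderiv volume hmeas hA'
    _ ≤ ∫⁻ x in contactSlab B e, Λ := by
        refine setLIntegral_mono' hmeas fun x hx => ENNReal.ofReal_le_ofReal ?_
        refine (abs_det_le_pow _).trans ?_
        gcongr
        exact hA x hx
    _ = volume (contactSlab B e) * Λ := by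
        rw [lintegral_const, Measure.restrict_apply_univ, mul_comm]

/-! ### The stochastic Poincaré inequality -/

theorem norm_basisVec {n : ℕ} (i : Fin n) : ‖(basisVec i : Space n)‖ = 1 := by simp [basisVec]

theorem exists_mem_of_ae_restrict {O I : Set ℝ} (hO : IsOpen O) (hne : O.Nonempty) (hOI : O ⊆ I)
    {P : ℝ → Prop} (h : ∀ᵐ t ∂(volume.restrict I), P t) : ∃ t ∈ O, P t := by
  by_contra hcon
  push Not at hcon
  have h1 : ∀ᵐ t ∂(volume.restrict O), P t := ae_restrict_of_ae_restrict_of_subset hOI h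
  rw [ae_restrict_iff' hO.measurableSet] at h1
  have h2 : volume O = 0 := by
    refine measure_mono_null (fun t ht => ?_) h1
    exact fun h3 => hcon t ht (h3 ht)
  exact (hO.measure_pos volume hne).ne' h2

namespace ErgodicSystem

variable {n : ℕ} {Ω : Type*} [MeasurableSpace Ω] {μ : Measure Ω} (S : ErgodicSystem n μ)
variable [IsProbabilityMeasure μ]

/-- The function `∫_{-R}^R |D_j f| (T(s e_j) ω) ds`, which bounds the oscillation of `f` in the
direction `e_j`. -/
def lineMajorant (j : Fin n) (R : ℝ) (f : S.D) : Lp ℝ 2 μ :=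
  ∫ s in (-R)..R, S.U (s • basisVec j) |S.deriv j f|

theorem continuous_U_line (j : Fin n) (g : Lp ℝ 2 μ) :
    Continuous fun s : ℝ => S.U (s • basisVec j) g :=
  (S.continuous_U g).comp (by fun_prop)

theorem norm_lineMajorant_le (j : Fin n) {R : ℝ} (hR : 0 ≤ R) (f : S.D) :
    ‖S.lineMajorant j R f‖ ≤ 2 * R * ‖S.deriv j f‖ := by
  refine (intervalIntegral.norm_integral_le_of_norm_le_const (C := ‖S.deriv j f‖)
    fun s _ => ?_).trans (le_of_eq ?_)
  · rw [S.norm_U, norm_abs_eq_norm]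
  · rw [abs_of_nonneg (by linarith)]; ring

/-- The fundamental theorem of calculus holds for the orbit as a curve in `L²(Ω)`, not for single
realizations. The pointwise inequality is obtained by integrating over arbitrary measurable sets
`A`, which reduces it to scalar integrals in the time variable. -/
theorem abs_U_sub_le_lineMajorant (j : Fin n) {R : ℝ} (f : S.D) {t : ℝ}
    (ht : t ∈ Icc (-R) R) :
    ∀ᵐ ω ∂μ, |S.val f (S.T (t • basisVec j) ω) - S.val f ω| ≤ S.lineMajorant j R f ω := by
  set I := S.U (t • basisVec j) (S.val f) - S.val f with hI
  set J := S.lineMajorant j R f with hJ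
  have hint : ∫ s in (0 : ℝ)..t, S.U (s • basisVec j) (S.deriv j f) = I := by
    rw [intervalIntegral.integral_eq_sub_of_hasDerivAt (fun s _ => S.hasDerivAt_U f j s)
      (S.continuous_U_line j _).continuousOn.intervalIntegrable]
    rw [zero_smul, S.U_zero]
  have key : ∀ A : Set Ω, MeasurableSet A → |∫ ω in A, I ω ∂μ| ≤ ∫ ω in A, J ω ∂μ := by
    intro A hA
    let a : Lp ℝ 2 μ := indicatorConstLp 2 hA (measure_ne_top μ A) (1 : ℝ)
    have ha : ∀ g : Lp ℝ 2 μ, ∫ ω in A, g ω ∂μ = innerSL ℝ a g := fun g => by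
      rw [innerSL_apply_apply, L2.inner_indicatorConstLp_one]
    have hc : ∀ g : Lp ℝ 2 μ, Continuous fun s : ℝ => innerSL ℝ a (S.U (s • basisVec j) g) :=
      fun g => (innerSL ℝ a).continuous.comp (S.continuous_U_line j g)
    have hle : ∀ s : ℝ, |innerSL ℝ a (S.U (s • basisVec j) (S.deriv j f))| ≤
        innerSL ℝ a (S.U (s • basisVec j) |S.deriv j f|) := by
      intro s
      rw [← ha, ← ha]
      refine (abs_integral_le_integral_abs).trans (le_of_eq ?_)
      refine setIntegral_congr_ae hA ?_
      have hq := (S.measurePreserving (s • (basisVec j : Space n))).quasiMeasurePreserving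
      filter_upwards [S.U_coeFn (s • basisVec j) (S.deriv j f),
        S.U_coeFn (s • basisVec j) |S.deriv j f|, hq.ae (Lp.coeFn_abs (S.deriv j f))]
        with ω h1 h2 h3 _
      rw [h1, h2, h3]
    rw [ha, ha, ← hint, hJ, lineMajorant,
      ← ContinuousLinearMap.intervalIntegral_comp_comm _
        (S.continuous_U_line j _).continuousOn.intervalIntegrable,
      ← ContinuousLinearMap.intervalIntegral_comp_comm _
        (S.continuous_U_line j _).continuousOn.intervalIntegrable]
    have hR : -R ≤ R := ht.1.trans ht.2
    calc |∫ s in (0 : ℝ)..t, innerSL ℝ a (S.U (s • basisVec j) (S.deriv j f))|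
        ≤ abs (∫ s in (0 : ℝ)..t, abs (innerSL ℝ a (S.U (s • basisVec j) (S.deriv j f)))) :=
          by simpa only [Real.norm_eq_abs] using
            intervalIntegral.norm_integral_le_abs_integral_norm (a := 0) (b := t) (μ := volume)
              (f := fun s : ℝ => innerSL ℝ a (S.U (s • basisVec j) (S.deriv j f)))
      _ ≤ abs (∫ s in (-R)..R, innerSL ℝ a (S.U (s • basisVec j) (abs (S.deriv j f)))) := by
          refine (intervalIntegral.abs_integral_mono_interval (c := -R) (d := R)
            ?_ ?_ ?_).trans ?_
          · rw [uIoc_of_le hR]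
            rcases le_total 0 t with h | h
            · rw [uIoc_of_le h]
              exact Ioc_subset_Ioc (by linarith [ht.2]) ht.2
            · rw [uIoc_of_ge h]
              exact Ioc_subset_Ioc ht.1 (by linarith [ht.1])
          · exact ae_of_all _ fun s => abs_nonneg _
          · exact (hc _).abs.intervalIntegrable _ _
          · rw [abs_of_nonneg (intervalIntegral.integral_nonneg hR fun s _ => abs_nonneg _)]
            refine le_trans ?_ (le_abs_self _)
            exact intervalIntegral.integral_mono_on hR ((hc _).abs.intervalIntegrable _ _)
              ((hc _).intervalIntegrable _ _) fun s _ => hle s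
      _ = _ := abs_of_nonneg (intervalIntegral.integral_nonneg hR fun s _ =>
          (abs_nonneg _).trans (hle s))
  have hIi : Integrable I μ := (Lp.memLp I).integrable (by norm_num)
  have hJi : Integrable J μ := (Lp.memLp J).integrable (by norm_num)
  have h1 : I ≤ᵐ[μ] J := ae_le_of_forall_setIntegral_le hIi hJi fun A hA _ =>
    (le_abs_self _).trans (key A hA)
  have h2 : (fun ω => -I ω) ≤ᵐ[μ] J := ae_le_of_forall_setIntegral_le hIi.neg hJi fun A hA _ => by
    have : ∫ ω in A, (-I) ω ∂μ = -∫ ω in A, I ω ∂μ := by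
      rw [← integral_neg]
      refine setIntegral_congr_ae hA ((Lp.coeFn_neg I).mono fun ω h _ => ?_)
      rw [h]; rfl
    have h3 := (neg_le_abs _).trans (key A hA)
    rw [← integral_neg] at h3
    exact h3
  filter_upwards [h1, h2, Lp.coeFn_sub (S.U (t • basisVec j) (S.val f)) (S.val f),
    S.U_coeFn (t • basisVec j) (S.val f)] with ω e1 e2 e3 e4
  rw [hI, e3, Pi.sub_apply, e4] at e1 e2
  exact abs_le.2 ⟨by linarith, e1⟩

theorem quasiMeasurePreserving_add_line (j : Fin n) (R : ℝ) :
    Measure.QuasiMeasurePreserving (fun p : Space n × ℝ => p.1 + p.2 • (basisVec j : Space n))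
      ((volume : Measure (Space n)).prod (volume.restrict (Icc (-R) R))) volume := by
  refine QuasiMeasurePreserving.prod_of_left (by fun_prop) (ae_of_all _ fun t => ?_)
  exact (measurePreserving_add_right_space (t • (basisVec j : Space n))).quasiMeasurePreserving

/-- For each `x` and `t` the bound holds for almost all `ω`. Joint measurability and Fubini exchange
the quantifiers, so that it can be used on the lines of one realization. -/
theorem ae_ae_line_bound (j : Fin n) (R : ℝ) (f : S.D) :
    ∀ᵐ ω ∂μ, ∀ᵐ x : Space n, ∀ᵐ t ∂(volume.restrict (Icc (-R) R)),
      |S.val f (S.T (x + t • basisVec j) ω) - S.val f (S.T x ω)| ≤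
        S.lineMajorant j R f (S.T x ω) := by
  have hg := quasiMeasurePreserving_add_line (n := n) j R
  have hfst : Measure.QuasiMeasurePreserving (fun p : Space n × ℝ => p.1)
      ((volume : Measure (Space n)).prod (volume.restrict (Icc (-R) R))) volume :=
    Measure.quasiMeasurePreserving_fst
  have hm := (Lp.aestronglyMeasurable (S.val f)).aemeasurable
  have hm2 := (Lp.aestronglyMeasurable (S.lineMajorant j R f)).aemeasurable
  have hmeas := ((((S.aemeasurable_flow_comp hg hm).sub (S.aemeasurable_flow_comp hfst hm)).abs).sub
    (S.aemeasurable_flow_comp hfst hm2)).ennreal_ofReal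
  have hz := ae_eq_zero_of_ae_slices hmeas ?_
  · have h1 := Measure.ae_ae_of_ae_prod
      (Measure.measurePreserving_swap.quasiMeasurePreserving.ae hz)
    filter_upwards [h1] with ω h2
    have h3 := Measure.ae_ae_of_ae_prod h2
    filter_upwards [h3] with x h4
    filter_upwards [h4] with t h5
    simpa [ENNReal.ofReal_eq_zero, Prod.swap] using h5
  · have ht : ∀ᵐ p ∂((volume : Measure (Space n)).prod (volume.restrict (Icc (-R) R))),
        p.2 ∈ Icc (-R) R :=
      Measure.quasiMeasurePreserving_snd.ae (ae_restrict_mem measurableSet_Icc)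
    filter_upwards [ht] with p hp
    filter_upwards [(S.measurePreserving p.1).quasiMeasurePreserving.ae
      (S.abs_U_sub_le_lineMajorant j f hp)] with ω h
    rw [← S.add, add_comm] at h
    simpa [ENNReal.ofReal_eq_zero] using h

theorem ae_ae_line_zero {p : Ω → Prop} (hp : ∀ᵐ ω ∂μ, p ω) (j : Fin n) (R : ℝ) :
    ∀ᵐ ω ∂μ, ∀ᵐ x : Space n, ∀ᵐ t ∂(volume.restrict (Icc (-R) R)),
      p (S.T (x + t • basisVec j) ω) := by
  have h := S.ae_flow_comp (quasiMeasurePreserving_add_line (n := n) j R) hp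
  have h1 := Measure.ae_ae_of_ae_prod
      (Measure.measurePreserving_swap.quasiMeasurePreserving.ae h)
  filter_upwards [h1] with ω h2
  exact Measure.ae_ae_of_ae_prod h2

/-- Almost surely a ball of fixed radius contains a grain with a contact slab of volume at least
a constant. -/
theorem IsDisperseMedium.exists_slab {F : Set Ω} (hF : S.IsDisperseMedium F) (j : Fin n) :
    ∃ (c : ℝ≥0∞) (R : ℝ), 0 < c ∧ c ≠ ∞ ∧ 0 < R ∧ ∀ᵐ ω ∂μ, ∃ A : Set (Space n),
      MeasurableSet A ∧ c ≤ volume A ∧ A ⊆ Metric.ball 0 R ∧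
      ∀ x ∈ A, ∃ O : Set ℝ, IsOpen O ∧ O.Nonempty ∧ O ⊆ Icc (-(2 * R)) (2 * R) ∧
        ∀ t ∈ O, S.T (x + t • basisVec j) ω ∈ Fᶜ := by
  obtain ⟨K, hK⟩ := hF.grains_smooth
  obtain ⟨d, hd⟩ := hF.diameter
  obtain ⟨r₀, hr₀, hdense⟩ := hF.dense
  obtain ⟨c, hc, hcv⟩ := exists_le_volume_contactSlab (norm_basisVec j) K
  -- A grain meeting the ball of radius `r₀` around the origin lies within distance `r₀ + |d|`. Its
  -- contact slab extends this by 1, and a further 1 gives an open ball. The minimum with 1 keeps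
  -- the constant finite.
  refine ⟨min c 1, r₀ + |d| + 2, lt_min hc one_pos, ne_top_of_le_ne_top ENNReal.one_ne_top
    (min_le_right _ _), by positivity, ?_⟩
  filter_upwards [hK, hd, hdense] with ω h1 h2 h3
  obtain ⟨x₀, hx₀, hx₀s⟩ := h3 0
  have hC : connectedComponentIn (S.skeleton F ω) x₀ ∈ S.grains F ω := ⟨x₀, hx₀s, rfl⟩
  obtain ⟨B, hB, hCB, hBK⟩ := h1 _ hC
  have hcl : closure B ⊆ Metric.closedBall 0 (r₀ + |d|) := by
    intro y hy
    rw [← hCB] at hy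
    have h4 := h2 _ hC y hy x₀ (mem_connectedComponentIn hx₀s)
    have h5 : dist x₀ 0 < r₀ := hx₀
    rw [Metric.mem_closedBall]
    linarith [dist_triangle y x₀ 0, le_abs_self d]
  have hA := contactSlab_subset_closedBall (norm_basisVec j) hcl
  refine ⟨contactSlab B (basisVec j), ?_, (min_le_left _ _).trans (hcv B hB hBK), ?_, ?_⟩
  · exact (isCompact_contactSlab (norm_basisVec j) hB.isBounded).isClosed.measurableSet
  · refine hA.trans (Metric.closedBall_subset_ball (by linarith))
  · intro x hx
    obtain ⟨t, ht⟩ := exists_add_smul_mem (norm_basisVec j) hB hx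
    refine ⟨{t | x + t • basisVec j ∈ B}, hB.isOpen.preimage (by fun_prop), ⟨t, ht⟩, ?_, ?_⟩
    · intro s hs
      have h4 : ‖x + s • (basisVec j : Space n)‖ ≤ r₀ + |d| := by
        simpa using hcl (subset_closure hs)
      have h5 : ‖x‖ ≤ r₀ + |d| + 1 := by simpa using hA hx
      have h6 : ‖s • (basisVec j : Space n)‖ ≤ ‖x + s • (basisVec j : Space n)‖ + ‖x‖ := by
        have := norm_sub_le (x + s • (basisVec j : Space n)) x
        rwa [add_sub_cancel_left] at this
      rw [norm_smul, norm_basisVec, mul_one, Real.norm_eq_abs] at h6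
      exact abs_le.1 (by linarith)
    · intro s hs
      have h4 : x + s • basisVec j ∈ connectedComponentIn (S.skeleton F ω) x₀ := by
        rw [hCB]; exact subset_closure hs
      exact connectedComponentIn_subset (S.skeleton F ω) x₀ h4

/-- For fixed `ω` the inequality is integrated over the random slab, whose volume is at least `c`;
the integrand is nonnegative, so the domain can be enlarged to the deterministic ball. Taking
expectations then removes the shift `T x` by invariance. -/
theorem lintegral_poincare {F : Set Ω} (hF : S.IsDisperseMedium F) (j : Fin n) :
    ∃ (c : ℝ≥0∞) (R : ℝ), 0 < c ∧ c ≠ ∞ ∧ 0 < R ∧ ∀ f : S.D,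
      (∀ᵐ ω ∂(μ.restrict Fᶜ), S.val f ω = 0) →
      c * ‖S.val f‖ₑ ^ 2 ≤ ∫⁻ x in Metric.ball (0 : Space n) R,
        2 * (‖S.lineMajorant j (2 * R) f‖ₑ ^ 2 + ‖S.U x (S.val f) - S.val f‖ₑ ^ 2) := by
  obtain ⟨c, R, hc, hc', hR, hA⟩ := hF.exists_slab S j
  refine ⟨c, R, hc, hc', hR, fun f hf => ?_⟩
  rw [ae_restrict_iff' hF.measurableSet.compl] at hf
  set J := S.lineMajorant j (2 * R) f with hJ
  have hfm := (Lp.aestronglyMeasurable (S.val f)).aemeasurable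
  have hJm := (Lp.aestronglyMeasurable J).aemeasurable
  have hid : Measure.QuasiMeasurePreserving (fun x : Space n => x)
      (volume.restrict (Metric.ball 0 R)) volume :=
    ⟨measurable_id, by
      rw [show (fun x : Space n => x) = id from rfl, Measure.map_id]
      exact Measure.restrict_le_self.absolutelyContinuous⟩
  have hjoint : AEMeasurable (fun p : Space n × Ω => 2 * (‖J (S.T p.1 p.2)‖ₑ ^ 2 +
      ‖S.val f (S.T p.1 p.2) - S.val f p.2‖ₑ ^ 2))
      ((volume.restrict (Metric.ball 0 R)).prod μ) := by
    refine AEMeasurable.const_mul ?_ _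
    refine ((S.aemeasurable_flow_comp hid hJm).enorm.pow_const 2).add ?_
    exact ((S.aemeasurable_flow_comp hid hfm).sub
      (hfm.comp_quasiMeasurePreserving Measure.quasiMeasurePreserving_snd)).enorm.pow_const 2
  have hpt : ∀ᵐ ω ∂μ, c * ‖S.val f ω‖ₑ ^ 2 ≤ ∫⁻ x in Metric.ball (0 : Space n) R,
      2 * (‖J (S.T x ω)‖ₑ ^ 2 + ‖S.val f (S.T x ω) - S.val f ω‖ₑ ^ 2) := by
    filter_upwards [hA, S.ae_ae_line_bound j (2 * R) f, S.ae_ae_line_zero hf j (2 * R)]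
      with ω ⟨A, hAm, hcA, hAR, hAO⟩ h1 h2
    calc c * ‖S.val f ω‖ₑ ^ 2 ≤ ∫⁻ x in A, ‖S.val f ω‖ₑ ^ 2 := by
          rw [lintegral_const, Measure.restrict_apply_univ, mul_comm]
          gcongr
      _ ≤ ∫⁻ x in A, 2 * (‖J (S.T x ω)‖ₑ ^ 2 + ‖S.val f (S.T x ω) - S.val f ω‖ₑ ^ 2) := by
          refine lintegral_mono_ae ?_
          rw [ae_restrict_iff' hAm]
          filter_upwards [h1, h2] with x h3 h4 hx
          obtain ⟨O, hO, hOne, hOR, hOF⟩ := hAO x hx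
          -- At such a time the line is inside a grain, where the function vanishes, so the
          -- oscillation bound becomes a bound for its value at `T x ω`. The times in the grain form
          -- a nonempty open set, which must meet every set of full measure.
          obtain ⟨t, htO, h5, h6⟩ := exists_mem_of_ae_restrict hO hOne hOR (h3.and h4)
          rw [h6 (hOF t htO), zero_sub, abs_neg] at h5
          have h7 : ‖S.val f (S.T x ω)‖ₑ ≤ ‖J (S.T x ω)‖ₑ := by
            rw [Real.enorm_eq_ofReal_abs, Real.enorm_eq_ofReal_abs]
            exact ENNReal.ofReal_le_ofReal (h5.trans (le_abs_self _))
          have h8 := enorm_sub_sq_le (S.val f (S.T x ω)) (S.val f (S.T x ω) - S.val f ω)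
          rw [sub_sub_cancel] at h8
          refine h8.trans ?_
          gcongr
      _ ≤ _ := lintegral_mono_set hAR
  calc c * ‖S.val f‖ₑ ^ 2 = ∫⁻ ω, c * ‖S.val f ω‖ₑ ^ 2 ∂μ := by
        rw [lintegral_const_mul' _ _ hc', enorm_sq_eq_lintegral]
    _ ≤ ∫⁻ ω, (∫⁻ x in Metric.ball (0 : Space n) R,
      2 * (‖J (S.T x ω)‖ₑ ^ 2 + ‖S.val f (S.T x ω) - S.val f ω‖ₑ ^ 2)) ∂μ := lintegral_mono_ae hpt
    _ = ∫⁻ x in Metric.ball (0 : Space n) R, ∫⁻ ω,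
      2 * (‖J (S.T x ω)‖ₑ ^ 2 + ‖S.val f (S.T x ω) - S.val f ω‖ₑ ^ 2) ∂μ :=
        (lintegral_lintegral_swap hjoint).symm
    _ = _ := by
        refine lintegral_congr fun x => ?_
        rw [lintegral_const_mul' _ _ (by simp)]
        have hJx : AEMeasurable (fun ω => ‖J (S.T x ω)‖ₑ ^ 2) μ :=
          (hJm.comp_quasiMeasurePreserving
            (S.measurePreserving x).quasiMeasurePreserving).enorm.pow_const 2
        rw [lintegral_add_left' hJx, S.lintegral_enorm_sq_flow]
        have h0 := S.lintegral_enorm_sq_flow_sub (S.val f) 0 x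
        simp only [zero_add, S.zero] at h0
        rw [h0]

/-- The Poincaré inequality for functions vanishing on the skeleton. -/
theorem exists_poincare {F : Set Ω} (hF : S.IsDisperseMedium F) (j : Fin n) :
    ∃ C : ℝ, 0 ≤ C ∧ ∀ f : S.D, (∀ᵐ ω ∂(μ.restrict Fᶜ), S.val f ω = 0) →
      ‖S.val f‖ ^ 2 ≤ C * ∑ i, ‖S.deriv i f‖ ^ 2 := by
  obtain ⟨c, R, hc, hc', hR, h⟩ := S.lintegral_poincare hF j
  set V := volume (Metric.ball (0 : Space n) R) with hV
  have hVtop : V ≠ ∞ := measure_ball_lt_top.ne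
  -- The line majorant over `[-2R, 2R]` contributes `4R`. Shifts of length less than `R` contribute
  -- `R` times a sum of `n` norms, whence the factor `n` by Cauchy–Schwarz.
  set M : ℝ := 2 * ((4 * R) ^ 2 + R ^ 2 * n) with hM
  refine ⟨M * V.toReal / c.toReal, by positivity, fun f hf => ?_⟩
  set D := ∑ i, ‖S.deriv i f‖ ^ 2 with hD
  have hle : ∫⁻ x in Metric.ball (0 : Space n) R,
        2 * (‖S.lineMajorant j (2 * R) f‖ₑ ^ 2 + ‖S.U x (S.val f) - S.val f‖ₑ ^ 2) ≤
      ∫⁻ x in Metric.ball (0 : Space n) R, ENNReal.ofReal (M * D) := by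
    refine setLIntegral_mono' measurableSet_ball fun x hx => ?_
    have hx' : ‖x‖ < R := by simpa using hx
    have e : ∀ g : Lp ℝ 2 μ, ‖g‖ₑ ^ 2 = ENNReal.ofReal (‖g‖ ^ 2) := fun g => by
      rw [← ofReal_norm, ENNReal.ofReal_pow (norm_nonneg _)]
    have e2 : ∀ z : ℝ, 2 * ENNReal.ofReal z = ENNReal.ofReal (2 * z) := fun z => by
      rw [ENNReal.ofReal_mul (by norm_num)]; simp
    rw [e, e, ← ENNReal.ofReal_add (by positivity) (by positivity), e2]
    refine ENNReal.ofReal_le_ofReal ?_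
    have h1 : ‖S.lineMajorant j (2 * R) f‖ ^ 2 ≤ (4 * R) ^ 2 * D := by
      have h2 := S.norm_lineMajorant_le j (R := 2 * R) (by linarith) f
      have h3 : ‖S.deriv j f‖ ^ 2 ≤ D :=
        Finset.single_le_sum (f := fun i => ‖S.deriv i f‖ ^ 2) (fun i _ => by positivity)
          (Finset.mem_univ j)
      calc ‖S.lineMajorant j (2 * R) f‖ ^ 2 ≤ (2 * (2 * R) * ‖S.deriv j f‖) ^ 2 := by gcongr
        _ = (4 * R) ^ 2 * ‖S.deriv j f‖ ^ 2 := by ring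
        _ ≤ _ := by gcongr
    have h2 : ‖S.U x (S.val f) - S.val f‖ ^ 2 ≤ R ^ 2 * n * D := by
      have h3 : ‖S.U x (S.val f) - S.val f‖ ≤ R * ∑ i, ‖S.deriv i f‖ := by
        refine (S.norm_U_sub_le f x).trans ?_
        rw [Finset.mul_sum]
        refine Finset.sum_le_sum fun i _ => ?_
        gcongr
        exact (PiLp.norm_apply_le x i).trans hx'.le
      have h4 : (∑ i, ‖S.deriv i f‖) ^ 2 ≤ n * D := by
        have := sq_sum_le_card_mul_sum_sq (s := (Finset.univ : Finset (Fin n)))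
          (f := fun i => ‖S.deriv i f‖)
        simpa using this
      calc ‖S.U x (S.val f) - S.val f‖ ^ 2 ≤ (R * ∑ i, ‖S.deriv i f‖) ^ 2 := by gcongr
        _ = R ^ 2 * (∑ i, ‖S.deriv i f‖) ^ 2 := by ring
        _ ≤ R ^ 2 * (n * D) := by gcongr
        _ = _ := by ring
    rw [hM]
    linarith
  have h1 := (h f hf).trans hle
  rw [lintegral_const, Measure.restrict_apply_univ] at h1
  have h2 := ENNReal.toReal_mono (ENNReal.mul_ne_top ENNReal.ofReal_ne_top hVtop) h1
  have hD0 : 0 ≤ D := Finset.sum_nonneg fun i _ => by positivity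
  rw [ENNReal.toReal_mul, ENNReal.toReal_mul, ENNReal.toReal_ofReal (by positivity),
    ENNReal.toReal_pow, toReal_enorm] at h2
  have hcpos : 0 < c.toReal := ENNReal.toReal_pos hc.ne' hc'
  rw [div_mul_eq_mul_div, le_div_iff₀ hcpos]
  linarith

end ErgodicSystem

/-! ### A stationary field which is linear on the grains -/

section Reach

variable {n : ℕ}

/-- The points of a countable dense set that lie in `M` and are reached from the ball of radius `δ`
around `0` by steps of length at most `δ` in `M`, after `m` steps. -/
def reach (n : ℕ) (M : Set (Space n)) (δ : ℝ) : ℕ → Set ℕ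
  | 0 => {k | TopologicalSpace.denseSeq (Space n) k ∈ M ∧
      ‖TopologicalSpace.denseSeq (Space n) k‖ < δ}
  | m + 1 => {k | TopologicalSpace.denseSeq (Space n) k ∈ M ∧ ∃ l, l ∈ reach n M δ m ∧
      dist (TopologicalSpace.denseSeq (Space n) k) (TopologicalSpace.denseSeq (Space n) l) < δ}

/-- The smallest `i`-th coordinate of the points that are reached. -/
def lowest (M : Set (Space n)) (δ H : ℝ) (i : Fin n) : ℝ :=
  open Classical in
  ⨅ k, if ∃ m, k ∈ reach n M δ m then TopologicalSpace.denseSeq (Space n) k i else H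

/-- Grains are `4δ` apart, so steps shorter than `2δ` cannot change the grain. The initial ball of
radius `2δ` around the origin lies within `3δ` of `p`, so the first points are already in the grain
of `p`. -/
theorem reach_subset {M C : Set (Space n)} {δ : ℝ} {p : Space n}
    (hp : p ∈ C) (hpδ : ‖p‖ ≤ δ) (hsep : ∀ x ∈ C, ∀ y ∈ M, y ∉ C → 4 * δ ≤ dist x y)
    (hδ : 0 < δ) (m k : ℕ) (hk : k ∈ reach n M (2 * δ) m) :
    TopologicalSpace.denseSeq (Space n) k ∈ C := by
  induction m generalizing k with
  | zero =>
    obtain ⟨h1, h2⟩ := hk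
    by_contra hC
    have h3 := hsep p hp _ h1 hC
    have h4 := dist_triangle p 0 (TopologicalSpace.denseSeq (Space n) k)
    rw [dist_zero_right, dist_zero_left] at h4
    linarith
  | succ m ih =>
    obtain ⟨h1, l, hl, h2⟩ := hk
    by_contra hC
    have h3 := hsep _ (ih l hl) _ h1 hC
    rw [dist_comm] at h3
    linarith

/-- The balls of radius `δ` around the reached and around the unreached dense points of `C` form two
open sets covering `C`. By connectedness they would meet inside `C`, and the two centres would then
be less than `2δ` apart, within one step. Regularity of `C` ensures that it contains dense points
near each of its points. -/
theorem exists_mem_reach {M C : Set (Space n)} {δ : ℝ} {p : Space n}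
    (hp : p ∈ C) (hpδ : ‖p‖ ≤ δ) (hδ : 0 < δ) (hCM : C ⊆ M) (hC : IsPreconnected C)
    (hreg : C ⊆ closure (interior C)) {k : ℕ}
    (hk : TopologicalSpace.denseSeq (Space n) k ∈ C) : ∃ m, k ∈ reach n M (2 * δ) m := by
  set d := TopologicalSpace.denseSeq (Space n) with hd
  have hdense : ∀ c ∈ C, ∃ l, d l ∈ C ∧ dist c (d l) < δ := by
    intro c hc
    obtain ⟨c', hc', hcc'⟩ := Metric.mem_closure_iff.1 (hreg hc) (δ / 2) (by linarith)
    obtain ⟨l, hl⟩ := (TopologicalSpace.denseRange_denseSeq (Space n)).exists_mem_open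
      (isOpen_interior.inter Metric.isOpen_ball) ⟨c', hc', Metric.mem_ball_self (half_pos hδ)⟩
    refine ⟨l, interior_subset hl.1, ?_⟩
    have h1 : dist (d l) c' < δ / 2 := hl.2
    rw [dist_comm] at h1
    linarith [dist_triangle c c' (d l)]
  by_contra hcon
  set R : Set ℕ := {l | ∃ m, l ∈ reach n M (2 * δ) m} with hR
  have hcon' : k ∉ R := hcon
  set A : Set (Space n) := ⋃ l ∈ {l | l ∈ R ∧ d l ∈ C}, Metric.ball (d l) δ with hA
  set A' : Set (Space n) := ⋃ l ∈ {l | l ∉ R ∧ d l ∈ C}, Metric.ball (d l) δ with hA'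
  have hAo : IsOpen A := isOpen_biUnion fun _ _ => Metric.isOpen_ball
  have hAo' : IsOpen A' := isOpen_biUnion fun _ _ => Metric.isOpen_ball
  have hcov : C ⊆ A ∪ A' := by
    intro c hc
    obtain ⟨l, hl, hcl⟩ := hdense c hc
    by_cases h : l ∈ R
    · exact Or.inl (mem_iUnion₂.2 ⟨l, ⟨h, hl⟩, hcl⟩)
    · exact Or.inr (mem_iUnion₂.2 ⟨l, ⟨h, hl⟩, hcl⟩)
  have h1 : (C ∩ A).Nonempty := by
    obtain ⟨l, hl, hpl⟩ := hdense p hp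
    have h0 : l ∈ reach n M (2 * δ) 0 := by
      refine ⟨hCM hl, ?_⟩
      have h2 := dist_triangle (d l) p 0
      rw [dist_zero_right, dist_zero_right, dist_comm] at h2
      linarith
    exact ⟨p, hp, mem_iUnion₂.2 ⟨l, ⟨⟨0, h0⟩, hl⟩, hpl⟩⟩
  have h2 : (C ∩ A').Nonempty :=
    ⟨d k, hk, mem_iUnion₂.2 ⟨k, ⟨hcon', hk⟩, Metric.mem_ball_self hδ⟩⟩
  obtain ⟨c, -, hcA, hcA'⟩ := hC A A' hAo hAo' hcov h1 h2
  obtain ⟨l, ⟨⟨m, hm⟩, -⟩, hcl⟩ := mem_iUnion₂.1 hcA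
  obtain ⟨l', ⟨hl', hl'C⟩, hcl'⟩ := mem_iUnion₂.1 hcA'
  refine hl' ⟨m + 1, hCM hl'C, l, hm, ?_⟩
  rw [Metric.mem_ball] at hcl hcl'
  rw [dist_comm] at hcl'
  have := dist_triangle (d l') c (d l)
  linarith

/-- The reached points are exactly the dense points in `C`. All the other indices receive the
default value `H`, an upper bound for the coordinate on `C`, and so do not affect the infimum. -/
theorem lowest_eq {M C : Set (Space n)} {δ H g : ℝ} {p : Space n} {i : Fin n}
    (hp : p ∈ C) (hpδ : ‖p‖ ≤ δ) (hδ : 0 < δ) (hCM : C ⊆ M) (hC : IsPreconnected C)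
    (hreg : C ⊆ closure (interior C))
    (hsep : ∀ x ∈ C, ∀ y ∈ M, y ∉ C → 4 * δ ≤ dist x y)
    (hH : ∀ x ∈ C, x i ≤ H) (hg : IsGLB ((fun x : Space n => x i) '' C) g) :
    lowest M (2 * δ) H i = g := by
  have hiff : ∀ k, (∃ m, k ∈ reach n M (2 * δ) m) ↔ TopologicalSpace.denseSeq (Space n) k ∈ C :=
    fun k => ⟨fun ⟨m, hm⟩ => reach_subset hp hpδ hsep hδ m k hm,
      exists_mem_reach hp hpδ hδ hCM hC hreg⟩
  have hlb : ∀ x ∈ C, g ≤ x i := fun x hx => hg.1 (mem_image_of_mem _ hx)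
  refine IsGLB.ciInf_eq ⟨?_, ?_⟩
  · rintro _ ⟨k, rfl⟩
    simp only
    split_ifs with h
    · exact hlb _ ((hiff k).1 h)
    · exact (hlb p hp).trans (hH p hp)
  · intro a ha
    refine hg.2 ?_
    rintro _ ⟨c, hc, rfl⟩
    simp only
    by_contra hlt
    push Not at hlt
    have ho : IsOpen {x : Space n | x i < a} := isOpen_lt (by fun_prop) continuous_const
    obtain ⟨c', hc', hc'i⟩ := mem_closure_iff.1 (hreg hc) _ ho hlt
    obtain ⟨l, hl⟩ := (TopologicalSpace.denseRange_denseSeq (Space n)).exists_mem_open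
      (isOpen_interior.inter ho) ⟨c', hc'i, hc'⟩
    have h1 := ha ⟨l, rfl⟩
    simp only [if_pos ((hiff l).2 (interior_subset hl.1))] at h1
    exact absurd hl.2 (not_lt.2 h1)

/-- `lowest` is covariant under translations. -/
theorem lowest_translate {M C : Set (Space n)} {δ H : ℝ} {i : Fin n}
    (h0 : (0 : Space n) ∈ C) (hδ : 0 < δ) (hCM : C ⊆ M) (hC : IsPreconnected C)
    (hreg : C ⊆ closure (interior C))
    (hsep : ∀ x ∈ C, ∀ y ∈ M, y ∉ C → 4 * δ ≤ dist x y)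
    (hH : ∀ x ∈ C, ‖x‖ + δ ≤ H) {y : Space n} (hy : ‖y‖ ≤ δ) :
    lowest {x | x - y ∈ M} (2 * δ) H i = lowest M (2 * δ) H i + y i ∧
      |lowest M (2 * δ) H i + y i| ≤ H := by
  have habs : ∀ x : Space n, |x i| ≤ ‖x‖ := fun x => PiLp.norm_apply_le x i
  have hbd : BddBelow ((fun x : Space n => x i) '' C) := by
    refine ⟨-H, ?_⟩
    rintro _ ⟨x, hx, rfl⟩
    have := (abs_le.1 (habs x)).1
    have := hH x hx
    simp only
    linarith
  have hg := isGLB_csInf (⟨_, mem_image_of_mem _ h0⟩ : ((fun x : Space n => x i) '' C).Nonempty) hbd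
  set g := sInf ((fun x : Space n => x i) '' C) with hgdef
  have e1 : lowest M (2 * δ) H i = g := by
    refine lowest_eq h0 (by simpa using hδ.le) hδ hCM hC hreg hsep (fun x hx => ?_) hg
    linarith [(abs_le.1 (habs x)).2, hH x hx]
  have hφ : (fun x : Space n => x - y) = (Homeomorph.subRight y : Space n ≃ₜ Space n) := rfl
  have hset : {x : Space n | x - y ∈ C} = (Homeomorph.addRight y : Space n ≃ₜ Space n) '' C := by
    ext x
    simp only [mem_ofPred_eq, mem_image, Homeomorph.coe_addRight]
    exact ⟨fun h => ⟨x - y, h, by abel⟩, fun ⟨c, hc, h⟩ => by rw [← h, add_sub_cancel_right]; exact hc⟩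
  -- The translated grain contains `y`, but perhaps no longer the origin; for this reason `reach`
  -- starts from a ball.
  have e2 : lowest {x | x - y ∈ M} (2 * δ) H i = g + y i := by
    refine lowest_eq (C := {x | x - y ∈ C}) (p := y) (by simpa using h0) hy hδ
      (fun x hx => hCM hx) ?_ ?_ ?_ ?_ ?_
    · rw [hset]
      exact hC.image _ (Homeomorph.continuous _).continuousOn
    · rw [hset, ← Homeomorph.image_interior, ← Homeomorph.image_closure]
      exact image_mono hreg
    · intro x hx z hz hzC
      have := hsep _ hx _ hz hzC
      rwa [dist_sub_right] at this
    · intro x hx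
      have h1 := hH _ hx
      have h2 := (abs_le.1 (habs x)).2
      have h3 := norm_add_le (x - y) y
      rw [sub_add_cancel] at h3
      linarith
    · constructor
      · rintro _ ⟨x, hx, rfl⟩
        have h1 := hg.1 (mem_image_of_mem (fun x : Space n => x i) hx)
        simp only [PiLp.sub_apply] at h1 ⊢
        linarith
      · intro a ha
        have : a - y i ≤ g := hg.2 (by
          rintro _ ⟨x, hx, rfl⟩
          have h1 := ha (mem_image_of_mem (fun x : Space n => x i)
            (show x + y ∈ {x | x - y ∈ C} by simpa using hx))
          simp only [PiLp.add_apply] at h1 ⊢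
          linarith)
        linarith
  refine ⟨by rw [e1, e2], ?_⟩
  rw [e1, abs_le]
  have hyi := abs_le.1 ((habs y).trans hy)
  constructor
  · have h1 : -H + δ ≤ g := hg.2 (by
      rintro _ ⟨x, hx, rfl⟩
      have h2 := (abs_le.1 (habs x)).1
      have h3 := hH x hx
      simp only
      linarith)
    linarith [hyi.1]
  · have h1 := hg.1 (mem_image_of_mem (fun x : Space n => x i) h0)
    have h2 := hH 0 h0
    rw [norm_zero] at h2
    simp only [PiLp.zero_apply] at h1
    linarith [hyi.2]

end Reach

namespace ErgodicSystem

variable {n : ℕ} {Ω : Type*} [MeasurableSpace Ω] {μ : Measure Ω} (S : ErgodicSystem n μ)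
variable [IsProbabilityMeasure μ]

/-- Only countably many fixed points are tested for membership in the random set, and for each fixed
`x` the event is a preimage under `T x`. -/
theorem measurableSet_mem_reach {F : Set Ω} (hF : MeasurableSet F) (δ : ℝ) (m k : ℕ) :
    MeasurableSet {ω | k ∈ reach n (S.skeleton F ω) δ m} := by
  have h0 : ∀ x, MeasurableSet {ω | x ∈ S.skeleton F ω} := fun x =>
    (S.measurePreserving x).measurable hF.compl
  induction m generalizing k with
  | zero => exact (h0 _).inter (MeasurableSet.const _)
  | succ m ih =>
    have : {ω | ∃ l, l ∈ reach n (S.skeleton F ω) δ m ∧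
        dist (TopologicalSpace.denseSeq (Space n) k) (TopologicalSpace.denseSeq (Space n) l) < δ} =
        ⋃ l, {ω | l ∈ reach n (S.skeleton F ω) δ m} ∩ {_ω |
          dist (TopologicalSpace.denseSeq (Space n) k)
            (TopologicalSpace.denseSeq (Space n) l) < δ} := by
      ext ω; simp
    have h1 := MeasurableSet.iUnion fun l => (ih l).inter (MeasurableSet.const (α := Ω)
      (dist (TopologicalSpace.denseSeq (Space n) k)
        (TopologicalSpace.denseSeq (Space n) l) < δ))
    rw [← this] at h1
    exact (h0 _).inter h1

theorem measurable_lowest {F : Set Ω} (hF : MeasurableSet F) (δ H : ℝ) (i : Fin n) :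
    Measurable fun ω => lowest (S.skeleton F ω) δ H i := by
  classical
  refine Measurable.iInf fun k => ?_
  refine Measurable.ite ?_ measurable_const measurable_const
  have : {ω | ∃ m, k ∈ reach n (S.skeleton F ω) δ m} =
      ⋃ m, {ω | k ∈ reach n (S.skeleton F ω) δ m} := by
    ext ω; simp
  rw [this]
  exact MeasurableSet.iUnion fun m => S.measurableSet_mem_reach hF δ m k

theorem skeleton_T (F : Set Ω) (y : Space n) (ω : Ω) :
    S.skeleton F (S.T (-y) ω) = {x | x - y ∈ S.skeleton F ω} := by
  ext x
  simp only [skeleton, pore, mem_compl_iff, mem_ofPred_eq]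
  rw [← S.add, sub_eq_add_neg]

/-- There is a stationary field `b` with `b(T(-y) ω) = b(ω) - y` for `ω ∈ ℳ` and small `y`. -/
theorem IsDisperseMedium.exists_field {F : Set Ω} (hF : S.IsDisperseMedium F) :
    ∃ (b : Fin n → Lp ℝ 2 μ) (δ : ℝ), 0 < δ ∧ ∀ i, ∀ y : Space n, ‖y‖ ≤ δ →
      ∀ᵐ ω ∂μ, ω ∈ Fᶜ → S.U (-y) (b i) ω = b i ω - y i := by
  obtain ⟨K, hK⟩ := hF.grains_smooth
  obtain ⟨r, hr, hsep⟩ := hF.separated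
  obtain ⟨d, hd⟩ := hF.diameter
  -- The minimal distance `r` between grains plays the role of `4δ` in the lemmas on `reach`.
  set δ := r / 4 with hδ
  have hδ0 : 0 < δ := by positivity
  set H := |d| + δ with hH
  -- The truncation at `±H` makes the field bounded for every `ω`; it has no effect almost surely on
  -- `ℳ`, where the lowest coordinate has modulus at most `H`. The minus sign yields `b - y_i`
  -- rather than `b + y_i`.
  let β : Fin n → Ω → ℝ := fun i ω => -max (-H) (min H (lowest (S.skeleton F ω) (2 * δ) H i))
  have hβm : ∀ i, Measurable (β i) := fun i =>
    (measurable_const.max (measurable_const.min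
      (S.measurable_lowest hF.measurableSet (2 * δ) H i))).neg
  have hH0 : 0 ≤ H := by positivity
  have hβb : ∀ i ω, ‖β i ω‖ ≤ H := by
    intro i ω
    simp only [β, norm_neg, Real.norm_eq_abs]
    rw [abs_le]
    exact ⟨le_max_left _ _, max_le (by linarith) (min_le_left _ _)⟩
  have hβL : ∀ i, MemLp (β i) 2 μ := fun i =>
    MemLp.of_bound (hβm i).aestronglyMeasurable H (ae_of_all _ (hβb i))
  refine ⟨fun i => (hβL i).toLp, δ, hδ0, fun i y hy => ?_⟩
  have hq := (S.measurePreserving (-y)).quasiMeasurePreserving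
  filter_upwards [hK, hsep, hd, S.U_coeFn (-y) ((hβL i).toLp), (hβL i).coeFn_toLp,
    hq.ae ((hβL i).coeFn_toLp)] with ω h1 h2 h3 h4 h5 h6 hω
  rw [h4, h6, h5]
  have h0 : (0 : Space n) ∈ S.skeleton F ω := by
    simp only [skeleton, pore, mem_compl_iff, mem_ofPred_eq, S.zero]
    exact hω
  set C := connectedComponentIn (S.skeleton F ω) 0 with hC
  have hCg : C ∈ S.grains F ω := ⟨0, h0, rfl⟩
  have h0C : (0 : Space n) ∈ C := mem_connectedComponentIn h0
  obtain ⟨B, hB, hCB, -⟩ := h1 C hCg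
  have hreg : C ⊆ closure (interior C) := by
    rw [hCB]
    exact closure_mono (interior_maximal subset_closure hB.isOpen)
  have hsep' : ∀ x ∈ C, ∀ z ∈ S.skeleton F ω, z ∉ C → 4 * δ ≤ dist x z := by
    intro x hx z hz hzC
    have h7 : connectedComponentIn (S.skeleton F ω) z ∈ S.grains F ω := ⟨z, hz, rfl⟩
    have h8 : C ≠ connectedComponentIn (S.skeleton F ω) z := by
      intro h9
      exact hzC (h9 ▸ mem_connectedComponentIn hz)
    have := h2 C hCg _ h7 h8 x hx z (mem_connectedComponentIn hz)
    rw [hδ]; linarith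
  have hH' : ∀ x ∈ C, ‖x‖ + δ ≤ H := by
    intro x hx
    have := h3 C hCg x hx 0 h0C
    rw [dist_zero_right] at this
    linarith [le_abs_self d]
  have key : ∀ y : Space n, ‖y‖ ≤ δ → _ := fun y hy =>
    lowest_translate (i := i) h0C hδ0 (connectedComponentIn_subset _ _)
      isPreconnected_connectedComponentIn hreg hsep' hH' hy
  have k1 := key y hy
  have k0 := (key 0 (by simpa using hδ0.le)).2
  simp only [PiLp.zero_apply, add_zero] at k0
  have ktr : ∀ c : ℝ, |c| ≤ H → max (-H) (min H c) = c := fun c hc => by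
    rw [min_eq_right (abs_le.1 hc).2, max_eq_right (abs_le.1 hc).1]
  simp only [β]
  rw [S.skeleton_T, k1.1, ktr _ k1.2, ktr _ k0]
  ring

/-- The hypotheses on the medium are possible only in dimension at least two. -/
theorem IsDisperseMedium.two_le {F : Set Ω} (hF : S.IsDisperseMedium F) : 2 ≤ n := by
  obtain ⟨d, hd⟩ := hF.diameter
  obtain ⟨r₀, hr₀, hdense⟩ := hF.dense
  have hne : ∃ ω, ω ∈ F ∧ IsConnected (S.pore F ω) ∧
      (∀ C ∈ S.grains F ω, ∀ x ∈ C, ∀ y ∈ C, dist x y ≤ d) ∧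
      ∀ x : Space n, (Metric.ball x r₀ ∩ S.skeleton F ω).Nonempty := by
    have h1 : ∃ᵐ ω ∂μ, ω ∈ F := by
      rw [frequently_ae_mem_iff]; exact hF.pore_pos.ne'
    obtain ⟨ω, h2, h3⟩ := (h1.and_eventually (hF.pore_connected.and (hd.and hdense))).exists
    exact ⟨ω, h2, h3.1, h3.2.1, h3.2.2⟩
  obtain ⟨ω, hωF, hconn, hdiam, hdn⟩ := hne
  have h0 : (0 : Space n) ∈ S.pore F ω := by
    simp only [pore, mem_ofPred_eq, S.zero]; exact hωF
  by_contra hn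
  have hn' : n = 0 ∨ n = 1 := by omega
  rcases hn' with rfl | rfl
  · obtain ⟨x, -, hx⟩ := hdn 0
    rw [Subsingleton.elim x 0] at hx
    exact hx h0
  -- On the line the connected pore set is an interval containing 0. The half-line beyond a skeleton
  -- point on its right therefore belongs to the skeleton, which gives an unbounded grain.
  · set u : Space 1 := basisVec 0 with hu
    have hx1 : ∀ x : Space 1, x = x 0 • u := fun x => by
      ext i; rw [Subsingleton.elim i 0]; simp [hu, basisVec]
    obtain ⟨s, hs1, hs2⟩ := hdn (r₀ • u)
    have hs0 : 0 < s 0 := by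
      have h1 : |(s - r₀ • u) 0| ≤ ‖s - r₀ • u‖ :=
        PiLp.norm_apply_le (s - r₀ • u) (0 : Fin 1)
      rw [Metric.mem_ball, dist_eq_norm] at hs1
      have h2 := (abs_lt.1 (h1.trans_lt hs1)).1
      have h3 : (s - r₀ • u) 0 = s 0 - r₀ := by simp [hu, basisVec]
      rw [h3] at h2
      linarith
    have hI : (Set.OrdConnected ((fun x : Space 1 => x 0) '' S.pore F ω)) :=
      (hconn.isPreconnected.image _ (by fun_prop)).ordConnected
    have hray : ∀ t : ℝ, 0 ≤ t → s + t • u ∈ S.skeleton F ω := by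
      intro t ht hcon
      have h1 := hI.out (mem_image_of_mem _ h0) (mem_image_of_mem _ hcon)
      have h2 : s 0 ∈ (fun x : Space 1 => x 0) '' S.pore F ω := by
        refine h1 ⟨?_, ?_⟩
        · simpa using hs0.le
        · simp [hu, basisVec, ht]
      obtain ⟨x, hx, hxs⟩ := h2
      have h3 : x = s := by rw [hx1 x, hx1 s]; simp only at hxs; rw [hxs]
      exact hs2 (h3 ▸ hx)
    have hpre : IsPreconnected ((fun t : ℝ => s + t • u) '' Ici 0) :=
      isPreconnected_Ici.image _ (by fun_prop)
    have hsub : (fun t : ℝ => s + t • u) '' Ici 0 ⊆ S.skeleton F ω := by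
      rintro _ ⟨t, ht, rfl⟩; exact hray t ht
    have hcomp := hpre.subset_connectedComponentIn (x := s) ⟨0, by simp, by simp⟩ hsub
    have h4 := hdiam _ ⟨s, hs2, rfl⟩ _ (hcomp ⟨|d| + 1, by simp; positivity, rfl⟩) _
      (mem_connectedComponentIn hs2)
    rw [dist_eq_norm] at h4
    simp only [add_sub_cancel_left, norm_smul, hu, norm_basisVec, mul_one, Real.norm_eq_abs] at h4
    rw [abs_of_nonneg (by positivity)] at h4
    linarith [le_abs_self d]

end ErgodicSystem

theorem integral_mul_pd {n : ℕ} {f κ : Space n → ℝ}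
    (hκ : IsTestFunction univ κ) (hf : ContDiff ℝ smooth f) (j : Fin n) :
    ∫ x, f x * pd j κ x = -∫ x, pd j f x * κ x := by
  have hfd : Continuous (pd j f) :=
    (hf.continuous_fderiv (by simp)).clm_apply continuous_const
  refine integral_mul_fderiv_eq_neg_fderiv_mul_of_integrable ?_ ?_ ?_ ?_ ?_
  · exact (hfd.mul hκ.continuous).integrable_of_hasCompactSupport hκ.hasCompactSupport.mul_left
  · exact (hf.continuous.mul (hκ.pd j).continuous).integrable_of_hasCompactSupport
      (hκ.pd j).hasCompactSupport.mul_left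
  · exact (hf.continuous.mul hκ.continuous).integrable_of_hasCompactSupport
      hκ.hasCompactSupport.mul_left
  · exact fun x _ => hf.differentiable (by simp) x
  · exact fun x _ => hκ.differentiable x

/-! ### Divergence-free fields with prescribed expectation, and the angle between constants and `X`
-/

namespace ErgodicSystem

variable {n : ℕ} {Ω : Type*} [MeasurableSpace Ω] {μ : Measure Ω} (S : ErgodicSystem n μ)
variable [IsProbabilityMeasure μ]

/-- Restriction of square integrable functions to a subset. -/
def restr (s : Set Ω) : Lp ℝ 2 μ →L[ℝ] Lp ℝ 2 (μ.restrict s) := LpToLpRestrictCLM Ω ℝ ℝ μ 2 s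

theorem restr_coeFn (s : Set Ω) (f : Lp ℝ 2 μ) : restr s f =ᵐ[μ.restrict s] f :=
  LpToLpRestrictCLM_coeFn ℝ s f

theorem restr_eq_zero_iff (s : Set Ω) (f : Lp ℝ 2 μ) :
    restr s f = 0 ↔ ∀ᵐ ω ∂(μ.restrict s), f ω = 0 := by
  rw [Lp.eq_zero_iff_ae_eq_zero]
  exact ⟨fun h => (restr_coeFn s f).symm.trans h, fun h => (restr_coeFn s f).trans h⟩

/-- The components of the elements of `𝒟(Ω)ⁿ`. -/
def compL (i : Fin n) : S.DVec →L[ℝ] S.D := PiLp.proj (𝕜 := ℝ) 2 (fun _ : Fin n => S.D) i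

@[simp] theorem compL_apply (i : Fin n) (z : S.DVec) : S.compL i z = z i := rfl

/-- The stochastic divergence. -/
def divL : S.DVec →L[ℝ] Lp ℝ 2 μ := ∑ j, (S.derivL j).comp (S.compL j)

theorem divL_apply (z : S.DVec) : S.divL z = ∑ j, S.deriv j (z j) := by
  simp [divL]

theorem divL_coeFn (z : S.DVec) : S.divL z =ᵐ[μ] fun ω => ∑ j, S.deriv j (z j) ω := by
  rw [divL_apply]
  exact Lp.coeFn_fun_finsetSum _ _

/-- The expectation, as a continuous linear map. -/
def meanL : S.DVec →L[ℝ] Space n :=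
  ((PiLp.continuousLinearEquiv 2 ℝ (fun _ : Fin n => ℝ)).symm : (Fin n → ℝ) →L[ℝ] Space n).comp
    (ContinuousLinearMap.pi fun i =>
      (innerSL ℝ (one : Lp ℝ 2 μ)).comp (S.valL.comp (S.compL i)))

@[simp] theorem meanL_apply (z : S.DVec) : S.meanL z = S.mean z := by
  ext i
  exact inner_one _

/-- The restriction to `F` of the values of the elements of `𝒟(Ω)ⁿ`. -/
def evalL (F : Set Ω) : S.DVec →L[ℝ] L2Vec n (μ.restrict F) :=
  ((PiLp.continuousLinearEquiv 2 ℝ (fun _ : Fin n => Lp ℝ 2 (μ.restrict F))).symm :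
    (Fin n → Lp ℝ 2 (μ.restrict F)) →L[ℝ] L2Vec n (μ.restrict F)).comp
    (ContinuousLinearMap.pi fun i => (restr F).comp (S.valL.comp (S.compL i)))

@[simp] theorem evalL_apply (F : Set Ω) (z : S.DVec) (i : Fin n) :
    S.evalL F z i = restr F (S.val (z i)) := rfl

/-- The embedding of the constants in `L²(F)ⁿ`. -/
def constL (μ : Measure Ω) [IsProbabilityMeasure μ] (F : Set Ω) :
    Space n →L[ℝ] L2Vec n (μ.restrict F) :=
  ((PiLp.continuousLinearEquiv 2 ℝ (fun _ : Fin n => Lp ℝ 2 (μ.restrict F))).symm :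
    (Fin n → Lp ℝ 2 (μ.restrict F)) →L[ℝ] L2Vec n (μ.restrict F)).comp
    (ContinuousLinearMap.pi fun i =>
      (PiLp.proj (𝕜 := ℝ) 2 (fun _ : Fin n => ℝ) i).smulRight (restr F one))

@[simp] theorem constL_apply (F : Set Ω) (v : Space n) (i : Fin n) :
    constL μ F v i = v i • restr F (one : Lp ℝ 2 μ) := rfl

theorem one_coeFn : (one : Lp ℝ 2 μ) =ᵐ[μ] fun _ => 1 := by
  refine (indicatorConstLp_coeFn).trans ?_
  simp only [indicator_univ]
  rfl

theorem constL_eval (F : Set Ω) (v : Space n) :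
    ∀ᵐ ω ∂(μ.restrict F), (constL μ F v).eval ω = v := by
  have h : ∀ i, ∀ᵐ ω ∂(μ.restrict F), constL μ F v i ω = v i := by
    intro i
    rw [constL_apply]
    filter_upwards [Lp.coeFn_smul (v i) (restr F (one : Lp ℝ 2 μ)), restr_coeFn F (one : Lp ℝ 2 μ),
      ae_restrict_of_ae one_coeFn] with ω h1 h2 h3
    rw [h1, Pi.smul_apply, h2, h3, smul_eq_mul, mul_one]
  filter_upwards [ae_all_iff.2 h] with ω hω
  ext i
  exact hω i

/-- The space of the fields in `𝒟(Ω)ⁿ` which vanish outside of `F` and are divergence free in `F`,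
as a linear subspace. -/
def Wsub (F : Set Ω) : Submodule ℝ S.DVec :=
  (⨅ i, LinearMap.ker ((restr Fᶜ).comp (S.valL.comp (S.compL i))).toLinearMap) ⊓
    LinearMap.ker ((restr F).comp S.divL).toLinearMap

theorem mem_Wsub {F : Set Ω} {z : S.DVec} : z ∈ S.Wsub F ↔ z ∈ S.W F := by
  have h : ∀ s, restr s (S.divL z) = 0 ↔ ∀ᵐ ω ∂(μ.restrict s), ∑ j, S.deriv j (z j) ω = 0 := by
    intro s
    rw [restr_eq_zero_iff]
    have h1 := ae_restrict_of_ae (s := s) (S.divL_coeFn z)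
    constructor <;> intro h2 <;> filter_upwards [h1, h2] with ω h3 h4
    · rw [← h3, h4]
    · rw [h3, h4]
  simp only [Wsub, Submodule.mem_inf, Submodule.mem_iInf, LinearMap.mem_ker,
    ContinuousLinearMap.coe_coe, ContinuousLinearMap.comp_apply, compL_apply, valL_apply,
    restr_eq_zero_iff, W]
  rw [← restr_eq_zero_iff, h]
  rfl

theorem isClosed_Wsub (F : Set Ω) : IsClosed (S.Wsub F : Set S.DVec) := by
  rw [Wsub, Submodule.coe_inf, Submodule.coe_iInf]
  exact (isClosed_iInter fun i => ContinuousLinearMap.isClosed_ker _).inter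
    (ContinuousLinearMap.isClosed_ker _)

theorem restr_compl_val {F : Set Ω} {z : S.DVec} (hz : z ∈ S.Wsub F) (i : Fin n) :
    ∀ᵐ ω ∂(μ.restrict Fᶜ), S.val (z i) ω = 0 := (S.mem_Wsub.1 hz).1 i

/-- Scalar products over `F` with a function vanishing outside of `F`. -/
theorem inner_restr_of_compl {F : Set Ω} (hF : MeasurableSet F) {w : Lp ℝ 2 (μ.restrict F)}
    {f h : Lp ℝ 2 μ} (hw : ∀ᵐ ω ∂(μ.restrict F), w ω = f ω)
    (hh : ∀ᵐ ω ∂(μ.restrict Fᶜ), h ω = 0) : inner ℝ w (restr F h) = inner ℝ f h := by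
  rw [L2.inner_def, L2.inner_def]
  have h1 : ∫ ω in F, inner ℝ (w ω) (restr F h ω) ∂μ = ∫ ω in F, inner ℝ (f ω) (h ω) ∂μ := by
    refine integral_congr_ae ?_
    filter_upwards [hw, restr_coeFn F h] with ω h1 h2
    rw [h1, h2]
  have h0 : Integrable (fun ω => inner ℝ (f ω) (h ω)) μ := L2.integrable_inner f h
  rw [h1, ← integral_add_compl hF h0]
  have h2 : ∫ ω in Fᶜ, inner ℝ (f ω) (h ω) ∂μ = 0 := by
    rw [integral_eq_zero_of_ae]
    filter_upwards [hh] with ω h1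
    rw [h1]; simp
  rw [h2, add_zero]

theorem inner_evalL {F : Set Ω} (hF : MeasurableSet F) {w : L2Vec n (μ.restrict F)}
    {f : L2Vec n μ} (hw : ∀ i, ∀ᵐ ω ∂(μ.restrict F), w i ω = f i ω) {z : S.DVec}
    (hz : z ∈ S.Wsub F) : inner ℝ w (S.evalL F z) = ∑ i, inner ℝ (f i) (S.val (z i)) := by
  rw [PiLp.inner_apply]
  exact Finset.sum_congr rfl fun i _ => inner_restr_of_compl hF (hw i) (S.restr_compl_val hz i)

theorem inner_constL_evalL {F : Set Ω} (hF : MeasurableSet F) (v : Space n) {z : S.DVec}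
    (hz : z ∈ S.Wsub F) : inner ℝ (constL μ F v) (S.evalL F z) = inner ℝ v (S.mean z) := by
  rw [S.inner_evalL hF (f := WithLp.toLp 2 fun i => v i • one) (fun i => ?_) hz, PiLp.inner_apply]
  · refine Finset.sum_congr rfl fun i _ => ?_
    simp only [real_inner_smul_left, inner_one, mean]
    simp [mul_comm]
  · rw [constL_apply]
    filter_upwards [Lp.coeFn_smul (v i) (restr F (one : Lp ℝ 2 μ)),
      ae_restrict_of_ae (Lp.coeFn_smul (v i) (one : Lp ℝ 2 μ)), restr_coeFn F (one : Lp ℝ 2 μ)]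
      with ω h1 h2 h3
    simp only [h1, h2, Pi.smul_apply, h3]

/-- A smeared field is constant on the set where the field is affine along the flow. -/
theorem smear_ae_eq {κ : Space n → ℝ} {F : Set Ω} (hF : MeasurableSet F) (hκ : Continuous κ)
    (hc : HasCompactSupport κ) {δ : ℝ} (hs : ∀ y, κ y ≠ 0 → ‖y‖ ≤ δ) (h0 : ∫ y, κ y = 0)
    {b : Lp ℝ 2 μ} {i : Fin n}
    (hb : ∀ y, ‖y‖ ≤ δ → ∀ᵐ ω ∂μ, ω ∈ Fᶜ → S.U (-y) b ω = b ω - y i) :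
    ∀ᵐ ω ∂(μ.restrict Fᶜ), S.smear κ b ω = -∫ y, κ y * y i := by
  set c := ∫ y, κ y * y i with hcdef
  -- The claim is `r = 0` on `ℳ`. With `g` the cutoff of `r` to `ℳ`, the product of `g` with `r` is
  -- the squared norm of `g`, and it vanishes by the affine behaviour of `b` under the integral
  -- defining `smear` together with `∫ κ = 0`.
  set r : Lp ℝ 2 μ := S.smear κ b + c • one with hr
  have hgm : MemLp (Fᶜ.indicator r) 2 μ := (Lp.memLp r).indicator hF.compl
  set g : Lp ℝ 2 μ := hgm.toLp _ with hg
  have hgc : g =ᵐ[μ] Fᶜ.indicator r := hgm.coeFn_toLp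
  have h1 : ∀ y, κ y * inner ℝ g (S.U (-y) b) =
      κ y * inner ℝ g b - κ y * y i * inner ℝ g one := by
    intro y
    by_cases hy : κ y = 0
    · simp [hy]
    have h2 : inner ℝ g (S.U (-y) b) = inner ℝ g (b - y i • one) := by
      rw [L2.inner_def, L2.inner_def]
      refine integral_congr_ae ?_
      filter_upwards [hgc, hb y (hs y hy), Lp.coeFn_sub b (y i • (one : Lp ℝ 2 μ)),
        Lp.coeFn_smul (y i) (one : Lp ℝ 2 μ), one_coeFn (μ := μ)] with ω e1 e2 e3 e4 e5
      by_cases hω : ω ∈ Fᶜ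
      · rw [e2 hω, e3, Pi.sub_apply, e4, Pi.smul_apply, e5]; simp
      · rw [e1, indicator_of_notMem hω]; simp
    rw [h2, inner_sub_right, real_inner_smul_right]
    ring
  have hi : Integrable fun y => κ y * y i :=
    (hκ.mul (by fun_prop)).integrable_of_hasCompactSupport hc.mul_right
  have h3 : inner ℝ g r = 0 := by
    rw [hr, inner_add_right, real_inner_smul_right, S.inner_smear hκ hc]
    simp only [h1]
    rw [integral_sub ((hκ.integrable_of_hasCompactSupport hc).mul_const _) (hi.mul_const _),
      integral_mul_const, integral_mul_const, h0, ← hcdef]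
    ring
  have h4 : inner ℝ g g = (0 : ℝ) := by
    rw [← h3, L2.inner_def, L2.inner_def]
    refine integral_congr_ae ?_
    filter_upwards [hgc] with ω e1
    by_cases hω : ω ∈ Fᶜ
    · rw [e1, indicator_of_mem hω]
    · rw [e1, indicator_of_notMem hω]; simp
  have h5 : g = 0 := inner_self_eq_zero.1 h4
  have h6 : Fᶜ.indicator r =ᵐ[μ] 0 := hgc.symm.trans (h5 ▸ Lp.coeFn_zero ℝ 2 μ)
  rw [ae_restrict_iff' hF.compl]
  filter_upwards [h6, Lp.coeFn_add (S.smear κ b) (c • (one : Lp ℝ 2 μ)),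
    Lp.coeFn_smul c (one : Lp ℝ 2 μ), one_coeFn (μ := μ)] with ω e1 e2 e3 e4 hω
  rw [indicator_of_mem hω, hr, e2, Pi.add_apply, e3, Pi.smul_apply, e4] at e1
  simp at e1
  linarith

end ErgodicSystem

namespace ErgodicSystem

variable {n : ℕ} {Ω : Type*} [MeasurableSpace Ω] {μ : Measure Ω} (S : ErgodicSystem n μ)
variable [IsProbabilityMeasure μ]

theorem integral_pd {κ : Space n → ℝ} (hκ : IsTestFunction univ κ) (j : Fin n) :
    ∫ y, pd j κ y = 0 := by
  have h := integral_mul_pd hκ (contDiff_const (c := (1 : ℝ))) j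
  simpa [pd] using h

theorem integral_pd_mul_coord {κ : Space n → ℝ} (hκ : IsTestFunction univ κ) (i j : Fin n) :
    ∫ y, pd j κ y * y i = if i = j then -∫ y, κ y else 0 := by
  have hc : ContDiff ℝ smooth fun y : Space n => y i := by fun_prop
  have hp : ∀ y, pd j (fun y : Space n => y i) y = if i = j then 1 else 0 := by
    intro y
    have : HasFDerivAt (fun y : Space n => y i)
        (PiLp.proj (𝕜 := ℝ) 2 (fun _ : Fin n => ℝ) i) y :=
      (PiLp.proj (𝕜 := ℝ) 2 (fun _ : Fin n => ℝ) i).hasFDerivAt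
    rw [pd, this.fderiv]
    simp [basisVec]
  have h := integral_mul_pd hκ hc j
  simp only [hp] at h
  simp only [mul_comm (pd j κ _), h]
  split_ifs <;> simp

/-- The stochastic fields with expectation the vectors of the canonical basis, built from a field
`b` which is affine along the flow in the grains. -/
def unitField {ρ : Space n → ℝ} (hρ : IsTestFunction univ ρ) (b : Fin n → Lp ℝ 2 μ) (k : Fin n) :
    S.DVec :=
  WithLp.toLp 2 fun i =>
    (if i = k then S.oneD - ((n : ℝ) - 1)⁻¹ • ∑ j, S.smearD (hρ.pd j) (b j) else 0) +
      ((n : ℝ) - 1)⁻¹ • S.smearD (hρ.pd k) (b i)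

theorem val_unitField {ρ : Space n → ℝ} (hρ : IsTestFunction univ ρ) (b : Fin n → Lp ℝ 2 μ)
    (k i : Fin n) : S.val (S.unitField hρ b k i) =
      (if i = k then one - ((n : ℝ) - 1)⁻¹ • ∑ j, S.smear (pd j ρ) (b j) else 0) +
      ((n : ℝ) - 1)⁻¹ • S.smear (pd k ρ) (b i) := by
  simp only [← valL_apply, unitField, map_add, map_smul]
  split_ifs <;> simp only [map_sub, map_smul, map_sum, map_zero] <;> simp

theorem deriv_unitField {ρ : Space n → ℝ} (hρ : IsTestFunction univ ρ) (b : Fin n → Lp ℝ 2 μ)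
    (k i l : Fin n) : S.deriv l (S.unitField hρ b k i) =
      (if i = k then - (((n : ℝ) - 1)⁻¹ • ∑ j, S.smear (pd l (pd j ρ)) (b j)) else 0) +
      ((n : ℝ) - 1)⁻¹ • S.smear (pd l (pd k ρ)) (b i) := by
  simp only [← derivL_apply, unitField, map_add, map_smul]
  split_ifs <;> simp only [map_sub, map_smul, map_sum, map_zero] <;> simp

/-- The two second-order terms cancel because partial derivatives of `ρ` commute. -/
theorem divL_unitField {ρ : Space n → ℝ} (hρ : IsTestFunction univ ρ) (b : Fin n → Lp ℝ 2 μ)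
    (k : Fin n) : S.divL (S.unitField hρ b k) = 0 := by
  rw [divL_apply]
  simp only [deriv_unitField, Finset.sum_add_distrib, Finset.sum_ite_eq', Finset.mem_univ, if_true,
    ← Finset.smul_sum, pd_comm hρ.contDiff k]
  exact neg_add_cancel _

/-- All terms except the constant field are stochastic derivatives, which have zero expectation. -/
theorem mean_unitField {ρ : Space n → ℝ} (hρ : IsTestFunction univ ρ) (b : Fin n → Lp ℝ 2 μ)
    (k : Fin n) : S.mean (S.unitField hρ b k) = basisVec k := by
  have h0 : ∀ j i, inner ℝ (one : Lp ℝ 2 μ) (S.smear (pd j ρ) (b i)) = 0 := by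
    intro j i
    rw [inner_one, ← S.deriv_smearD hρ, integral_deriv]
  have h1 : inner ℝ (one : Lp ℝ 2 μ) one = (1 : ℝ) := by
    rw [inner_one, integral_congr_ae one_coeFn]; simp
  ext i
  simp only [mean, ← inner_one, val_unitField, inner_add_right, real_inner_smul_right, h0]
  split_ifs with h
  · subst h
    simp only [inner_sub_right, real_inner_smul_right, inner_sum, h0, h1]
    simp
  · simp [h]

/-- Potential fields have zero expectation, which removes the constant term, and are curl-free,
which lets the indices `j` and `k` be exchanged so that the other two terms cancel. -/
theorem inner_unitField {ρ : Space n → ℝ} (hρ : IsTestFunction univ ρ) (b : Fin n → Lp ℝ 2 μ)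
    (k : Fin n) {f : L2Vec n μ} (hf : f ∈ S.Vpot) :
    ∑ i, inner ℝ (f i) (S.val (S.unitField hρ b k i)) = 0 := by
  have h1 : inner ℝ (f k) (one : Lp ℝ 2 μ) = (0 : ℝ) := by
    rw [real_inner_comm, inner_one, hf.2 k]
  have h2 : ∀ i, inner ℝ (f i) (S.val (S.unitField hρ b k i)) =
      (if i = k then - (((n : ℝ) - 1)⁻¹ * ∑ j, inner ℝ (f k) (S.smear (pd j ρ) (b j))) else 0) +
      ((n : ℝ) - 1)⁻¹ * inner ℝ (f i) (S.smear (pd k ρ) (b i)) := by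
    intro i
    rw [val_unitField, inner_add_right, real_inner_smul_right]
    split_ifs with h
    · subst h
      rw [inner_sub_right, real_inner_smul_right, inner_sum, h1, zero_sub]
    · rw [inner_zero_right]
  simp only [h2, Finset.sum_add_distrib, Finset.sum_ite_eq', Finset.mem_univ, if_true,
    ← Finset.mul_sum, S.inner_smear_pd_comm hf hρ (b _) k]
  exact neg_add_cancel _

/-- Smearing `b_i` with `∂_j ρ` gives `δ_ij` on `ℳ`, provided that the support of `ρ` lies within
the range `δ` in which `b` is affine. The two corrections in `unitField` then cancel the constant on
`ℳ`. -/
theorem IsDisperseMedium.exists_unitFields {F : Set Ω} (hF : S.IsDisperseMedium F) :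
    ∃ ζ : Fin n → S.DVec, (∀ k, ζ k ∈ S.Wsub F) ∧ (∀ k, S.mean (ζ k) = basisVec k) ∧
      ∀ k, ∀ f ∈ S.Vpot, ∑ i, inner ℝ (f i) (S.val (ζ k i)) = 0 := by
  obtain ⟨b, δ, hδ, hb⟩ := hF.exists_field
  have hn := hF.two_le
  let χ : ContDiffBump (0 : Space n) := ⟨δ / 4, δ / 2, by positivity, by linarith⟩
  set ρ : Space n → ℝ := χ.normed volume with hρdef
  have hρ : IsTestFunction univ ρ :=
    ⟨χ.contDiff_normed, χ.hasCompactSupport_normed, subset_univ _⟩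
  have hsupp : ∀ j y, pd j ρ y ≠ 0 → ‖y‖ ≤ δ := by
    intro j y hy
    have h1 : y ∈ tsupport ρ :=
      tsupport_fderiv_apply_subset ℝ (basisVec j) (subset_tsupport _ hy)
    rw [hρdef, χ.tsupport_normed_eq, mem_closedBall_zero_iff] at h1
    exact h1.trans (by simp only [χ]; linarith)
  have hint : ∫ y, ρ y = 1 := χ.integral_normed
  have key : ∀ j i, ∀ᵐ ω ∂(μ.restrict Fᶜ), S.smear (pd j ρ) (b i) ω = if i = j then 1 else 0 := by
    intro j i
    have h := S.smear_ae_eq hF.measurableSet (hρ.pd j).continuous (hρ.pd j).hasCompactSupport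
      (hsupp j) (integral_pd hρ j) (hb i)
    rw [integral_pd_mul_coord hρ i j, hint] at h
    filter_upwards [h] with ω hω
    rw [hω]
    split_ifs <;> simp
  refine ⟨S.unitField hρ b, fun k => S.mem_Wsub.2 ⟨fun i => ?_, ?_⟩, S.mean_unitField hρ b,
    fun k f hf => S.inner_unitField hρ b k hf⟩
  · have hall : ∀ᵐ ω ∂(μ.restrict Fᶜ), ∀ j i,
        S.smear (pd j ρ) (b i) ω = if i = j then 1 else 0 :=
      ae_all_iff.2 fun j => ae_all_iff.2 fun i => key j i
    rw [val_unitField]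
    set c := ((n : ℝ) - 1)⁻¹ with hc
    have hn1 : ((n : ℝ) - 1) ≠ 0 := by
      have : (2 : ℝ) ≤ n := by exact_mod_cast hn
      linarith
    -- The divergence of `b` contributes `n` on `ℳ`, the diagonal entry contributes 1; this identity
    -- fixes the factor `1/(n - 1)`.
    have hcn : 1 - c * n + c = 0 := by
      rw [hc]; field_simp; ring
    by_cases hik : i = k
    · subst hik
      simp only [if_true]
      filter_upwards [hall,
        ae_restrict_of_ae (Lp.coeFn_add (one - c • ∑ j, S.smear (pd j ρ) (b j))
          (c • S.smear (pd i ρ) (b i))),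
        ae_restrict_of_ae (Lp.coeFn_sub (one : Lp ℝ 2 μ) (c • ∑ j, S.smear (pd j ρ) (b j))),
        ae_restrict_of_ae (Lp.coeFn_smul c (∑ j, S.smear (pd j ρ) (b j))),
        ae_restrict_of_ae (Lp.coeFn_smul c (S.smear (pd i ρ) (b i))),
        ae_restrict_of_ae (Lp.coeFn_fun_finsetSum Finset.univ (fun j => S.smear (pd j ρ) (b j))),
        ae_restrict_of_ae one_coeFn] with ω h0 h1 h2 h3 h4 h5 h6
      rw [h1, Pi.add_apply, h2, Pi.sub_apply, h3, Pi.smul_apply, h4, Pi.smul_apply, h5, h6]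
      simp only [h0, if_true, smul_eq_mul, mul_one, Finset.sum_const, Finset.card_univ,
        Fintype.card_fin, nsmul_eq_mul]
      linarith
    · simp only [hik, if_false, zero_add]
      filter_upwards [hall, ae_restrict_of_ae (Lp.coeFn_smul c (S.smear (pd k ρ) (b i)))]
        with ω h0 h1
      rw [h1, Pi.smul_apply, h0, if_neg hik, smul_zero]
  · have h := S.divL_coeFn (S.unitField hρ b k)
    rw [divL_unitField] at h
    filter_upwards [ae_restrict_of_ae h, ae_restrict_of_ae (Lp.coeFn_zero ℝ 2 μ)] with ω h1 h2
    rw [← h1, h2]; rfl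

/-- The constants are at a positive angle to the space `X`. -/
theorem IsDisperseMedium.exists_angle {F : Set Ω} (hF : S.IsDisperseMedium F)
    {ζ : Fin n → S.DVec} (h1 : ∀ k, ζ k ∈ S.Wsub F) (h2 : ∀ k, S.mean (ζ k) = basisVec k)
    (h3 : ∀ k, ∀ f ∈ S.Vpot, ∑ i, inner ℝ (f i) (S.val (ζ k i)) = 0) :
    ∃ C, 0 ≤ C ∧ ∀ v : Space n, ∀ g ∈ S.X F,
      ‖v‖ ^ 2 + ‖g‖ ^ 2 ≤ C * ‖constL μ F v + g‖ ^ 2 := by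
  -- Orthogonality extends from the restrictions of `𝒱²_pot` to their closed span, since the scalar
  -- product is continuous. Integrals over `ℱ` agree with integrals over `Ω` because `ζ_k` vanishes
  -- on `ℳ`.
  have horth : ∀ k, ∀ g ∈ S.X F, inner ℝ g (S.evalL F (ζ k)) = (0 : ℝ) := by
    intro k g hg
    set L : L2Vec n (μ.restrict F) →L[ℝ] ℝ := innerSL ℝ (S.evalL F (ζ k)) with hL
    have h : S.X F ≤ LinearMap.ker L.toLinearMap := by
      refine Submodule.topologicalClosure_minimal _ (Submodule.span_le.2 ?_)
        (ContinuousLinearMap.isClosed_ker L)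
      rintro w ⟨f, hf, hw⟩
      have : inner ℝ (S.evalL F (ζ k)) w = (0 : ℝ) := by
        rw [real_inner_comm, S.inner_evalL hF.measurableSet hw (h1 k), h3 k f hf]
      exact this
    rw [real_inner_comm]
    exact h hg
  set M := ∑ k, ‖S.evalL F (ζ k)‖ with hM
  have hM0 : 0 ≤ M := Finset.sum_nonneg fun k _ => norm_nonneg _
  set K := ‖(constL μ F : Space n →L[ℝ] _)‖ with hK
  have hK0 : 0 ≤ K := norm_nonneg _
  have hv : ∀ v : Space n, ∀ g ∈ S.X F, ‖v‖ ≤ M * ‖constL μ F v + g‖ := by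
    intro v g hg
    -- Testing `v + g` against `ζ_k` removes `g` and leaves the product of `v` with `𝔼(ζ_k) = e_k`.
    have e1 : ‖v‖ ^ 2 = ∑ k, v k * inner ℝ (constL μ F v + g) (S.evalL F (ζ k)) := by
      simp only [inner_add_left, horth _ g hg, S.inner_constL_evalL hF.measurableSet v (h1 _), h2,
        add_zero]
      rw [EuclideanSpace.norm_sq_eq]
      refine Finset.sum_congr rfl fun k _ => ?_
      rw [EuclideanSpace.inner_single_right]
      simp [sq]
    have e2 : ‖v‖ ^ 2 ≤ ‖v‖ * (M * ‖constL μ F v + g‖) := by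
      rw [e1, hM, Finset.sum_mul, Finset.mul_sum]
      refine Finset.sum_le_sum fun k _ => ?_
      refine (le_abs_self _).trans ?_
      rw [abs_mul, mul_comm ‖S.evalL F (ζ k)‖]
      have i1 : |v k| ≤ ‖v‖ := PiLp.norm_apply_le v k
      have i2 := abs_real_inner_le_norm (constL μ F v + g) (S.evalL F (ζ k))
      exact mul_le_mul i1 i2 (abs_nonneg _) (norm_nonneg _)
    rcases (norm_nonneg v).eq_or_lt with h0 | h0
    · rw [← h0]; exact mul_nonneg hM0 (norm_nonneg _)
    · rw [sq] at e2
      exact le_of_mul_le_mul_left e2 h0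
  -- The first term bounds `v`; the second bounds `g` as the difference of `v + g` and the constant
  -- field `v`.
  refine ⟨M ^ 2 + (1 + K * M) ^ 2, by positivity, fun v g hg => ?_⟩
  have a1 := hv v g hg
  have a3 : ‖constL μ F v‖ ≤ K * ‖v‖ := (constL μ F).le_opNorm v
  have a4 : ‖g‖ ≤ ‖constL μ F v + g‖ + ‖constL μ F v‖ := by
    have h := norm_sub_le (constL μ F v + g) (constL μ F v)
    rwa [add_sub_cancel_left] at h
  have a5 := norm_nonneg g
  have a6 := norm_nonneg v
  generalize ‖constL μ F v + g‖ = x at *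
  generalize ‖constL μ F v‖ = y at *
  generalize ‖g‖ = p at *
  generalize ‖v‖ = q at *
  have a2 : p ≤ (1 + K * M) * x := by
    have := mul_le_mul_of_nonneg_left a1 hK0
    linarith
  have b1 := pow_le_pow_left₀ a6 a1 2
  have b2 := pow_le_pow_left₀ a5 a2 2
  rw [mul_pow] at b1 b2
  linarith

end ErgodicSystem

/-! ### Functions with weak gradients on `G`, and Poincaré's inequality on `H¹₀(G)` -/

variable {n : ℕ}

/-- The ambient Hilbert space `L²(G) × L²(G)ⁿ` of pairs (function, weak gradient). -/
abbrev L2Pair (G : Set (Space n)) : Type := WithLp 2 (L2 G × L2Vec n (volume.restrict G))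

namespace IsTestFunction

variable {A G : Set (Space n)} {φ ψ : Space n → ℝ}

theorem memLp {H : Type*} [NormedAddCommGroup H] [NormedSpace ℝ H] {φ : Space n → H}
    (h : IsTestFunction A φ) (G : Set (Space n)) :
    MemLp φ 2 (volume.restrict G) :=
  (h.continuous.memLp_of_hasCompactSupport h.hasCompactSupport).restrict G

/-- The pair formed by the restrictions to `G` of a test function and of its gradient. -/
def pair (h : IsTestFunction A φ) (G : Set (Space n)) : L2Pair G :=
  WithLp.toLp 2 ((h.memLp G).toLp φ, WithLp.toLp 2 fun i => ((h.pd i).memLp G).toLp _)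

theorem pair_fst (h : IsTestFunction A φ) : ∀ᵐ x ∂(volume.restrict G), (h.pair G).fst x = φ x :=
  (h.memLp G).coeFn_toLp

theorem pair_snd (h : IsTestFunction A φ) (i : Fin n) :
    ∀ᵐ x ∂(volume.restrict G), (h.pair G).snd i x = TwoScale.pd i φ x :=
  ((h.pd i).memLp G).coeFn_toLp

theorem add {H : Type*} [NormedAddCommGroup H] [NormedSpace ℝ H] {φ ψ : Space n → H}
    (hφ : IsTestFunction A φ) (hψ : IsTestFunction A ψ) :
    IsTestFunction A fun x => φ x + ψ x :=
  ⟨hφ.contDiff.add hψ.contDiff, hφ.hasCompactSupport.add hψ.hasCompactSupport,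
    (tsupport_add φ ψ).trans (union_subset hφ.tsupport_subset hψ.tsupport_subset)⟩

theorem const_smul {H : Type*} [NormedAddCommGroup H] [NormedSpace ℝ H] {φ : Space n → H}
    (hφ : IsTestFunction A φ) (c : ℝ) : IsTestFunction A fun x => c • φ x :=
  ⟨contDiff_const.smul hφ.contDiff, hφ.hasCompactSupport.smul_left (f := fun _ => c),
    (tsupport_smul_subset_right (fun _ => c) φ).trans hφ.tsupport_subset⟩

theorem zero {H : Type*} [NormedAddCommGroup H] [NormedSpace ℝ H] :
    IsTestFunction A fun _ : Space n => (0 : H) :=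
  ⟨contDiff_const, HasCompactSupport.zero, by
    have : tsupport (fun _ : Space n => (0 : H)) = ∅ := tsupport_eq_empty_iff.2 rfl
    rw [this]; exact empty_subset A⟩

/-- The product of a test function and a smooth function. -/
theorem mul_smooth (hφ : IsTestFunction A φ) (hψ : ContDiff ℝ smooth ψ) :
    IsTestFunction A fun x => φ x * ψ x :=
  ⟨hφ.contDiff.mul hψ, hφ.hasCompactSupport.mul_right,
    (tsupport_mul_subset_left (f := φ) (g := ψ)).trans hφ.tsupport_subset⟩

end IsTestFunction

theorem pd_add {φ ψ : Space n → ℝ} (hφ : Differentiable ℝ φ) (hψ : Differentiable ℝ ψ) (i : Fin n)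
    (x : Space n) : pd i (fun x => φ x + ψ x) x = pd i φ x + pd i ψ x := by
  simp only [pd]
  rw [fderiv_fun_add (hφ x) (hψ x)]; rfl

theorem pd_const_smul {φ : Space n → ℝ} (hφ : Differentiable ℝ φ) (c : ℝ) (i : Fin n)
    (x : Space n) : pd i (fun x => c • φ x) x = c • pd i φ x := by
  simp only [pd]
  rw [fderiv_fun_const_smul (hφ x)]; rfl

theorem pd_mul {φ ψ : Space n → ℝ} (hφ : Differentiable ℝ φ) (hψ : Differentiable ℝ ψ) (i : Fin n)
    (x : Space n) : pd i (fun x => φ x * ψ x) x = φ x * pd i ψ x + ψ x * pd i φ x := by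
  simp only [pd]
  rw [fderiv_fun_mul (hφ x) (hψ x)]; rfl

/-- The pairs `(φ, ∇φ)` for the test functions `φ` supported in `A`, on `G`. -/
def smoothPairs (A G : Set (Space n)) : Submodule ℝ (L2Pair G) where
  carrier := {p | ∃ φ : Space n → ℝ, IsTestFunction A φ ∧
    (∀ᵐ x ∂(volume.restrict G), p.fst x = φ x) ∧
    ∀ i, ∀ᵐ x ∂(volume.restrict G), p.snd i x = pd i φ x}
  zero_mem' := by
    refine ⟨fun _ => 0, IsTestFunction.zero, Lp.coeFn_zero ℝ 2 _, fun i => ?_⟩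
    have h : pd i (fun _ : Space n => (0 : ℝ)) = 0 := by ext x; simp [pd]
    rw [h]
    exact Lp.coeFn_zero ℝ 2 _
  add_mem' := by
    rintro a b ⟨φ, hφ, h1, h2⟩ ⟨ψ, hψ, h3, h4⟩
    refine ⟨_, hφ.add hψ, ?_, fun i => ?_⟩
    · filter_upwards [h1, h3, Lp.coeFn_add a.fst b.fst] with x e1 e3 e
      rw [WithLp.add_fst, e, Pi.add_apply, e1, e3]
    · filter_upwards [h2 i, h4 i, Lp.coeFn_add (a.snd i) (b.snd i)] with x e1 e3 e
      rw [WithLp.add_snd, PiLp.add_apply, e, Pi.add_apply, e1, e3,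
        pd_add hφ.differentiable hψ.differentiable]
  smul_mem' := by
    rintro c a ⟨φ, hφ, h1, h2⟩
    refine ⟨_, hφ.const_smul c, ?_, fun i => ?_⟩
    · filter_upwards [h1, Lp.coeFn_smul c a.fst] with x e1 e
      rw [WithLp.smul_fst, e, Pi.smul_apply, e1]
    · filter_upwards [h2 i, Lp.coeFn_smul c (a.snd i)] with x e1 e
      rw [WithLp.smul_snd, PiLp.smul_apply, e, Pi.smul_apply, e1, pd_const_smul hφ.differentiable]

theorem IsTestFunction.pair_mem {A G : Set (Space n)} {φ : Space n → ℝ} (h : IsTestFunction A φ) :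
    h.pair G ∈ smoothPairs A G := ⟨φ, h, h.pair_fst, h.pair_snd⟩

/-- The closure of the pairs `(φ, ∇φ)` for the test functions `φ` supported in `A`, on `G`. -/
def H1 (A G : Set (Space n)) : Submodule ℝ (L2Pair G) := (smoothPairs A G).topologicalClosure

theorem IsTestFunction.pair_mem_H1 {A G : Set (Space n)} {φ : Space n → ℝ}
    (h : IsTestFunction A φ) : h.pair G ∈ H1 A G :=
  Submodule.le_topologicalClosure _ h.pair_mem

theorem isClosed_H1 (A G : Set (Space n)) : IsClosed (H1 A G : Set (L2Pair G)) :=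
  Submodule.isClosed_topologicalClosure _

theorem eval_eq_gradient_iff {ν : Measure (Space n)} {m : L2Vec n ν} {φ : Space n → ℝ} :
    (∀ᵐ x ∂ν, m.eval x = gradient φ x) ↔ ∀ i, ∀ᵐ x ∂ν, m i x = pd i φ x := by
  rw [← ae_all_iff]
  refine eventually_congr (Eventually.of_forall fun x => ⟨fun h i => ?_, fun h => ?_⟩)
  · rw [← gradient_apply_eq_pd, ← h]; rfl
  · ext i
    rw [gradient_apply_eq_pd, ← h i]; rfl

theorem coe_H1_eq_H10 (G : Set (Space n)) : (H1 G G : Set (L2Pair G)) = H10 G := by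
  rw [H1, Submodule.topologicalClosure_coe, H10]
  congr 1
  ext p
  simp only [eval_eq_gradient_iff]
  rfl

theorem inner_L2_eq {α : Type*} [MeasurableSpace α] {ν : Measure α} (f g : Lp ℝ 2 ν) :
    inner ℝ f g = ∫ x, f x * g x ∂ν := by
  rw [L2.inner_def]
  simp [mul_comm]

theorem norm_sq_L2_eq {α : Type*} [MeasurableSpace α] {ν : Measure α} (f : Lp ℝ 2 ν) :
    ‖f‖ ^ 2 = ∫ x, f x ^ 2 ∂ν := by
  rw [← real_inner_self_eq_norm_sq, inner_L2_eq]
  simp [sq]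

theorem norm_sq_eq_setIntegral {G : Set (Space n)} {f : L2 G} {φ : Space n → ℝ}
    (h : ∀ᵐ x ∂(volume.restrict G), f x = φ x) : ‖f‖ ^ 2 = ∫ x in G, φ x ^ 2 := by
  rw [norm_sq_L2_eq]
  exact integral_congr_ae (h.mono fun x hx => by simp only [hx])

/-- Poincaré's inequality for the test functions on a bounded open set. -/
theorem exists_poincare_test {G : Set (Space n)} (hG : Bornology.IsBounded G) (i : Fin n) :
    ∃ C, 0 ≤ C ∧ ∀ φ : Space n → ℝ, IsTestFunction G φ →
      ∫ x, φ x ^ 2 ≤ C * ∫ x, pd i φ x ^ 2 := by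
  obtain ⟨R, hR0, hR⟩ := hG.exists_pos_norm_le
  refine ⟨4 * R ^ 2, by positivity, fun φ hφ => ?_⟩
  have hi : ContDiff ℝ smooth fun y : Space n => y i := by fun_prop
  have hp : ∀ y, pd i (fun y : Space n => y i) y = 1 := by
    intro y
    have : HasFDerivAt (fun y : Space n => y i)
        (PiLp.proj (𝕜 := ℝ) 2 (fun _ : Fin n => ℝ) i) y :=
      (PiLp.proj (𝕜 := ℝ) 2 (fun _ : Fin n => ℝ) i).hasFDerivAt
    rw [pd, this.fderiv]
    simp [basisVec]
  -- Since `∂_i x_i = 1`, the integral of `φ²` equals minus the integral of `x_i ∂_i(φ²)`, and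
  -- `|x_i| ≤ R` on the support.
  have h := integral_mul_pd ((hφ.mul_smooth hφ.contDiff).mono (subset_univ _)) hi i
  simp only [hp, one_mul, pd_mul hφ.differentiable hφ.differentiable] at h
  have hφR : ∀ x, |x i| * |φ x| ≤ R * |φ x| := by
    intro x
    by_cases hx : φ x = 0
    · simp [hx]
    · have h1 : |x i| ≤ ‖x‖ := PiLp.norm_apply_le x i
      have h2 := hR x (hφ.tsupport_subset (subset_tsupport _ hx))
      gcongr
      exact h1.trans h2
  -- Young's inequality leaves half of `φ²` to be absorbed on the left, whence the constant `4R²`.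
  have hpt : ∀ x, -(x i * (φ x * pd i φ x + φ x * pd i φ x)) ≤
      (1 / 2) * φ x ^ 2 + 2 * R ^ 2 * pd i φ x ^ 2 := by
    intro x
    have h1 := hφR x
    have h2 : -(x i * (φ x * pd i φ x + φ x * pd i φ x)) ≤ 2 * (|x i| * |φ x|) * |pd i φ x| := by
      refine (neg_le_abs _).trans (le_of_eq ?_)
      rw [← two_mul, abs_mul, abs_mul, abs_mul, abs_two]; ring
    have h3 := mul_le_mul_of_nonneg_right h1 (abs_nonneg (pd i φ x))
    have h4 := sq_nonneg (|φ x| - 2 * (R * |pd i φ x|))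
    rw [← sq_abs (φ x), ← sq_abs (pd i φ x)]
    nlinarith
  have i1 : Integrable fun x => φ x ^ 2 := by
    simp only [sq]; exact (hφ.mul_smooth hφ.contDiff).integrable
  have i2 : Integrable fun x => pd i φ x ^ 2 := by
    simp only [sq]; exact ((hφ.pd i).mul_smooth (hφ.pd i).contDiff).integrable
  have i3 : Integrable fun x => -(x i * (φ x * pd i φ x + φ x * pd i φ x)) := by
    have hc : Continuous fun x => -(x i * (φ x * pd i φ x + φ x * pd i φ x)) := by
      have h1 := hφ.continuous
      have h2 := (hφ.pd i).continuous
      fun_prop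
    refine hc.integrable_of_hasCompactSupport ?_
    have e : (fun x => -(x i * (φ x * pd i φ x + φ x * pd i φ x))) =
        fun x => φ x * (-(x i * (pd i φ x + pd i φ x))) := by funext x; ring
    rw [e]
    exact hφ.hasCompactSupport.mul_right
  have h5 : ∫ x, φ x ^ 2 = ∫ x, -(x i * (φ x * pd i φ x + φ x * pd i φ x)) := by
    rw [integral_neg, h, neg_neg]
    simp only [sq]
  have h6 := integral_mono i3 ((i1.const_mul (1 / 2)).add (i2.const_mul (2 * R ^ 2))) hpt
  simp only [Pi.add_apply] at h6
  rw [integral_add (i1.const_mul (1 / 2)) (i2.const_mul (2 * R ^ 2)), integral_const_mul,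
    integral_const_mul, ← h5] at h6
  linarith

theorem exists_poincare_H10 {G : Set (Space n)} (hG : Bornology.IsBounded G) (i : Fin n) :
    ∃ C, 0 ≤ C ∧ ∀ p ∈ H1 G G, ‖p.fst‖ ^ 2 ≤ C * ‖p.snd‖ ^ 2 := by
  obtain ⟨C, hC0, hC⟩ := exists_poincare_test hG i
  refine ⟨C, hC0, fun p hp => ?_⟩
  have hcl : IsClosed {p : L2Pair G | ‖p.fst‖ ^ 2 ≤ C * ‖p.snd‖ ^ 2} := by
    refine isClosed_le ?_ ?_
    · exact (WithLp.fstL 2 ℝ (L2 G) (L2Vec n (volume.restrict G))).continuous.norm.pow 2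
    · exact ((WithLp.sndL 2 ℝ (L2 G) (L2Vec n (volume.restrict G))).continuous.norm.pow 2).const_mul
        C
  refine closure_minimal ?_ hcl hp
  rintro p ⟨φ, hφ, h1, h2⟩
  have hs : ∀ ψ : Space n → ℝ, IsTestFunction G ψ → ∫ x in G, ψ x ^ 2 = ∫ x, ψ x ^ 2 := by
    intro ψ hψ
    refine setIntegral_eq_integral_of_forall_compl_eq_zero fun x hx => ?_
    rw [image_eq_zero_of_notMem_tsupport fun h => hx (hψ.tsupport_subset h)]; simp
  have h3 : ‖p.snd i‖ ≤ ‖p.snd‖ := PiLp.norm_apply_le p.snd i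
  have h4 := pow_le_pow_left₀ (norm_nonneg _) h3 2
  rw [norm_sq_eq_setIntegral (h2 i), hs _ (hφ.pd i)] at h4
  change ‖p.fst‖ ^ 2 ≤ C * ‖p.snd‖ ^ 2
  rw [norm_sq_eq_setIntegral h1, hs _ hφ]
  exact (hC φ hφ).trans (mul_le_mul_of_nonneg_left h4 hC0)

/-! ### The Poincaré–Wirtinger inequality on a smooth domain -/

variable {n : ℕ}

/-- Near each point of its closure, a smooth domain can be shifted into itself. -/
theorem IsBoundedDomain.exists_inward {G : Set (Space n)} (hG : IsBoundedDomain smooth G)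
    {p : Space n} (hp : p ∈ closure G) : ∃ (e : Space n) (R : ℝ), 0 < R ∧
      ∀ x ∈ closure G, dist x p < R → ∀ s ∈ Ioc (0 : ℝ) 1, x + s • e ∈ G := by
  by_cases hpG : p ∈ G
  · obtain ⟨R, hR, hb⟩ := Metric.isOpen_iff.1 hG.isOpen p hpG
    exact ⟨0, R, hR, fun x _ hx s _ => by simpa using hb hx⟩
  have hpf : p ∈ frontier G := by
    rw [frontier, hG.isOpen.interior_eq]; exact ⟨hp, hpG⟩
  obtain ⟨U, ψ, hU, hpU, hψ, hd, hGU⟩ := hG.boundary p hpf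
  obtain ⟨e, he⟩ : ∃ e, fderiv ℝ ψ p e < 0 := by
    by_contra! h
    refine hd (ContinuousLinearMap.ext fun v => ?_)
    have h1 := h v
    have h2 := h (-v)
    rw [map_neg] at h2
    simp only [zero_apply]
    linarith
  have hcont : ContinuousOn (fun x => fderiv ℝ ψ x e) U :=
    (hψ.continuousOn_fderiv_of_isOpen hU (by simp)).clm_apply continuousOn_const
  have hnear : ∀ᶠ x in 𝓝 p, x ∈ U ∧ fderiv ℝ ψ x e < 0 :=
    Filter.Eventually.and (hU.mem_nhds hpU)
      ((hcont.continuousAt (hU.mem_nhds hpU)).eventually_lt_const he)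
  obtain ⟨R, hR, hb⟩ := Metric.eventually_nhds_iff.1 hnear
  -- This scaling keeps the segment from `x` to `x + τ e` within `R/2` of `x`, hence within `R` of
  -- `p`, where `ψ` decreases in the direction `e`.
  set τ := R / (2 * (‖e‖ + 1)) with hτ
  have hne := norm_nonneg e
  have hτ0 : 0 < τ := by positivity
  have hτe : τ * ‖e‖ ≤ R / 2 := by
    rw [hτ, div_mul_eq_mul_div, div_le_div_iff₀ (by positivity) (by positivity)]
    nlinarith
  refine ⟨τ • e, R / 2, by positivity, fun x hx hxp s hs => ?_⟩
  have hin : ∀ t ∈ Icc (0 : ℝ) s, dist (x + t • τ • e) p < R := by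
    intro t ht
    have h1 : dist (x + t • τ • e) x ≤ R / 2 := by
      rw [dist_eq_norm, add_sub_cancel_left, norm_smul, norm_smul, Real.norm_of_nonneg ht.1,
        Real.norm_of_nonneg hτ0.le]
      have h2 : t ≤ 1 := ht.2.trans hs.2
      have h3 : 0 ≤ τ * ‖e‖ := by positivity
      nlinarith
    have h4 := dist_triangle (x + t • τ • e) x p
    linarith
  have hxU : x ∈ U := (hb (by linarith)).1
  have hx0 : ψ x ≤ 0 := by
    by_contra! h
    have hcx : ContinuousAt ψ x := hψ.continuousOn.continuousAt (hU.mem_nhds hxU)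
    have h1 : ∀ᶠ y in 𝓝 x, 0 < ψ y ∧ y ∈ U :=
      Filter.Eventually.and (hcx.eventually_const_lt h) (hU.mem_nhds hxU)
    obtain ⟨y, hy, hyG⟩ := mem_closure_iff_nhds.1 hx _ h1
    have h2 : y ∈ {x ∈ U | ψ x < 0} := hGU ▸ ⟨hyG, hy.2⟩
    exact lt_asymm hy.1 h2.2
  have hder : ∀ t ∈ Icc (0 : ℝ) s, HasDerivAt (fun t : ℝ => ψ (x + t • τ • e))
      (fderiv ℝ ψ (x + t • τ • e) (τ • e)) t := by
    intro t ht
    have h1 : DifferentiableAt ℝ ψ (x + t • τ • e) :=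
      (hψ.differentiableOn (by simp)).differentiableAt (hU.mem_nhds (hb (hin t ht)).1)
    have h2 : HasDerivAt (fun t : ℝ => x + t • τ • e) (τ • e) t := by
      simpa using ((hasDerivAt_id t).smul_const (τ • e)).const_add x
    exact h1.hasFDerivAt.comp_hasDerivAt t h2
  have hanti : StrictAntiOn (fun t : ℝ => ψ (x + t • τ • e)) (Icc 0 s) := by
    refine strictAntiOn_of_deriv_neg (convex_Icc 0 s)
      (fun t ht => (hder t ht).continuousAt.continuousWithinAt) fun t ht => ?_
    rw [interior_Icc] at ht
    have ht' := Ioo_subset_Icc_self ht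
    rw [(hder t ht').deriv, map_smul, smul_eq_mul]
    exact mul_neg_of_pos_of_neg hτ0 (hb (hin t ht')).2
  have h1 := hanti ⟨le_rfl, hs.1.le⟩ ⟨hs.1.le, le_rfl⟩ hs.1
  simp only [zero_smul, add_zero] at h1
  have h2 : x + s • τ • e ∈ {x ∈ U | ψ x < 0} :=
    ⟨(hb (hin s ⟨hs.1.le, le_rfl⟩)).1, h1.trans_le hx0⟩
  rw [← hGU] at h2
  exact h2.1

/-- The Dirichlet integral. -/
def energy (G : Set (Space n)) (φ : Space n → ℝ) : ℝ≥0∞ := ∫⁻ x in G, ‖fderiv ℝ φ x‖ₑ ^ 2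

/-- The oscillation of test functions between `A` and `B` is controlled by their energy in `G`. -/
def OscBound (G A B : Set (Space n)) : Prop :=
  ∃ C : ℝ≥0∞, C ≠ ⊤ ∧ ∀ φ : Space n → ℝ, IsTestFunction univ φ →
    ∫⁻ x in A, ∫⁻ y in B, ‖φ x - φ y‖ₑ ^ 2 ≤ C * energy G φ

theorem measurable_enorm_sub_sq {φ : Space n → ℝ} (h : Continuous φ) :
    Measurable fun q : Space n × Space n => ‖φ q.1 - φ q.2‖ₑ ^ 2 := by
  have : Measurable φ := h.measurable
  fun_prop

theorem enorm_sub_sq_le' (a b c : ℝ) : ‖a - c‖ₑ ^ 2 ≤ 2 * ‖a - b‖ₑ ^ 2 + 2 * ‖b - c‖ₑ ^ 2 := by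
  have h : ∀ x : ℝ, ‖x‖ₑ ^ 2 = ENNReal.ofReal (x ^ 2) := fun x => by
    rw [← ofReal_norm, ← ENNReal.ofReal_pow (norm_nonneg x), Real.norm_eq_abs, sq_abs]
  have h2 : ∀ z : ℝ, 2 * ENNReal.ofReal z = ENNReal.ofReal (2 * z) := fun z => by
    rw [ENNReal.ofReal_mul (by norm_num)]; simp
  rw [h, h, h, h2, h2, ← ENNReal.ofReal_add (by positivity) (by positivity)]
  exact ENNReal.ofReal_le_ofReal (by nlinarith [sq_nonneg (a - b - (b - c))])

namespace OscBound

variable {G A B D : Set (Space n)}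

theorem symm (h : OscBound G A B) : OscBound G B A := by
  obtain ⟨C, hC, h⟩ := h
  refine ⟨C, hC, fun φ hφ => ?_⟩
  rw [lintegral_lintegral_swap (measurable_enorm_sub_sq hφ.continuous).aemeasurable]
  refine le_trans (le_of_eq ?_) (h φ hφ)
  simp only [enorm_sub_rev]

theorem mono {A' B' : Set (Space n)} (h : OscBound G A B) (hA : A' ⊆ A) (hB : B' ⊆ B) :
    OscBound G A' B' := by
  obtain ⟨C, hC, h⟩ := h
  refine ⟨C, hC, fun φ hφ => le_trans ?_ (h φ hφ)⟩
  exact (lintegral_mono_set hA).trans (lintegral_mono fun x => lintegral_mono_set hB)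

theorem union (h1 : OscBound G A B) (h2 : OscBound G D B) : OscBound G (A ∪ D) B := by
  obtain ⟨C, hC, h1⟩ := h1
  obtain ⟨C', hC', h2⟩ := h2
  refine ⟨C + C', ENNReal.add_ne_top.2 ⟨hC, hC'⟩, fun φ hφ => ?_⟩
  rw [add_mul]
  exact (lintegral_union_le _ _ _).trans (add_le_add (h1 φ hφ) (h2 φ hφ))

/-- The difference between values in `A` and `D` is split at a point of `B` and averaged over `B`,
which must therefore have positive volume. -/
theorem trans (h1 : OscBound G A B) (h2 : OscBound G B D) (hB0 : volume B ≠ 0)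
    (hA : volume A ≠ ⊤) (hB : volume B ≠ ⊤) (hD : volume D ≠ ⊤) : OscBound G A D := by
  obtain ⟨C, hC, h1⟩ := h1
  obtain ⟨C', hC', h2⟩ := h2.symm
  refine ⟨(volume B)⁻¹ * (2 * volume D * C + 2 * volume A * C'), ?_, fun φ hφ => ?_⟩
  · refine ENNReal.mul_ne_top (ENNReal.inv_ne_top.2 hB0) (ENNReal.add_ne_top.2 ⟨?_, ?_⟩)
    · exact ENNReal.mul_ne_top (ENNReal.mul_ne_top (by simp) hD) hC
    · exact ENNReal.mul_ne_top (ENNReal.mul_ne_top (by simp) hA) hC'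
  have hm := measurable_enorm_sub_sq hφ.continuous
  have hφm : Measurable φ := hφ.continuous.measurable
  have key : volume B * ∫⁻ x in A, ∫⁻ z in D, ‖φ x - φ z‖ₑ ^ 2 ≤
      2 * volume D * (∫⁻ x in A, ∫⁻ y in B, ‖φ x - φ y‖ₑ ^ 2) +
      2 * volume A * (∫⁻ z in D, ∫⁻ y in B, ‖φ z - φ y‖ₑ ^ 2) := by
    have e1 : ∀ x z, volume B * ‖φ x - φ z‖ₑ ^ 2 ≤
        2 * (∫⁻ y in B, ‖φ x - φ y‖ₑ ^ 2) + 2 * ∫⁻ y in B, ‖φ z - φ y‖ₑ ^ 2 := by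
      intro x z
      rw [← lintegral_const_mul _ (by fun_prop), ← lintegral_const_mul _ (by fun_prop),
        ← lintegral_add_left (by fun_prop), mul_comm, ← setLIntegral_const]
      refine lintegral_mono fun y => ?_
      rw [enorm_sub_rev (φ z)]
      exact enorm_sub_sq_le' (φ x) (φ y) (φ z)
    have hI : Measurable fun x => ∫⁻ y in B, ‖φ x - φ y‖ₑ ^ 2 := hm.lintegral_prod_right'
    calc volume B * ∫⁻ x in A, ∫⁻ z in D, ‖φ x - φ z‖ₑ ^ 2
        = ∫⁻ x in A, ∫⁻ z in D, volume B * ‖φ x - φ z‖ₑ ^ 2 := by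
          rw [← lintegral_const_mul _ hm.lintegral_prod_right']
          refine lintegral_congr fun x => ?_
          rw [← lintegral_const_mul _ (by fun_prop)]
      _ ≤ ∫⁻ x in A, ∫⁻ z in D, (2 * (∫⁻ y in B, ‖φ x - φ y‖ₑ ^ 2) +
            2 * ∫⁻ y in B, ‖φ z - φ y‖ₑ ^ 2) :=
          lintegral_mono fun x => lintegral_mono fun z => e1 x z
      _ = _ := by
          have e2 : ∀ x, ∫⁻ z in D, (2 * (∫⁻ y in B, ‖φ x - φ y‖ₑ ^ 2) +
              2 * ∫⁻ y in B, ‖φ z - φ y‖ₑ ^ 2) =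
              2 * volume D * (∫⁻ y in B, ‖φ x - φ y‖ₑ ^ 2) +
              2 * ∫⁻ z in D, ∫⁻ y in B, ‖φ z - φ y‖ₑ ^ 2 := by
            intro x
            rw [lintegral_add_left measurable_const, setLIntegral_const,
              lintegral_const_mul _ hI]
            ring
          simp only [e2]
          rw [lintegral_add_right _ measurable_const, setLIntegral_const,
            lintegral_const_mul _ hI]
          ring
  have key2 := key.trans (add_le_add (mul_le_mul_right (h1 φ hφ) _) (mul_le_mul_right (h2 φ hφ) _))
  rw [mul_assoc, ← ENNReal.div_eq_inv_mul, ENNReal.le_div_iff_mul_le (Or.inl hB0) (Or.inl hB),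
    mul_comm]
  refine key2.trans (le_of_eq ?_)
  ring

end OscBound

theorem sq_lintegral_Ioc_le {g : ℝ → ℝ≥0∞} (hg : Measurable g) :
    (∫⁻ s in Ioc (0 : ℝ) 1, g s) ^ 2 ≤ ∫⁻ s in Ioc (0 : ℝ) 1, g s ^ 2 := by
  have h := ENNReal.lintegral_mul_le_Lp_mul_Lq (volume.restrict (Ioc (0 : ℝ) 1))
    Real.HolderConjugate.two_two hg.aemeasurable (aemeasurable_const (b := (1 : ℝ≥0∞)))
  simp only [Pi.mul_apply, mul_one, ENNReal.one_rpow, lintegral_const, Measure.restrict_apply,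
    MeasurableSet.univ, univ_inter, Real.volume_Ioc, sub_zero, ENNReal.ofReal_one, one_div] at h
  have h2 := ENNReal.rpow_le_rpow h (z := 2) (by norm_num)
  rw [← ENNReal.rpow_mul] at h2
  norm_num at h2
  exact h2

/-- Differences of a test function under a shift are controlled by the energy. -/
theorem lintegral_shift_le {G A : Set (Space n)} (hG : MeasurableSet G) {φ : Space n → ℝ}
    (hφ : IsTestFunction univ φ) (v : Space n)
    (hA : ∀ x ∈ A, ∀ s ∈ Ioc (0 : ℝ) 1, x + s • v ∈ G) :
    ∫⁻ x in A, ‖φ (x + v) - φ x‖ₑ ^ 2 ≤ ‖v‖ₑ ^ 2 * energy G φ := by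
  have hc : Continuous (fderiv ℝ φ) := hφ.contDiff.continuous_fderiv (by simp)
  set q : Space n → ℝ≥0∞ := fun x => ‖fderiv ℝ φ x‖ₑ ^ 2 with hq
  have hqm : Measurable q := by
    have := hc.measurable
    fun_prop
  have hpt : ∀ x, ‖φ (x + v) - φ x‖ₑ ^ 2 ≤ ‖v‖ₑ ^ 2 * ∫⁻ s in Ioc (0 : ℝ) 1, q (x + s • v) := by
    intro x
    have hder : ∀ s ∈ uIcc (0 : ℝ) 1, HasDerivAt (fun t : ℝ => φ (x + t • v))
        (fderiv ℝ φ (x + s • v) v) s := by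
      intro s _
      have h2 : HasDerivAt (fun t : ℝ => x + t • v) v s := by
        simpa using ((hasDerivAt_id s).smul_const v).const_add x
      exact (hφ.differentiable _).hasFDerivAt.comp_hasDerivAt s h2
    have hcs : Continuous fun s : ℝ => fderiv ℝ φ (x + s • v) v :=
      (hc.comp (by fun_prop)).clm_apply continuous_const
    have h1 := intervalIntegral.integral_eq_sub_of_hasDerivAt hder (hcs.intervalIntegrable 0 1)
    simp only [one_smul, zero_smul, add_zero] at h1
    rw [← h1, intervalIntegral.integral_of_le zero_le_one]
    have hcm : Measurable fun s : ℝ => ‖fderiv ℝ φ (x + s • v)‖ₑ :=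
      (hc.comp (by fun_prop : Continuous fun s : ℝ => x + s • v)).measurable.enorm
    calc ‖∫ s in Ioc (0 : ℝ) 1, fderiv ℝ φ (x + s • v) v‖ₑ ^ 2
        ≤ (∫⁻ s in Ioc (0 : ℝ) 1, ‖v‖ₑ * ‖fderiv ℝ φ (x + s • v)‖ₑ) ^ 2 := by
          refine pow_le_pow_left' ((enorm_integral_le_lintegral_enorm _).trans ?_) 2
          refine lintegral_mono fun s => ?_
          rw [mul_comm]
          exact ContinuousLinearMap.le_opENorm _ _
      _ = ‖v‖ₑ ^ 2 * (∫⁻ s in Ioc (0 : ℝ) 1, ‖fderiv ℝ φ (x + s • v)‖ₑ) ^ 2 := by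
          rw [lintegral_const_mul _ hcm, mul_pow]
      _ ≤ _ := by
          gcongr
          exact sq_lintegral_Ioc_le hcm
  have hmj : Measurable fun r : Space n × ℝ => q (r.1 + r.2 • v) :=
    hqm.comp (by fun_prop)
  calc ∫⁻ x in A, ‖φ (x + v) - φ x‖ₑ ^ 2
      ≤ ∫⁻ x in A, ‖v‖ₑ ^ 2 * ∫⁻ s in Ioc (0 : ℝ) 1, q (x + s • v) := lintegral_mono hpt
    _ = ‖v‖ₑ ^ 2 * ∫⁻ s in Ioc (0 : ℝ) 1, ∫⁻ x in A, q (x + s • v) := by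
        rw [lintegral_const_mul _ hmj.lintegral_prod_right',
          lintegral_lintegral_swap hmj.aemeasurable]
    _ ≤ ‖v‖ₑ ^ 2 * ∫⁻ _s in Ioc (0 : ℝ) 1, energy G φ := by
        gcongr 1
        refine setLIntegral_mono' measurableSet_Ioc fun s hs => ?_
        have hsub : ∀ x ∈ A, q (x + s • v) = G.indicator q (x + s • v) := fun x hx => by
          rw [indicator_of_mem (hA x hx s hs)]
        calc ∫⁻ x in A, q (x + s • v) ≤ ∫⁻ x in A, G.indicator q (x + s • v) :=
              setLIntegral_mono (by
                exact (hqm.indicator hG).comp (measurable_add_const _))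
                fun x hx => (hsub x hx).le
          _ ≤ ∫⁻ x, G.indicator q (x + s • v) := setLIntegral_le_lintegral _ _
          _ = ∫⁻ x, G.indicator q x := lintegral_add_right_eq_self _ _
          _ = energy G φ := lintegral_indicator hG _
    _ = _ := by simp

/-- The oscillation in a convex set. -/
theorem OscBound.of_convex {G A : Set (Space n)} (hG : MeasurableSet G) (hA : Convex ℝ A)
    (hAm : MeasurableSet A) {d : ℝ} (hd : ∀ x ∈ A, ∀ y ∈ A, ‖y - x‖ ≤ d) (hAG : A ⊆ G) :
    OscBound G A A := by
  classical
  refine ⟨volume (Metric.closedBall (0 : Space n) d) * ENNReal.ofReal d ^ 2,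
    ENNReal.mul_ne_top measure_closedBall_lt_top.ne (by simp), fun φ hφ => ?_⟩
  have hφm : Measurable φ := hφ.continuous.measurable
  have hm := measurable_enorm_sub_sq hφ.continuous
  -- Substituting `y = x + v` turns the double integral into an integral over shifts `v`. Each shift
  -- is controlled by the energy through `lintegral_shift_le`, since convexity keeps the segments in
  -- `A`.
  set h : Space n → Space n → ℝ≥0∞ := fun x v =>
    A.indicator (fun x => A.indicator (fun y => ‖φ x - φ y‖ₑ ^ 2) (x + v)) x with hh
  have hhm : Measurable (Function.uncurry h) := by
    have e : Function.uncurry h = fun r : Space n × Space n =>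
        ({r : Space n × Space n | r.1 ∈ A} ∩ {r | r.1 + r.2 ∈ A}).indicator
          (fun r => ‖φ r.1 - φ (r.1 + r.2)‖ₑ ^ 2) r := by
      funext r
      simp only [Function.uncurry, hh, indicator_apply, mem_inter_iff, Set.mem_ofPred_eq]
      split_ifs <;> simp_all
    rw [e]
    refine Measurable.indicator (by fun_prop) ?_
    exact (measurable_fst hAm).inter ((measurable_fst.add measurable_snd) hAm)
  calc ∫⁻ x in A, ∫⁻ y in A, ‖φ x - φ y‖ₑ ^ 2
      = ∫⁻ x, ∫⁻ v, h x v := by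
        rw [← lintegral_indicator hAm]
        refine lintegral_congr fun x => ?_
        by_cases hx : x ∈ A
        · simp only [hh, indicator_of_mem hx]
          rw [lintegral_add_left_eq_self (fun y => A.indicator (fun y => ‖φ x - φ y‖ₑ ^ 2) y) x,
            lintegral_indicator hAm]
        · simp only [hh, indicator_of_notMem hx, lintegral_zero]
    _ = ∫⁻ v, ∫⁻ x, h x v := lintegral_lintegral_swap hhm.aemeasurable
    _ ≤ ∫⁻ v, (Metric.closedBall (0 : Space n) d).indicator
          (fun _ => ENNReal.ofReal d ^ 2 * energy G φ) v := by
        refine lintegral_mono fun v => ?_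
        by_cases hv : v ∈ Metric.closedBall (0 : Space n) d
        · rw [indicator_of_mem hv]
          have hv' : ‖v‖ₑ ≤ ENNReal.ofReal d := by
            rw [← ofReal_norm]
            exact ENNReal.ofReal_le_ofReal (mem_closedBall_zero_iff.1 hv)
          have hAv : MeasurableSet (A ∩ {x | x + v ∈ A}) :=
            hAm.inter (measurable_add_const v hAm)
          calc ∫⁻ x, h x v = ∫⁻ x in A ∩ {x | x + v ∈ A}, ‖φ (x + v) - φ x‖ₑ ^ 2 := by
                rw [← lintegral_indicator hAv]
                refine lintegral_congr fun x => ?_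
                simp only [hh, indicator_apply, mem_inter_iff, Set.mem_ofPred_eq]
                rw [enorm_sub_rev (φ (x + v))]
                split_ifs <;> simp_all
            _ ≤ ‖v‖ₑ ^ 2 * energy G φ := by
                refine lintegral_shift_le hG hφ v fun x hx s hs => hAG ?_
                have := hA.add_smul_sub_mem hx.1 hx.2 ⟨hs.1.le, hs.2⟩
                rwa [add_sub_cancel_left] at this
            _ ≤ _ := by gcongr
        · rw [indicator_of_notMem hv]
          refine le_of_eq ?_
          refine (lintegral_congr fun x => ?_).trans lintegral_zero
          simp only [hh, indicator_apply]
          split_ifs with h1 h2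
          · refine absurd ?_ hv
            have := hd x h1 _ h2
            rwa [add_sub_cancel_left, ← mem_closedBall_zero_iff] at this
          · rfl
          · rfl
    _ = _ := by
        rw [lintegral_indicator measurableSet_closedBall, setLIntegral_const]
        ring

variable {n : ℕ}

theorem OscBound.empty {G B : Set (Space n)} : OscBound G ∅ B :=
  ⟨0, by simp, fun φ _ => by simp⟩

/-- A bound for the oscillation is transported along an admissible shift. -/
theorem OscBound.of_shift {G A U B : Set (Space n)} (hG : MeasurableSet G) (hU : MeasurableSet U)
    (hB : volume B ≠ ⊤) {e : Space n} (hA : ∀ x ∈ A, ∀ s ∈ Ioc (0 : ℝ) 1, x + s • e ∈ G)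
    (hAU : ∀ x ∈ A, x + e ∈ U) (h : OscBound G U B) : OscBound G A B := by
  obtain ⟨C, hC, h⟩ := h
  refine ⟨2 * volume B * ‖e‖ₑ ^ 2 + 2 * C, ?_, fun φ hφ => ?_⟩
  · refine ENNReal.add_ne_top.2 ⟨ENNReal.mul_ne_top (ENNReal.mul_ne_top (by simp) hB) (by simp),
      ENNReal.mul_ne_top (by simp) hC⟩
  have hφm : Measurable φ := hφ.continuous.measurable
  have hm := measurable_enorm_sub_sq hφ.continuous
  set g : Space n → ℝ≥0∞ := fun x => ∫⁻ y in B, ‖φ x - φ y‖ₑ ^ 2 with hg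
  have hgm : Measurable g := hm.lintegral_prod_right'
  have e1 : ∀ x, g x ≤ 2 * volume B * ‖φ (x + e) - φ x‖ₑ ^ 2 + 2 * g (x + e) := by
    intro x
    have : 2 * volume B * ‖φ (x + e) - φ x‖ₑ ^ 2 + 2 * g (x + e) =
        ∫⁻ y in B, (2 * ‖φ (x + e) - φ x‖ₑ ^ 2 + 2 * ‖φ (x + e) - φ y‖ₑ ^ 2) := by
      rw [lintegral_add_left measurable_const, setLIntegral_const,
        lintegral_const_mul _ (by fun_prop)]
      ring
    rw [this]
    refine lintegral_mono fun y => ?_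
    rw [enorm_sub_rev (φ (x + e)) (φ x)]
    exact enorm_sub_sq_le' _ _ _
  have e2 : ∫⁻ x in A, g (x + e) ≤ C * energy G φ := by
    calc ∫⁻ x in A, g (x + e) ≤ ∫⁻ x in A, U.indicator g (x + e) :=
          setLIntegral_mono ((hgm.indicator hU).comp (measurable_add_const e))
            fun x hx => by rw [indicator_of_mem (hAU x hx)]
      _ ≤ ∫⁻ x, U.indicator g (x + e) := setLIntegral_le_lintegral _ _
      _ = ∫⁻ x, U.indicator g x := lintegral_add_right_eq_self _ _
      _ = ∫⁻ x in U, g x := lintegral_indicator hU _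
      _ ≤ _ := h φ hφ
  calc ∫⁻ x in A, g x
      ≤ ∫⁻ x in A, (2 * volume B * ‖φ (x + e) - φ x‖ₑ ^ 2 + 2 * g (x + e)) := lintegral_mono e1
    _ = 2 * volume B * (∫⁻ x in A, ‖φ (x + e) - φ x‖ₑ ^ 2) + 2 * ∫⁻ x in A, g (x + e) := by
        rw [lintegral_add_left (by fun_prop), lintegral_const_mul _ (by fun_prop),
          lintegral_const_mul _ (by fun_prop)]
    _ ≤ 2 * volume B * (‖e‖ₑ ^ 2 * energy G φ) + 2 * (C * energy G φ) := by
        gcongr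
        exact lintegral_shift_le hG hφ e hA
    _ = _ := by ring

/-- Oscillation bounds against one fixed ball propagate through overlapping balls to every point of
the connected set `G`. Near a boundary point they are obtained by shifting into the interior.
Compactness of the closure then leaves finitely many bounds to combine, and the fixed ball serves as
the intermediate set between two copies of `G`. -/
theorem IsBoundedDomain.oscBound {G : Set (Space n)} (hG : IsBoundedDomain smooth G) :
    OscBound G G G := by
  have hGm := hG.isOpen.measurableSet
  have hfin : ∀ {A : Set (Space n)}, A ⊆ G → volume A ≠ ⊤ := fun h =>
    (hG.isBounded.subset h).measure_lt_top.ne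
  have hball : ∀ q r, Metric.ball q r ⊆ G → OscBound G (Metric.ball q r) (Metric.ball q r) := by
    intro q r h
    refine OscBound.of_convex (d := r + r) hGm (convex_ball q r) measurableSet_ball
      (fun x hx y hy => ?_) h
    rw [← dist_eq_norm]
    have h1 := dist_triangle_right y x q
    rw [Metric.mem_ball] at hx hy
    linarith
  obtain ⟨p₀, hp₀⟩ := hG.isConnected.nonempty
  obtain ⟨r₀, hr₀, hb₀⟩ := Metric.isOpen_iff.1 hG.isOpen p₀ hp₀
  set B := Metric.ball p₀ r₀ with hB
  set K : Set (Space n) := {p | ∃ U ∈ 𝓝 p, OscBound G (U ∩ G) B} with hK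
  have key : ∀ q r, Metric.ball q r ⊆ G → ∀ p ∈ Metric.ball q r, p ∈ K →
      OscBound G (Metric.ball q r) B := by
    rintro q r hqr p hp ⟨U, hU, h⟩
    have hO : U ∩ Metric.ball q r ∈ 𝓝 p := inter_mem hU (Metric.isOpen_ball.mem_nhds hp)
    refine ((hball q r hqr).mono subset_rfl inter_subset_right).trans
      (h.mono (inter_subset_inter_right _ hqr) subset_rfl) (Measure.measure_pos_of_mem_nhds _ hO).ne'
      (hfin hqr) (hfin (inter_subset_right.trans hqr)) (hfin hb₀)
  have key2 : ∀ q r, Metric.ball q r ⊆ G → ∀ p ∈ Metric.ball q r, p ∈ K →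
      Metric.ball q r ⊆ K := fun q r hqr p hp hpK x hx =>
    ⟨Metric.ball q r, Metric.isOpen_ball.mem_nhds hx,
      (key q r hqr p hp hpK).mono inter_subset_left subset_rfl⟩
  have hp₀K : p₀ ∈ K :=
    ⟨B, Metric.ball_mem_nhds _ hr₀, (hball p₀ r₀ hb₀).mono inter_subset_left subset_rfl⟩
  -- In a ball contained in `G`, one point of `K` puts the whole ball into `K`. Hence `G ∩ K` and `G
  -- \ K` are both open, and connectedness decides.
  have hGK : G ⊆ G ∩ K := by
    refine IsPreconnected.subset_left_of_subset_union (u := G ∩ K) (v := G \ K) ?_ ?_ ?_ ?_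
      ⟨p₀, hp₀, hp₀, hp₀K⟩ hG.isConnected.isPreconnected
    · rw [Metric.isOpen_iff]
      rintro q ⟨hq, hqK⟩
      obtain ⟨r, hr, hqr⟩ := Metric.isOpen_iff.1 hG.isOpen q hq
      exact ⟨r, hr, subset_inter hqr (key2 q r hqr q (Metric.mem_ball_self hr) hqK)⟩
    · rw [Metric.isOpen_iff]
      rintro q ⟨hq, hqK⟩
      obtain ⟨r, hr, hqr⟩ := Metric.isOpen_iff.1 hG.isOpen q hq
      exact ⟨r, hr, fun x hx => ⟨hqr hx, fun hxK =>
        hqK (key2 q r hqr x hx hxK (Metric.mem_ball_self hr))⟩⟩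
    · exact (disjoint_sdiff_right.mono_left inter_subset_right)
    · intro x hx
      by_cases h : x ∈ K
      · exact Or.inl ⟨hx, h⟩
      · exact Or.inr ⟨hx, h⟩
  have hclK : ∀ p ∈ closure G, p ∈ K := by
    intro p hp
    obtain ⟨e, R, hR, he⟩ := hG.exists_inward hp
    have hq : p + e ∈ G := by
      simpa using he p hp (by simpa using hR) 1 ⟨one_pos, le_rfl⟩
    obtain ⟨U, hU, h⟩ := (hGK hq).2
    obtain ⟨U', hU'U, hU'o, hqU'⟩ := mem_nhds_iff.1 hU
    have hO : IsOpen (U' ∩ G) := hU'o.inter hG.isOpen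
    have hcont : Continuous fun x : Space n => x + e := by fun_prop
    refine ⟨Metric.ball p R ∩ (fun x => x + e) ⁻¹' (U' ∩ G),
      inter_mem (Metric.ball_mem_nhds _ hR) ((hO.preimage hcont).mem_nhds ⟨hqU', hq⟩), ?_⟩
    refine OscBound.of_shift hGm hO.measurableSet (hfin hb₀) (e := e) ?_ ?_
      (h.mono (inter_subset_inter_left _ hU'U) subset_rfl)
    · exact fun x hx s hs => he x (subset_closure hx.2) hx.1.1 s hs
    · exact fun x hx => hx.1.2
  have hcomp : IsCompact (closure G) := hG.isBounded.isCompact_closure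
  have hfinal : OscBound G (closure G ∩ G) B := by
    refine hcomp.induction_on (p := fun s => OscBound G (s ∩ G) B) ?_ ?_ ?_ ?_
    · rw [empty_inter]; exact OscBound.empty
    · exact fun s t hst h => h.mono (inter_subset_inter_left _ hst) subset_rfl
    · intro s t hs ht
      rw [union_inter_distrib_right]
      exact hs.union ht
    · intro p hp
      obtain ⟨U, hU, h⟩ := hclK p hp
      exact ⟨U, mem_nhdsWithin_of_mem_nhds hU, h⟩
  rw [inter_eq_right.2 subset_closure] at hfinal
  exact hfinal.trans hfinal.symm (Metric.measure_ball_pos volume p₀ hr₀).ne' (hfin subset_rfl)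
    (hfin hb₀) (hfin subset_rfl)

theorem norm_sq_fderiv_eq {φ : Space n → ℝ} (x : Space n) :
    ‖fderiv ℝ φ x‖ ^ 2 = ∑ i, pd i φ x ^ 2 := by
  have h : ‖gradient φ x‖ = ‖fderiv ℝ φ x‖ := by
    rw [gradient, LinearIsometryEquiv.norm_map]
  rw [← h, EuclideanSpace.norm_sq_eq]
  simp [gradient_apply_eq_pd]

theorem norm_sq_snd_eq {G : Set (Space n)} {p : L2Pair G} {A : Set (Space n)} {φ : Space n → ℝ}
    (hφ : IsTestFunction A φ)
    (h : ∀ i, ∀ᵐ x ∂(volume.restrict G), p.snd i x = pd i φ x) :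
    ENNReal.ofReal (‖p.snd‖ ^ 2) = energy G φ := by
  have hi : ∀ i, IntegrableOn (fun x => pd i φ x ^ 2) G := fun i => by
    simp only [sq]; exact ((hφ.pd i).mul_smooth (hφ.pd i).contDiff).integrable.integrableOn
  have h1 : ‖p.snd‖ ^ 2 = ∫ x in G, ‖fderiv ℝ φ x‖ ^ 2 := by
    simp only [norm_sq_fderiv_eq]
    rw [integral_finsetSum _ fun i _ => hi i, PiLp.norm_sq_eq_of_L2]
    exact Finset.sum_congr rfl fun i _ => norm_sq_eq_setIntegral (h i)
  rw [h1, ofReal_integral_eq_lintegral_ofReal _ (Eventually.of_forall fun x => sq_nonneg _), energy]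
  · refine lintegral_congr fun x => ?_
    rw [← ofReal_norm, ENNReal.ofReal_pow (norm_nonneg _)]
  · simp only [norm_sq_fderiv_eq]
    exact integrable_finsetSum _ fun i _ => hi i

theorem integral_quadratic {α : Type*} [MeasurableSpace α] {ν : Measure α} [IsFiniteMeasure ν]
    {φ : α → ℝ} (h1 : Integrable φ ν) (h2 : Integrable (fun x => φ x ^ 2) ν) (a b c : ℝ) :
    Integrable (fun x => a * φ x ^ 2 + b * φ x + c) ν ∧
      ∫ x, (a * φ x ^ 2 + b * φ x + c) ∂ν =
        a * (∫ x, φ x ^ 2 ∂ν) + b * (∫ x, φ x ∂ν) + c * ν.real univ := by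
  have e1 := h2.const_mul a
  have e2 := h1.const_mul b
  have e3 : Integrable (fun x => a * φ x ^ 2 + b * φ x) ν := e1.add e2
  refine ⟨e3.add (integrable_const c), ?_⟩
  rw [integral_add e3 (integrable_const c), integral_add e1 e2, integral_const_mul,
    integral_const_mul, integral_const, smul_eq_mul, mul_comm c]

/-- The Poincaré–Wirtinger inequality. -/
theorem IsBoundedDomain.exists_poincare_wirtinger {G : Set (Space n)}
    (hG : IsBoundedDomain smooth G) : ∃ C, 0 ≤ C ∧ ∀ p ∈ H1 univ G,
      volume.real G * ‖p.fst‖ ^ 2 ≤ C * ‖p.snd‖ ^ 2 + (∫ x in G, p.fst x) ^ 2 := by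
  obtain ⟨C, hC, h⟩ := hG.oscBound
  have hfin : volume G ≠ ⊤ := hG.isBounded.measure_lt_top.ne
  have : IsFiniteMeasure (volume.restrict G) := ⟨by simpa using hfin.lt_top⟩
  refine ⟨C.toReal / 2, by positivity, fun p hp => ?_⟩
  set o : L2 G := indicatorConstLp 2 MeasurableSet.univ (measure_ne_top _ univ) (1 : ℝ) with ho
  have hoi : ∀ f : L2 G, inner ℝ o f = ∫ x in G, f x := fun f => by
    rw [ho, L2.inner_indicatorConstLp_one, setIntegral_univ]
  rw [← hoi]
  have hcf : Continuous fun p : L2Pair G => p.fst :=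
    (WithLp.fstL 2 ℝ (L2 G) (L2Vec n (volume.restrict G))).continuous
  have hcs : Continuous fun p : L2Pair G => p.snd :=
    (WithLp.sndL 2 ℝ (L2 G) (L2Vec n (volume.restrict G))).continuous
  have hcl : IsClosed {p : L2Pair G | volume.real G * ‖p.fst‖ ^ 2 ≤
      C.toReal / 2 * ‖p.snd‖ ^ 2 + inner ℝ o p.fst ^ 2} := by
    refine isClosed_le ((hcf.norm.pow 2).const_mul _) ?_
    exact ((hcs.norm.pow 2).const_mul _).add ((continuous_const.inner hcf).pow 2)
  refine closure_minimal ?_ hcl hp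
  rintro p ⟨φ, hφ, h1, h2⟩
  change volume.real G * ‖p.fst‖ ^ 2 ≤ C.toReal / 2 * ‖p.snd‖ ^ 2 + inner ℝ o p.fst ^ 2
  have hI : inner ℝ o p.fst = ∫ x in G, φ x := by
    rw [hoi]; exact integral_congr_ae h1
  rw [hI, norm_sq_eq_setIntegral h1]
  set I := ∫ x in G, φ x
  set Q := ∫ x in G, φ x ^ 2
  have i1 : Integrable φ (volume.restrict G) := hφ.integrable.integrableOn
  have i2 : Integrable (fun x => φ x ^ 2) (volume.restrict G) := by
    simp only [sq]; exact (hφ.mul_smooth hφ.contDiff).integrable.integrableOn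
  have hV : (volume.restrict G).real univ = volume.real G := by
    rw [measureReal_restrict_apply_univ]
  have hquad := fun a b c => integral_quadratic i1 i2 a b c
  rw [hV] at hquad
  -- Expanding the square, the full double integral is `2 (|G| ∫ φ² - (∫ φ)²)`; this is where `C/2`
  -- comes from.
  have a1 : ∀ x, ∫⁻ y in G, ‖φ x - φ y‖ₑ ^ 2 =
      ENNReal.ofReal (volume.real G * φ x ^ 2 + -(2 * I) * φ x + Q) := by
    intro x
    have e : ∀ y, ‖φ x - φ y‖ₑ ^ 2 =
        ENNReal.ofReal (1 * φ y ^ 2 + -(2 * φ x) * φ y + φ x ^ 2) := by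
      intro y
      rw [← ofReal_norm, ← ENNReal.ofReal_pow (norm_nonneg _), Real.norm_eq_abs, sq_abs]
      congr 1; ring
    simp only [e]
    rw [← ofReal_integral_eq_lintegral_ofReal (hquad _ _ _).1 (Eventually.of_forall fun y => ?_),
      (hquad _ _ _).2]
    · congr 1; ring
    · have : (0 : ℝ) ≤ (φ x - φ y) ^ 2 := sq_nonneg _
      simp only [Pi.zero_apply]
      linarith
  have a2 := h φ hφ
  have hpos : ∀ x, 0 ≤ volume.real G * φ x ^ 2 + -(2 * I) * φ x + Q := by
    intro x
    have e : volume.real G * φ x ^ 2 + -(2 * I) * φ x + Q =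
        ∫ y in G, (1 * φ y ^ 2 + -(2 * φ x) * φ y + φ x ^ 2) := by
      rw [(hquad _ _ _).2]; ring
    rw [e]
    refine integral_nonneg fun y => ?_
    have : (0 : ℝ) ≤ (φ x - φ y) ^ 2 := sq_nonneg _
    simp only [Pi.zero_apply]
    linarith
  simp only [a1] at a2
  rw [← ofReal_integral_eq_lintegral_ofReal (hquad _ _ _).1 (Eventually.of_forall hpos),
    ← norm_sq_snd_eq hφ h2, ← ENNReal.ofReal_toReal hC,
    ← ENNReal.ofReal_mul ENNReal.toReal_nonneg, ENNReal.ofReal_le_ofReal_iff (by positivity),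
    (hquad _ _ _).2] at a2
  linarith

/-! ### Correlations and mollification: integration by parts up to the boundary -/

open scoped Pointwise Convolution

variable {n : ℕ}

theorem integrable_mul_L2 {α : Type*} [MeasurableSpace α] {ν : Measure α} {a b : α → ℝ}
    (ha : MemLp a 2 ν) (hb : MemLp b 2 ν) : Integrable (fun x => a x * b x) ν :=
  ha.integrable_mul hb

/-- The correlation of two square integrable functions. -/
def corr (a b : Space n → ℝ) (y : Space n) : ℝ := ∫ x, a x * b (x - y)

theorem memLp_comp_sub {b : Space n → ℝ} (hb : MemLp b 2 volume) (y : Space n) :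
    MemLp (fun x => b (x - y)) 2 volume :=
  hb.comp_measurePreserving (measurePreserving_sub_right volume y)

theorem continuous_corr {a b : Space n → ℝ} (ha : MemLp a 2 volume) (hb : MemLp b 2 volume) :
    Continuous (corr a b) := by
  let g : Space n → C(Space n, Space n) := fun h => ⟨fun x => x - h, by fun_prop⟩
  have hgm : ∀ h, MeasurePreserving (g h) (volume : Measure (Space n)) volume := fun h =>
    measurePreserving_sub_right volume h
  have hg : Continuous g := by
    refine ContinuousMap.continuous_of_continuous_uncurry _ ?_
    change Continuous fun p : Space n × Space n => p.2 - p.1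
    fun_prop
  have h1 : Continuous fun h => Lp.compMeasurePreserving (g h) (hgm h) (hb.toLp b) :=
    continuous_const.compMeasurePreservingLp hg hgm (by simp)
  have h2 : corr a b = fun y =>
      inner ℝ (ha.toLp a) (Lp.compMeasurePreserving (g y) (hgm y) (hb.toLp b)) := by
    funext y
    rw [inner_L2_eq, corr]
    refine integral_congr_ae ?_
    filter_upwards [ha.coeFn_toLp, Lp.coeFn_compMeasurePreserving (hb.toLp b) (hgm y),
      (hgm y).quasiMeasurePreserving.ae hb.coeFn_toLp] with x e1 e2 e3
    rw [e1, e2, Function.comp_apply, e3]; rfl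
  rw [h2]
  exact continuous_const.inner h1

/-- Fubini's theorem for correlations. -/
theorem integral_mul_corr {a b κ : Space n → ℝ} (ha : MemLp a 2 volume) (hb : MemLp b 2 volume)
    (hκ : Continuous κ) (hc : HasCompactSupport κ) :
    ∫ y, κ y * corr a b y = ∫ x, a x * ∫ y, κ y * b (x - y) := by
  have hmeas : AEStronglyMeasurable (fun p : Space n × Space n => a p.1 * (κ p.2 * b (p.1 - p.2)))
      (volume.prod volume) :=
    (ha.1.comp_fst).mul (hκ.aestronglyMeasurable.convolution_integrand
      (ContinuousLinearMap.mul ℝ ℝ) hb.1)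
  have hint : Integrable (fun p : Space n × Space n => a p.1 * (κ p.2 * b (p.1 - p.2)))
      (volume.prod volume) := by
    rw [integrable_prod_iff' hmeas]
    have e : ∀ x y, a x * (κ y * b (x - y)) = κ y * (a x * b (x - y)) := fun x y => by ring
    simp only [e, norm_mul]
    refine ⟨Eventually.of_forall fun y =>
      (integrable_mul_L2 ha (memLp_comp_sub hb y)).const_mul _, ?_⟩
    simp only [integral_const_mul]
    have h1 : Continuous (corr (fun x => ‖a x‖) fun x => ‖b x‖) := continuous_corr ha.norm hb.norm
    exact (hκ.norm.mul h1).integrable_of_hasCompactSupport hc.norm.mul_right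
  have h2 := integral_integral_swap (f := fun x y => a x * (κ y * b (x - y))) hint
  simp only [integral_const_mul] at h2
  rw [h2]
  refine integral_congr_ae (Eventually.of_forall fun y => ?_)
  simp only [corr]
  rw [← integral_const_mul]
  refine integral_congr_ae (Eventually.of_forall fun x => ?_)
  simp only []
  ring

/-- The convolution of a square integrable function and a test function. -/
def conv (b κ : Space n → ℝ) : Space n → ℝ := b ⋆[ContinuousLinearMap.mul ℝ ℝ, volume] κ

theorem conv_apply (b κ : Space n → ℝ) (x : Space n) : conv b κ x = ∫ t, b t * κ (x - t) := rfl

theorem conv_apply_swap (b κ : Space n → ℝ) (x : Space n) :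
    conv b κ x = ∫ y, κ y * b (x - y) := by
  rw [conv, convolution_eq_swap]
  simp [mul_comm]

theorem contDiff_conv {b κ : Space n → ℝ} (hb : MemLp b 2 volume) (hκ : IsTestFunction univ κ) :
    ContDiff ℝ smooth (conv b κ) :=
  hκ.hasCompactSupport.contDiff_convolution_right _ (hb.locallyIntegrable (by norm_num))
    hκ.contDiff

theorem pd_conv {b κ : Space n → ℝ} (hb : MemLp b 2 volume) (hκ : IsTestFunction univ κ)
    (j : Fin n) (x : Space n) : pd j (conv b κ) x = ∫ t, b t * pd j κ (x - t) := by
  have hbl : LocallyIntegrable b volume := hb.locallyIntegrable (by norm_num)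
  have h := hκ.hasCompactSupport.hasFDerivAt_convolution_right (ContinuousLinearMap.mul ℝ ℝ) hbl
    hκ.contDiff_one x
  rw [pd, conv, h.fderiv, convolution_precompR_apply _ hbl (hκ.hasCompactSupport.fderiv ℝ)
    (hκ.contDiff.continuous_fderiv (by simp))]
  rfl

theorem isTestFunction_conv {b κ : Space n → ℝ} {K G : Set (Space n)} (hb : MemLp b 2 volume)
    (hκ : IsTestFunction univ κ) (hK : IsCompact K) (hbK : ∀ x, x ∉ K → b x = 0)
    (hG : ∀ y ∈ tsupport κ, ∀ x ∈ K, x + y ∈ G) : IsTestFunction G (conv b κ) := by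
  have hcomp : IsCompact (K + tsupport κ) := hK.add hκ.hasCompactSupport
  have hsub : tsupport (conv b κ) ⊆ K + tsupport κ := by
    refine closure_minimal ?_ hcomp.isClosed
    refine (support_convolution_subset _).trans (add_subset_add ?_ (subset_tsupport κ))
    intro x hx
    by_contra h
    exact hx (hbK x h)
  refine ⟨contDiff_conv hb hκ, hcomp.of_isClosed_subset (isClosed_tsupport _) hsub, ?_⟩
  intro z hz
  obtain ⟨x, hx, y, hy, rfl⟩ := hsub hz
  exact hG y hy x hx

/-- If `div V = w` in the whole space then this remains true after mollification. -/
theorem sum_pd_conv {w κ : Space n → ℝ} {V : Fin n → Space n → ℝ}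
    (hV : ∀ i, MemLp (V i) 2 volume) (hκ : IsTestFunction univ κ)
    (h : ∀ φ, IsTestFunction univ φ → (∫ x, w x * φ x) + ∑ i, ∫ x, V i x * pd i φ x = 0)
    (x : Space n) : ∑ i, pd i (conv (V i) κ) x = conv w κ x := by
  have hφ : IsTestFunction univ fun t => κ (x - t) := by
    refine ⟨hκ.contDiff.comp (by fun_prop), ?_, subset_univ _⟩
    exact hκ.hasCompactSupport.comp_homeomorph (Homeomorph.subLeft x)
  have hpd : ∀ i t, pd i (fun t => κ (x - t)) t = -pd i κ (x - t) := by
    intro i t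
    have h1 : HasFDerivAt (fun t => x - t) (-ContinuousLinearMap.id ℝ (Space n)) t := by
      simpa using (hasFDerivAt_id t).const_sub x
    have h2 : HasFDerivAt (fun t => κ (x - t)) _ t :=
      ((hκ.differentiable (x - t)).hasFDerivAt).comp t h1
    rw [pd, h2.fderiv]
    simp [pd]
  have h3 := h _ hφ
  simp only [hpd, mul_neg, integral_neg, Finset.sum_neg_distrib] at h3
  simp only [pd_conv (hV _) hκ]
  rw [conv_apply]
  linarith

theorem isOpen_forall_add_mem {K G : Set (Space n)} (hK : IsCompact K) (hG : IsOpen G) :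
    IsOpen {y | ∀ x ∈ K, x + y ∈ G} := by
  rw [isOpen_iff_eventually]
  intro y hy
  refine hK.eventually_forall_of_forall_eventually fun x hx => ?_
  have hc : Continuous fun q : Space n × Space n => q.2 + q.1 := by fun_prop
  exact (hG.preimage hc).mem_nhds (hy x hx)

/-- Integration by parts in a set which can be shifted into an open set. -/
theorem integral_add_sum_eq_zero {G K : Set (Space n)} (hG : IsOpen G) (hK : IsCompact K)
    (hshift : (0 : Space n) ∈ closure {y | ∀ x ∈ K, x + y ∈ G}) {P w : Space n → ℝ}
    {m V : Fin n → Space n → ℝ} (hP : MemLp P 2 volume) (hm : ∀ i, MemLp (m i) 2 volume)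
    (hw : MemLp w 2 volume) (hV : ∀ i, MemLp (V i) 2 volume) (hVK : ∀ i x, x ∉ K → V i x = 0)
    (hgrad : ∀ φ, IsTestFunction G φ → ∀ i, ∫ x, P x * pd i φ x = -∫ x, m i x * φ x)
    (hdiv : ∀ φ, IsTestFunction univ φ → (∫ x, w x * φ x) + ∑ i, ∫ x, V i x * pd i φ x = 0) :
    (∫ x, P x * w x) + ∑ i, ∫ x, m i x * V i x = 0 := by
  -- `k y` is the expression to be evaluated with `w` and `V` translated by `y`. Averaged with a
  -- kernel supported in `U`, it involves only mollified fields that are test functions in `G`, for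
  -- which integration by parts is allowed; so `k` vanishes on `U`.
  set k : Space n → ℝ := fun y => corr P w y + ∑ i, corr (m i) (V i) y with hk
  have hkc : Continuous k :=
    (continuous_corr hP hw).add (continuous_finsetSum _ fun i _ => continuous_corr (hm i) (hV i))
  set U := {y : Space n | ∀ x ∈ K, x + y ∈ G} with hU
  have hUo : IsOpen U := isOpen_forall_add_mem hK hG
  have hk0 : ∀ᵐ y, y ∈ U → k y = 0 := by
    refine hUo.ae_eq_zero_of_integral_contDiff_smul_eq_zero
      (hkc.locallyIntegrable.locallyIntegrableOn U) fun κ h1 h2 h3 => ?_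
    have hκ : IsTestFunction univ κ := ⟨h1, h2, subset_univ _⟩
    have hψ : ∀ i, IsTestFunction G (conv (V i) κ) := fun i =>
      isTestFunction_conv (hV i) hκ hK (hVK i) fun y hy => h3 hy
    have ic : ∀ {a b : Space n → ℝ}, MemLp a 2 volume → MemLp b 2 volume →
        Integrable fun y => κ y * corr a b y := fun ha hb =>
      (h1.continuous.mul (continuous_corr ha hb)).integrable_of_hasCompactSupport h2.mul_right
    have e1 : ∫ x, P x * conv w κ x = -∑ i, ∫ x, m i x * conv (V i) κ x := by
      rw [← Finset.sum_neg_distrib]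
      simp only [← hgrad _ (hψ _)]
      rw [← integral_finsetSum _ fun i _ => integrable_mul_L2 hP
        (by simpa using ((hψ i).pd i).memLp univ)]
      simp only [← Finset.mul_sum, sum_pd_conv hV hκ hdiv]
    simp only [hk, smul_eq_mul, mul_add, Finset.mul_sum]
    rw [integral_add (ic hP hw) (integrable_finsetSum _ fun i _ => ic (hm i) (hV i)),
      integral_finsetSum _ fun i _ => ic (hm i) (hV i),
      integral_mul_corr hP hw h1.continuous h2]
    simp only [integral_mul_corr (hm _) (hV _) h1.continuous h2, ← conv_apply_swap]
    rw [e1]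
    exact neg_add_cancel _
  have hkU : ∀ y ∈ U, k y = 0 := by
    have h := Measure.eqOn_open_of_ae_eq (μ := volume) (f := k) (g := 0) (U := U)
      ((ae_restrict_iff' hUo.measurableSet).2 hk0) hUo hkc.continuousOn continuousOn_const
    exact h
  -- `k` is continuous and 0 is a limit of admissible shifts.
  have h0 : k 0 = 0 := by
    have hcl : IsClosed {y | k y = 0} := isClosed_eq hkc continuous_const
    exact closure_minimal hkU hcl hshift
  simpa [hk, corr] using h0

/-! ### Density of smooth gradients, and gradients as the complement of solenoidal fields -/

variable {n : ℕ}

theorem inner_L2Pair {G : Set (Space n)} (p q : L2Pair G) :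
    inner ℝ p q = (∫ x in G, p.fst x * q.fst x) + ∑ i, ∫ x in G, p.snd i x * q.snd i x := by
  rw [WithLp.prod_inner_apply, PiLp.inner_apply]
  simp only [inner_L2_eq]
  rfl

/-- A smooth partition of unity on a compact set. -/
theorem exists_partition {K : Set (Space n)} (hK : IsCompact K) (r : Space n → ℝ)
    (hr : ∀ p ∈ K, 0 < r p) : ∃ (t : Finset (Space n)) (θ : Space n → Space n → ℝ),
      (∀ p ∈ t, p ∈ K ∧ IsTestFunction (Metric.ball p (r p)) (θ p)) ∧
      ∀ x ∈ K, ∑ p ∈ t, θ p x = 1 := by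
  obtain ⟨t, htK, ht⟩ := hK.elim_nhds_subcover (fun p => Metric.ball p (r p))
    fun p hp => Metric.ball_mem_nhds p (hr p hp)
  obtain ⟨f, hf⟩ := SmoothPartitionOfUnity.exists_isSubordinate (modelWithCornersSelf ℝ (Space n))
    hK.isClosed (fun p : t => Metric.ball (p : Space n) (r p)) (fun p => Metric.isOpen_ball)
    (by intro x hx; simpa using ht hx)
  classical
  refine ⟨t, fun p => if h : p ∈ t then f ⟨p, h⟩ else 0, fun p hp => ⟨htK p hp, ?_⟩, fun x hx => ?_⟩
  · simp only [hp, dif_pos]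
    have h1 := hf ⟨p, hp⟩
    have hb : IsCompact (Metric.closedBall p (r p)) := isCompact_closedBall p (r p)
    exact ⟨(f ⟨p, hp⟩).contMDiff.contDiff, hb.of_isClosed_subset (isClosed_tsupport _)
      (h1.trans Metric.ball_subset_closedBall), h1⟩
  · have h1 := f.sum_eq_one hx
    rw [finsum_eq_sum_of_fintype] at h1
    rw [← h1, ← Finset.sum_coe_sort]
    refine Finset.sum_congr rfl fun p _ => ?_
    simp

theorem memLp_indicator_L2 {G : Set (Space n)} (hG : MeasurableSet G) (f : L2 G) :
    MemLp (G.indicator f) 2 volume := by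
  rw [memLp_indicator_iff_restrict hG]
  exact Lp.memLp f

theorem IsTestFunction.memLp_mul {A : Set (Space n)} {θ f : Space n → ℝ} (h : IsTestFunction A θ)
    (hf : MemLp f 2 volume) : MemLp (fun x => θ x * f x) 2 volume := by
  obtain ⟨C, hC⟩ := h.hasCompactSupport.exists_bound_of_continuous h.continuous
  refine MemLp.of_le_mul (c := C) hf (h.continuous.aestronglyMeasurable.mul hf.1)
    (Eventually.of_forall fun x => ?_)
  rw [norm_mul]
  exact mul_le_mul_of_nonneg_right (hC x) (norm_nonneg _)

/-- In a smooth domain, weak gradients are approximated by gradients of functions which are smooth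
up to the boundary. -/
theorem IsBoundedDomain.mem_H1 {G : Set (Space n)} (hG : IsBoundedDomain smooth G) {p : L2Pair G}
    (hp : ∀ φ : Space n → ℝ, IsTestFunction G φ → ∀ i,
      ∫ x in G, p.fst x * pd i φ x = -∫ x in G, p.snd i x * φ x) : p ∈ H1 univ G := by
  have hGm := hG.isOpen.measurableSet
  -- By double orthogonality it suffices to show that `p` is orthogonal to every `q` orthogonal to
  -- the smooth pairs. For such `q`, extension by zero gives a field on `ℝⁿ` whose weak divergence
  -- is the extension of `q.fst`.
  rw [H1, ← Submodule.orthogonal_orthogonal_eq_closure, Submodule.mem_orthogonal]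
  intro q hq
  rw [Submodule.mem_orthogonal] at hq
  have hq' : ∀ φ : Space n → ℝ, IsTestFunction univ φ →
      (∫ x in G, φ x * q.fst x) + ∑ i, ∫ x in G, pd i φ x * q.snd i x = 0 := by
    intro φ hφ
    have h := hq _ (hφ.pair_mem (G := G))
    rw [inner_L2Pair] at h
    rw [← h]
    congr 1
    · exact integral_congr_ae (hφ.pair_fst.mono fun x hx => by simp only [hx])
    · exact Finset.sum_congr rfl fun i _ =>
        integral_congr_ae ((hφ.pair_snd i).mono fun x hx => by simp only [hx])
  set P := G.indicator p.fst with hP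
  set m := fun i => G.indicator (p.snd i) with hm
  set w := G.indicator q.fst with hw
  set v := fun i => G.indicator (q.snd i) with hv
  have hPm : MemLp P 2 volume := memLp_indicator_L2 hGm _
  have hmm : ∀ i, MemLp (m i) 2 volume := fun i => memLp_indicator_L2 hGm _
  have hwm : MemLp w 2 volume := memLp_indicator_L2 hGm _
  have hvm : ∀ i, MemLp (v i) 2 volume := fun i => memLp_indicator_L2 hGm _
  have hind : ∀ f g : Space n → ℝ, ∫ x, G.indicator f x * g x = ∫ x in G, f x * g x := by
    intro f g
    rw [← integral_indicator hGm]
    refine integral_congr_ae (Eventually.of_forall fun x => ?_)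
    by_cases hx : x ∈ G <;> simp [hx]
  -- the localized identity
  have local_eq : ∀ p₀ ∈ closure G, ∃ R > 0, ∀ θ, IsTestFunction (Metric.ball p₀ R) θ →
      (∫ x, P x * (θ x * w x + ∑ i, pd i θ x * v i x)) + ∑ i, ∫ x, m i x * (θ x * v i x) = 0 := by
    intro p₀ hp₀
    obtain ⟨e, R, hR, he⟩ := hG.exists_inward hp₀
    refine ⟨R, hR, fun θ hθ => ?_⟩
    have hθu := hθ.mono (subset_univ _)
    have hK : IsCompact (tsupport θ ∩ closure G) :=
      hθ.hasCompactSupport.inter_right isClosed_closure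
    have hWm : MemLp (fun x => θ x * w x + ∑ i, pd i θ x * v i x) 2 volume :=
      (hθ.memLp_mul hwm).add (memLp_finsetSum _ fun i _ => (hθ.pd i).memLp_mul (hvm i))
    refine integral_add_sum_eq_zero hG.isOpen hK ?_ hPm hmm hWm
      (fun i => hθ.memLp_mul (hvm i)) ?_ ?_ ?_
    · have hlim : Tendsto (fun s : ℝ => s • e) (𝓝[>] 0) (𝓝 0) := by
        have : Continuous fun s : ℝ => s • e := by fun_prop
        simpa using (this.tendsto 0).mono_left nhdsWithin_le_nhds
      refine mem_closure_of_tendsto hlim ?_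
      filter_upwards [Ioc_mem_nhdsGT (zero_lt_one' ℝ)] with s hs x hx
      exact he x hx.2 (hθ.tsupport_subset hx.1) s hs
    · intro i x hx
      by_cases h1 : x ∈ tsupport θ
      · have h2 : x ∉ G := fun h => hx ⟨h1, subset_closure h⟩
        simp [hv, h2]
      · rw [image_eq_zero_of_notMem_tsupport h1, zero_mul]
    · intro φ hφ i
      rw [hind, hind, hp φ hφ i]
    · intro φ hφ
      have hprod : IsTestFunction univ fun x => θ x * φ x := hθu.mul_smooth hφ.contDiff
      have hφ2 : MemLp φ 2 volume := by simpa using hφ.memLp univ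
      have hpφ2 : ∀ i, MemLp (pd i φ) 2 volume := fun i => by simpa using (hφ.pd i).memLp univ
      have h := hq' _ hprod
      have c1 : ∫ x in G, θ x * φ x * q.fst x = ∫ x, θ x * w x * φ x := by
        simp only [mul_comm (_ * _) (q.fst _)]
        rw [← hind]
        exact integral_congr_ae (Eventually.of_forall fun x => by simp only [hw]; ring)
      have c2 : ∀ i, ∫ x in G, pd i (fun x => θ x * φ x) x * q.snd i x =
          (∫ x, pd i θ x * v i x * φ x) + ∫ x, θ x * v i x * pd i φ x := by
        intro i
        simp only [mul_comm _ (q.snd i _)]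
        rw [← hind, ← integral_add (integrable_mul_L2 ((hθ.pd i).memLp_mul (hvm i)) hφ2)
          (integrable_mul_L2 (hθ.memLp_mul (hvm i)) (hpφ2 i))]
        refine integral_congr_ae (Eventually.of_forall fun x => ?_)
        simp only [hv, pd_mul hθ.differentiable hφ.differentiable]
        ring
      rw [c1] at h
      simp only [c2, Finset.sum_add_distrib] at h
      have i1 := fun i : Fin n => integrable_mul_L2 ((hθ.pd i).memLp_mul (hvm i)) hφ2
      simp only [add_mul, Finset.sum_mul]
      rw [integral_add (integrable_mul_L2 (hθ.memLp_mul hwm) hφ2)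
        (integrable_finsetSum _ fun i _ => i1 i), integral_finsetSum _ fun i _ => i1 i]
      linarith
  choose! R hR hloc using local_eq
  obtain ⟨t, θ, ht, hsum⟩ := exists_partition hG.isBounded.isCompact_closure R hR
  -- The cutoffs add up to 1 near each point of `G`, so the terms with their gradients disappear
  -- when the local identities are summed.
  have hsumpd : ∀ x ∈ G, ∀ i, ∑ p ∈ t, pd i (θ p) x = 0 := by
    intro x hx i
    have h1 : (fun y => ∑ p ∈ t, θ p y) =ᶠ[𝓝 x] fun _ => 1 := by
      filter_upwards [hG.isOpen.mem_nhds hx] with y hy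
      exact hsum y (subset_closure hy)
    have h2 := h1.fderiv_eq (𝕜 := ℝ)
    rw [fderiv_fun_const, fderiv_fun_sum fun p hp => (ht p hp).2.differentiable x] at h2
    have h3 := DFunLike.congr_fun h2 (basisVec i)
    simpa [pd] using h3
  have key : ∑ p ∈ t, ((∫ x, P x * (θ p x * w x + ∑ i, pd i (θ p) x * v i x)) +
      ∑ i, ∫ x, m i x * (θ p x * v i x)) = 0 :=
    Finset.sum_eq_zero fun p hp => hloc p (ht p hp).1 _ (ht p hp).2
  have i1 : ∀ p ∈ t, Integrable fun x => P x * (θ p x * w x + ∑ i, pd i (θ p) x * v i x) :=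
    fun p hp => integrable_mul_L2 hPm (((ht p hp).2.memLp_mul hwm).add
      (memLp_finsetSum _ fun i _ => ((ht p hp).2.pd i).memLp_mul (hvm i)))
  have i2 : ∀ i, ∀ p ∈ t, Integrable fun x => m i x * (θ p x * v i x) :=
    fun i p hp => integrable_mul_L2 (hmm i) ((ht p hp).2.memLp_mul (hvm i))
  rw [Finset.sum_add_distrib, Finset.sum_comm, ← integral_finsetSum _ i1] at key
  simp only [← integral_finsetSum _ (i2 _)] at key
  have k1 : ∫ x, ∑ p ∈ t, P x * (θ p x * w x + ∑ i, pd i (θ p) x * v i x) =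
      ∫ x in G, q.fst x * p.fst x := by
    have : ∀ x, ∑ p ∈ t, P x * (θ p x * w x + ∑ i, pd i (θ p) x * v i x) = w x * P x := by
      intro x
      by_cases hx : x ∈ G
      · rw [← Finset.mul_sum, Finset.sum_add_distrib, ← Finset.sum_mul, hsum x (subset_closure hx),
          Finset.sum_comm]
        simp only [← Finset.sum_mul, hsumpd x hx]
        simp [mul_comm]
      · simp [hP, hx]
    rw [integral_congr_ae (Eventually.of_forall this)]
    simp only [hw, hind]
    refine setIntegral_congr_fun hGm fun x hx => ?_
    simp [hP, hx]
  have k2 : ∀ i, ∫ x, ∑ p ∈ t, m i x * (θ p x * v i x) = ∫ x in G, q.snd i x * p.snd i x := by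
    intro i
    have : ∀ x, ∑ p ∈ t, m i x * (θ p x * v i x) = v i x * m i x := by
      intro x
      by_cases hx : x ∈ G
      · rw [← Finset.mul_sum, ← Finset.sum_mul, hsum x (subset_closure hx)]
        ring
      · simp [hm, hx]
    rw [integral_congr_ae (Eventually.of_forall this)]
    simp only [hv, hind]
    refine setIntegral_congr_fun hGm fun x hx => ?_
    simp [hm, hx]
  rw [k1] at key
  simp only [k2] at key
  rw [inner_L2Pair, key]

/-- The elements of `H¹` are functions together with their weak gradients. -/
theorem integral_mul_pd_of_mem_H1 {G : Set (Space n)} {p : L2Pair G}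
    (hp : p ∈ H1 univ G) {φ : Space n → ℝ} (hφ : IsTestFunction G φ) (i : Fin n) :
    ∫ x in G, p.fst x * pd i φ x = -∫ x in G, p.snd i x * φ x := by
  set a : L2 G := ((hφ.pd i).memLp G).toLp _
  set b : L2 G := (hφ.memLp G).toLp _
  have ha : ∀ f : L2 G, inner ℝ f a = ∫ x in G, f x * pd i φ x := fun f => by
    rw [inner_L2_eq]
    exact integral_congr_ae (((hφ.pd i).memLp G).coeFn_toLp.mono fun x hx => by simp only [a, hx])
  have hb : ∀ f : L2 G, inner ℝ f b = ∫ x in G, f x * φ x := fun f => by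
    rw [inner_L2_eq]
    exact integral_congr_ae ((hφ.memLp G).coeFn_toLp.mono fun x hx => by simp only [b, hx])
  rw [← ha, ← hb]
  have hcl : IsClosed {p : L2Pair G | inner ℝ p.fst a = -inner ℝ (p.snd i) b} := by
    have h1 : Continuous fun p : L2Pair G => p.fst :=
      (WithLp.fstL 2 ℝ (L2 G) (L2Vec n (volume.restrict G))).continuous
    have h2 : Continuous fun p : L2Pair G => p.snd i :=
      ((PiLp.proj (𝕜 := ℝ) 2 (fun _ : Fin n => L2 G) i).comp
        (WithLp.sndL 2 ℝ (L2 G) (L2Vec n (volume.restrict G)))).continuous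
    exact isClosed_eq (h1.inner continuous_const) (h2.inner continuous_const).neg
  refine closure_minimal ?_ hcl hp
  rintro p ⟨ψ, hψ, h1, h2⟩
  change inner ℝ p.fst a = -inner ℝ (p.snd i) b
  rw [ha, hb]
  have e1 : ∫ x in G, p.fst x * pd i φ x = ∫ x, ψ x * pd i φ x := by
    rw [integral_congr_ae (g := fun x => ψ x * pd i φ x) (h1.mono fun x hx => by simp only [hx])]
    refine setIntegral_eq_integral_of_forall_compl_eq_zero fun x hx => ?_
    rw [image_eq_zero_of_notMem_tsupport fun h => hx ((hφ.pd i).tsupport_subset h), mul_zero]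
  have e2 : ∫ x in G, p.snd i x * φ x = ∫ x, pd i ψ x * φ x := by
    rw [integral_congr_ae (g := fun x => pd i ψ x * φ x)
      ((h2 i).mono fun x hx => by simp only [hx])]
    refine setIntegral_eq_integral_of_forall_compl_eq_zero fun x hx => ?_
    rw [image_eq_zero_of_notMem_tsupport fun h => hx (hφ.tsupport_subset h), mul_zero]
  rw [e1, e2]
  exact integral_mul_pd (hφ.mono (subset_univ _)) hψ.contDiff i

/-- A field orthogonal to the tangential solenoidal fields is a pressure gradient. -/
theorem IsBoundedDomain.exists_pressure {G : Set (Space n)} (hG : IsBoundedDomain smooth G)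
    {m : L2Vec n (volume.restrict G)}
    (hm : ∀ q : L2Vec n (volume.restrict G), (∀ φ, IsTestFunction univ φ →
      ∑ i, ∫ x in G, q i x * pd i φ x = 0) → inner ℝ q m = 0) :
    ∃ P : L2 G, ∫ x in G, P x = 0 ∧ (WithLp.toLp 2 (P, m) : L2Pair G) ∈ H1 univ G := by
  obtain ⟨C, hC0, hC⟩ := hG.exists_poincare_wirtinger
  have hfin : volume G ≠ ⊤ := hG.isBounded.measure_lt_top.ne
  have : IsFiniteMeasure (volume.restrict G) := ⟨by simpa using hfin.lt_top⟩
  have hV : 0 < volume.real G :=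
    ENNReal.toReal_pos (hG.isOpen.measure_pos volume hG.isConnected.nonempty).ne' hfin
  set o : L2 G := indicatorConstLp 2 MeasurableSet.univ (measure_ne_top _ univ) (1 : ℝ) with ho
  have hoi : ∀ f : L2 G, inner ℝ o f = ∫ x in G, f x := fun f => by
    rw [ho, L2.inner_indicatorConstLp_one, setIntegral_univ]
  set ℓ : L2Pair G →L[ℝ] ℝ :=
    (innerSL ℝ o).comp (WithLp.fstL 2 ℝ (L2 G) (L2Vec n (volume.restrict G))) with hℓ
  have hℓi : ∀ p, ℓ p = ∫ x in G, p.fst x := fun p => hoi p.fst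
  set Z : Submodule ℝ (L2Pair G) := H1 univ G ⊓ LinearMap.ker ℓ.toLinearMap with hZ
  have hZc : IsClosed (Z : Set (L2Pair G)) :=
    (isClosed_H1 univ G).inter (ContinuousLinearMap.isClosed_ker ℓ)
  have : CompleteSpace Z := hZc.completeSpace_coe
  set T : Z →L[ℝ] L2Vec n (volume.restrict G) :=
    (WithLp.sndL 2 ℝ (L2 G) (L2Vec n (volume.restrict G))).comp Z.subtypeL with hT
  have hTa : ∀ z : Z, T z = z.1.snd := fun z => rfl
  -- On pairs with zero mean the Poincaré–Wirtinger inequality bounds the function by its gradient,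
  -- so the gradient map is bounded below and its range is closed.
  have hbound : ∀ z : Z, ‖z‖ ≤ Real.toNNReal (Real.sqrt (C / volume.real G + 1)) * ‖T z‖ := by
    intro z
    rw [Real.coe_toNNReal _ (Real.sqrt_nonneg _)]
    have h1 := hC z.1 z.2.1
    have h2 : ℓ z.1 = 0 := z.2.2
    rw [← hℓi, h2] at h1
    have h3 : ‖z‖ ^ 2 = ‖z.1.fst‖ ^ 2 + ‖z.1.snd‖ ^ 2 := WithLp.prod_norm_sq_eq_of_L2 z.1
    refine abs_le_of_sq_le_sq' ?_ (by positivity) |>.2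
    rw [mul_pow, Real.sq_sqrt (by positivity), h3, hTa, add_mul, one_mul]
    have h4 : ‖z.1.fst‖ ^ 2 ≤ C / volume.real G * ‖z.1.snd‖ ^ 2 := by
      rw [div_mul_eq_mul_div, le_div_iff₀ hV]
      linarith
    linarith
  have hcl : IsClosed (LinearMap.range T.toLinearMap : Set (L2Vec n (volume.restrict G))) := by
    have := (AddMonoidHomClass.antilipschitz_of_bound T hbound).isClosed_range T.uniformContinuous
    rw [LinearMap.coe_range]
    exact this
  obtain ⟨Rad, -, hRad⟩ := hG.isBounded.exists_pos_norm_le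
  -- A compactly supported substitute for the constant 1: it equals 1 near each point of `G` and is
  -- used to subtract the mean of a test function.
  let χ : ContDiffBump (0 : Space n) := ⟨|Rad| + 1, |Rad| + 2, by positivity, by linarith⟩
  have hχ : IsTestFunction univ χ := ⟨χ.contDiff, χ.hasCompactSupport, subset_univ _⟩
  have hχ1 : ∀ x ∈ G, χ =ᶠ[𝓝 x] fun _ => 1 := by
    intro x hx
    have hx' : x ∈ Metric.ball (0 : Space n) (|Rad| + 1) := by
      rw [mem_ball_zero_iff]
      linarith [hRad x hx, le_abs_self Rad]
    filter_upwards [Metric.isOpen_ball.mem_nhds hx'] with y hy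
    exact χ.one_of_mem_closedBall (Metric.ball_subset_closedBall hy)
  have hχpd : ∀ x ∈ G, ∀ i, pd i χ x = 0 := by
    intro x hx i
    rw [pd, (hχ1 x hx).fderiv_eq]
    simp
  have hmem : m ∈ LinearMap.range T.toLinearMap := by
    rw [← hcl.submodule_topologicalClosure_eq, ← Submodule.orthogonal_orthogonal_eq_closure,
      Submodule.mem_orthogonal]
    intro q hq
    refine hm q fun φ hφ => ?_
    set c := (∫ x in G, φ x) / volume.real G with hc
    have hψ := hφ.add (hχ.const_smul (-c))
    have hψZ : hψ.pair G ∈ Z := by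
      refine ⟨hψ.pair_mem_H1, ?_⟩
      change ℓ _ = 0
      rw [hℓi, integral_congr_ae hψ.pair_fst]
      have i1 : IntegrableOn φ G := hφ.integrable.integrableOn
      have i2 : IntegrableOn (fun x => -c • χ x) G := (hχ.const_smul (-c)).integrable.integrableOn
      rw [integral_add i1 i2, setIntegral_congr_fun (f := fun x => -c • χ x)
        hG.isOpen.measurableSet (g := fun _ => -c)
        fun x hx => by simp [(hχ1 x hx).self_of_nhds]]
      rw [setIntegral_const, smul_eq_mul, hc]
      field_simp
      ring
    have h1 := (Submodule.mem_orthogonal' _ _).1 hq (T ⟨_, hψZ⟩) ⟨_, rfl⟩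
    rw [PiLp.inner_apply] at h1
    rw [← h1]
    refine Finset.sum_congr rfl fun i _ => ?_
    rw [inner_L2_eq]
    refine integral_congr_ae ?_
    filter_upwards [hψ.pair_snd (G := G) i, ae_restrict_mem hG.isOpen.measurableSet] with x e1 hx
    rw [hTa]
    simp only [e1]
    rw [pd_add hφ.differentiable (hχ.const_smul (-c)).differentiable,
      pd_const_smul hχ.differentiable, hχpd x hx]
    simp
  obtain ⟨z, hz⟩ := hmem
  have hz' : z.1.snd = m := hz
  refine ⟨z.1.fst, ?_, ?_⟩
  · rw [← hℓi]; exact z.2.2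
  · rw [← hz']; exact z.2.1

/-- The Lax–Milgram theorem for a coercive system with skew-symmetric coupling. -/
theorem exists_unique_skew {V K : Type*} [NormedAddCommGroup V] [InnerProductSpace ℝ V]
    [CompleteSpace V] [NormedAddCommGroup K] [InnerProductSpace ℝ K] [CompleteSpace K]
    {a : V →L[ℝ] V →L[ℝ] ℝ} {b : K →L[ℝ] K →L[ℝ] ℝ} (c : V →L[ℝ] K →L[ℝ] ℝ)
    (ha : IsCoercive a) (hb : IsCoercive b) (f : V →L[ℝ] ℝ) (g : K →L[ℝ] ℝ) :
    ∃! p : V × K, (∀ ξ, a p.1 ξ - c ξ p.2 = f ξ) ∧ ∀ φ, c p.1 φ + b p.2 φ = g φ := by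
  obtain ⟨Ca, hCa, ha⟩ := ha
  obtain ⟨Cb, hCb, hb⟩ := hb
  let π₁ : WithLp 2 (V × K) →L[ℝ] V := WithLp.fstL 2 ℝ V K
  let π₂ : WithLp 2 (V × K) →L[ℝ] K := WithLp.sndL 2 ℝ V K
  let B : WithLp 2 (V × K) →L[ℝ] WithLp 2 (V × K) →L[ℝ] ℝ :=
    a.bilinearComp π₁ π₁ - (c.flip).bilinearComp π₂ π₁ + c.bilinearComp π₁ π₂ +
      b.bilinearComp π₂ π₂
  have hBa : ∀ x y, B x y = a x.fst y.fst - c y.fst x.snd + c x.fst y.snd + b x.snd y.snd :=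
    fun x y => rfl
  -- On the diagonal the two coupling terms cancel, which leaves the two coercive forms.
  have hB : IsCoercive B := by
    refine ⟨min Ca Cb, lt_min hCa hCb, fun x => ?_⟩
    have h1 := ha x.fst
    have h2 := hb x.snd
    have h3 : ‖x‖ ^ 2 = ‖x.fst‖ ^ 2 + ‖x.snd‖ ^ 2 := WithLp.prod_norm_sq_eq_of_L2 x
    have h4 : min Ca Cb * ‖x.fst‖ ^ 2 ≤ Ca * ‖x.fst‖ ^ 2 := by gcongr; exact min_le_left _ _
    have h5 : min Ca Cb * ‖x.snd‖ ^ 2 ≤ Cb * ‖x.snd‖ ^ 2 := by gcongr; exact min_le_right _ _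
    rw [hBa, mul_assoc, ← sq, h3]
    rw [mul_assoc, ← sq] at h1 h2
    linarith
  let L : WithLp 2 (V × K) →L[ℝ] ℝ := f.comp π₁ + g.comp π₂
  have hL : ∀ y, L y = f y.fst + g y.snd := fun y => rfl
  have hiff : ∀ p : V × K, ((∀ ξ, a p.1 ξ - c ξ p.2 = f ξ) ∧ ∀ φ, c p.1 φ + b p.2 φ = g φ) ↔
      ∀ y, B (WithLp.toLp 2 p) y = L y := by
    intro p
    constructor
    · rintro ⟨h1, h2⟩ y
      rw [hBa, hL, ← h1, ← h2]
      change a p.1 y.fst - c y.fst p.2 + c p.1 y.snd + b p.2 y.snd = _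
      ring
    · intro h
      refine ⟨fun ξ => ?_, fun φ => ?_⟩
      · have := h (WithLp.toLp 2 (ξ, 0))
        rw [hBa, hL] at this
        simpa using this
      · have := h (WithLp.toLp 2 (0, φ))
        rw [hBa, hL] at this
        simpa using this
  let r := (InnerProductSpace.toDual ℝ (WithLp 2 (V × K))).symm L
  have hr : ∀ y, inner ℝ r y = L y := fun y => InnerProductSpace.toDual_symm_apply
  let x := hB.continuousLinearEquivOfBilin.symm r
  refine ⟨x.ofLp, (hiff _).2 fun y => ?_, fun q hq => ?_⟩
  · change B x y = L y
    rw [← hr, ← hB.continuousLinearEquivOfBilin_apply, ContinuousLinearEquiv.apply_symm_apply]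
  · have h1 := (hiff q).1 hq
    have h2 : r = hB.continuousLinearEquivOfBilin (WithLp.toLp 2 q) :=
      hB.unique_continuousLinearEquivOfBilin fun y => by rw [hr, h1]
    have h3 : x = WithLp.toLp 2 q := by
      simp only [x, h2, ContinuousLinearEquiv.symm_apply_apply]
    rw [h3]

/-! ### Square integrable functions with values in a Hilbert space -/

section LpTools

variable {α : Type*} [MeasurableSpace α] {ν : Measure α}
variable {E E' : Type*} [NormedAddCommGroup E] [InnerProductSpace ℝ E] [NormedAddCommGroup E']
  [InnerProductSpace ℝ E']

theorem norm_sq_Lp_eq (y : Lp E 2 ν) : ‖y‖ ^ 2 = ∫ x, ‖y x‖ ^ 2 ∂ν := by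
  rw [← real_inner_self_eq_norm_sq, L2.inner_def]
  simp only [real_inner_self_eq_norm_sq]

theorem integrable_norm_sq_Lp (y : Lp E 2 ν) : Integrable (fun x => ‖y x‖ ^ 2) ν := by
  have := L2.integrable_inner (𝕜 := ℝ) y y
  simpa only [real_inner_self_eq_norm_sq] using this

theorem norm_sq_Lp_le {y : Lp E 2 ν} {y' : Lp E' 2 ν} {C : ℝ}
    (h : ∀ᵐ x ∂ν, ‖y x‖ ^ 2 ≤ C * ‖y' x‖ ^ 2) : ‖y‖ ^ 2 ≤ C * ‖y'‖ ^ 2 := by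
  rw [norm_sq_Lp_eq, norm_sq_Lp_eq, ← integral_const_mul]
  exact integral_mono_ae (integrable_norm_sq_Lp y) ((integrable_norm_sq_Lp y').const_mul C) h

theorem le_inner_compLpL {T : E →L[ℝ] E} {c : ℝ} (h : ∀ e, c * ‖e‖ ^ 2 ≤ inner ℝ e (T e))
    (y : Lp E 2 ν) : c * ‖y‖ ^ 2 ≤ inner ℝ y (T.compLpL 2 ν y) := by
  rw [norm_sq_Lp_eq, L2.inner_def, ← integral_const_mul]
  refine integral_mono_ae ((integrable_norm_sq_Lp y).const_mul c) (L2.integrable_inner _ _) ?_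
  filter_upwards [T.coeFn_compLpL y] with x hx
  rw [hx]
  exact h _

/-- A bounded functional on `L²(ν; E)` which vanishes on the fields `v(x) w` vanishes. -/
theorem eq_zero_of_forall_smulRight {Λ : Lp E 2 ν →L[ℝ] ℝ}
    (h : ∀ (w : E) (v : Lp ℝ 2 ν),
      Λ (((ContinuousLinearMap.id ℝ ℝ).smulRight w).compLpL 2 ν v) = 0) : Λ = 0 := by
  ext y
  refine Lp.induction (p := 2) (by simp) (fun y => Λ y = 0) ?_ ?_ ?_ y
  · intro w s hs hμs
    rw [← h w (indicatorConstLp 2 hs hμs.ne 1)]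
    congr 1
    rw [Lp.simpleFunc.coe_indicatorConst]
    refine Lp.ext ?_
    filter_upwards [((ContinuousLinearMap.id ℝ ℝ).smulRight w).coeFn_compLpL
      (indicatorConstLp 2 hs hμs.ne (1 : ℝ)), indicatorConstLp_coeFn (p := 2) (hs := hs)
      (hμs := hμs.ne) (c := (1 : ℝ)), indicatorConstLp_coeFn (p := 2) (hs := hs)
      (hμs := hμs.ne) (c := w)] with x h1 h2 h3
    rw [h1, h2, h3]
    by_cases hx : x ∈ s <;> simp [hx]
  · intro f g hf hg _ h1 h2
    rw [map_add, h1, h2, add_zero]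
  · exact isClosed_eq Λ.continuous continuous_const

end LpTools

/-! ### Multiplication by bounded weights -/

section Weights

variable {n : ℕ} {Ω : Type*} [MeasurableSpace Ω] {μ : Measure Ω} {w : Ω → ℝ}

/-- Multiplication by a bounded weight in `L²(μ)ⁿ`. -/
def mulVec (n : ℕ) (hw : MemLp w ⊤ μ) : L2Vec n μ →L[ℝ] L2Vec n μ :=
  ((PiLp.continuousLinearEquiv 2 ℝ (fun _ : Fin n => Lp ℝ 2 μ)).symm :
    (Fin n → Lp ℝ 2 μ) →L[ℝ] L2Vec n μ).comp
    (ContinuousLinearMap.pi fun i =>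
      ((ContinuousLinearMap.mul ℝ ℝ).holderL μ ⊤ 2 2 (hw.toLp w)).comp
        (PiLp.proj (𝕜 := ℝ) 2 (fun _ : Fin n => Lp ℝ 2 μ) i))

theorem mulVec_coeFn (hw : MemLp w ⊤ μ) (y : L2Vec n μ) (i : Fin n) :
    mulVec n hw y i =ᵐ[μ] fun ω => w ω * y i ω := by
  have h : mulVec n hw y i = (ContinuousLinearMap.mul ℝ ℝ).holder 2 (hw.toLp w) (y i) := rfl
  rw [h]
  filter_upwards [(ContinuousLinearMap.mul ℝ ℝ).coeFn_holder (r := 2) (hw.toLp w) (y i),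
    hw.coeFn_toLp] with ω h1 h2
  rw [h1, h2]; rfl

theorem inner_eval (x y : L2Vec n μ) (ω : Ω) :
    inner ℝ (x.eval ω) (y.eval ω) = ∑ i, y i ω * x i ω := by
  simp [PiLp.inner_apply, L2Vec.eval, mul_comm]

theorem inner_mulVec_ae (hw : MemLp w ⊤ μ) (x y : L2Vec n μ) :
    (fun ω => w ω * inner ℝ (x.eval ω) (y.eval ω)) =ᵐ[μ]
      fun ω => ∑ i, inner ℝ (x i ω) (mulVec n hw y i ω) := by
  filter_upwards [ae_all_iff.2 fun i => mulVec_coeFn hw y i] with ω h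
  simp only [h, inner_eval, Finset.mul_sum]
  refine Finset.sum_congr rfl fun i _ => ?_
  simp; ring

theorem integrable_mul_inner_eval (hw : MemLp w ⊤ μ) (x y : L2Vec n μ) :
    Integrable (fun ω => w ω * inner ℝ (x.eval ω) (y.eval ω)) μ :=
  (integrable_finsetSum _ fun _ _ => L2.integrable_inner _ _).congr (inner_mulVec_ae hw x y).symm

theorem integral_mul_inner_eval (hw : MemLp w ⊤ μ) (x y : L2Vec n μ) :
    ∫ ω, w ω * inner ℝ (x.eval ω) (y.eval ω) ∂μ = inner ℝ x (mulVec n hw y) := by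
  rw [integral_congr_ae (inner_mulVec_ae hw x y),
    integral_finsetSum _ fun _ _ => L2.integrable_inner _ _, PiLp.inner_apply]
  rfl

theorem integrable_inner_eval (x y : L2Vec n μ) :
    Integrable (fun ω => inner ℝ (x.eval ω) (y.eval ω)) μ := by
  have h : (fun ω => inner ℝ (x.eval ω) (y.eval ω)) = fun ω => ∑ i, inner ℝ (x i ω) (y i ω) := by
    funext ω; simp [inner_eval]
  rw [h]
  exact integrable_finsetSum _ fun _ _ => L2.integrable_inner _ _

theorem integral_inner_eval (x y : L2Vec n μ) :
    ∫ ω, inner ℝ (x.eval ω) (y.eval ω) ∂μ = inner ℝ x y := by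
  have h : (fun ω => inner ℝ (x.eval ω) (y.eval ω)) = fun ω => ∑ i, inner ℝ (x i ω) (y i ω) := by
    funext ω; simp [inner_eval]
  rw [h, integral_finsetSum _ fun _ _ => L2.integrable_inner _ _, PiLp.inner_apply]
  rfl

theorem le_inner_mulVec (hw : MemLp w ⊤ μ) {c : ℝ} (hc : ∀ᵐ ω ∂μ, c ≤ w ω) (x : L2Vec n μ) :
    c * ‖x‖ ^ 2 ≤ inner ℝ x (mulVec n hw x) := by
  rw [← real_inner_self_eq_norm_sq, ← integral_inner_eval, ← integral_mul_inner_eval hw,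
    ← integral_const_mul]
  refine integral_mono_ae ((integrable_inner_eval x x).const_mul c)
    (integrable_mul_inner_eval hw x x) ?_
  filter_upwards [hc] with ω h
  exact mul_le_mul_of_nonneg_right h real_inner_self_nonneg

theorem eval_add (x y : L2Vec n μ) : ∀ᵐ ω ∂μ, (x + y).eval ω = x.eval ω + y.eval ω := by
  have h : ∀ i, ∀ᵐ ω ∂μ, (x + y) i ω = x i ω + y i ω := fun i => Lp.coeFn_add (x i) (y i)
  filter_upwards [ae_all_iff.2 h] with ω hω
  ext i
  exact hω i

theorem concentration_bounds {N : ℕ} {nc : Fin N → ℝ} (hnc : ∀ j, 0 < nc j) (z : Fin N → ℤ)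
    {Ψ : Ω → ℝ} (hΨ : MemLp Ψ ⊤ μ) (j : Fin N) :
    MemLp (concentration nc z Ψ j) ⊤ μ ∧ ∃ c > 0, ∀ᵐ ω ∂μ, c ≤ concentration nc z Ψ j ω := by
  obtain ⟨M, hM⟩ : ∃ M : ℝ, ∀ᵐ ω ∂μ, ‖Ψ ω‖ ≤ M :=
    ⟨(eLpNormEssSup Ψ μ).toReal, by
      have h1 : eLpNormEssSup Ψ μ ≠ ⊤ := by simpa using hΨ.2.ne
      filter_upwards [enorm_ae_le_eLpNormEssSup Ψ μ] with ω h
      rw [← toReal_enorm]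
      exact ENNReal.toReal_mono h1 h⟩
  have hb : ∀ᵐ ω ∂μ, abs (-(z j : ℝ) * Ψ ω) ≤ |(z j : ℝ)| * M := by
    filter_upwards [hM] with ω h
    rw [abs_mul, abs_neg]
    exact mul_le_mul_of_nonneg_left h (abs_nonneg _)
  have hm : AEStronglyMeasurable (concentration nc z Ψ j) μ :=
    (Real.continuous_exp.comp_aestronglyMeasurable (hΨ.1.const_mul _)).const_mul _
  refine ⟨memLp_top_of_bound hm (nc j * Real.exp (|(z j : ℝ)| * M)) ?_,
    nc j * Real.exp (-(|(z j : ℝ)| * M)), mul_pos (hnc j) (Real.exp_pos _), ?_⟩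
  · filter_upwards [hb] with ω h
    rw [concentration, Real.norm_of_nonneg (mul_nonneg (hnc j).le (Real.exp_pos _).le)]
    exact mul_le_mul_of_nonneg_left (Real.exp_le_exp.2 (le_abs_self _ |>.trans h)) (hnc j).le
  · filter_upwards [hb] with ω h
    exact mul_le_mul_of_nonneg_left (Real.exp_le_exp.2 (abs_le.1 h).1) (hnc j).le

end Weights

theorem t2Space_of_norm (E : Type*) [NormedAddCommGroup E] : T2Space E := inferInstance

/-! ### The two-scale spaces and their coercivity estimates -/

namespace ErgodicSystem

variable {n : ℕ} {Ω : Type*} [MeasurableSpace Ω] {μ : Measure Ω} (S : ErgodicSystem n μ)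
variable [IsProbabilityMeasure μ] (F : Set Ω) (G : Set (Space n))

instance : InnerProductSpace ℝ S.D := Submodule.innerProductSpace _
instance : NormedSpace ℝ S.D := Submodule.normedSpace _
instance : InnerProductSpace ℝ S.DVec := PiLp.innerProductSpace _
instance : NormedSpace ℝ S.DVec := PiLp.normedSpace 2 ℝ _

instance : InnerProductSpace ℝ (Lp S.DVec 2 (volume.restrict G)) := L2.innerProductSpace
instance : NormedSpace ℝ (Lp S.DVec 2 (volume.restrict G)) := Lp.instNormedSpace
instance : Module ℝ (Lp S.DVec 2 (volume.restrict G)) := Lp.instModule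
instance : T2Space (Lp S.DVec 2 (volume.restrict G)) := t2Space_of_norm _

/-- The space `L²(G; L²(F)ⁿ)`. -/
abbrev L2Pore (μ : Measure Ω) (F : Set Ω) (G : Set (Space n)) : Type _ :=
  Lp (L2Vec n (μ.restrict F)) 2 (volume.restrict G)

/-- The values in the pores of a velocity field. -/
def evL : Lp S.DVec 2 (volume.restrict G) →L[ℝ] L2Pore μ F G :=
  (S.evalL F).compLpL 2 (volume.restrict G)

/-- The stochastic velocity gradient in `F`. -/
def gradL : S.DVec →L[ℝ] PiLp 2 (fun _ : Fin n × Fin n => Lp ℝ 2 (μ.restrict F)) :=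
  ((PiLp.continuousLinearEquiv 2 ℝ (fun _ : Fin n × Fin n => Lp ℝ 2 (μ.restrict F))).symm :
    (Fin n × Fin n → Lp ℝ 2 (μ.restrict F)) →L[ℝ]
      PiLp 2 (fun _ : Fin n × Fin n => Lp ℝ 2 (μ.restrict F))).comp
    (ContinuousLinearMap.pi fun ik => (restr F).comp ((S.derivL ik.2).comp (S.compL ik.1)))

@[simp] theorem gradL_apply (z : S.DVec) (ik : Fin n × Fin n) :
    S.gradL F z ik = restr F (S.deriv ik.2 (z ik.1)) := rfl

/-- The stochastic gradient of a two-scale velocity field. -/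
def grL : Lp S.DVec 2 (volume.restrict G) →L[ℝ]
    Lp (PiLp 2 (fun _ : Fin n × Fin n => Lp ℝ 2 (μ.restrict F))) 2 (volume.restrict G) :=
  (S.gradL F).compLpL 2 (volume.restrict G)

/-- The fields `v(x) w`. -/
def tens {H : Type*} [NormedAddCommGroup H] [NormedSpace ℝ H] (G : Set (Space n)) (w : H) :
    L2 G →L[ℝ] Lp H 2 (volume.restrict G) :=
  ((ContinuousLinearMap.id ℝ ℝ).smulRight w).compLpL 2 (volume.restrict G)

theorem tens_coeFn {H : Type*} [NormedAddCommGroup H] [NormedSpace ℝ H] (w : H) (v : L2 G) :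
    ∀ᵐ x ∂(volume.restrict G), tens G w v x = v x • w :=
  ((ContinuousLinearMap.id ℝ ℝ).smulRight w).coeFn_compLpL v

/-- Macroscopic fields as two-scale fields. -/
def constY (μ : Measure Ω) [IsProbabilityMeasure μ] (F : Set Ω) (G : Set (Space n)) :
    L2Vec n (volume.restrict G) →L[ℝ] L2Pore μ F G :=
  ∑ i, (tens G (constL μ F (basisVec i))).comp
    (PiLp.proj (𝕜 := ℝ) 2 (fun _ : Fin n => L2 G) i)

theorem constY_coeFn (m : L2Vec n (volume.restrict G)) :
    ∀ᵐ x ∂(volume.restrict G), constY μ F G m x = constL μ F (m.eval x) := by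
  have h1 : constY μ F G m = ∑ i, tens G (constL μ F (basisVec i)) (m i) := by
    simp [constY]
  rw [h1]
  filter_upwards [Lp.coeFn_fun_finsetSum Finset.univ
    (fun i => tens G (constL μ F (basisVec i)) (m i)),
    ae_all_iff.2 fun i => tens_coeFn G (constL μ F (basisVec i)) (m i)] with x h2 h3
  rw [h2]
  simp only [h3, ← map_smul, ← map_sum]
  congr 1
  ext i
  simp [L2Vec.eval, Pi.single_apply]

/-- Two-scale correctors as two-scale fields. -/
def inclX : Lp (S.X F) 2 (volume.restrict G) →L[ℝ] L2Pore μ F G :=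
  (S.X F).subtypeL.compLpL 2 (volume.restrict G)

theorem inclX_coeFn (g : Lp (S.X F) 2 (volume.restrict G)) :
    ∀ᵐ x ∂(volume.restrict G), S.inclX F G g x = (g x : L2Vec n (μ.restrict F)) :=
  (S.X F).subtypeL.coeFn_compLpL g

/-- The space `H¹₀(G) × L²(G; X)` of one ionic potential. -/
abbrev Potential : Type _ := WithLp 2 (H1 G G × Lp (S.X F) 2 (volume.restrict G))

/-- The two-scale gradient `∇Φ⁰ + Φ¹`. -/
def flux : S.Potential F G →L[ℝ] L2Pore μ F G :=
  (constY μ F G).comp ((WithLp.sndL 2 ℝ (L2 G) (L2Vec n (volume.restrict G))).comp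
    ((H1 G G).subtypeL.comp (WithLp.fstL 2 ℝ _ _))) +
  (S.inclX F G).comp (WithLp.sndL 2 ℝ _ _)

theorem flux_apply (κ : S.Potential F G) :
    S.flux F G κ = constY μ F G κ.fst.1.snd + S.inclX F G κ.snd := rfl

theorem flux_coeFn (κ : S.Potential F G) : ∀ᵐ x ∂(volume.restrict G),
    S.flux F G κ x = constL μ F (κ.fst.1.snd.eval x) + (κ.snd x : L2Vec n (μ.restrict F)) := by
  rw [flux_apply]
  filter_upwards [Lp.coeFn_add (constY μ F G κ.fst.1.snd) (S.inclX F G κ.snd),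
    constY_coeFn (μ := μ) F G κ.fst.1.snd, S.inclX_coeFn F G κ.snd] with x h1 h2 h3
  rw [h1, Pi.add_apply, h2, h3]

/-- The components of the expectation of a two-scale velocity field. -/
def meanZ (i : Fin n) : Lp S.DVec 2 (volume.restrict G) →L[ℝ] L2 G :=
  ((PiLp.proj (𝕜 := ℝ) 2 (fun _ : Fin n => ℝ) i).comp S.meanL).compLpL 2 (volume.restrict G)

theorem meanZ_coeFn (i : Fin n) (z : Lp S.DVec 2 (volume.restrict G)) :
    ∀ᵐ x ∂(volume.restrict G), S.meanZ G i z x = S.mean (z x) i := by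
  filter_upwards [((PiLp.proj (𝕜 := ℝ) 2 (fun _ : Fin n => ℝ) i).comp S.meanL).coeFn_compLpL z]
    with x hx
  rw [meanZ, hx]
  simp

instance : CompleteSpace (S.Wsub F) := (S.isClosed_Wsub F).completeSpace_coe

/-- The two-scale velocity fields with values in `W`. -/
def WZ : Submodule ℝ (Lp S.DVec 2 (volume.restrict G)) :=
  LinearMap.ker (((S.Wsub F).starProjection.compLpL 2 (volume.restrict G) :
    Lp S.DVec 2 (volume.restrict G) →L[ℝ] Lp S.DVec 2 (volume.restrict G)) -
    ContinuousLinearMap.id ℝ (Lp S.DVec 2 (volume.restrict G))).toLinearMap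

theorem mem_WZ_iff_proj {z : Lp S.DVec 2 (volume.restrict G)} : z ∈ S.WZ F G ↔
    (S.Wsub F).starProjection.compLpL 2 (volume.restrict G) z = z := by
  rw [WZ, LinearMap.mem_ker]
  exact sub_eq_zero

/-- The pointwise constraint is the fixed-point equation of a continuous operator, the pointwise
projection onto the closed subspace `Wsub`. -/
theorem isClosed_WZ : IsClosed (S.WZ F G : Set (Lp S.DVec 2 (volume.restrict G))) := by
  have h : (S.WZ F G : Set (Lp S.DVec 2 (volume.restrict G))) =
      {z | (S.Wsub F).starProjection.compLpL 2 (volume.restrict G) z = z} :=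
    Set.ext fun z => S.mem_WZ_iff_proj F G
  rw [h]
  let T : Lp S.DVec 2 (volume.restrict G) →L[ℝ] Lp S.DVec 2 (volume.restrict G) :=
    (S.Wsub F).starProjection.compLpL 2 (volume.restrict G)
  exact isClosed_eq T.continuous continuous_id

theorem mem_WZ {z : Lp S.DVec 2 (volume.restrict G)} :
    z ∈ S.WZ F G ↔ ∀ᵐ x ∂(volume.restrict G), z x ∈ S.Wsub F := by
  rw [mem_WZ_iff_proj, Lp.ext_iff]
  have h := (S.Wsub F).starProjection.coeFn_compLpL (p := 2) (μ := volume.restrict G) z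
  constructor <;> intro h1 <;> filter_upwards [h, h1] with x h2 h3
  · rw [h2] at h3
    exact Submodule.starProjection_eq_self_iff.1 h3
  · rw [h2]
    exact Submodule.starProjection_eq_self_iff.2 h3

/-- The functional `z ↦ ∫ 𝔼(z) · ∇φ`. -/
def solL {φ : Space n → ℝ} (hφ : IsTestFunction univ φ) :
    Lp S.DVec 2 (volume.restrict G) →L[ℝ] ℝ :=
  ∑ i, (innerSL ℝ (((hφ.pd i).memLp G).toLp _ : L2 G)).comp (S.meanZ G i)

theorem solL_apply {φ : Space n → ℝ} (hφ : IsTestFunction univ φ)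
    (z : Lp S.DVec 2 (volume.restrict G)) :
    S.solL G hφ z = ∑ i, ∫ x in G, S.meanZ G i z x * pd i φ x := by
  have h : S.solL G hφ z =
      ∑ i, inner ℝ (((hφ.pd i).memLp G).toLp _ : L2 G) (S.meanZ G i z) := by
    simp [solL]
  rw [h]
  refine Finset.sum_congr rfl fun i _ => ?_
  rw [inner_L2_eq]
  refine integral_congr_ae ?_
  filter_upwards [((hφ.pd i).memLp G).coeFn_toLp] with x hx
  rw [hx, mul_comm]

/-- The velocity space `V`, as a linear subspace. -/
def Vsub : Submodule ℝ (Lp S.DVec 2 (volume.restrict G)) :=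
  S.WZ F G ⊓ ⨅ φ : {φ : Space n → ℝ // IsTestFunction univ φ},
    LinearMap.ker (S.solL G φ.2).toLinearMap

theorem isClosed_Vsub : IsClosed (S.Vsub F G : Set (Lp S.DVec 2 (volume.restrict G))) := by
  rw [Vsub, Submodule.coe_inf, Submodule.coe_iInf]
  exact (S.isClosed_WZ F G).inter
    (isClosed_iInter fun φ => ContinuousLinearMap.isClosed_ker (S.solL G φ.2))

instance : CompleteSpace (S.Vsub F G) := (S.isClosed_Vsub F G).completeSpace_coe

theorem mem_Vsub_iff {z : Lp S.DVec 2 (volume.restrict G)} : z ∈ S.Vsub F G ↔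
    z ∈ S.WZ F G ∧ ∀ φ, IsTestFunction univ φ →
      ∑ i, ∫ x in G, S.meanZ G i z x * pd i φ x = 0 := by
  rw [Vsub, Submodule.mem_inf, Submodule.mem_iInf]
  refine and_congr_right fun _ => ⟨fun h φ hφ => ?_, fun h φ => ?_⟩
  · rw [← S.solL_apply G hφ]; exact h ⟨φ, hφ⟩
  · change S.solL G φ.2 z = 0
    rw [solL_apply]; exact h φ.1 φ.2

theorem mem_Vsub {z : Lp S.DVec 2 (volume.restrict G)} : z ∈ S.Vsub F G ↔ z ∈ S.V F G := by
  rw [mem_Vsub_iff, mem_WZ, V]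
  refine and_congr (eventually_congr (Eventually.of_forall fun x => S.mem_Wsub)) ?_
  refine forall_congr' fun φ => forall_congr' fun hφ => ?_
  have h : ∫ x in G, inner ℝ (S.mean (z x)) (gradient φ x) =
      ∑ i, ∫ x in G, S.meanZ G i z x * pd i φ x := by
    rw [← integral_finsetSum]
    · refine integral_congr_ae ?_
      filter_upwards [ae_all_iff.2 fun i => S.meanZ_coeFn G i z] with x hx
      simp only [hx, PiLp.inner_apply, gradient_apply_eq_pd]
      refine Finset.sum_congr rfl fun i _ => ?_
      simp [mul_comm]
    · exact fun i _ => integrable_mul_L2 (Lp.memLp _) ((hφ.pd i).memLp G)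
  rw [h]

/-- The derivatives vanish on `ℳ` together with the field, so the gradient over `ℱ` alone controls
the graph norm. -/
theorem norm_sq_DVec_le {F : Set Ω} (hF : MeasurableSet F) {C : ℝ}
    (hC : ∀ f : S.D, (∀ᵐ ω ∂(μ.restrict Fᶜ), S.val f ω = 0) →
      ‖S.val f‖ ^ 2 ≤ C * ∑ i, ‖S.deriv i f‖ ^ 2) {z : S.DVec} (hz : z ∈ S.Wsub F) :
    ‖z‖ ^ 2 ≤ (C + 1) * ‖S.gradL F z‖ ^ 2 := by
  have h1 : ∀ i k, ‖restr F (S.deriv k (z i))‖ ^ 2 = ‖S.deriv k (z i)‖ ^ 2 := by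
    intro i k
    have hd := S.deriv_eq_zero_on hF (z i) (S.restr_compl_val hz i) k
    rw [← real_inner_self_eq_norm_sq, ← real_inner_self_eq_norm_sq,
      inner_restr_of_compl hF (restr_coeFn F _) hd]
  have h2 : ‖S.gradL F z‖ ^ 2 = ∑ i, ∑ k, ‖S.deriv k (z i)‖ ^ 2 := by
    rw [PiLp.norm_sq_eq_of_L2, Fintype.sum_prod_type]
    simp only [gradL_apply, h1]
  rw [h2, PiLp.norm_sq_eq_of_L2, Finset.mul_sum]
  refine Finset.sum_le_sum fun i _ => ?_
  rw [norm_sq_D]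
  have := hC (z i) (S.restr_compl_val hz i)
  linarith

/-- The stochastic gradient is coercive. -/
theorem IsDisperseMedium.exists_coercive_grL {F : Set Ω} (hF : S.IsDisperseMedium F) :
    ∃ C, 0 < C ∧ ∀ z ∈ S.WZ F G, ‖z‖ ^ 2 ≤ C * ‖S.grL F G z‖ ^ 2 := by
  obtain ⟨C, hC0, hC⟩ := S.exists_poincare hF ⟨0, by have := hF.two_le; omega⟩
  refine ⟨C + 1, by linarith, fun z hz => norm_sq_Lp_le ?_⟩
  filter_upwards [(S.mem_WZ F G).1 hz, (S.gradL F).coeFn_compLpL z] with x h1 h2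
  rw [grL, h2]
  exact S.norm_sq_DVec_le hF.measurableSet hC h1

theorem norm_sq_L2Vec_eq (m : L2Vec n (volume.restrict G)) :
    ‖m‖ ^ 2 = ∫ x in G, ‖m.eval x‖ ^ 2 := by
  rw [← real_inner_self_eq_norm_sq, ← integral_inner_eval]
  simp only [real_inner_self_eq_norm_sq]

theorem norm_sq_add_le {G : Set (Space n)} {E E' : Type*} [NormedAddCommGroup E]
    [InnerProductSpace ℝ E] [NormedAddCommGroup E'] [InnerProductSpace ℝ E']
    {m : L2Vec n (volume.restrict G)} {g : Lp E 2 (volume.restrict G)}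
    {y : Lp E' 2 (volume.restrict G)} {A : ℝ}
    (h : ∀ᵐ x ∂(volume.restrict G), ‖m.eval x‖ ^ 2 + ‖g x‖ ^ 2 ≤ A * ‖y x‖ ^ 2) :
    ‖m‖ ^ 2 + ‖g‖ ^ 2 ≤ A * ‖y‖ ^ 2 := by
  have i1 : Integrable (fun x => ‖m.eval x‖ ^ 2) (volume.restrict G) := by
    simpa only [real_inner_self_eq_norm_sq] using integrable_inner_eval m m
  have i2 := integrable_norm_sq_Lp g
  rw [norm_sq_L2Vec_eq, norm_sq_Lp_eq, norm_sq_Lp_eq, ← integral_const_mul, ← integral_add i1 i2]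
  exact integral_mono_ae (i1.add i2) ((integrable_norm_sq_Lp _).const_mul A) h

theorem norm_sq_Potential (κ : S.Potential F G) :
    ‖κ‖ ^ 2 = ‖κ.fst.1.fst‖ ^ 2 + ‖κ.fst.1.snd‖ ^ 2 + ‖κ.snd‖ ^ 2 := by
  have e3 : ‖κ‖ ^ 2 = ‖κ.fst‖ ^ 2 + ‖κ.snd‖ ^ 2 := WithLp.prod_norm_sq_eq_of_L2 κ
  have e4 : ‖κ.fst‖ ^ 2 = ‖κ.fst.1.fst‖ ^ 2 + ‖κ.fst.1.snd‖ ^ 2 :=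
    WithLp.prod_norm_sq_eq_of_L2 κ.fst.1
  rw [e3, e4]

/-- The angle estimate is applied for almost every `x`, with `v = ∇Φ⁰(x)` and `g = Φ¹(x)`, and
integrated over `G`. -/
theorem IsDisperseMedium.exists_angle_flux {F : Set Ω} (hF : S.IsDisperseMedium F) :
    ∃ A, 0 ≤ A ∧ ∀ κ : S.Potential F G,
      ‖κ.fst.1.snd‖ ^ 2 + ‖κ.snd‖ ^ 2 ≤ A * ‖S.flux F G κ‖ ^ 2 := by
  obtain ⟨ζ, h1, h2, h3⟩ := IsDisperseMedium.exists_unitFields S hF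
  obtain ⟨A, hA0, hA⟩ := IsDisperseMedium.exists_angle S hF h1 h2 h3
  refine ⟨A, hA0, fun κ => norm_sq_add_le (G := G) ?_⟩
  filter_upwards [S.flux_coeFn F G κ] with x hx
  rw [hx]
  exact hA _ _ (κ.snd x).2

/-- The two-scale gradient is coercive. -/
theorem IsDisperseMedium.exists_coercive_flux {F : Set Ω} (hF : S.IsDisperseMedium F)
    (hG : Bornology.IsBounded G) :
    ∃ C, 0 < C ∧ ∀ κ : S.Potential F G, ‖κ‖ ^ 2 ≤ C * ‖S.flux F G κ‖ ^ 2 := by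
  obtain ⟨A, hA0, hA⟩ := IsDisperseMedium.exists_angle_flux S G hF
  obtain ⟨B, hB0, hB⟩ := exists_poincare_H10 hG (⟨0, by have := hF.two_le; omega⟩ : Fin n)
  -- `A` bounds `∇Φ⁰` and `Φ¹` by the flux, `B` bounds `Φ⁰` by its gradient; the last 1 only makes
  -- the constant positive.
  refine ⟨(B + 1) * A + 1, by positivity, fun κ => ?_⟩
  have e1 := hA κ
  have e2 := hB κ.fst.1 κ.fst.2
  have aux : ∀ a b d y : ℝ, 0 ≤ d → 0 ≤ y → b + d ≤ A * y → a ≤ B * b →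
      a + b + d ≤ ((B + 1) * A + 1) * y := by
    intro a b d y hd hy h1 h2
    have := mul_nonneg hB0 hd
    have := mul_le_mul_of_nonneg_left h1 hB0
    linarith
  rw [norm_sq_Potential]
  exact aux _ _ _ _ (sq_nonneg _) (sq_nonneg _) e1 e2

end ErgodicSystem

theorem IsTestFunction.clm_comp {n : ℕ} {H H' : Type*} [NormedAddCommGroup H] [NormedSpace ℝ H]
    [NormedAddCommGroup H'] [NormedSpace ℝ H'] {A : Set (Space n)} {ξ : Space n → H}
    (h : IsTestFunction A ξ) (L : H →L[ℝ] H') : IsTestFunction A fun x => L (ξ x) where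
  contDiff := L.contDiff.comp h.contDiff
  hasCompactSupport := h.hasCompactSupport.comp_left (map_zero L)
  tsupport_subset := (tsupport_comp_subset (map_zero L) ξ).trans h.tsupport_subset

/-! ### The pressure of a functional on velocity fields -/

namespace ErgodicSystem

variable {n : ℕ} {Ω : Type*} [MeasurableSpace Ω] {μ : Measure Ω} (S : ErgodicSystem n μ)
variable [IsProbabilityMeasure μ] (F : Set Ω) (G : Set (Space n))

/-- The restriction to `G` of a test field. -/
def testZ {ξ : Space n → S.DVec} (h : IsTestFunction G ξ) : Lp S.DVec 2 (volume.restrict G) :=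
  (h.memLp G).toLp ξ

theorem testZ_coeFn {ξ : Space n → S.DVec} (h : IsTestFunction G ξ) :
    ∀ᵐ x ∂(volume.restrict G), S.testZ G h x = ξ x :=
  (h.memLp G).coeFn_toLp

theorem isTestFunction_mean {ξ : Space n → S.DVec} (h : IsTestFunction G ξ) (i : Fin n) :
    IsTestFunction G fun x => S.mean (ξ x) i := by
  have := h.clm_comp ((PiLp.proj (𝕜 := ℝ) 2 (fun _ : Fin n => ℝ) i).comp S.meanL)
  simpa using this

/-- `P` is the pressure of the functional `ℓ` on velocity fields. -/
def IsPressure (ℓ : Lp S.DVec 2 (volume.restrict G) →L[ℝ] ℝ) (P : L2 G) : Prop :=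
  ∀ (ξ : Space n → S.DVec) (h : IsTestFunction G ξ), (∀ x, ξ x ∈ S.W F) →
    ℓ (S.testZ G h) = ∑ i, ∫ x in G, P x * pd i (fun x => S.mean (ξ x) i) x

variable {F G}

theorem testZ_mem_WZ {ξ : Space n → S.DVec} (h : IsTestFunction G ξ) (hW : ∀ x, ξ x ∈ S.W F) :
    S.testZ G h ∈ S.WZ F G := by
  rw [mem_WZ]
  filter_upwards [S.testZ_coeFn G h] with x hx
  rw [hx, S.mem_Wsub]
  exact hW x

theorem meanZ_tens (i : Fin n) (w : S.DVec) (v : L2 G) :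
    S.meanZ G i (tens G w v) = (S.mean w i) • v := by
  refine Lp.ext ?_
  filter_upwards [S.meanZ_coeFn G i (tens G w v), tens_coeFn G w v,
    Lp.coeFn_smul (S.mean w i) v] with x h1 h2 h3
  rw [h1, h2, h3, ← S.meanL_apply, ← S.meanL_apply, map_smul]
  simp [mul_comm]

theorem tens_mem_WZ {w : S.DVec} (hw : w ∈ S.Wsub F) (v : L2 G) : tens G w v ∈ S.WZ F G := by
  rw [mem_WZ]
  filter_upwards [tens_coeFn G w v] with x hx
  rw [hx]
  exact (S.Wsub F).smul_mem _ hw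

theorem mem_Vsub_of_meanZ {z : Lp S.DVec 2 (volume.restrict G)} (hz : z ∈ S.WZ F G)
    {q : L2Vec n (volume.restrict G)} (hq : ∀ i, S.meanZ G i z = q i)
    (h : ∀ φ, IsTestFunction univ φ → ∑ i, ∫ x in G, q i x * pd i φ x = 0) : z ∈ S.Vsub F G := by
  rw [mem_Vsub_iff]
  refine ⟨hz, fun φ hφ => ?_⟩
  simp only [hq]
  exact h φ hφ

variable {ζ : Fin n → S.DVec}

/-- The lift of a macroscopic velocity field. -/
def lift (ζ : Fin n → S.DVec) (q : L2Vec n (volume.restrict G)) :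
    Lp S.DVec 2 (volume.restrict G) := ∑ i, tens G (ζ i) (q i)

theorem lift_mem_WZ (hζ : ∀ k, ζ k ∈ S.Wsub F) (q : L2Vec n (volume.restrict G)) :
    S.lift ζ q ∈ S.WZ F G :=
  Submodule.sum_mem _ fun i _ => S.tens_mem_WZ (hζ i) _

theorem meanZ_lift (hζ : ∀ k, S.mean (ζ k) = basisVec k) (q : L2Vec n (volume.restrict G))
    (i : Fin n) : S.meanZ G i (S.lift ζ q) = q i := by
  rw [lift, map_sum]
  simp only [S.meanZ_tens, hζ]
  rw [Finset.sum_eq_single i]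
  · simp
  · intro k _ hk
    simp [hk.symm]
  · simp

/-- The macroscopic density of a functional on velocity fields. -/
def density (ℓ : Lp S.DVec 2 (volume.restrict G) →L[ℝ] ℝ) (ζ : Fin n → S.DVec) :
    L2Vec n (volume.restrict G) :=
  WithLp.toLp 2 fun i => (InnerProductSpace.toDual ℝ (L2 G)).symm (ℓ.comp (tens G (ζ i)))

theorem inner_density (ℓ : Lp S.DVec 2 (volume.restrict G) →L[ℝ] ℝ) (i : Fin n) (v : L2 G) :
    inner ℝ (S.density ℓ ζ i) v = ℓ (tens G (ζ i) v) :=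
  InnerProductSpace.toDual_symm_apply

theorem apply_lift (ℓ : Lp S.DVec 2 (volume.restrict G) →L[ℝ] ℝ)
    (q : L2Vec n (volume.restrict G)) :
    ℓ (S.lift ζ q) = ∑ i, inner ℝ (S.density ℓ ζ i) (q i) := by
  simp only [inner_density, lift, map_sum]

/-- On lifts of solenoidal tangential fields the functional vanishes, so its density is a gradient.
An arbitrary test field differs from the lift of its expectation by an element of `V`. -/
theorem exists_isPressure (hG : IsBoundedDomain smooth G) (hζ : ∀ k, ζ k ∈ S.Wsub F)
    (hζ' : ∀ k, S.mean (ζ k) = basisVec k) {ℓ : Lp S.DVec 2 (volume.restrict G) →L[ℝ] ℝ}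
    (hℓ : ∀ z ∈ S.Vsub F G, ℓ z = 0) : ∃ P ∈ L2Zero G, S.IsPressure F G ℓ P := by
  have hm : ∀ q : L2Vec n (volume.restrict G), (∀ φ, IsTestFunction univ φ →
      ∑ i, ∫ x in G, q i x * pd i φ x = 0) → inner ℝ q (S.density ℓ ζ) = 0 := by
    intro q hq
    have h := hℓ _ (S.mem_Vsub_of_meanZ (S.lift_mem_WZ hζ q) (S.meanZ_lift hζ' q) hq)
    rw [apply_lift] at h
    rw [real_inner_comm, PiLp.inner_apply]
    exact h
  obtain ⟨P, hP, hPm⟩ := hG.exists_pressure hm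
  have hneg : ∀ᵐ x ∂(volume.restrict G), (-P) x = -P x := Lp.coeFn_neg P
  -- The density is `∇P`, and integration by parts against the expectation of `ξ` changes the sign.
  refine ⟨-P, ?_, fun ξ h hW => ?_⟩
  · change ∫ x in G, (-P) x = 0
    rw [integral_congr_ae hneg, integral_neg, hP, neg_zero]
  · let q : L2Vec n (volume.restrict G) := WithLp.toLp 2 fun i => S.meanZ G i (S.testZ G h)
    -- Its expectation is zero, which is trivially solenoidal and tangential.
    have h1 : S.testZ G h - S.lift ζ q ∈ S.Vsub F G := by
      refine S.mem_Vsub_of_meanZ (q := 0) (Submodule.sub_mem _ (S.testZ_mem_WZ h hW)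
        (S.lift_mem_WZ hζ q)) (fun i => ?_) fun φ hφ => ?_
      · rw [map_sub, S.meanZ_lift hζ']
        exact sub_self _
      · refine Finset.sum_eq_zero fun i _ => ?_
        have : ∀ᵐ x ∂(volume.restrict G), (0 : L2 G) x * pd i φ x = 0 := by
          filter_upwards [Lp.coeFn_zero ℝ 2 (volume.restrict G)] with x hx
          rw [hx]; simp
        exact integral_eq_zero_of_ae this
    have h2 := hℓ _ h1
    rw [map_sub, sub_eq_zero, apply_lift] at h2
    rw [h2]
    refine Finset.sum_congr rfl fun i _ => ?_
    have h3 := integral_mul_pd_of_mem_H1 hPm (S.isTestFunction_mean G h i) i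
    have h4 : ∫ x in G, (-P) x * pd i (fun x => S.mean (ξ x) i) x =
        -∫ x in G, P x * pd i (fun x => S.mean (ξ x) i) x := by
      rw [← integral_neg]
      exact integral_congr_ae (hneg.mono fun x hx => by simp only [hx, neg_mul])
    rw [inner_L2_eq, h4]
    refine Eq.trans ?_ (neg_eq_iff_eq_neg.2 h3).symm
    refine integral_congr_ae ?_
    filter_upwards [S.meanZ_coeFn G i (S.testZ G h), S.testZ_coeFn G h] with x h5 h6
    change _ * S.meanZ G i (S.testZ G h) x = _
    rw [h5, h6]
    rfl

theorem isTestFunction_smul {φ : Space n → ℝ} (hφ : IsTestFunction G φ) (w : S.DVec) :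
    IsTestFunction G fun x => φ x • w :=
  hφ.clm_comp ((ContinuousLinearMap.id ℝ ℝ).smulRight w)

theorem testZ_smul {φ : Space n → ℝ} (hφ : IsTestFunction G φ) (w : S.DVec) :
    S.testZ G (S.isTestFunction_smul hφ w) = tens G w ((hφ.memLp G).toLp φ) := by
  refine Lp.ext ?_
  filter_upwards [S.testZ_coeFn G (S.isTestFunction_smul hφ w),
    tens_coeFn G w ((hφ.memLp G).toLp φ), (hφ.memLp G).coeFn_toLp] with x h1 h2 h3
  rw [h1, h2, h3]

/-- Separated test fields `φ(x) w` are enough to determine the functional on fields with values in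
`Wsub`, and with `w = ζ_i` they identify the weak gradient of `P`. -/
theorem IsPressure.apply_tens {ℓ : Lp S.DVec 2 (volume.restrict G) →L[ℝ] ℝ} {P : L2 G}
    (hP : S.IsPressure F G ℓ P) {w : S.DVec} (hw : w ∈ S.Wsub F) {φ : Space n → ℝ}
    (hφ : IsTestFunction G φ) :
    ℓ (tens G w ((hφ.memLp G).toLp φ)) = ∑ i, S.mean w i * ∫ x in G, P x * pd i φ x := by
  rw [← S.testZ_smul hφ w, hP _ _ fun x => S.mem_Wsub.1 ((S.Wsub F).smul_mem _ hw)]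
  refine Finset.sum_congr rfl fun i _ => ?_
  have h1 : (fun x => S.mean (φ x • w) i) = fun x => S.mean w i • φ x := by
    ext x
    rw [← S.meanL_apply, ← S.meanL_apply, map_smul]
    simp [mul_comm]
  rw [h1, ← integral_const_mul]
  refine integral_congr_ae (Eventually.of_forall fun x => ?_)
  have h2 := pd_const_smul (hφ.contDiff.differentiable (by simp)) (S.mean w i) i
  change P x * pd i (fun x => S.mean w i • φ x) x = _
  rw [h2 x, smul_eq_mul]
  ring

theorem IsPressure.inner_density {ℓ : Lp S.DVec 2 (volume.restrict G) →L[ℝ] ℝ} {P : L2 G}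
    (hP : S.IsPressure F G ℓ P) (hζ : ∀ k, ζ k ∈ S.Wsub F)
    (hζ' : ∀ k, S.mean (ζ k) = basisVec k) {φ : Space n → ℝ} (hφ : IsTestFunction G φ)
    (i : Fin n) :
    inner ℝ (S.density ℓ ζ i) ((hφ.memLp G).toLp φ) = ∫ x in G, P x * pd i φ x := by
  rw [ErgodicSystem.inner_density, hP.apply_tens S (hζ i) hφ, Finset.sum_eq_single i]
  · simp [hζ']
  · intro k _ hk
    simp [hζ', hk]
  · simp

theorem inner_toLp (m : L2 G) {φ : Space n → ℝ} (hφ : IsTestFunction G φ) :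
    inner ℝ m ((hφ.memLp G).toLp φ) = ∫ x in G, m x * φ x := by
  rw [inner_L2_eq]
  refine integral_congr_ae ?_
  filter_upwards [(hφ.memLp G).coeFn_toLp] with x hx
  rw [hx]

/-- The pressure has a weak gradient. -/
theorem IsPressure.mem_H1 (hG : IsBoundedDomain smooth G)
    {ℓ : Lp S.DVec 2 (volume.restrict G) →L[ℝ] ℝ} {P : L2 G}
    (hP : S.IsPressure F G ℓ P) (hζ : ∀ k, ζ k ∈ S.Wsub F)
    (hζ' : ∀ k, S.mean (ζ k) = basisVec k) :
    (WithLp.toLp 2 (P, -S.density ℓ ζ) : L2Pair G) ∈ H1 univ G := by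
  refine hG.mem_H1 fun φ hφ i => ?_
  change ∫ x in G, P x * pd i φ x = -∫ x in G, (-S.density ℓ ζ i) x * φ x
  rw [← hP.inner_density S hζ hζ' hφ i, inner_toLp _ hφ, ← integral_neg]
  refine integral_congr_ae ?_
  filter_upwards [Lp.coeFn_neg (S.density ℓ ζ i)] with x hx
  rw [hx, Pi.neg_apply]
  ring

theorem eq_zero_of_forall_inner_test (hG : IsOpen G) {r : L2 G}
    (h : ∀ φ, ∀ hφ : IsTestFunction G φ, inner ℝ r ((hφ.memLp G).toLp φ) = 0) : r = 0 := by
  have h1 : LocallyIntegrableOn r G (volume.restrict G) :=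
    ((Lp.memLp r).locallyIntegrable (by norm_num)).locallyIntegrableOn G
  have h2 := hG.ae_eq_zero_of_integral_contDiff_smul_eq_zero h1 fun φ h1 h2 h3 => by
    have := h φ ⟨h1, h2, h3⟩
    rw [inner_toLp _ ⟨h1, h2, h3⟩] at this
    simpa only [smul_eq_mul, mul_comm] using this
  rw [Lp.eq_zero_iff_ae_eq_zero]
  filter_upwards [h2, ae_restrict_mem hG.measurableSet] with x h3 h4
  exact h3 h4

theorem starProjection_tens (w : S.DVec) (v : L2 G) :
    (S.Wsub F).starProjection.compLpL 2 (volume.restrict G) (tens G w v) =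
      tens G ((S.Wsub F).starProjection w) v := by
  refine Lp.ext ?_
  filter_upwards [(S.Wsub F).starProjection.coeFn_compLpL (tens G w v), tens_coeFn G w v,
    tens_coeFn G ((S.Wsub F).starProjection w) v] with x h1 h2 h3
  rw [h1, h2, h3, map_smul]

/-- A functional with a pressure only depends on the expectation of the velocity. -/
theorem IsPressure.apply_eq (hG : IsBoundedDomain smooth G)
    {ℓ : Lp S.DVec 2 (volume.restrict G) →L[ℝ] ℝ} {P : L2 G}
    (hP : S.IsPressure F G ℓ P) (hζ : ∀ k, ζ k ∈ S.Wsub F)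
    (hζ' : ∀ k, S.mean (ζ k) = basisVec k) {z : Lp S.DVec 2 (volume.restrict G)}
    (hz : z ∈ S.WZ F G) : ℓ z = ∑ i, inner ℝ (S.density ℓ ζ i) (S.meanZ G i z) := by
  let L : Lp S.DVec 2 (volume.restrict G) →L[ℝ] ℝ :=
    ℓ - ∑ i, (innerSL ℝ (S.density ℓ ζ i)).comp (S.meanZ G i)
  have hL : ∀ y, L y = ℓ y - ∑ i, inner ℝ (S.density ℓ ζ i) (S.meanZ G i y) := by
    intro y
    simp [L]
  have h1 : ∀ w ∈ S.Wsub F, ∀ v : L2 G, L (tens G w v) = 0 := by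
    intro w hw v
    let r := (InnerProductSpace.toDual ℝ (L2 G)).symm (L.comp (tens G w))
    have hr : ∀ v, inner ℝ r v = L (tens G w v) := fun v => InnerProductSpace.toDual_symm_apply
    -- For smooth `v` both terms of `L` give the same combination of the integrals of `P ∂_i v`;
    -- test functions determine an element of `L²(G)`.
    have h0 : r = 0 := eq_zero_of_forall_inner_test hG.isOpen fun φ hφ => by
      rw [hr, hL, hP.apply_tens S hw hφ, sub_eq_zero]
      refine Finset.sum_congr rfl fun i _ => ?_
      rw [meanZ_tens, inner_smul_right, hP.inner_density S hζ hζ' hφ i]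
    rw [← hr, h0, inner_zero_left]
  let T : Lp S.DVec 2 (volume.restrict G) →L[ℝ] Lp S.DVec 2 (volume.restrict G) :=
    (S.Wsub F).starProjection.compLpL 2 (volume.restrict G)
  -- Separated fields determine a functional on the full space. Composing with the pointwise
  -- projection `T` brings their second factor into `Wsub`, and `T` fixes `z`.
  have h2 : L.comp T = 0 := eq_zero_of_forall_smulRight fun w v => by
    change L (T (tens G w v)) = 0
    rw [S.starProjection_tens w v]
    exact h1 _ (Submodule.starProjection_apply_mem _ _) v
  have h3 : L z = 0 := by
    have h4 : T z = z := (S.mem_WZ_iff_proj F G).1 hz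
    rw [← h4]
    exact DFunLike.congr_fun h2 z
  rw [hL] at h3
  linarith

/-- A functional with a pressure vanishes on `V`. -/
theorem IsPressure.apply_eq_zero (hG : IsBoundedDomain smooth G)
    {ℓ : Lp S.DVec 2 (volume.restrict G) →L[ℝ] ℝ} {P : L2 G}
    (hP : S.IsPressure F G ℓ P) (hζ : ∀ k, ζ k ∈ S.Wsub F)
    (hζ' : ∀ k, S.mean (ζ k) = basisVec k) {z : Lp S.DVec 2 (volume.restrict G)}
    (hz : z ∈ S.Vsub F G) : ℓ z = 0 := by
  rw [mem_Vsub_iff] at hz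
  rw [hP.apply_eq S hG hζ hζ' hz.1]
  let T : L2Pair G →L[ℝ] ℝ := ∑ i, (innerSL ℝ (S.meanZ G i z)).comp
    ((PiLp.proj (𝕜 := ℝ) 2 (fun _ : Fin n => L2 G) i).comp (WithLp.sndL 2 ℝ _ _))
  have hT : ∀ p, T p = ∑ i, inner ℝ (S.meanZ G i z) (p.snd i) := by
    intro p
    simp [T]
  -- The expectation of `z` is orthogonal to gradients of smooth functions, hence to their limits,
  -- among which is the gradient of the pressure.
  have h1 : H1 univ G ≤ LinearMap.ker T.toLinearMap := by
    refine Submodule.topologicalClosure_minimal _ ?_ T.isClosed_ker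
    rintro p ⟨φ, hφ, -, hp⟩
    change T p = 0
    rw [hT, ← hz.2 φ hφ]
    refine Finset.sum_congr rfl fun i _ => ?_
    rw [inner_L2_eq]
    exact integral_congr_ae ((hp i).mono fun x hx => by simp only [hx])
  have h2 : T _ = 0 := h1 (hP.mem_H1 S hG hζ hζ')
  rw [hT] at h2
  change ∑ i, inner ℝ (S.meanZ G i z) (-S.density ℓ ζ i) = 0 at h2
  simp only [inner_neg_right, Finset.sum_neg_distrib, neg_eq_zero] at h2
  simpa only [real_inner_comm] using h2

/-- The pressure is unique. -/
theorem IsPressure.unique (hG : IsBoundedDomain smooth G)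
    {ℓ : Lp S.DVec 2 (volume.restrict G) →L[ℝ] ℝ} {P Q : L2 G}
    (hP : S.IsPressure F G ℓ P) (hQ : S.IsPressure F G ℓ Q) (hP0 : P ∈ L2Zero G)
    (hQ0 : Q ∈ L2Zero G) (hζ : ∀ k, ζ k ∈ S.Wsub F)
    (hζ' : ∀ k, S.mean (ζ k) = basisVec k) : P = Q := by
  have hfin : volume G ≠ ⊤ := hG.isBounded.measure_lt_top.ne
  have : IsFiniteMeasure (volume.restrict G) := ⟨by simpa using hfin.lt_top⟩
  have hV : 0 < volume.real G :=
    ENNReal.toReal_pos (hG.isOpen.measure_pos volume hG.isConnected.nonempty).ne' hfin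
  obtain ⟨C, hC0, hC⟩ := hG.exists_poincare_wirtinger
  -- Both pressures have minus the density as weak gradient, so the Poincaré–Wirtinger inequality is
  -- applied to a difference with zero gradient and zero mean.
  have h1 := hC _ (Submodule.sub_mem _ (hP.mem_H1 S hG hζ hζ') (hQ.mem_H1 S hG hζ hζ'))
  rw [← WithLp.toLp_sub, Prod.mk_sub_mk, sub_self] at h1
  change volume.real G * ‖P - Q‖ ^ 2 ≤ C * ‖(0 : L2Vec n (volume.restrict G))‖ ^ 2 +
    (∫ x in G, (P - Q) x) ^ 2 at h1
  have h2 : ∫ x in G, (P - Q) x = 0 := by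
    rw [integral_congr_ae (Lp.coeFn_sub P Q)]
    have e1 : ∫ x in G, P x = 0 := hP0
    have e2 : ∫ x in G, Q x = 0 := hQ0
    have i1 : Integrable P (volume.restrict G) := (Lp.memLp P).integrable (by norm_num)
    have i2 : Integrable Q (volume.restrict G) := (Lp.memLp Q).integrable (by norm_num)
    change ∫ x in G, P x - Q x = 0
    rw [integral_sub i1 i2, e1, e2, sub_zero]
  rw [h2] at h1
  have h3 : ‖P - Q‖ ^ 2 ≤ 0 := by
    by_contra! h
    have := mul_pos hV h
    simp at h1
    linarith
  have h4 : ‖P - Q‖ = 0 := by nlinarith [norm_nonneg (P - Q)]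
  exact sub_eq_zero.1 (norm_eq_zero.1 h4)

end ErgodicSystem

/-! ### Iterated integrals over `G × ℱ` as scalar products -/

namespace ErgodicSystem

variable {n : ℕ} {Ω : Type*} [MeasurableSpace Ω] {μ : Measure Ω} (S : ErgodicSystem n μ)
variable [IsProbabilityMeasure μ] {F : Set Ω} {G : Set (Space n)}

/-- The function `v` of two variables is a representative of `y ∈ L²(G; L²(F)ⁿ)`. -/
def Represents (y : L2Pore μ F G) (v : Space n → Ω → Space n) : Prop :=
  ∀ᵐ x ∂(volume.restrict G), ∀ᵐ ω ∂(μ.restrict F), v x ω = (y x).eval ω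

theorem represents_evL (z : Lp S.DVec 2 (volume.restrict G)) :
    Represents (S.evL F G z) fun x ω => S.eval (z x) ω := by
  filter_upwards [(S.evalL F).coeFn_compLpL z] with x hx
  rw [evL, hx]
  filter_upwards [ae_all_iff.2 fun i => restr_coeFn F (S.val (z x i))] with ω hω
  ext i
  exact (hω i).symm

theorem represents_testZ {ξ : Space n → S.DVec} (h : IsTestFunction G ξ) :
    Represents (S.evL F G (S.testZ G h)) fun x ω => S.eval (ξ x) ω := by
  filter_upwards [S.represents_evL (F := F) (S.testZ G h), S.testZ_coeFn G h] with x h1 h2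
  simpa only [h2] using h1

theorem represents_constY (m : L2Vec n (volume.restrict G)) :
    Represents (constY μ F G m) fun x _ => m.eval x := by
  filter_upwards [constY_coeFn (μ := μ) F G m] with x hx
  rw [hx]
  filter_upwards [constL_eval (μ := μ) F (m.eval x)] with ω hω
  exact hω.symm

theorem represents_flux {κ : S.Potential F G} {v : Space n → Space n}
    (hv : ∀ᵐ x ∂(volume.restrict G), κ.fst.1.snd.eval x = v x) :
    Represents (S.flux F G κ) fun x ω => v x + (κ.snd x).1.eval ω := by
  filter_upwards [S.flux_coeFn F G κ, hv] with x h1 h2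
  rw [h1, h2]
  filter_upwards [constL_eval (μ := μ) F (v x),
    eval_add (constL μ F (v x)) (κ.snd x : L2Vec n (μ.restrict F))] with ω h3 h4
  rw [h4, h3]

/-- Multiplication by a bounded weight in `L²(G; L²(F)ⁿ)`. -/
def weightL (G : Set (Space n)) {w : Ω → ℝ} (hw : MemLp w ⊤ (μ.restrict F)) :
    L2Pore μ F G →L[ℝ] L2Pore μ F G :=
  (mulVec n hw).compLpL 2 (volume.restrict G)

variable {w : Ω → ℝ} (hw : MemLp w ⊤ (μ.restrict F))

theorem inner_weightL_ae (y y' : L2Pore μ F G) : ∀ᵐ x ∂(volume.restrict G),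
    ∫ ω in F, w ω * inner ℝ ((y x).eval ω) ((y' x).eval ω) ∂μ =
      inner ℝ (y x) (weightL G hw y' x) := by
  filter_upwards [(mulVec n hw).coeFn_compLpL y'] with x hx
  rw [weightL, hx, integral_mul_inner_eval hw]

theorem integral_integral_inner {y y' : L2Pore μ F G} {v v' : Space n → Ω → Space n}
    (h : Represents y v) (h' : Represents y' v') :
    ∫ x in G, (∫ ω in F, inner ℝ (v x ω) (v' x ω) ∂μ) = inner ℝ y y' := by
  rw [L2.inner_def]
  refine integral_congr_ae ?_
  filter_upwards [h, h'] with x h1 h2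
  rw [← integral_inner_eval]
  refine integral_congr_ae ?_
  filter_upwards [h1, h2] with ω h3 h4
  rw [h3, h4]

theorem integral_integral_weight {y y' : L2Pore μ F G} {v v' : Space n → Ω → Space n}
    (h : Represents y v) (h' : Represents y' v') :
    ∫ x in G, (∫ ω in F, w ω * inner ℝ (v x ω) (v' x ω) ∂μ) = inner ℝ y (weightL G hw y') := by
  rw [L2.inner_def]
  refine integral_congr_ae ?_
  filter_upwards [h, h', inner_weightL_ae hw y y'] with x h1 h2 h0
  rw [← h0]
  refine integral_congr_ae ?_
  filter_upwards [h1, h2] with ω h3 h4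
  rw [h3, h4]

theorem integral_integral_const_weight (c : ℝ) {y y' : L2Pore μ F G}
    {v v' : Space n → Ω → Space n} (h : Represents y v) (h' : Represents y' v') :
    ∫ x in G, (∫ ω in F, c * w ω * inner ℝ (v x ω) (v' x ω) ∂μ) =
      c * inner ℝ y (weightL G hw y') := by
  simp only [mul_assoc, integral_const_mul]
  rw [integral_integral_weight hw h h']

theorem integral_integral_drag (c : ℝ) {y y' u u' : L2Pore μ F G}
    {v v' r r' : Space n → Ω → Space n} (h : Represents y v) (h' : Represents y' v')
    (k : Represents u r) (k' : Represents u' r') :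
    ∫ x in G, (∫ ω in F, c * w ω *
      (-inner ℝ (v x ω) (v' x ω) + inner ℝ (r x ω) (r' x ω)) ∂μ) =
      c * (inner ℝ u (weightL G hw u') - inner ℝ y (weightL G hw y')) := by
  simp only [mul_assoc, integral_const_mul]
  congr 1
  rw [L2.inner_def, L2.inner_def, ← integral_sub (L2.integrable_inner _ _)
    (L2.integrable_inner _ _)]
  refine integral_congr_ae ?_
  filter_upwards [h, h', k, k', inner_weightL_ae hw y y', inner_weightL_ae hw u u']
    with x h1 h2 h3 h4 h5 h6
  rw [← h5, ← h6, ← integral_sub (integrable_mul_inner_eval hw _ _)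
    (integrable_mul_inner_eval hw _ _)]
  refine integral_congr_ae ?_
  filter_upwards [h1, h2, h3, h4] with ω e1 e2 e3 e4
  rw [e1, e2, e3, e4]
  ring

theorem inner_gradL (a b : S.DVec) : inner ℝ (S.gradL F a) (S.gradL F b) =
    ∫ ω in F, ∑ i, ∑ k, S.deriv k (a i) ω * S.deriv k (b i) ω ∂μ := by
  have h : ∀ f g : Lp ℝ 2 μ, Integrable (fun ω => f ω * g ω) (μ.restrict F) := fun f g => by
    have := (L2.integrable_inner (𝕜 := ℝ) f g).restrict (s := F)
    refine this.congr (Eventually.of_forall fun ω => ?_)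
    simp [mul_comm]
  rw [integral_finsetSum _ fun i _ => integrable_finsetSum _ fun k _ => h _ _,
    PiLp.inner_apply, Fintype.sum_prod_type]
  refine Finset.sum_congr rfl fun i _ => ?_
  rw [integral_finsetSum _ fun k _ => h _ _]
  refine Finset.sum_congr rfl fun k _ => ?_
  rw [gradL_apply, gradL_apply, L2.inner_def]
  refine integral_congr_ae ?_
  filter_upwards [restr_coeFn F (S.deriv k (a i)), restr_coeFn F (S.deriv k (b i))] with ω h1 h2
  simp only [h1, h2]
  simp [mul_comm]

theorem integral_integral_deriv (u : Lp S.DVec 2 (volume.restrict G)) {ξ : Space n → S.DVec}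
    (h : IsTestFunction G ξ) :
    ∫ x in G, (∫ ω in F, ∑ i, ∑ k, S.deriv k (u x i) ω * S.deriv k (ξ x i) ω ∂μ) =
      inner ℝ (S.grL F G u) (S.grL F G (S.testZ G h)) := by
  rw [L2.inner_def]
  refine integral_congr_ae ?_
  filter_upwards [(S.gradL F).coeFn_compLpL u, (S.gradL F).coeFn_compLpL (S.testZ G h),
    S.testZ_coeFn G h] with x h1 h2 h3
  rw [grL, h1, h2, h3, S.inner_gradL]

/-- A curve in a closed subspace is fixed by the projection, and so is its derivative. -/
theorem fderiv_mem_Wsub {ξ : Space n → S.DVec} (h : IsTestFunction G ξ)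
    (hW : ∀ x, ξ x ∈ S.W F) (x v : Space n) : fderiv ℝ ξ x v ∈ S.Wsub F := by
  have hd : HasFDerivAt ξ (fderiv ℝ ξ x) x :=
    (h.contDiff.differentiable (by simp) x).hasFDerivAt
  have h1 : HasFDerivAt ξ ((S.Wsub F).starProjection.comp (fderiv ℝ ξ x)) x := by
    refine ((S.Wsub F).starProjection.hasFDerivAt.comp x hd).congr_of_eventuallyEq
      (Eventually.of_forall fun y => ?_)
    exact (Submodule.starProjection_eq_self_iff.2 (S.mem_Wsub.2 (hW y))).symm
  have : T2Space S.DVec := t2Space_of_norm _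
  rw [hd.unique h1]
  exact Submodule.starProjection_apply_mem _ _

theorem integral_val {z : S.DVec} (hF : MeasurableSet F) (hz : z ∈ S.Wsub F) (i : Fin n) :
    ∫ ω in F, S.val (z i) ω ∂μ = S.mean z i := by
  change _ = ∫ ω, S.val (z i) ω ∂μ
  have h1 : Integrable (S.val (z i)) μ := (Lp.memLp _).integrable (by norm_num)
  rw [← integral_add_compl hF h1, integral_eq_zero_of_ae (S.restr_compl_val hz i), add_zero]

/-- The derivatives of `ξ` still vanish on `ℳ`, so integration over `ℱ` gives their expectation,
which commutes with differentiation in `x`. Thus `P` only sees the macroscopic divergence of `𝔼(ξ)`.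
-/
theorem integral_integral_pressure (hF : MeasurableSet F) (P : L2 G) {ξ : Space n → S.DVec}
    (h : IsTestFunction G ξ) (hW : ∀ x, ξ x ∈ S.W F) :
    ∫ x in G, (∫ ω in F, P x * ∑ i, S.val (fderiv ℝ ξ x (basisVec i) i) ω ∂μ) =
      ∑ i, ∫ x in G, P x * pd i (fun x => S.mean (ξ x) i) x := by
  rw [← integral_finsetSum _ fun i _ => integrable_mul_L2 (Lp.memLp _)
    (((S.isTestFunction_mean G h i).pd i).memLp G)]
  refine integral_congr_ae (Eventually.of_forall fun x => ?_)
  simp only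
  rw [integral_const_mul, ← Finset.mul_sum, integral_finsetSum]
  · congr 1
    refine Finset.sum_congr rfl fun i _ => ?_
    rw [S.integral_val hF (S.fderiv_mem_Wsub h hW x _)]
    let L : S.DVec →L[ℝ] ℝ := (PiLp.proj (𝕜 := ℝ) 2 (fun _ : Fin n => ℝ) i).comp S.meanL
    have h1 : ∀ z, L z = S.mean z i := fun z => by simp [L]
    have hd : HasFDerivAt ξ (fderiv ℝ ξ x) x :=
      (h.contDiff.differentiable (by simp) x).hasFDerivAt
    have h2 := (L.hasFDerivAt.comp x hd).fderiv
    rw [pd]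
    simp only [← h1]
    exact (DFunLike.congr_fun h2 (basisVec i)).symm
  · exact fun i _ => ((Lp.memLp _).integrable (by norm_num)).restrict

end ErgodicSystem

/-- The bilinear form `(x, y) ↦ (A x, B y)`. -/
def innerForm {V K H : Type*} [NormedAddCommGroup V] [NormedSpace ℝ V] [NormedAddCommGroup K]
    [NormedSpace ℝ K] [NormedAddCommGroup H] [InnerProductSpace ℝ H] (A : V →L[ℝ] H)
    (B : K →L[ℝ] H) : V →L[ℝ] K →L[ℝ] ℝ := (innerSL ℝ).bilinearComp A B

@[simp] theorem innerForm_apply {V K H : Type*} [NormedAddCommGroup V] [NormedSpace ℝ V]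
    [NormedAddCommGroup K] [NormedSpace ℝ K] [NormedAddCommGroup H] [InnerProductSpace ℝ H]
    (A : V →L[ℝ] H) (B : K →L[ℝ] H) (x : V) (y : K) :
    innerForm A B x y = inner ℝ (A x) (B y) := rfl

/-! ### An abstract flow problem coupled with diffusion problems -/

section Coupled

variable {Z R Y Q : Type*} [NormedAddCommGroup Z] [InnerProductSpace ℝ Z]
  [NormedAddCommGroup R] [InnerProductSpace ℝ R] [NormedAddCommGroup Y] [InnerProductSpace ℝ Y]
  [NormedAddCommGroup Q] [InnerProductSpace ℝ Q] {N : ℕ}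

/-- A weighted diffusion form is coercive. -/
theorem isCoercive_sum_innerForm {T : Fin N → Y →L[ℝ] Y} {fl : Q →L[ℝ] Y} {r : Fin N → ℝ}
    (hfl : ∃ C, 0 < C ∧ ∀ q, ‖q‖ ^ 2 ≤ C * ‖fl q‖ ^ 2) (hr : ∀ j, 0 < r j)
    (hT : ∀ j, ∃ c > 0, ∀ y, c * ‖y‖ ^ 2 ≤ inner ℝ y (T j y)) :
    IsCoercive (∑ j, r j • innerForm (V := PiLp 2 fun _ : Fin N => Q)
      (K := PiLp 2 fun _ : Fin N => Q)
      (fl.comp (PiLp.proj (𝕜 := ℝ) 2 (fun _ : Fin N => Q) j))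
      (((T j).comp fl).comp (PiLp.proj (𝕜 := ℝ) 2 (fun _ : Fin N => Q) j))) := by
  obtain ⟨C, hC0, hC⟩ := hfl
  choose c hc0 hc using hT
  -- A common lower bound for finitely many positive products, with default value 1 when `N = 0`.
  obtain ⟨δ, hδ0, hδ⟩ : ∃ δ : ℝ, 0 < δ ∧ ∀ j, δ ≤ r j * c j := by
    rcases isEmpty_or_nonempty (Fin N) with h | h
    · exact ⟨1, one_pos, fun j => (h.false j).elim⟩
    · obtain ⟨i, hi⟩ := Finite.exists_min fun j => r j * c j
      exact ⟨_, mul_pos (hr i) (hc0 i), hi⟩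
  refine ⟨δ / C, by positivity, fun κ => ?_⟩
  rw [mul_assoc, ← sq, PiLp.norm_sq_eq_of_L2, Finset.mul_sum]
  have h : (∑ j, r j • innerForm (V := PiLp 2 fun _ : Fin N => Q)
      (K := PiLp 2 fun _ : Fin N => Q)
      (fl.comp (PiLp.proj (𝕜 := ℝ) 2 (fun _ : Fin N => Q) j))
      (((T j).comp fl).comp (PiLp.proj (𝕜 := ℝ) 2 (fun _ : Fin N => Q) j))) κ κ =
      ∑ j, r j * inner ℝ (fl (κ j)) (T j (fl (κ j))) := by simp
  rw [h]
  refine Finset.sum_le_sum fun j _ => ?_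
  have e1 := hC (κ j)
  have e2 := hc j (fl (κ j))
  have e3 := sq_nonneg ‖fl (κ j)‖
  calc δ / C * ‖κ j‖ ^ 2 ≤ δ / C * (C * ‖fl (κ j)‖ ^ 2) := by gcongr
    _ = δ * ‖fl (κ j)‖ ^ 2 := by field_simp
    _ ≤ r j * c j * ‖fl (κ j)‖ ^ 2 := by gcongr; exact hδ j
    _ = r j * (c j * ‖fl (κ j)‖ ^ 2) := by ring
    _ ≤ _ := mul_le_mul_of_nonneg_left e2 (hr j).le

/-- The residual of the momentum equation, for a velocity `u` and potentials `κ`. -/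
def residual (gr : Z →L[ℝ] R) (ev : Z →L[ℝ] Y) (T : Fin N → Y →L[ℝ] Y) (fl : Q →L[ℝ] Y)
    (z : Fin N → ℝ) (L : Z →L[ℝ] ℝ) (u : Z) (κ : Fin N → Q) : Z →L[ℝ] ℝ :=
  (innerSL ℝ (gr u)).comp gr - (∑ j, z j • (innerSL ℝ (T j (fl (κ j)))).comp ev) - L

theorem residual_apply (gr : Z →L[ℝ] R) (ev : Z →L[ℝ] Y) (T : Fin N → Y →L[ℝ] Y)
    (fl : Q →L[ℝ] Y) (z : Fin N → ℝ) (L : Z →L[ℝ] ℝ) (u : Z) (κ : Fin N → Q) (ξ : Z) :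
    residual gr ev T fl z L u κ ξ = inner ℝ (gr u) (gr ξ) -
      ∑ j, z j * inner ℝ (ev ξ) (T j (fl (κ j))) - L ξ := by
  simp [residual, real_inner_comm]

/-- The functional of an external field `e` and a force `f` on the velocities. -/
def load (ev : Z →L[ℝ] Y) (T : Fin N → Y →L[ℝ] Y) (z : Fin N → ℝ) (e f : Y) : Z →L[ℝ] ℝ :=
  (∑ j, z j • (innerSL ℝ e).comp ((T j).comp ev)) - (innerSL ℝ f).comp ev

theorem load_apply (ev : Z →L[ℝ] Y) (T : Fin N → Y →L[ℝ] Y) (z : Fin N → ℝ) (e f : Y) (ξ : Z) :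
    load ev T z e f ξ = ∑ j, z j * inner ℝ e (T j (ev ξ)) - inner ℝ f (ev ξ) := by
  simp [load]

/-- The functional of an external field `e` on a potential. -/
def field (T : Y →L[ℝ] Y) (fl : Q →L[ℝ] Y) (r : ℝ) (e : Y) : Q →L[ℝ] ℝ :=
  -(r • (innerSL ℝ e).comp (T.comp fl))

theorem field_apply (T : Y →L[ℝ] Y) (fl : Q →L[ℝ] Y) (r : ℝ) (e : Y) (q : Q) :
    field T fl r e q = -(r * inner ℝ e (T (fl q))) := by
  simp [field]

/-- Well-posedness of a flow problem in a subspace `V` coupled with diffusion problems. -/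
theorem exists_unique_coupled [CompleteSpace Q] (V : Submodule ℝ Z) [CompleteSpace V]
    {gr : Z →L[ℝ] R} (ev : Z →L[ℝ] Y) {T : Fin N → Y →L[ℝ] Y} {fl : Q →L[ℝ] Y} {r : Fin N → ℝ}
    (hgr : ∃ C, 0 < C ∧ ∀ u ∈ V, ‖u‖ ^ 2 ≤ C * ‖gr u‖ ^ 2)
    (hfl : ∃ C, 0 < C ∧ ∀ q, ‖q‖ ^ 2 ≤ C * ‖fl q‖ ^ 2) (hr : ∀ j, 0 < r j)
    (hT : ∀ j, ∃ c > 0, ∀ y, c * ‖y‖ ^ 2 ≤ inner ℝ y (T j y)) (z : Fin N → ℝ)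
    (L : Z →L[ℝ] ℝ) (g : Fin N → Q →L[ℝ] ℝ) :
    ∃! p : V × (Fin N → Q), (∀ ξ ∈ V, residual gr ev T fl z L p.1 p.2 ξ = 0) ∧
      ∀ j q, z j * inner ℝ (ev p.1) (T j (fl q)) + r j * inner ℝ (fl (p.2 j)) (T j (fl q)) =
        g j q := by
  let K := PiLp 2 fun _ : Fin N => Q
  let π : Fin N → K →L[ℝ] Q := fun j => PiLp.proj (𝕜 := ℝ) 2 (fun _ : Fin N => Q) j
  let a : V →L[ℝ] V →L[ℝ] ℝ := innerForm (gr.comp V.subtypeL) (gr.comp V.subtypeL)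
  have ha : IsCoercive a := by
    obtain ⟨C, hC0, hC⟩ := hgr
    refine ⟨C⁻¹, by positivity, fun u => ?_⟩
    have h2 : a u u = ‖gr u‖ ^ 2 := real_inner_self_eq_norm_sq _
    rw [h2, mul_assoc, ← sq, inv_mul_le_iff₀ hC0]
    exact hC u u.2
  let b : K →L[ℝ] K →L[ℝ] ℝ := ∑ j, r j • innerForm (fl.comp (π j)) (((T j).comp fl).comp (π j))
  let c : V →L[ℝ] K →L[ℝ] ℝ :=
    ∑ j, z j • innerForm (ev.comp V.subtypeL) (((T j).comp fl).comp (π j))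
  let G : K →L[ℝ] ℝ := ∑ j, (g j).comp (π j)
  have hb : ∀ κ κ', b κ κ' = ∑ j, r j * inner ℝ (fl (κ j)) (T j (fl (κ' j))) := by
    intro κ κ'
    simp [b, π]
    rfl
  have hc : ∀ ξ κ, c ξ κ = ∑ j, z j * inner ℝ (ev ξ) (T j (fl (κ j))) := by
    intro ξ κ
    simp [c, π]
    rfl
  have hG : ∀ κ, G κ = ∑ j, g j (κ j) := by
    intro κ
    simp [G, π]
    rfl
  obtain ⟨p, h, h3⟩ := exists_unique_skew c ha (isCoercive_sum_innerForm hfl hr hT)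
    (L.comp V.subtypeL) G
  have key : ∀ (u : V) (κ : K), ((∀ ξ ∈ V, residual gr ev T fl z L u κ ξ = 0) ∧
      ∀ j q, z j * inner ℝ (ev u) (T j (fl q)) + r j * inner ℝ (fl (κ j)) (T j (fl q)) =
        g j q) ↔ ((∀ ξ, a u ξ - c ξ κ = L.comp V.subtypeL ξ) ∧ ∀ φ, c u φ + b κ φ = G φ) := by
    intro u κ
    refine and_congr ?_ ⟨fun h φ => ?_, fun h j q => ?_⟩
    · rw [Subtype.forall]
      refine forall_congr' fun ξ => forall_congr' fun hξ => ?_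
      rw [residual_apply, sub_eq_zero, hc]
      rfl
    · rw [hb, hc, hG, ← Finset.sum_add_distrib]
      exact Finset.sum_congr rfl fun j _ => h j _
    -- A test vector with a single nonzero component isolates the `j`-th equation.
    · have h1 := h (WithLp.toLp 2 (Pi.single j q))
      rw [hb, hc, hG, ← Finset.sum_add_distrib, Finset.sum_eq_single j, Finset.sum_eq_single j]
        at h1
      · simpa using h1
      · intro i _ hi
        simp [hi]
      · simp
      · intro i _ hi
        simp [hi]
      · simp
  refine ⟨(p.1, p.2.ofLp), (key p.1 p.2).2 h, fun q hq => ?_⟩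
  have h4 := h3 (q.1, WithLp.toLp 2 q.2) ((key q.1 (WithLp.toLp 2 q.2)).1 hq)
  rw [← h4]

end Coupled

/-- Continuous functions which agree on a dense subspace of the first factor agree. -/
theorem eq_of_eq_on_topologicalClosure {H X : Type*} [NormedAddCommGroup H] [NormedSpace ℝ H]
    [NormedAddCommGroup X] {A : Submodule ℝ H} {f f' : WithLp 2 (A.topologicalClosure × X) → ℝ}
    (hf : Continuous f) (hf' : Continuous f') (h : ∀ q, q.fst.1 ∈ A → f q = f' q)
    (q : WithLp 2 (A.topologicalClosure × X)) : f q = f' q := by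
  obtain ⟨p, hp, hpq⟩ := mem_closure_iff_seq_limit.1 (q.fst.2 : (q.fst.1 : H) ∈ closure (A : Set H))
  let P : ℕ → A.topologicalClosure := fun k => ⟨p k, A.le_topologicalClosure (hp k)⟩
  have h1 : Tendsto P atTop (𝓝 q.fst) := tendsto_subtype_rng.2 hpq
  have h2 : Tendsto (fun k => WithLp.toLp 2 (P k, q.snd)) atTop (𝓝 q) :=
    ((WithLp.prod_continuous_toLp 2 _ _).tendsto _).comp (h1.prodMk_nhds tendsto_const_nhds)
  refine tendsto_nhds_unique ((hf.tendsto q).comp h2) ?_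
  refine ((hf'.tendsto q).comp h2).congr fun k => (h _ ?_).symm
  exact hp k

theorem balance_iff {N : ℕ} (A B m : ℝ) (z r u y d e l : Fin N → ℝ) :
    A - B + ∑ j, z j * (u j - y j) + ∑ j, r j * d j = -∑ j, r j * e j + ∑ j, z j * l j - m ↔
      A - ∑ j, z j * y j - (∑ j, z j * l j - m) - B +
        ∑ j, (z j * u j + r j * d j - -(r j * e j)) = 0 := by
  rw [← sub_eq_zero]
  simp only [mul_sub, Finset.sum_sub_distrib, Finset.sum_add_distrib, Finset.sum_neg_distrib]
  refine Eq.congr ?_ rfl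
  ring

theorem balance_eq_zero {N : ℕ} {A B : ℝ} {c d : Fin N → ℝ} (h : A = B) (h' : ∀ j, c j = d j) :
    A - B + ∑ j, (c j - d j) = 0 := by
  simp [h, h']

theorem balance_single {N : ℕ} {A B : ℝ} {c d : Fin N → ℝ} (h : A - B + ∑ j, (c j - d j) = 0)
    (hA : A = B) (j : Fin N) (hc : ∀ i, i ≠ j → c i = 0) (hd : ∀ i, i ≠ j → d i = 0) :
    c j = d j := by
  rw [hA, sub_self, zero_add, Finset.sum_eq_single_of_mem j (Finset.mem_univ j) fun i _ hi => by
    rw [hc i hi, hd i hi, sub_zero]] at h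
  exact sub_eq_zero.1 h

/-! ### Splitting of the variational equation, and the unique solution -/

namespace ErgodicSystem

variable {n : ℕ} {Ω : Type*} [MeasurableSpace Ω] {μ : Measure Ω} (S : ErgodicSystem n μ)
variable [IsProbabilityMeasure μ] {F : Set Ω} {G : Set (Space n)} {N : ℕ}

instance : CompleteSpace (S.X F) :=
  (Submodule.isClosed_topologicalClosure _).completeSpace_coe

instance : CompleteSpace (H1 G G) := (isClosed_H1 G G).completeSpace_coe

instance : InnerProductSpace ℝ (S.Potential F G) := WithLp.instProdInnerProductSpace
instance : NormedSpace ℝ (S.Potential F G) := WithLp.instProdNormedSpace 2 ℝ _ _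

variable {w : Fin N → Ω → ℝ} (hw : ∀ j, MemLp (w j) ⊤ (μ.restrict F)) (z : Fin N → ℤ)
variable (Pe : Fin N → ℝ) (E f : L2Vec n (volume.restrict G))

/-- The residual of the momentum equation of the two-scale problem. -/
def momentum (u : Lp S.DVec 2 (volume.restrict G)) (κ : Fin N → S.Potential F G) :
    Lp S.DVec 2 (volume.restrict G) →L[ℝ] ℝ :=
  residual (S.grL F G) (S.evL F G) (fun j => weightL G (hw j)) (S.flux F G) (fun j => (z j : ℝ))
    (load (S.evL F G) (fun j => weightL G (hw j)) (fun j => (z j : ℝ)) (constY μ F G E)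
      (constY μ F G f)) u κ

/-- The form of the equation of the `j`-th potential. -/
def transportForm (u : Lp S.DVec 2 (volume.restrict G)) (κ : Fin N → S.Potential F G)
    (j : Fin N) (q : S.Potential F G) : ℝ :=
  (z j : ℝ) * inner ℝ (S.evL F G u) (weightL G (hw j) (S.flux F G q)) +
    (z j : ℝ) ^ 2 / Pe j * inner ℝ (S.flux F G (κ j)) (weightL G (hw j) (S.flux F G q))

theorem transportForm_zero (u : Lp S.DVec 2 (volume.restrict G)) (κ : Fin N → S.Potential F G)
    (j : Fin N) : S.transportForm hw z Pe u κ j 0 = 0 := by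
  simp only [transportForm, map_zero, inner_zero_right, mul_zero, add_zero]

theorem continuous_transportForm (u : Lp S.DVec 2 (volume.restrict G))
    (κ : Fin N → S.Potential F G) (j : Fin N) :
    Continuous (S.transportForm hw z Pe u κ j) := by
  have hc : Continuous fun q : S.Potential F G => weightL G (hw j) (S.flux F G q) :=
    (weightL G (hw j)).continuous.comp (S.flux F G).continuous
  exact (continuous_const.mul (continuous_const.inner hc)).add
    (continuous_const.mul (continuous_const.inner hc))

/-- The functional of the external field in the equation of the `j`-th potential. -/
def transportLoad (j : Fin N) : S.Potential F G →L[ℝ] ℝ :=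
  field (Q := S.Potential F G) (weightL G (hw j)) (S.flux F G) ((z j : ℝ) ^ 2 / Pe j) (constY μ F G E)

/-- The single equation is the sum of a momentum balance, linear in `ξ`, and of one transport
balance for each potential. The element `κ' j` carries the gradient of `φ j` and the corrector `g
j`. -/
theorem variationalEquation_iff (hF : MeasurableSet F) {s : Unknowns N S F G}
    {κ : Fin N → S.Potential F G} (hκ₀ : ∀ j, (κ j).fst.1 = s.Φ₀ j) (hκ₁ : ∀ j, (κ j).snd = s.Φ₁ j)
    {ξ : Space n → S.DVec} (hξ : IsTestFunction G ξ) (hW : ∀ x, ξ x ∈ S.W F)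
    {φ : Fin N → Space n → ℝ} {g : Fin N → Lp (S.X F) 2 (volume.restrict G)}
    {κ' : Fin N → S.Potential F G}
    (hφ : ∀ j, ∀ᵐ x ∂(volume.restrict G), (κ' j).fst.1.snd.eval x = gradient (φ j) x)
    (hg : ∀ j, (κ' j).snd = g j) :
    VariationalEquation S F G z Pe w E f s ξ φ g ↔
      (S.momentum hw z E f s.u κ (S.testZ G hξ) -
        ∑ i, ∫ x in G, s.P x * pd i (fun x => S.mean (ξ x) i) x) +
      ∑ j, (S.transportForm hw z Pe s.u κ j (κ' j) - S.transportLoad hw z Pe E j (κ' j)) = 0 := by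
  have ru := S.represents_evL (F := F) s.u
  have rξ := S.represents_testZ (F := F) hξ
  have rE := represents_constY (μ := μ) (F := F) E
  have rf := represents_constY (μ := μ) (F := F) f
  have rκ : ∀ j, Represents (S.flux F G (κ j))
      fun x ω => (s.Φ₀ j).snd.eval x + (s.Φ₁ j x).1.eval ω := fun j => by
    have := S.represents_flux (κ := κ j) (v := (s.Φ₀ j).snd.eval)
      (Eventually.of_forall fun x => by rw [hκ₀])
    simpa only [hκ₁] using this
  have rκ' : ∀ j, Represents (S.flux F G (κ' j))
      fun x ω => gradient (φ j) x + (g j x).1.eval ω := fun j => by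
    have := S.represents_flux (hφ j)
    simpa only [hg] using this
  have e5 := S.integral_integral_deriv (F := F) s.u hξ
  have e6 := S.integral_integral_pressure hF s.P hξ hW
  have e7 := integral_integral_inner rf rξ
  have e1 := fun j => integral_integral_drag (hw j) (z j : ℝ) rξ (rκ j) ru (rκ' j)
  have e2 := fun j => integral_integral_weight (hw j) (rκ j) (rκ' j)
  have e3 := fun j => integral_integral_weight (hw j) rE (rκ' j)
  have e4 := fun j => integral_integral_const_weight (hw j) (z j : ℝ) rE rξ
  simp only [VariationalEquation, e1, e2, e3, e4, e5, e6, e7, momentum, residual_apply, load_apply, transportForm, transportLoad,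
    field_apply]
  exact balance_iff _ _ _ _ _ _ _ _ _ _

theorem zero_eval_eq_gradient : ∀ᵐ x ∂(volume.restrict G),
    (0 : S.Potential F G).fst.1.snd.eval x = gradient (fun _ : Space n => (0 : ℝ)) x := by
  refine eval_eq_gradient_iff.2 fun i => ?_
  filter_upwards [Lp.coeFn_zero ℝ 2 (volume.restrict G)] with x hx
  change (0 : L2 G) x = _
  rw [hx]
  simp [pd]

variable {S z Pe E f} {s : Unknowns N S F G} {κ : Fin N → S.Potential F G}

/-- Testing with vanishing `φ_j` and `g_j` leaves the momentum balance. -/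
theorem _root_.TwoScale.IsSolution.isPressure (h : IsSolution S F G z Pe w E f s)
    (hF : MeasurableSet F) (hκ₀ : ∀ j, (κ j).fst.1 = s.Φ₀ j) (hκ₁ : ∀ j, (κ j).snd = s.Φ₁ j) :
    S.IsPressure F G (S.momentum hw z E f s.u κ) s.P := by
  intro ξ hξ hW
  have e := (S.variationalEquation_iff hw z Pe E f hF hκ₀ hκ₁ hξ hW
    (φ := fun _ _ => 0) (g := fun _ => 0) (κ' := fun _ => 0)
    (fun _ => S.zero_eval_eq_gradient) fun _ => rfl).1
    (h.equation ξ _ _ hξ hW fun _ => IsTestFunction.zero)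
  simp only [transportForm_zero, map_zero, sub_zero, Finset.sum_const_zero, add_zero] at e
  exact sub_eq_zero.1 e

/-- Testing with `ξ = 0` and a single nonzero pair `(φ_j, g_j)` leaves the `j`-th transport balance.
-/
theorem _root_.TwoScale.IsSolution.transport_of_smooth (h : IsSolution S F G z Pe w E f s)
    (hF : MeasurableSet F) (hκ₀ : ∀ j, (κ j).fst.1 = s.Φ₀ j) (hκ₁ : ∀ j, (κ j).snd = s.Φ₁ j)
    (j : Fin N) {q : S.Potential F G} (hq : q.fst.1 ∈ smoothPairs G G) :
    S.transportForm hw z Pe s.u κ j q = S.transportLoad hw z Pe E j q := by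
  obtain ⟨φ, hφ, -, hφ'⟩ := hq
  let κ' : Fin N → S.Potential F G := Pi.single j q
  let φ' : Fin N → Space n → ℝ := fun i => if i = j then φ else fun _ => 0
  have h0 : IsTestFunction G fun _ : Space n => (0 : S.DVec) := IsTestFunction.zero
  have hW : ∀ x : Space n, (fun _ => (0 : S.DVec)) x ∈ S.W F :=
    fun _ => S.mem_Wsub.1 (S.Wsub F).zero_mem
  have e1 : ∀ i, ∀ᵐ x ∂(volume.restrict G), (κ' i).fst.1.snd.eval x = gradient (φ' i) x := by
    intro i
    by_cases hi : i = j
    · subst hi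
      simp only [κ', φ', Pi.single_eq_same, if_true]
      exact eval_eq_gradient_iff.2 hφ'
    · simp only [κ', φ', Pi.single_eq_of_ne hi, if_neg hi]
      exact S.zero_eval_eq_gradient
  have e2 : ∀ i, IsTestFunction G (φ' i) := by
    intro i
    by_cases hi : i = j
    · simpa only [φ', if_pos hi] using hφ
    · simpa only [φ', if_neg hi] using IsTestFunction.zero
  have e := (S.variationalEquation_iff hw z Pe E f hF hκ₀ hκ₁ h0 hW e1 fun _ => rfl).1
    (h.equation _ _ _ h0 hW e2)
  have e3 : κ' j = q := Pi.single_eq_same (M := fun _ => S.Potential F G) j q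
  have e4 : ∀ i, i ≠ j → κ' i = 0 := fun i hi => Pi.single_eq_of_ne (M := fun _ => S.Potential F G) hi q
  have e5 := balance_single e (h.isPressure hw hF hκ₀ hκ₁ _ h0 hW) j
    (fun i hi => (congrArg _ (e4 i hi)).trans (S.transportForm_zero hw z Pe s.u κ i))
    (fun i hi => (congrArg _ (e4 i hi)).trans (map_zero (S.transportLoad hw z Pe E i)))
  rwa [e3] at e5

/-- Both sides are continuous in the test potential, and `H¹₀(G)` is the closure of the smooth
pairs. -/
theorem transport_eq_of_smooth {u : Lp S.DVec 2 (volume.restrict G)} {j : Fin N}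
    (h : ∀ q : S.Potential F G, q.fst.1 ∈ smoothPairs G G →
      S.transportForm hw z Pe u κ j q = S.transportLoad hw z Pe E j q) (q : S.Potential F G) :
    S.transportForm hw z Pe u κ j q = S.transportLoad hw z Pe E j q := by
  exact eq_of_eq_on_topologicalClosure (A := smoothPairs G G)
    (S.continuous_transportForm hw z Pe u κ j) (S.transportLoad hw z Pe E j).continuous h q

/-- Solutions of the two-scale problem, by means of the pressure and of the transport equations. -/
theorem isSolution_iff (hF : MeasurableSet F) (hκ₀ : ∀ j, (κ j).fst.1 = s.Φ₀ j)
    (hκ₁ : ∀ j, (κ j).snd = s.Φ₁ j) :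
    IsSolution S F G z Pe w E f s ↔ s.u ∈ S.Vsub F G ∧ s.P ∈ L2Zero G ∧
      S.IsPressure F G (S.momentum hw z E f s.u κ) s.P ∧
      ∀ j q, S.transportForm hw z Pe s.u κ j q = S.transportLoad hw z Pe E j q := by
  constructor
  · intro h
    exact ⟨(S.mem_Vsub F G).2 h.u_mem, h.P_mem, h.isPressure hw hF hκ₀ hκ₁, fun j =>
      transport_eq_of_smooth hw fun q hq => h.transport_of_smooth hw hF hκ₀ hκ₁ j hq⟩
  · rintro ⟨h1, h2, h3, h4⟩
    refine ⟨(S.mem_Vsub F G).1 h1, h2, fun j => ?_, fun ξ φ g hξ hW hφ => ?_⟩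
    · rw [← coe_H1_eq_H10, ← hκ₀]
      exact (κ j).fst.2
    · refine (S.variationalEquation_iff hw z Pe E f hF hκ₀ hκ₁ hξ hW
        (κ' := fun j => WithLp.toLp 2 (⟨(hφ j).pair G, (hφ j).pair_mem_H1⟩, g j))
        (fun j => eval_eq_gradient_iff.2 (hφ j).pair_snd) fun j => rfl).2 ?_
      exact balance_eq_zero (h3 ξ hξ hW) fun j => h4 j _

variable (S z E f)

set_option maxHeartbeats 400000 in
/-- The two-scale problem without pressure is well-posed. -/
theorem existsUnique_velocity_potentials (hw : ∀ j, MemLp (w j) ⊤ (μ.restrict F))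
    (hF : S.IsDisperseMedium F) (hG : Bornology.IsBounded G) (hz : ∀ j, z j ≠ 0)
    (hPe : ∀ j, 0 < Pe j) (hc : ∀ j, ∃ c > 0, ∀ᵐ ω ∂(μ.restrict F), c ≤ w j ω) :
    ∃! p : S.Vsub F G × (Fin N → S.Potential F G),
      (∀ ξ ∈ S.Vsub F G, S.momentum hw z E f p.1.1 p.2 ξ = 0) ∧
      ∀ j q, S.transportForm hw z Pe p.1.1 p.2 j q = S.transportLoad hw z Pe E j q := by
  have hr : ∀ j, 0 < (z j : ℝ) ^ 2 / Pe j := fun j => by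
    have := hPe j
    have : (z j : ℝ) ≠ 0 := Int.cast_ne_zero.2 (hz j)
    positivity
  have hT : ∀ j, ∃ c > 0, ∀ y : L2Pore μ F G, c * ‖y‖ ^ 2 ≤ inner ℝ y (weightL G (hw j) y) := by
    intro j
    obtain ⟨c, hc0, hc⟩ := hc j
    exact ⟨c, hc0, le_inner_compLpL (le_inner_mulVec (hw j) hc)⟩
  obtain ⟨C, hC0, hC⟩ := IsDisperseMedium.exists_coercive_grL S G hF
  have h := exists_unique_coupled (Q := S.Potential F G) (fl := S.flux F G)
    (gr := S.grL F G) (T := fun j => weightL G (hw j)) (S.Vsub F G) (S.evL F G)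
    ⟨C, hC0, fun u hu => hC u ((S.mem_Vsub_iff F G).1 hu).1⟩
    (IsDisperseMedium.exists_coercive_flux S G hF hG) hr hT (fun j => (z j : ℝ))
    (load (S.evL F G) (fun j => weightL G (hw j)) (fun j => (z j : ℝ)) (constY μ F G E)
      (constY μ F G f)) fun j => S.transportLoad hw z Pe E j
  exact h

/-- Velocity and potentials come from the problem without pressure. The momentum residual vanishes
on `V` and therefore has a pressure, unique with zero mean. -/
theorem existsUnique_isSolution (hw : ∀ j, MemLp (w j) ⊤ (μ.restrict F))
    (hF : S.IsDisperseMedium F) (hG : IsBoundedDomain smooth G) (hz : ∀ j, z j ≠ 0)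
    (hPe : ∀ j, 0 < Pe j) (hc : ∀ j, ∃ c > 0, ∀ᵐ ω ∂(μ.restrict F), c ≤ w j ω) :
    ∃! s : Unknowns N S F G, IsSolution S F G z Pe w E f s := by
  obtain ⟨ζ, hζ, hζ', -⟩ := IsDisperseMedium.exists_unitFields S hF
  obtain ⟨⟨u, κ⟩, ⟨hp1, hp2⟩, hp⟩ :=
    S.existsUnique_velocity_potentials z E f hw hF hG.isBounded hz hPe hc
  obtain ⟨P, hP0, hP⟩ := S.exists_isPressure hG hζ hζ' hp1
  refine ⟨⟨u.1, P, fun j => (κ j).fst.1, fun j => (κ j).snd⟩,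
    (isSolution_iff hw hF.measurableSet (fun _ => rfl) fun _ => rfl).2 ⟨u.2, hP0, hP, hp2⟩, ?_⟩
  intro s hs
  have hΦ : ∀ j, s.Φ₀ j ∈ H1 G G := fun j => by
    have h := hs.Φ₀_mem j
    rw [← coe_H1_eq_H10] at h
    exact h
  let κ' : Fin N → S.Potential F G := fun j => WithLp.toLp 2 (⟨s.Φ₀ j, hΦ j⟩, s.Φ₁ j)
  obtain ⟨h1, h2, h3, h4⟩ :=
    (isSolution_iff (κ := κ') hw hF.measurableSet (fun _ => rfl) fun _ => rfl).1 hs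
  -- Any solution also solves the problem without pressure, because a functional with a pressure
  -- vanishes on `V`.
  have h5 := hp (⟨s.u, h1⟩, κ') ⟨fun ξ hξ => h3.apply_eq_zero S hG hζ hζ' hξ, h4⟩
  have h6 : s.u = u.1 := congrArg (fun p => p.1.1) h5
  have h7 : κ' = κ := congrArg Prod.snd h5
  subst h7
  rw [h6] at h3
  have h8 : s.P = P := h3.unique S hG hP h2 hP0 hζ hζ'
  calc s = ⟨s.u, s.P, s.Φ₀, s.Φ₁⟩ := rfl
    _ = _ := by rw [h6, h8]; rfl

end ErgodicSystem

end TwoScale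

end

/-- The essentially bounded equilibrium potential keeps every concentration between two positive
constants on `ℱ`, which is all that the well-posedness result asks of the weights. -/
theorem mainTheorem6 {n N : ℕ} {Ω : Type*} [MeasurableSpace Ω] (μ : Measure Ω)
    [IsProbabilityMeasure μ] (hsep : TopologicalSpace.SeparableSpace (Lp ℝ 2 μ))
    (S : ErgodicSystem n μ) (F : Set Ω) (hF : S.IsDisperseMedium F)
    (G : Set (Space n)) (hG : IsBoundedDomain smooth G)
    (z : Fin N → ℤ) (hz : ∀ j, z j ≠ 0) (Pe : Fin N → ℝ) (hPe : ∀ j, 0 < Pe j)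
    (nc : Fin N → ℝ) (hnc : ∀ j, 0 < nc j)
    (Ψ : Ω → ℝ) (hΨ : MemLp Ψ ⊤ (μ.restrict F))
    (E f : L2Vec n (volume.restrict G)) :
    ∃! s : Unknowns N S F G, IsSolution S F G z Pe (concentration nc z Ψ) E f s := by
  exact S.existsUnique_isSolution z E f (fun j => (concentration_bounds hnc z hΨ j).1) hF hG hz hPe
    fun j => (concentration_bounds hnc z hΨ j).2
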